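/- **Conventions.** $n$ is the security parameter; all algorithms and adversaries are (uniform) quantum polynomial time (QPT); all spaces are ensembles of finite sets of strings of polynomial length; a negligible function decays faster than every inverse polynomial. Two experiments are *indistinguishable* if for every QPT adversary the probabilities of output $1$ differ by a negligible function of $n$. **Building blocks.** * $\mathsf{SKFE}=(\mathsf{Setup},\mathsf{KeyGen},\mathsf{Enc},\mathsf{Dec})$ is an untelegraphable secret-key functional encryption scheme with message space $\{\mathcal M_n\}$ and function space $\{\mathcal F_n\}$, both efficiently recognizable, the functions in $\mathcal F_n$ being efficiently computable. Master keys and function keys are classical and ciphertexts are quantum. $\mathsf{KeyGen}(\mathsf{msk},f;r)$ is a deterministic polynomial-time function of $\mathsf{msk}$, $f$ and the uniform coins $r\in\{0,1\}^{\rho(n)}$. * $\mathsf F_n:\mathcal K_n\times\mathcal F_n\to\{0,1\}^{\rho(n)}$ is an efficiently computable function family whose keys can be sampled uniformly by an efficient algorithm. * $\mathsf{SKE}=(\mathsf{Gen},\mathsf{Enc},\mathsf{Dec})$ is a classical secret-key encryption scheme with deterministic decryption, whose message space contains a fixed message $0$ and all function keys of $\mathsf{SKFE}$. * $\mathsf{PKFE}=(\mathsf{Setup},\mathsf{KeyGen},\mathsf{Enc},\mathsf{Dec})$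 is a plain public-key functional encryption scheme with classical ciphertexts, whose message space contains the tuples $(0,\mathsf{msk},k,\bot)$ and $(1,\bot,\bot,\mathsf{sk})$ for all keys $\mathsf{msk}$ of $\mathsf{SKFE}$, $k\in\mathcal K_n$, and $\mathsf{sk}$ of $\mathsf{SKE}$, and whose function space contains efficiently constructible circuits for the functions $$G[\mathsf{ct},f](b,\mathsf{msk},k,\mathsf{sk})=\begin{cases}\mathsf{SKFE.KeyGen}(\mathsf{msk},f;\mathsf F_n(k,f)) & b=0,\\ \mathsf{SKE.Dec}(\mathsf{sk},\mathsf{ct}) & b=1,\end{cases}$$ where $f\in\mathcal F_n$ and $\mathsf{ct}$ is an $\mathsf{SKE}$ ciphertext (for instance, a scheme for $\mathsf{P}/\mathsf{poly}$). **Construction.** * $\mathsf{Setup}(1^n)$: sample $(\mathsf{pk},\mathsf{msk}_{\mathsf{PKFE}})\leftarrow\mathsf{PKFE.Setup}(1^n)$ and $\mathsf{sk}_{\mathsf{SKE}}\leftarrow\mathsf{SKE.Gen}(1^n)$; output $\mathsf{pk}$ and $\mathsf{msk}=(\mathsf{msk}_{\mathsf{PKFE}},\mathsf{sk}_{\mathsf{SKE}})$.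 * $\mathsf{KeyGen}(\mathsf{msk},f)$: compute $\mathsf{ct}\leftarrow\mathsf{SKE.Enc}(\mathsf{sk}_{\mathsf{SKE}},0)$ and output $\mathsf{PKFE.KeyGen}(\mathsf{msk}_{\mathsf{PKFE}},G[\mathsf{ct},f])$. * $\mathsf{Enc}(\mathsf{pk},m)$: sample $\mathsf{msk}'\leftarrow\mathsf{SKFE.Setup}(1^n)$ and uniform $k\in\mathcal K_n$; output $\mathsf{SKFE.Enc}(\mathsf{msk}',m)$ together with $\mathsf{PKFE.Enc}(\mathsf{pk},(0,\mathsf{msk}',k,\bot))$. * $\mathsf{Dec}(\mathsf{sk}_f,(|\mathsf{ct}'\rangle,\mathsf{ct}_{\mathsf{PKFE}}))$: output $\mathsf{SKFE.Dec}(\mathsf{PKFE.Dec}(\mathsf{sk}_f,\mathsf{ct}_{\mathsf{PKFE}}),|\mathsf{ct}'\rangle)$. **Security notions.** *Untelegraphable security with unrestricted key queries* of a public-key scheme is indistinguishability for $b=0,1$ of the following experiment with a two-stage adversary $(A,B)$. The challenger runs $\mathsf{Setup}$ and gives $\mathsf{pk}$ to $A$. $A$ adaptively obtains function keys for functions $f\in\mathcal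 F_n$, and outputs $m_0,m_1\in\mathcal M_n$; if $f(m_0)=f(m_1)$ for all functions $f$ queried so far, $A$ receives an encryption of $m_b$ (otherwise the experiment is aborted). $A$ obtains further keys for functions $f$ with $f(m_0)=f(m_1)$ and outputs a classical string $\mathsf{st}$. $B$ receives $\mathsf{st}$ only, adaptively obtains keys for arbitrary $f\in\mathcal F_n$, and outputs a bit, which is the output of the experiment. *Single-ciphertext untelegraphable security with unrestricted key queries* of a secret-key scheme is the same without a public key, and without access to encryptions other than the challenge ciphertext. *Adaptive security* of a plain public-key scheme is the same where $A$ itself outputs the bit and there is no second stage. *CPA-security* of $\mathsf{SKE}$ is indistinguishability of the oracles $(m_0,m_1)\mapsto\mathsf{SKE.Enc}(\mathsf{sk},m_b)$, $b=0,1$. *PRF security* of $\mathsf F$ is indistinguishability of the oracles $\mathsf F_n(k,\cdot)$ with uniform $k$ and a uniformly random function $\mathcal F_n\to\{0,1\}^{\rho(n)}$ under classical queries. *Correctness* of $\mathsf{SKE}$ means that $$\mathbb E_{\mathsf{sk}\leftarrow\mathsf{Gen}(1^n)}\Big[\sup_{m}\Pr\big[\mathsf{Dec}(\mathsf{sk},\mathsf{Enc}(\mathsf{sk},m))\ne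 m\big]\Big]$$ is negligible, where $m$ ranges over the message space (for instance, $\mathsf{SKE}$ is perfectly correct). **Theorem.** Suppose that $\mathsf{PKFE}$ is adaptively secure, $\mathsf F$ is a secure PRF, $\mathsf{SKE}$ is CPA-secure and correct, and $\mathsf{SKFE}$ satisfies single-ciphertext untelegraphable security with unrestricted key queries, all against QPT adversaries. Then the constructed public-key scheme satisfies untelegraphable security with unrestricted key queries. -/

import Mathlib

open scoped ENNReal NNReal

namespace UTFE

noncomputable section

/-! ## Classical data and deterministic polynomial time -/

/-- Classical data: finite binary trees, in which bit strings, tuples and unary numbers are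
written in the usual way. -/
inductive Data : Type
  | nil : Data
  | pair : Data → Data → Data
  deriving DecidableEq

namespace Data

/-- The number of nodes of the tree, that is, its length as a string up to a constant factor. -/
def size : Data → ℕ
  | nil => 1
  | pair a b => a.size + b.size + 1

def fst : Data → Data
  | nil => nil
  | pair a _ => a

def snd : Data → Data
  | nil => nil
  | pair _ b => b

/-- The unary numeral `1ⁿ`. -/
def unary : ℕ → Data
  | 0 => nil
  | n + 1 => pair nil (unary n)

/-- A single bit. -/
def bit : Bool → Data
  | false => nil
  | true => pair nil nil

/-- A bit string. -/
def bits : List Bool → Data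
  | [] => nil
  | b :: l => pair (bit b) (bits l)

/-- A bit string of length `m`, given as a function on positions. -/
def word {m : ℕ} (r : Fin m → Bool) : Data := bits (List.ofFn r)

end Data

open Data

/-- Right-hand sides of assignments; the natural numbers name program variables. -/
inductive Expr : Type
  | nil : Expr
  | var : ℕ → Expr
  | pair : ℕ → ℕ → Expr
  | fst : ℕ → Expr
  | snd : ℕ → Expr
  | eq : ℕ → ℕ → Expr

/-- Programs of a structured imperative language with finitely many variables over `Data`. -/
inductive Cmd : Type
  | skip : Cmd
  | assign : ℕ → Expr → Cmd
  | seq : Cmd → Cmd → Cmd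
  | ite : ℕ → Cmd → Cmd → Cmd
  | while : ℕ → Cmd → Cmd

abbrev Store : Type := ℕ → Data

def Expr.val (s : Store) : Expr → Data
  | .nil => .nil
  | .var x => s x
  | .pair x y => .pair (s x) (s y)
  | .fst x => (s x).fst
  | .snd x => (s x).snd
  | .eq x y => bit (decide (s x = s y))

/-- The time that an assignment takes: linear in the size of the value that is written,
and for a comparison also in the sizes of the values that are compared. -/
def Expr.cost (s : Store) : Expr → ℕ
  | .eq x y => 1 + (s x).size + (s y).size
  | e => 1 + (e.val s).size

/-- `Cmd.Eval c s s' t`: the program `c`, started in the store `s`, halts in the store `s'`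
after `t` units of time. The value `nil` counts as false, every other value as true. -/
inductive Cmd.Eval : Cmd → Store → Store → ℕ → Prop
  | skip (s : Store) : Cmd.Eval .skip s s 1
  | assign (x : ℕ) (e : Expr) (s : Store) :
      Cmd.Eval (.assign x e) s (Function.update s x (e.val s)) (e.cost s)
  | seq {c₁ c₂ : Cmd} {s₁ s₂ s₃ : Store} {t₁ t₂ : ℕ} :
      Cmd.Eval c₁ s₁ s₂ t₁ → Cmd.Eval c₂ s₂ s₃ t₂ → Cmd.Eval (.seq c₁ c₂) s₁ s₃ (t₁ + t₂)
  | iteTrue {x : ℕ} {c₁ c₂ : Cmd} {s s' : Store} {t : ℕ} :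
      s x ≠ .nil → Cmd.Eval c₁ s s' t → Cmd.Eval (.ite x c₁ c₂) s s' (t + 1)
  | iteFalse {x : ℕ} {c₁ c₂ : Cmd} {s s' : Store} {t : ℕ} :
      s x = .nil → Cmd.Eval c₂ s s' t → Cmd.Eval (.ite x c₁ c₂) s s' (t + 1)
  | whileDone {x : ℕ} {c : Cmd} {s : Store} :
      s x = .nil → Cmd.Eval (.while x c) s s 1
  | whileStep {x : ℕ} {c : Cmd} {s₁ s₂ s₃ : Store} {t₁ t₂ : ℕ} :
      s₁ x ≠ .nil → Cmd.Eval c s₁ s₂ t₁ → Cmd.Eval (.while x c) s₂ s₃ t₂ →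
      Cmd.Eval (.while x c) s₁ s₃ (t₁ + t₂ + 1)

/-- The store in which variable `0` holds the input and all other variables hold `nil`. -/
def inputStore (x : Data) : Store := fun i => if i = 0 then x else .nil

/-- Functions computable in deterministic polynomial time. -/
def PolyTime (g : Data → Data) : Prop :=
  ∃ (c : Cmd) (p : Polynomial ℕ), ∀ x : Data, ∃ (s : Store) (t : ℕ),
    c.Eval (inputStore x) s t ∧ s 0 = g x ∧ t ≤ p.eval x.size

/-! ## Quantum memory -/

/-- Vectors of a quantum memory whose qubits are named by data, of which only finitely many
are ever used. The basis vector of a finite set `S` of names is the state in which the qubits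
in `S` are `|1⟩` and all others `|0⟩`. The machines below only produce unit vectors. -/
abbrev Ket : Type := Finset Data →₀ ℂ

/-- The basis vector of `S`. -/
def basis (S : Finset Data) : Ket := Finsupp.single S 1

/-- All qubits are `|0⟩`. -/
def vacuum : Ket := basis ∅

/-- The squared norm. -/
def normSq (v : Ket) : ℝ≥0 := v.sum fun _ z => ‖z‖₊ ^ 2

/-- The linear operator with the given values on the basis. -/
def linearOp (g : Finset Data → Ket) (v : Ket) : Ket := v.sum fun S z => z • g S

/-- The Hadamard gate on qubit `a`. -/
def hadamard (a : Data) : Ket → Ket :=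
  linearOp fun S => ((1 / Real.sqrt 2 : ℝ) : ℂ) •
    (basis (S.erase a) + (if a ∈ S then (-1 : ℂ) else 1) • basis (insert a S))

/-- The `T` gate, the phase `exp (iπ/4)`, on qubit `a`. -/
def tGate (a : Data) : Ket → Ket :=
  linearOp fun S => (if a ∈ S then Complex.exp (Complex.I * (Real.pi / 4)) else 1) • basis S

/-- The controlled-not gate with control `a` and target `b` (nothing happens if `a = b`). -/
def cnot (a b : Data) : Ket → Ket :=
  linearOp fun S =>
    if a ∈ S ∧ a ≠ b then basis (if b ∈ S then S.erase b else insert b S) else basis S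

/-- The component of `v` in which qubit `a` has the value `b`. -/
def component (a : Data) (b : Bool) (v : Ket) : Ket := v.filter fun S => decide (a ∈ S) = b

/-- The unit vector in the direction of `v`. -/
def normalize (v : Ket) : Ket := ((1 / Real.sqrt (normSq v) : ℝ) : ℂ) • v

/-- A biased coin that shows `true` with probability `p` (`p` is at most `1` in all uses on
unit vectors). -/
def coin (p : ℝ≥0) : PMF Bool :=
  PMF.ofFintype (fun b => if b then ((min p 1 : ℝ≥0) : ℝ≥0∞) else ((1 - min p 1 : ℝ≥0) : ℝ≥0∞)) (by
    rw [Fintype.sum_bool]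
    simp only [if_true, Bool.false_eq_true, if_false]
    rw [← ENNReal.coe_add, add_tsub_cancel_of_le (min_le_right p 1), ENNReal.coe_one])

/-- Measurement of qubit `a` of a unit vector: the outcome and the state afterwards. -/
def measure (a : Data) (v : Ket) : PMF (Bool × Ket) :=
  (coin (normSq (component a true v))).map fun b => (b, normalize (component a b v))

/-- The joint state of two memories: qubit `a` of the first one is now called `pair nil a`,
and qubit `a` of the second one `pair (pair nil nil) a`. -/
def tensor (v w : Ket) : Ket :=
  v.sum fun S y => w.sum fun T z =>
    (y * z) • basis (S.image (Data.pair (bit false)) ∪ T.image (Data.pair (bit true)))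

/-! ## Quantum polynomial time -/

/-- The instructions of a quantum machine with classical control. Every instruction but
`halt` also says in which classical state the machine goes on. -/
inductive Instr : Type
  | halt (out : Data) : Instr
  | hadamard (a c : Data) : Instr
  | tGate (a c : Data) : Instr
  | cnot (a b c : Data) : Instr
  | measure (a c : Data) : Instr
  | query (q c : Data) : Instr

/-- Instructions written as data. -/
def Instr.code : Instr → Data
  | .halt out => .pair (unary 0) out
  | .hadamard a c => .pair (unary 1) (.pair a c)
  | .tGate a c => .pair (unary 2) (.pair a c)
  | .cnot a b c => .pair (unary 3) (.pair a (.pair b c))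
  | .measure a c => .pair (unary 4) (.pair a c)
  | .query q c => .pair (unary 5) (.pair q c)

/-- `i.Next L c'`: after the instruction `i` the machine may be in the classical state `c'`,
if the answers to queries have size at most `L`. Outcomes and answers are put in front of
the classical state. -/
inductive Instr.Next (L : ℕ) : Instr → Data → Prop
  | hadamard (a c : Data) : Instr.Next L (.hadamard a c) c
  | tGate (a c : Data) : Instr.Next L (.tGate a c) c
  | cnot (a b c : Data) : Instr.Next L (.cnot a b c) c
  | measure (a c : Data) (o : Bool) : Instr.Next L (.measure a c) (.pair (bit o) c)
  | query (q c r : Data) : r.size ≤ L → Instr.Next L (.query q c) (.pair r c)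

/-- `Reaches step L x t c`: from the classical state `x` the machine can get to the classical
state `c` in `t` steps, if the answers to queries have size at most `L`. -/
inductive Reaches (step : Data → Instr) (L : ℕ) (x : Data) : ℕ → Data → Prop
  | start : Reaches step L x 0 x
  | next {t : ℕ} {c c' : Data} :
      Reaches step L x t c → (step c).Next L c' → Reaches step L x (t + 1) c'

/-- A quantum polynomial time (interactive) machine. A deterministic polynomial time function
maps the classical state to the next instruction, and both the number of steps and the size of
the classical state are polynomially bounded in the size of the input and of the answers
that are received, whatever the answers and the outcomes of measurements are. -/
structure QPT where
  step : Data → Instr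
  step_polyTime : PolyTime fun c => (step c).code
  bounded : ∃ p : Polynomial ℕ, ∀ (L : ℕ) (x : Data), x.size ≤ L →
    ∀ (t : ℕ) (c : Data), Reaches step L x t c → t ≤ p.eval L ∧ c.size ≤ p.eval L

/-- A randomized oracle with internal state in `σ`: state and query are mapped to a random
answer and the new state. -/
abbrev Oracle (σ : Type) : Type := σ → Data → PMF (Data × σ)

/-- At most `t` steps of the machine `M` with the oracle `O`, from the classical state `c`,
the quantum memory `v` and the oracle state `s`. The result is the output of the machine, its
quantum memory and the oracle state, or `none` if the machine has not halted. -/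
def QPT.run {σ : Type} (M : QPT) (O : Oracle σ) :
    ℕ → Data → Ket → σ → OptionT PMF (Data × Ket × σ)
  | 0, _, _, _ => failure
  | t + 1, c, v, s =>
    match M.step c with
    | .halt out => pure (out, v, s)
    | .hadamard a c' => QPT.run M O t c' (UTFE.hadamard a v) s
    | .tGate a c' => QPT.run M O t c' (UTFE.tGate a v) s
    | .cnot a b c' => QPT.run M O t c' (UTFE.cnot a b v) s
    | .measure a c' => do
        let (o, w) ← UTFE.measure a v
        QPT.run M O t (.pair (bit o) c') w s
    | .query q c' => do
        let (r, s') ← O s q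
        QPT.run M O t (.pair r c') v s'

/-- The run of a machine without an oracle: its output and its final quantum memory. -/
def QPT.output (M : QPT) (t : ℕ) (x : Data) (v : Ket) : PMF (Option (Data × Ket)) :=
  (M.run (fun _ _ => pure (.nil, ())) t x v ()).run.map (Option.map fun r => (r.1, r.2.1))

/-- The deterministic function `g`, on a security parameter and data, is computable in
polynomial time. -/
def PolyFun (g : ℕ → Data → Data) : Prop :=
  ∃ h : Data → Data, PolyTime h ∧ ∀ (n : ℕ) (x : Data), h (.pair (unary n) x) = g n x

/-- The algorithm `f` with classical input and output is QPT. -/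
def IsQPT (f : ℕ → Data → PMF Data) : Prop :=
  ∃ M : QPT, ∀ (n : ℕ) (x : Data), ∃ t : ℕ,
    (M.output t (.pair (unary n) x) vacuum).map (Option.map Prod.fst) = (f n x).map some

/-- The algorithm `f` with classical input and an output made of classical data and a quantum
state is QPT. The quantum output is the whole memory of the machine at the end; a machine
discards a qubit by measuring it and resetting it to `|0⟩`. -/
def IsQPTOut (f : ℕ → Data → PMF (Data × Ket)) : Prop :=
  ∃ M : QPT, ∀ (n : ℕ) (x : Data), ∃ t : ℕ,
    M.output t (.pair (unary n) x) vacuum = (f n x).map some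

/-- The algorithm `f` whose input is made of classical data and a quantum state, and whose
output is classical, is QPT. The machine has its own workspace next to the quantum input. -/
def IsQPTIn (f : ℕ → Data → Ket → PMF Data) : Prop :=
  ∃ M : QPT, ∀ (n : ℕ) (x : Data) (φ : Ket), normSq φ = 1 → ∃ t : ℕ,
    (M.output t (.pair (unary n) x) (tensor vacuum φ)).map (Option.map Prod.fst)
      = (f n x φ).map some

/-! ## Ensembles, advantages -/

/-- An ensemble of finite sets of strings of polynomial length. -/
def PolySize (X : ℕ → Finset Data) : Prop :=
  ∃ p : Polynomial ℕ, ∀ n, ∀ x ∈ X n, x.size ≤ p.eval n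

/-- Membership in the ensemble can be decided in polynomial time. -/
def PolyDecidable (X : ℕ → Finset Data) : Prop :=
  PolyFun fun n x => bit (decide (x ∈ X n))

/-- The probability that an experiment outputs `1`. Experiments are run with a bound on the
number of steps of every machine, and the bound tends to infinity; an experiment that is
aborted has no output. -/
def prOne (g : ℕ → OptionT PMF Bool) : ℝ := (⨆ t, (g t).run (some true)).toReal

/-- Negligible functions. -/
def Negligible (ε : ℕ → ℝ) : Prop :=
  Asymptotics.SuperpolynomialDecay Filter.atTop (fun n : ℕ => (n : ℝ)) ε

/-- No efficient distinguisher has a noticeable advantage between the experiments `g n false`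
and `g n true`. -/
def Indist (g : ℕ → Bool → ℕ → OptionT PMF Bool) : Prop :=
  Negligible fun n => |prOne (g n false) - prOne (g n true)|

/-! ## Pseudorandom functions -/

/-- A function family `F n : K n × X n → {0,1}^(ℓ n)`. -/
structure PRF (X : ℕ → Finset Data) (ℓ : ℕ → ℕ) where
  keys : ℕ → Finset Data
  keys_nonempty : ∀ n, (keys n).Nonempty
  eval : (n : ℕ) → Data → Data → (Fin (ℓ n) → Bool)

/-- The uniform distribution on the keys. -/
def PRF.key {X : ℕ → Finset Data} {ℓ : ℕ → ℕ} (F : PRF X ℓ) (n : ℕ) : PMF Data :=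
  PMF.uniformOfFinset (F.keys n) (F.keys_nonempty n)

/-- Keys can be sampled and the functions can be computed efficiently. -/
def PRF.Efficient {X : ℕ → Finset Data} {ℓ : ℕ → ℕ} (F : PRF X ℓ) : Prop :=
  IsQPT (fun n _ => F.key n) ∧ PolyFun fun n x => word (F.eval n x.fst x.snd)

/-- Oracle access to a function on `X`; other queries are refused. -/
def funOracle {m : ℕ} (X : Finset Data) (f : X → (Fin m → Bool)) : Oracle Unit :=
  fun _ x => pure (if h : x ∈ X then word (f ⟨x, h⟩) else .nil, ())

/-- The PRF experiment: the oracle is a random function if `b` is true, otherwise it is the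
family with a random key. -/
def PRF.game {X : ℕ → Finset Data} {ℓ : ℕ → ℕ} (F : PRF X ℓ) (A : QPT) (n : ℕ) (b : Bool)
    (t : ℕ) : OptionT PMF Bool := do
  let k ← F.key n
  let f ← PMF.uniformOfFintype (X n → (Fin (ℓ n) → Bool))
  let g : X n → (Fin (ℓ n) → Bool) := if b then f else fun x => F.eval n k x
  let (out, _) ← A.run (funOracle (X n) g) t (unary n) vacuum ()
  return decide (out = bit true)

/-- Security against QPT adversaries. -/
def PRF.Secure {X : ℕ → Finset Data} {ℓ : ℕ → ℕ} (F : PRF X ℓ) : Prop :=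
  ∀ A : QPT, Indist (F.game A)

/-! ## Secret-key encryption -/

/-- Secret-key encryption with classical ciphertexts and deterministic decryption. -/
structure SKE where
  msgs : ℕ → Finset Data
  gen : ℕ → PMF Data
  enc : ℕ → Data → Data → PMF Data
  dec : ℕ → Data → Data → Data

def SKE.Efficient (E : SKE) : Prop :=
  PolySize E.msgs ∧ IsQPT (fun n _ => E.gen n) ∧ IsQPT (fun n x => E.enc n x.fst x.snd) ∧
    PolyFun fun n x => E.dec n x.fst x.snd

/-- Correctness: on average over the secret key, the largest probability, among all messages,
that the message is encrypted to a ciphertext that does not decrypt to it is negligible. -/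
def SKE.Correct (E : SKE) : Prop :=
  Negligible fun n => (∑' sk, E.gen n sk *
    ⨆ m ∈ E.msgs n, (E.enc n sk m).toOuterMeasure {ct | E.dec n sk ct ≠ m}).toReal

/-- On the query `(m₀, m₁)` the oracle encrypts `m_b`; pairs outside of the message space are
refused. -/
def SKE.lrOracle (E : SKE) (n : ℕ) (sk : Data) (b : Bool) : Oracle Unit := fun _ q =>
  if q.fst ∈ E.msgs n ∧ q.snd ∈ E.msgs n then
    (E.enc n sk (if b then q.snd else q.fst)).map fun ct => (ct, ())
  else pure (.nil, ())

/-- The CPA experiment. -/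
def SKE.game (E : SKE) (A : QPT) (n : ℕ) (b : Bool) (t : ℕ) : OptionT PMF Bool := do
  let sk ← E.gen n
  let (out, _) ← A.run (E.lrOracle n sk b) t (unary n) vacuum ()
  return decide (out = bit true)

/-- CPA-security against QPT adversaries. -/
def SKE.CPASecure (E : SKE) : Prop := ∀ A : QPT, Indist (E.game A)

/-! ## Function spaces and key generation oracles -/

/-- An ensemble of finite sets of descriptions of functions, with the function
`eval n f` that is described by `f`. -/
structure FunSpace where
  desc : ℕ → Finset Data
  eval : ℕ → Data → Data → Data

/-- Functions that can be evaluated efficiently. -/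
def FunSpace.Efficient (𝓕 : FunSpace) : Prop :=
  PolySize 𝓕.desc ∧ PolyDecidable 𝓕.desc ∧ PolyFun fun n x => 𝓕.eval n x.fst x.snd

open scoped Classical in
/-- Key generation queries: a query that is allowed is answered by a fresh key and recorded,
other queries are refused. -/
def keyOracle (kg : Data → PMF Data) (ok : Data → Prop) : Oracle (List Data) := fun s f =>
  if ok f then (kg f).map fun sk => (sk, f :: s) else pure (.nil, s)

/-! ## Plain public-key functional encryption -/

/-- Public-key functional encryption with classical ciphertexts. -/
structure PKFE where
  msgs : ℕ → Finset Data
  funs : FunSpace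
  setup : ℕ → PMF (Data × Data)
  keyGen : ℕ → Data → Data → PMF Data
  enc : ℕ → Data → Data → PMF Data
  dec : ℕ → Data → Data → PMF Data

def PKFE.Efficient (P : PKFE) : Prop :=
  PolySize P.msgs ∧ PolySize P.funs.desc ∧
    IsQPT (fun n _ => (P.setup n).map fun k => .pair k.1 k.2) ∧
    IsQPT (fun n x => P.keyGen n x.fst x.snd) ∧
    IsQPT (fun n x => P.enc n x.fst x.snd) ∧
    IsQPT (fun n x => P.dec n x.fst x.snd)

/-- An adversary that makes key queries, outputs the challenge messages (and classical
information to go on with), is given the challenge ciphertext, makes further key queries, and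
outputs a bit. Its quantum memory is kept between the two parts. -/
structure FEAdversary where
  A₁ : QPT
  A₂ : QPT

/-- The experiment of adaptive security: all functions for which keys are given out have to agree
on the challenge messages. -/
def PKFE.game (P : PKFE) (𝒜 : FEAdversary) (n : ℕ) (b : Bool) (t : ℕ) : OptionT PMF Bool := do
  let (pk, msk) ← P.setup n
  let (out, v, fs) ← 𝒜.A₁.run (keyOracle (P.keyGen n msk) (· ∈ P.funs.desc n)) t
    (.pair (unary n) pk) vacuum []
  let m₀ := out.fst
  let m₁ := out.snd.fst
  let aux := out.snd.snd
  guard (m₀ ∈ P.msgs n ∧ m₁ ∈ P.msgs n ∧ ∀ f ∈ fs, P.funs.eval n f m₀ = P.funs.eval n f m₁)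
  let ct ← P.enc n pk (if b then m₁ else m₀)
  let (out, _) ← 𝒜.A₂.run (keyOracle (P.keyGen n msk)
      fun f => f ∈ P.funs.desc n ∧ P.funs.eval n f m₀ = P.funs.eval n f m₁) t
    (.pair (unary n) (.pair ct aux)) v []
  return decide (out = bit true)

/-- Adaptive security against QPT adversaries. -/
def PKFE.AdaptivelySecure (P : PKFE) : Prop := ∀ 𝒜 : FEAdversary, Indist (P.game 𝒜)

/-! ## Untelegraphable functional encryption -/

/-- A two-stage adversary `(A, B)`. The first stage `A` consists of the parts before and after
the challenge ciphertext is received. -/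
structure UTAdversary where
  A₁ : QPT
  A₂ : QPT
  B : QPT

/-- The experiment of untelegraphable security with unrestricted key queries, after the setup:
`pub` is the information that is given to the adversary, `kg` the key generation and `enc` the
encryption algorithm for the keys that have been sampled. The first stage ends with a classical
string; the second stage starts from this string alone, with an empty quantum memory, and may
query keys for all functions. -/
def utExperiment (msgs : Finset Data) (desc : Finset Data) (eval : Data → Data → Data)
    (pub : Data) (kg : Data → PMF Data) (enc : Data → PMF (Data × Ket))
    (𝒜 : UTAdversary) (n : ℕ) (b : Bool) (t : ℕ) : OptionT PMF Bool := do
  let (out, v, fs) ← 𝒜.A₁.run (keyOracle kg (· ∈ desc)) t (.pair (unary n) pub) vacuum []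
  let m₀ := out.fst
  let m₁ := out.snd.fst
  let aux := out.snd.snd
  guard (m₀ ∈ msgs ∧ m₁ ∈ msgs ∧ ∀ f ∈ fs, eval f m₀ = eval f m₁)
  let (c, φ) ← enc (if b then m₁ else m₀)
  let (st, _) ← 𝒜.A₂.run (keyOracle kg fun f => f ∈ desc ∧ eval f m₀ = eval f m₁) t
    (.pair (unary n) (.pair c aux)) (tensor v φ) []
  let (out, _) ← 𝒜.B.run (keyOracle kg (· ∈ desc)) t (.pair (unary n) st) vacuum []
  return decide (out = bit true)

/-- Untelegraphable secret-key functional encryption. Ciphertexts consist of classical data and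
a quantum state; `keyGen` is given its random coins explicitly. -/
structure UTSKFE where
  msgs : ℕ → Finset Data
  funs : FunSpace
  coins : ℕ → ℕ
  setup : ℕ → PMF Data
  keyGen : (n : ℕ) → Data → Data → (Fin (coins n) → Bool) → Data
  enc : ℕ → Data → Data → PMF (Data × Ket)
  dec : ℕ → Data → Data × Ket → PMF Data

def UTSKFE.Efficient (S : UTSKFE) : Prop :=
  PolySize S.msgs ∧ PolyDecidable S.msgs ∧ S.funs.Efficient ∧
    PolyFun (fun n _ => unary (S.coins n)) ∧
    IsQPT (fun n _ => S.setup n) ∧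
    (∃ h : Data → Data, PolyTime h ∧ ∀ (n : ℕ) (msk f : Data) (r : Fin (S.coins n) → Bool),
      h (.pair (unary n) (.pair msk (.pair f (word r)))) = S.keyGen n msk f r) ∧
    IsQPTOut (fun n x => S.enc n x.fst x.snd) ∧
    IsQPTIn (fun n x φ => S.dec n x.fst (x.snd, φ))

/-- Key generation with fresh coins. -/
def UTSKFE.sampleKey (S : UTSKFE) (n : ℕ) (msk f : Data) : PMF Data :=
  (PMF.uniformOfFintype (Fin (S.coins n) → Bool)).map (S.keyGen n msk f)

/-- The experiment with one ciphertext, the challenge. -/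
def UTSKFE.game (S : UTSKFE) (𝒜 : UTAdversary) (n : ℕ) (b : Bool) (t : ℕ) :
    OptionT PMF Bool := do
  let msk ← S.setup n
  utExperiment (S.msgs n) (S.funs.desc n) (S.funs.eval n) .nil (S.sampleKey n msk)
    (S.enc n msk) 𝒜 n b t

/-- Single-ciphertext untelegraphable security with unrestricted key queries. -/
def UTSKFE.SingleCiphertextSecure (S : UTSKFE) : Prop := ∀ 𝒜 : UTAdversary, Indist (S.game 𝒜)

/-- Untelegraphable public-key functional encryption. -/
structure UTPKFE where
  msgs : ℕ → Finset Data
  funs : FunSpace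
  setup : ℕ → PMF (Data × Data)
  keyGen : ℕ → Data → Data → PMF Data
  enc : ℕ → Data → Data → PMF (Data × Ket)
  dec : ℕ → Data → Data × Ket → PMF Data

/-- The experiment in which the adversary is given the public key. -/
def UTPKFE.game (U : UTPKFE) (𝒜 : UTAdversary) (n : ℕ) (b : Bool) (t : ℕ) :
    OptionT PMF Bool := do
  let (pk, msk) ← U.setup n
  utExperiment (U.msgs n) (U.funs.desc n) (U.funs.eval n) pk (U.keyGen n msk)
    (U.enc n pk) 𝒜 n b t

/-- Untelegraphable security with unrestricted key queries. -/
def UTPKFE.Secure (U : UTPKFE) : Prop := ∀ 𝒜 : UTAdversary, Indist (U.game 𝒜)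

/-! ## The construction -/

/-- The plaintext `(b, msk, k, sk)` for the plain scheme; `nil` stands for `⊥`. -/
def plaintext (b : Bool) (msk k sk : Data) : Data :=
  .pair (bit b) (.pair msk (.pair k sk))

/-- The function `G[ct, f]`: on `(0, msk, k, sk)` it generates a key for `f` under `msk` with the
coins `F (k, f)`, and on `(1, msk, k, sk)` it decrypts `ct` with `sk`. -/
def hybridFun (S : UTSKFE) (E : SKE) (F : PRF S.funs.desc S.coins) (n : ℕ) (ct f : Data)
    (b : Bool) (msk k sk : Data) : Data :=
  if b then E.dec n sk ct else S.keyGen n msk f (F.eval n k f)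

/-- The spaces of the building blocks fit together. The string `zero n` is the message `0` of the
secret-key scheme and `G n ct f` the circuit for the function `G[ct, f]`. -/
structure Compatible (P : PKFE) (S : UTSKFE) (E : SKE) (F : PRF S.funs.desc S.coins)
    (zero : ℕ → Data) (G : ℕ → Data → Data → Data) : Prop where
  /-- The message `0` is a message of the secret-key scheme. -/
  zero_mem : ∀ n, zero n ∈ E.msgs n
  zero_poly : PolyFun fun n _ => zero n
  /-- The secret-key scheme can encrypt the function keys. -/
  key_mem : ∀ n, ∀ msk ∈ (S.setup n).support, ∀ f ∈ S.funs.desc n, ∀ r,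
    S.keyGen n msk f r ∈ E.msgs n
  /-- The plain scheme can encrypt `(0, msk, k, ⊥)`. -/
  plain_false_mem : ∀ n, ∀ msk ∈ (S.setup n).support, ∀ k ∈ F.keys n,
    plaintext false msk k .nil ∈ P.msgs n
  /-- The plain scheme can encrypt `(1, ⊥, ⊥, sk)`. -/
  plain_true_mem : ∀ n, ∀ sk ∈ (E.gen n).support, plaintext true .nil .nil sk ∈ P.msgs n
  /-- The circuits can be written down efficiently. -/
  circuit_poly : PolyFun fun n x => G n x.fst x.snd
  /-- The circuits belong to the function space of the plain scheme. -/
  circuit_mem : ∀ n, ∀ sk ∈ (E.gen n).support, ∀ m ∈ E.msgs n, ∀ ct ∈ (E.enc n sk m).support,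
    ∀ f ∈ S.funs.desc n, G n ct f ∈ P.funs.desc n
  /-- The circuit for `G[ct, f]` computes `G[ct, f]`. -/
  circuit_eval : ∀ n, ∀ sk ∈ (E.gen n).support, ∀ m ∈ E.msgs n, ∀ ct ∈ (E.enc n sk m).support,
    ∀ f ∈ S.funs.desc n, ∀ (b : Bool) (msk k sk' : Data),
    plaintext b msk k sk' ∈ P.msgs n →
      P.funs.eval n (G n ct f) (plaintext b msk k sk') = hybridFun S E F n ct f b msk k sk'

/-- The untelegraphable public-key scheme. -/
def utpkfe (P : PKFE) (S : UTSKFE) (E : SKE) (F : PRF S.funs.desc S.coins)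
    (zero : ℕ → Data) (G : ℕ → Data → Data → Data) : UTPKFE where
  msgs := S.msgs
  funs := S.funs
  setup n := do
    let (pk, mskP) ← P.setup n
    let skE ← E.gen n
    return (pk, .pair mskP skE)
  keyGen n msk f := do
    let ct ← E.enc n msk.snd (zero n)
    P.keyGen n msk.fst (G n ct f)
  enc n pk m := do
    let msk ← S.setup n
    let k ← F.key n
    let (c, φ) ← S.enc n msk m
    let ctP ← P.enc n pk (plaintext false msk k .nil)
    return (.pair c ctP, φ)
  dec n skf ct := do
    let skf' ← P.dec n skf ct.1.snd
    S.dec n skf' (ct.1.fst, ct.2)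

end

end UTFE

namespace UTFE
noncomputable section
open Data

/-! ## Programs: frames and registers -/

/-! For each challenge bit `b` the experiment of the construction is led, by negligible changes, to
the single-ciphertext experiment of the secret-key functional scheme with the same bit. The
adversary at the end of the chain is the same for both bits, so the triangle inequality and the
security of that scheme conclude.

The chain, for an adversary `(A, B)`: (1) A function key is a plain key for the circuit `G[ct, f]`
with `ct` an encryption of `0`. While the plain ciphertext holds `(0, msk', k, ⊥)`, the secret key
`sk` is used for encryption only. By CPA security `ct` may encrypt the function key for `f` under
`msk'` with coins `F(k, f)` instead (`Kit.cpa_prOne`). (2) A key is withheld if its `ct` does not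
decrypt to that function key. This costs at most the number of steps times the decryption error,
averaged over `sk` (`abs_hybrid_checked_le`). (3) Every circuit for which a key is still given out
takes the same value on `(0, msk', k, ⊥)` and `(1, ⊥, ⊥, sk)`, and a circuit that is refused in the
plain experiment is one whose key was withheld in (2). Both plaintexts can be sampled before any key
is asked for, so the queries of `A` and of `B` alike are made after the challenge of the plain
experiment. By adaptive security the plaintext may be switched (`Kit.plain_prOne`). (4) Now `k`
occurs in the coins only. The pseudorandom function is replaced by a random one
(`Kit.prf_prOne_false`, `Kit.prf_prOne_true`), whose values are sampled when they are needed
(`core_lazyOracle`). (5) What is left is the experiment of the secret-key functional scheme, for an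
adversary that samples the plain keys, `sk` and the plain ciphertext, asks its oracle once per
function, and wraps the answers itself (`utDist_relay`, `Kit.relay_prOne`). Whatever its second
stage needs, namely those keys and the list of answered queries, is classical and can be appended to
the string that `A` outputs. The quantum ciphertext is handed on untouched.

Most of the work is to turn these reductions into machines. With bounded answers a machine has a
well-defined output distribution `QPT.exec`, governed by the recursion `QPT.exec_step`, and the
probability of output `1` in an experiment is read off from these distributions (`Lim.run`,
`Lim.bind`). A machine that runs another one is compared with it instruction by instruction
(`exec_lift`); the renaming of qubits is an operator that commutes with all gates
(`merge_intertwines`). Answering the queries of a machine by a subroutine on unused qubits is the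
same as giving it the oracle `served` (`inter_exec`), since the qubits left behind form a tensor
factor that is never touched again. Running times stay polynomial for arbitrary answers because
whatever a subroutine returns is cut off at a bound that is fixed in advance (`clip`). -/

theorem polyEval_mono (p : Polynomial ℕ) {a b : ℕ} (h : a ≤ b) : p.eval a ≤ p.eval b := by
  rw [Polynomial.eval_eq_sum_range, Polynomial.eval_eq_sum_range]
  gcongr

theorem Data.one_le_size (x : Data) : 1 ≤ x.size := by
  cases x <;> simp [Data.size]

@[simp] theorem Data.size_nil : Data.nil.size = 1 := rfl
@[simp] theorem Data.size_pair (a b : Data) : (Data.pair a b).size = a.size + b.size + 1 := rfl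
@[simp] theorem Data.fst_pair (a b : Data) : (Data.pair a b).fst = a := rfl
@[simp] theorem Data.snd_pair (a b : Data) : (Data.pair a b).snd = b := rfl
@[simp] theorem Data.fst_nil : Data.nil.fst = .nil := rfl
@[simp] theorem Data.snd_nil : Data.nil.snd = .nil := rfl

theorem Data.size_fst_le (x : Data) : x.fst.size ≤ x.size := by
  cases x <;> simp; omega

theorem Data.size_snd_le (x : Data) : x.snd.size ≤ x.size := by
  cases x <;> simp; omega

theorem Data.size_bit_le (b : Bool) : (bit b).size ≤ 3 := by cases b <;> simp [bit]

/-- A strict bound for the variables of an expression. -/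
def Expr.bound : Expr → ℕ
  | .nil => 0
  | .var x => x + 1
  | .pair x y => max (x + 1) (y + 1)
  | .fst x => x + 1
  | .snd x => x + 1
  | .eq x y => max (x + 1) (y + 1)

/-- A strict bound for the variables of a program. -/
def Cmd.bound : Cmd → ℕ
  | .skip => 0
  | .assign x e => max (x + 1) e.bound
  | .seq a b => max a.bound b.bound
  | .ite x a b => max (x + 1) (max a.bound b.bound)
  | .while x c => max (x + 1) c.bound

theorem Expr.val_cost_congr {e : Expr} {N : ℕ} (he : e.bound ≤ N) {s u : Store}
    (h : ∀ i < N, u i = s i) : e.val u = e.val s ∧ e.cost u = e.cost s := by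
  cases e <;> simp only [Expr.bound, max_le_iff, Nat.succ_le_iff] at he <;>
    simp [Expr.val, Expr.cost, h, he]

/-- A program neither reads nor writes variables beyond its bound. -/
theorem Cmd.Eval.frame {c : Cmd} {s s' : Store} {t : ℕ} (hc : c.Eval s s' t) {N : ℕ}
    (hN : c.bound ≤ N) {u : Store} (h : ∀ i < N, u i = s i) :
    ∃ u', c.Eval u u' t ∧ (∀ i < N, u' i = s' i) ∧ ∀ i, N ≤ i → u' i = u i := by
  induction hc generalizing u with
  | skip s => exact ⟨u, .skip u, h, fun _ _ => rfl⟩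
  | assign x e s =>
    simp only [Cmd.bound, max_le_iff, Nat.succ_le_iff] at hN
    obtain ⟨hv, hco⟩ := Expr.val_cost_congr hN.2 h
    refine ⟨Function.update u x (e.val u), hco ▸ .assign x e u, fun i hi => ?_, fun i hi => ?_⟩
    · by_cases hx : i = x
      · subst hx; simp [hv]
      · simp [hx, h i hi]
    · have : i ≠ x := by omega
      simp [this]
  | seq _ _ ih₁ ih₂ =>
    simp only [Cmd.bound, max_le_iff] at hN
    obtain ⟨u₁, e₁, a₁, b₁⟩ := ih₁ hN.1 h
    obtain ⟨u₂, e₂, a₂, b₂⟩ := ih₂ hN.2 a₁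
    exact ⟨u₂, .seq e₁ e₂, a₂, fun i hi => (b₂ i hi).trans (b₁ i hi)⟩
  | iteTrue hx _ ih =>
    simp only [Cmd.bound, max_le_iff, Nat.succ_le_iff] at hN
    obtain ⟨u₁, e₁, a₁, b₁⟩ := ih hN.2.1 h
    exact ⟨u₁, .iteTrue (by rwa [h _ hN.1]) e₁, a₁, b₁⟩
  | iteFalse hx _ ih =>
    simp only [Cmd.bound, max_le_iff, Nat.succ_le_iff] at hN
    obtain ⟨u₁, e₁, a₁, b₁⟩ := ih hN.2.2 h
    exact ⟨u₁, .iteFalse (by rwa [h _ hN.1]) e₁, a₁, b₁⟩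
  | whileDone hx =>
    simp only [Cmd.bound, max_le_iff, Nat.succ_le_iff] at hN
    exact ⟨u, .whileDone (by rwa [h _ hN.1]), h, fun _ _ => rfl⟩
  | whileStep hx _ _ ih₁ ih₂ =>
    have hN' := hN
    simp only [Cmd.bound, max_le_iff, Nat.succ_le_iff] at hN
    obtain ⟨u₁, e₁, a₁, b₁⟩ := ih₁ hN.2 h
    obtain ⟨u₂, e₂, a₂, b₂⟩ := ih₂ hN' a₁
    exact ⟨u₂, .whileStep (by rwa [h _ hN.1]) e₁ e₂, a₂, fun i hi => (b₂ i hi).trans (b₁ i hi)⟩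

theorem Expr.size_val_le_cost (e : Expr) (s : Store) : (e.val s).size ≤ e.cost s := by
  cases e
  case eq x y =>
    have := (s x).one_le_size
    have := (s y).one_le_size
    have := Data.size_bit_le (decide (s x = s y))
    simp only [Expr.val, Expr.cost]; omega
  all_goals simp [Expr.cost]

/-- An assignment costs at least the size of the value that it writes, so a variable that has
changed holds something no larger than the elapsed time. This is why polynomial time functions have
outputs of polynomial size. -/
theorem Cmd.Eval.size_le {c : Cmd} {s s' : Store} {t : ℕ} (hc : c.Eval s s' t) (i : ℕ) :
    s' i = s i ∨ (s' i).size ≤ t := by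
  induction hc with
  | skip s => exact .inl rfl
  | assign x e s =>
    by_cases hx : i = x
    · subst hx; right; simpa using e.size_val_le_cost s
    · left; simp [hx]
  | seq _ _ ih₁ ih₂ =>
    rcases ih₂ with h | h
    · rcases ih₁ with h' | h'
      · exact .inl (h.trans h')
      · right; rw [h]; omega
    · right; omega
  | iteTrue _ _ ih => rcases ih with h | h; exacts [.inl h, .inr (by omega)]
  | iteFalse _ _ ih => rcases ih with h | h; exacts [.inl h, .inr (by omega)]
  | whileDone => exact .inl rfl
  | whileStep _ _ _ ih₁ ih₂ =>
    rcases ih₂ with h | h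
    · rcases ih₁ with h' | h'
      · exact .inl (h.trans h')
      · right; rw [h]; omega
    · right; omega

theorem PolyTime.size_le {g : Data → Data} (hg : PolyTime g) :
    ∃ p : Polynomial ℕ, ∀ x, (g x).size ≤ p.eval x.size := by
  obtain ⟨c, p, h⟩ := hg
  refine ⟨p + Polynomial.X, fun x => ?_⟩
  obtain ⟨s, t, he, h0, ht⟩ := h x
  simp only [Polynomial.eval_add, Polynomial.eval_X]
  rcases he.size_le 0 with h | h
  · rw [← h0, h]; simp [inputStore]
  · rw [← h0]; omega

/-- Sets the variables `1, …, n` to `nil`. -/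
def clearVars : ℕ → Cmd
  | 0 => .skip
  | n + 1 => .seq (clearVars n) (.assign (n + 1) .nil)

theorem clearVars_eval (n : ℕ) (s : Store) :
    (clearVars n).Eval s (fun i => if 1 ≤ i ∧ i ≤ n then .nil else s i) (1 + 2 * n) := by
  induction n with
  | zero =>
    have : (fun i => if 1 ≤ i ∧ i ≤ 0 then Data.nil else s i) = s := by
      funext i; rw [if_neg]; omega
    rw [this]; exact .skip s
  | succ n ih =>
    have h := Cmd.Eval.seq ih (Cmd.Eval.assign (n + 1) .nil _)
    show (Cmd.seq _ _).Eval _ _ _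
    convert h using 1
    · funext i
      by_cases hi : i = n + 1
      · subst hi; simp [Expr.val]
      · simp only [Function.update_of_ne hi]
        congr 1
        apply propext; omega
    · simp [Expr.cost, Expr.val]; omega

/-- `c` computes `g` from register `j` into register `k`, and changes no register from `N` on
except `k`. -/
def Cmd.Computes (c : Cmd) (N j k : ℕ) (g : Data → Data) (p : Polynomial ℕ) : Prop :=
  ∀ s : Store, ∃ s' t, c.Eval s s' t ∧ s' k = g (s j) ∧ (∀ i, N ≤ i → i ≠ k → s' i = s i) ∧
    t ≤ p.eval (s j).size

/-- The program works in the variables below `N`, which are cleared beforehand; the input is copied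
from register `j` to variable `0` and the result from there to register `k`. By `Cmd.Eval.frame` the
registers from `N` on survive. One polynomial serves for all registers, so several such programs can
be combined. -/
theorem PolyTime.computes {g : Data → Data} (hg : PolyTime g) :
    ∃ N₀ : ℕ, ∀ N, N₀ ≤ N → ∃ p : Polynomial ℕ, ∀ j k, N ≤ j → N ≤ k →
      ∃ c : Cmd, c.Computes N j k g p := by
  obtain ⟨c, p, h⟩ := hg
  obtain ⟨pg, hpg⟩ := PolyTime.size_le ⟨c, p, h⟩
  refine ⟨max c.bound 1, fun N hN => ⟨p + pg + (Polynomial.X + Polynomial.C (3 + 2 * N)),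
    fun j k hj hk => ?_⟩⟩
  refine ⟨.seq (.assign 0 (.var j)) (.seq (clearVars (N - 1)) (.seq c (.assign k (.var 0)))),
    fun s => ?_⟩
  have hN1 : 1 ≤ N := le_trans (le_max_right _ _) hN
  obtain ⟨s₁, t, he, h0, ht⟩ := h (s j)
  obtain ⟨u, hu, hu1, hu2⟩ := he.frame (le_trans (le_max_left _ _) hN)
    (u := fun i => if 1 ≤ i ∧ i ≤ N - 1 then .nil else (Function.update s 0 (s j)) i) (by
      intro i hi
      by_cases hi0 : i = 0
      · subst hi0; simp [inputStore]
      · rw [if_pos (by omega)]; simp [inputStore, hi0])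
  refine ⟨_, _, .seq (.assign 0 (.var j) s) (.seq (clearVars_eval (N - 1) _)
    (.seq hu (.assign k (.var 0) _))), ?_, ?_, ?_⟩
  · simp [Expr.val, hu1 0 (by omega), h0]
  · intro i hi hik
    have hi0 : i ≠ 0 := by omega
    rw [Function.update_of_ne hik, hu2 i hi, if_neg (by omega)]
    exact Function.update_of_ne hi0 _ _
  · have := hpg (s j)
    simp only [Expr.cost, Expr.val, hu1 0 (by omega), h0, Polynomial.eval_add, Polynomial.eval_X,
      Polynomial.eval_C]
    have : (((fun i => if 1 ≤ i ∧ i ≤ N - 1 then Data.nil else s i) 0)) = s 0 := by simp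
    omega

/-- Functions computed by a program on registers are computable in polynomial time. -/
theorem PolyTime.of_registers {g : Data → Data} {c : Cmd} {N k : ℕ} {p : Polynomial ℕ}
    (h : ∀ s : Store, ∃ s' t, c.Eval s s' t ∧ s' k = g (s N) ∧ t ≤ p.eval (s N).size) :
    PolyTime g := by
  refine ⟨.seq (.assign N (.var 0)) (.seq c (.assign 0 (.var k))), 2 * p + 2 * Polynomial.X + 3,
    fun x => ?_⟩
  obtain ⟨s', t, he, hk, ht⟩ := h (Function.update (inputStore x) N x)
  refine ⟨_, _, .seq (.assign N (.var 0) _) (.seq he (.assign 0 (.var k) _)), ?_, ?_⟩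
  · simp [Expr.val, hk]
  · simp only [Function.update_self] at hk ht
    have hs := he.size_le k
    have hle : (s' k).size ≤ x.size + t := by
      rcases hs with h | h
      · rw [h]
        by_cases hkN : k = N
        · subst hkN; simp
        · rw [Function.update_of_ne hkN]
          have := x.one_le_size
          by_cases hk0 : k = 0 <;> simp [inputStore, hk0]; omega
      · omega
    simp [Expr.cost, Expr.val, inputStore]
    omega

end
end UTFE
namespace UTFE
noncomputable section
open Data

/-! ## Closure properties of polynomial time -/

theorem PolyTime.id : PolyTime fun x => x :=
  ⟨.skip, 1, fun x => ⟨_, _, .skip _, rfl, by simp⟩⟩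

theorem PolyTime.nil : PolyTime fun _ => .nil :=
  ⟨.assign 0 .nil, 2, fun x => ⟨_, _, .assign _ _ _, by simp [Expr.val], by simp [Expr.cost, Expr.val]⟩⟩

theorem PolyTime.comp {g f : Data → Data} (hg : PolyTime g) (hf : PolyTime f) :
    PolyTime fun x => g (f x) := by
  obtain ⟨Nf, hf'⟩ := hf.computes
  obtain ⟨Ng, hg'⟩ := hg.computes
  obtain ⟨pf, hf'⟩ := hf' (max Nf Ng) (le_max_left _ _)
  obtain ⟨pg, hg'⟩ := hg' (max Nf Ng) (le_max_right _ _)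
  obtain ⟨cf, hf'⟩ := hf' (max Nf Ng) (max Nf Ng + 1) le_rfl (by omega)
  obtain ⟨cg, hg'⟩ := hg' (max Nf Ng + 1) (max Nf Ng + 2) (by omega) (by omega)
  obtain ⟨qf, hqf⟩ := hf.size_le
  refine PolyTime.of_registers (c := .seq cf cg) (N := max Nf Ng) (k := max Nf Ng + 2)
    (p := pf + pg.comp qf) fun s => ?_
  obtain ⟨s₁, t₁, e₁, h₁, -, b₁⟩ := hf' s
  obtain ⟨s₂, t₂, e₂, h₂, -, b₂⟩ := hg' s₁
  refine ⟨s₂, _, .seq e₁ e₂, by rw [h₂, h₁], ?_⟩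
  have := polyEval_mono pg (hqf (s (max Nf Ng)))
  rw [h₁] at b₂
  simp only [Polynomial.eval_add, Polynomial.eval_comp]
  omega

/-- A unary assignment. -/
theorem PolyTime.of_expr₁ {h : Data → Data} (e : ℕ → Expr)
    (hv : ∀ s x, (e x).val s = h (s x)) (hc : ∀ s x, (e x).cost s ≤ 2 + 2 * (s x).size) :
    PolyTime h := by
  refine PolyTime.of_registers (c := .assign 2 (e 1)) (N := 1) (k := 2)
    (p := 2 + 2 * Polynomial.X) fun s => ⟨_, _, .assign _ _ _, by simp [hv], by simpa using hc s 1⟩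

theorem PolyTime.fst {f : Data → Data} (hf : PolyTime f) : PolyTime fun x => (f x).fst :=
  (PolyTime.of_expr₁ (h := Data.fst) .fst (fun _ _ => rfl) fun s x => by
    have := (s x).size_fst_le; simp [Expr.cost, Expr.val]; omega).comp hf

theorem PolyTime.snd {f : Data → Data} (hf : PolyTime f) : PolyTime fun x => (f x).snd :=
  (PolyTime.of_expr₁ (h := Data.snd) .snd (fun _ _ => rfl) fun s x => by
    have := (s x).size_snd_le; simp [Expr.cost, Expr.val]; omega).comp hf

/-- A binary assignment. -/
theorem PolyTime.of_expr₂ {h : Data → Data → Data} (e : ℕ → ℕ → Expr)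
    (hv : ∀ s x y, (e x y).val s = h (s x) (s y))
    (hc : ∀ s x y, (e x y).cost s ≤ 2 + (s x).size + (s y).size)
    {f g : Data → Data} (hf : PolyTime f) (hg : PolyTime g) : PolyTime fun x => h (f x) (g x) := by
  obtain ⟨Nf, hf'⟩ := hf.computes
  obtain ⟨Ng, hg'⟩ := hg.computes
  obtain ⟨pf, hf'⟩ := hf' (max Nf Ng) (le_max_left _ _)
  obtain ⟨pg, hg'⟩ := hg' (max Nf Ng) (le_max_right _ _)
  obtain ⟨cf, hf'⟩ := hf' (max Nf Ng) (max Nf Ng + 1) le_rfl (by omega)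
  obtain ⟨cg, hg'⟩ := hg' (max Nf Ng) (max Nf Ng + 2) le_rfl (by omega)
  obtain ⟨qf, hqf⟩ := hf.size_le
  obtain ⟨qg, hqg⟩ := hg.size_le
  refine PolyTime.of_registers
    (c := .seq cf (.seq cg (.assign (max Nf Ng) (e (max Nf Ng + 1) (max Nf Ng + 2)))))
    (N := max Nf Ng) (k := max Nf Ng)
    (p := pf + pg + 2 + qf + qg) fun s => ?_
  obtain ⟨s₁, t₁, e₁, h₁, f₁, b₁⟩ := hf' s
  obtain ⟨s₂, t₂, e₂, h₂, f₂, b₂⟩ := hg' s₁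
  have k₁ := f₁ (max Nf Ng) le_rfl (by omega)
  have k₂ := f₂ (max Nf Ng + 1) (by omega) (by omega)
  rw [k₁] at h₂ b₂
  rw [h₁] at k₂
  refine ⟨_, _, .seq e₁ (.seq e₂ (.assign _ _ _)), by simp [hv, k₂, h₂], ?_⟩
  have := hc s₂ (max Nf Ng + 1) (max Nf Ng + 2)
  rw [k₂, h₂] at this
  have := hqf (s (max Nf Ng))
  have := hqg (s (max Nf Ng))
  simp only [Polynomial.eval_add, Polynomial.eval_ofNat]
  omega

theorem PolyTime.pair {f g : Data → Data} (hf : PolyTime f) (hg : PolyTime g) :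
    PolyTime fun x => .pair (f x) (g x) :=
  .of_expr₂ .pair (fun _ _ _ => rfl) (fun s x y => by simp [Expr.cost, Expr.val]; ring_nf; rfl) hf hg

theorem PolyTime.eq {f g : Data → Data} (hf : PolyTime f) (hg : PolyTime g) :
    PolyTime fun x => bit (decide (f x = g x)) :=
  .of_expr₂ (h := fun a b => bit (decide (a = b))) .eq (fun _ _ _ => rfl)
    (fun s x y => by simp [Expr.cost]) hf hg

theorem PolyTime.const (d : Data) : PolyTime fun _ => d := by
  induction d with
  | nil => exact .nil
  | pair a b iha ihb => exact iha.pair ihb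

/-- Branching on whether a value is `nil`. -/
theorem PolyTime.ifNil {t f g : Data → Data} (ht : PolyTime t) (hf : PolyTime f)
    (hg : PolyTime g) : PolyTime fun x => if t x = .nil then f x else g x := by
  obtain ⟨Nt, ht'⟩ := ht.computes
  obtain ⟨Nf, hf'⟩ := hf.computes
  obtain ⟨Ng, hg'⟩ := hg.computes
  set N := max Nt (max Nf Ng) with hN
  obtain ⟨pt, ht'⟩ := ht' N (by omega)
  obtain ⟨pf, hf'⟩ := hf' N (by omega)
  obtain ⟨pg, hg'⟩ := hg' N (by omega)
  obtain ⟨ct, ht'⟩ := ht' N (N + 1) le_rfl (by omega)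
  obtain ⟨cf, hf'⟩ := hf' N (N + 2) le_rfl (by omega)
  obtain ⟨cg, hg'⟩ := hg' N (N + 2) le_rfl (by omega)
  refine PolyTime.of_registers (c := .seq ct (.ite (N + 1) cg cf)) (N := N) (k := N + 2)
    (p := pt + pf + pg + 1) fun s => ?_
  obtain ⟨s₁, t₁, e₁, h₁, f₁, b₁⟩ := ht' s
  have k₁ := f₁ N le_rfl (by omega)
  by_cases hc : t (s N) = .nil
  · obtain ⟨s₂, t₂, e₂, h₂, f₂, b₂⟩ := hf' s₁
    refine ⟨_, _, .seq e₁ (.iteFalse (by rw [h₁, hc]) e₂), by rw [h₂, k₁, if_pos hc], ?_⟩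
    rw [k₁] at b₂
    simp only [Polynomial.eval_add, Polynomial.eval_one]
    omega
  · obtain ⟨s₂, t₂, e₂, h₂, f₂, b₂⟩ := hg' s₁
    refine ⟨_, _, .seq e₁ (.iteTrue (by rwa [h₁]) e₂), by rw [h₂, k₁, if_neg hc], ?_⟩
    rw [k₁] at b₂
    simp only [Polynomial.eval_add, Polynomial.eval_one]
    omega

theorem bit_eq_nil {b : Bool} : bit b = .nil ↔ b = false := by cases b <;> simp [bit]

theorem PolyTime.ifEq {a b f g : Data → Data} (ha : PolyTime a) (hb : PolyTime b)
    (hf : PolyTime f) (hg : PolyTime g) : PolyTime fun x => if a x = b x then f x else g x := by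
  have := (ha.eq hb).ifNil hg hf
  simpa [bit_eq_nil] using this

/-- The length of the right spine. -/
def Data.spine : Data → ℕ
  | .nil => 0
  | .pair _ b => b.spine + 1

theorem Data.spine_lt_size (x : Data) : x.spine < x.size := by
  induction x with
  | nil => simp [Data.spine]
  | pair a b _ ih => simp [Data.spine]; omega

@[simp] theorem Data.spine_unary (n : ℕ) : (unary n).spine = n := by
  induction n with
  | zero => rfl
  | succ n ih => simp [unary, Data.spine, ih]

theorem Data.size_unary (n : ℕ) : (unary n).size = 2 * n + 1 := by
  induction n with
  | zero => rfl
  | succ n ih => simp [unary, ih]; omega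

/-- Iteration, as many times as the right spine of `cnt x` is long, provided that the
intermediate results are polynomially bounded. -/
theorem PolyTime.iterate {g cnt ini : Data → Data} (hg : PolyTime g) (hcnt : PolyTime cnt)
    (hini : PolyTime ini) (q : Polynomial ℕ)
    (hq : ∀ x : Data, ∀ i ≤ (cnt x).spine, (g^[i] (ini x)).size ≤ q.eval x.size) :
    PolyTime fun x => g^[(cnt x).spine] (ini x) := by
  obtain ⟨N₀, hg'⟩ := hg.computes
  obtain ⟨N₁, hcnt'⟩ := hcnt.computes
  obtain ⟨N₂, hini'⟩ := hini.computes
  set N := N₀ + N₁ + N₂ + 1 with hN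
  obtain ⟨p, hg'⟩ := hg' N (by omega)
  obtain ⟨p₁, hcnt'⟩ := hcnt' N (by omega)
  obtain ⟨p₂, hini'⟩ := hini' N (by omega)
  obtain ⟨c, hc⟩ := hg' (N + 2) (N + 2) (by omega) (by omega)
  obtain ⟨c₁, hc₁⟩ := hcnt' N (N + 1) (by omega) (by omega)
  obtain ⟨c₂, hc₂⟩ := hini' N (N + 2) (by omega) (by omega)
  obtain ⟨r, hr⟩ := hcnt.size_le
  -- `Q` bounds the values of the iteration and `A` the counter. A round consists of the counter
  -- update, at most `1 + A`, the body, at most `p(Q)`, and one unit for the test; the final `+ 1`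
  -- is the failing test.
  have loop : ∀ (m : ℕ) (s : Store) (Q A : ℕ), (s (N + 1)).spine = m → (s (N + 1)).size ≤ A →
      (∀ i ≤ m, (g^[i] (s (N + 2))).size ≤ Q) →
      ∃ s' t, (Cmd.while (N + 1) (.seq (.assign (N + 1) (.snd (N + 1))) c)).Eval s s' t ∧
        s' (N + 2) = g^[m] (s (N + 2)) ∧ t ≤ m * (p.eval Q + A + 2) + 1 := by
    intro m
    induction m with
    | zero =>
      intro s Q A hs _ _
      refine ⟨s, 1, .whileDone ?_, rfl, by simp⟩
      cases h : s (N + 1) with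
      | nil => rfl
      | pair a b => rw [h] at hs; simp [Data.spine] at hs
    | succ m ih =>
      intro s Q A hs hA hQ
      obtain ⟨a, b, hab⟩ : ∃ a b, s (N + 1) = .pair a b := by
        cases h : s (N + 1) with
        | nil => rw [h] at hs; simp [Data.spine] at hs
        | pair a b => exact ⟨a, b, rfl⟩
      have hb : b.spine = m := by rw [hab] at hs; simpa [Data.spine] using hs
      obtain ⟨s₁, t₁, e₁, h₁, f₁, b₁⟩ := hc (Function.update s (N + 1) b)
      have hs2 : (Function.update s (N + 1) b) (N + 2) = s (N + 2) := by simp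
      have hs1 : s₁ (N + 1) = b := by rw [f₁ (N + 1) (by omega) (by omega)]; simp
      rw [hs2] at h₁ b₁
      have hbA : b.size ≤ A := by rw [hab] at hA; simp at hA; omega
      obtain ⟨s₂, t₂, e₂, h₂, b₂⟩ := ih s₁ Q A (by rw [hs1, hb]) (by rwa [hs1]) (by
        intro i hi
        rw [h₁]
        exact hQ (i + 1) (by omega))
      have e₀ := Cmd.Eval.assign (N + 1) (.snd (N + 1)) s
      have hv : (Expr.snd (N + 1)).val s = b := by simp [Expr.val, hab]
      rw [hv] at e₀
      refine ⟨s₂, _, .whileStep (by simp [hab]) (.seq e₀ e₁) e₂, ?_, ?_⟩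
      · rw [h₂, h₁]; rfl
      · have := polyEval_mono p (hQ 0 (by omega))
        simp only [Function.iterate_zero, id_eq] at this
        simp only [Expr.cost, hv, Nat.succ_mul]
        omega
  refine PolyTime.of_registers (N := N) (k := N + 2)
    (c := .seq c₁ (.seq c₂ (.while (N + 1) (.seq (.assign (N + 1) (.snd (N + 1))) c))))
    (p := p₁ + p₂ + r * (p.comp q + r + 2) + 1) fun s => ?_
  obtain ⟨s₁, t₁, e₁, h₁, f₁, b₁⟩ := hc₁ s
  obtain ⟨s₂, t₂, e₂, h₂, f₂, b₂⟩ := hc₂ s₁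
  have hN1 := f₂ (N + 1) (by omega) (by omega)
  have hN0 := f₁ N le_rfl (by omega)
  rw [h₁] at hN1
  rw [hN0] at h₂ b₂
  have hr' := hr (s N)
  obtain ⟨s', t, e, h, b⟩ := loop (cnt (s N)).spine s₂
    (q.eval (s N).size) (r.eval (s N).size) (by rw [hN1]) (by rwa [hN1])
    (by rw [h₂]; exact hq (s N))
  refine ⟨s', _, .seq e₁ (.seq e₂ e), by rw [h, h₂], ?_⟩
  have h3 : (cnt (s N)).spine ≤ r.eval (s N).size := ((cnt (s N)).spine_lt_size.le).trans hr'
  simp only [Polynomial.eval_add, Polynomial.eval_mul,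
    Polynomial.eval_comp, Polynomial.eval_ofNat, Polynomial.eval_one]
  have := Nat.mul_le_mul_right (p.eval (q.eval (s N).size) + r.eval (s N).size + 2) h3
  omega

attribute [fun_prop] PolyTime
attribute [fun_prop] PolyTime.id PolyTime.const PolyTime.comp PolyTime.fst PolyTime.snd
  PolyTime.pair PolyTime.eq PolyTime.ifEq

end
end UTFE
namespace UTFE
noncomputable section
open Data

/-! ## List processing in polynomial time -/

/-- The entries along the right spine. -/
def Data.toList : Data → List Data
  | .nil => []
  | .pair a b => a :: b.toList

/-- Whether all entries `e` of the list satisfy `t (e, env) ≠ nil`. -/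
def allList (t : Data → Data) (env : Data) : Data → Bool
  | .nil => true
  | .pair e r => decide (t (.pair e env) ≠ .nil) && allList t env r

theorem allList_iff (t : Data → Data) (env l : Data) :
    allList t env l = true ↔ ∀ e ∈ l.toList, t (.pair e env) ≠ .nil := by
  induction l with
  | nil => simp [allList, Data.toList]
  | pair a b _ ih => simp [allList, Data.toList, ih]

/-- The loop state is `(rest of the list, (flag, env))`; a round drops the first entry and clears
the flag if the test fails. Since the list only shrinks, the states stay as small as
`PolyTime.iterate` requires. -/
theorem PolyTime.allList {t f g : Data → Data} (ht : PolyTime t) (hf : PolyTime f)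
    (hg : PolyTime g) : PolyTime fun x => bit (allList t (f x) (g x)) := by
  let st : Data → Data := fun s => .pair s.fst.snd (.pair
    (if t (.pair s.fst.fst s.snd.snd) = .nil then .nil else s.snd.fst) s.snd.snd)
  have hst : PolyTime st := by fun_prop
  have inv : ∀ i (l env : Data) (b : Bool), i ≤ l.spine →
      (st^[i] (.pair l (.pair (bit b) env))).size ≤ l.size + 3 + env.size + 2 := by
    intro i
    induction i with
    | zero =>
      intro l env b _
      have := size_bit_le b
      simp; omega
    | succ i ih =>
      intro l env b hi
      cases l with
      | nil => simp [Data.spine] at hi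
      | pair e r =>
        simp only [Data.spine] at hi
        rw [Function.iterate_succ_apply]
        by_cases h : t (.pair e env) = .nil
        · have h1 : st (.pair (.pair e r) (.pair (bit b) env)) = .pair r (.pair (bit false) env) := by
            simp [st, h, bit]
          have := ih r env false (by omega)
          rw [h1, size_pair]; omega
        · have h1 : st (.pair (.pair e r) (.pair (bit b) env)) = .pair r (.pair (bit b) env) := by
            simp [st, h]
          have := ih r env b (by omega)
          rw [h1, size_pair]; omega
  have val : ∀ (l env : Data) (b : Bool), st^[l.spine] (.pair l (.pair (bit b) env))
      = .pair .nil (.pair (bit (b && UTFE.allList t env l)) env) := by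
    intro l
    induction l with
    | nil => intro env b; simp [Data.spine, UTFE.allList]
    | pair e r _ ih =>
      intro env b
      rw [Data.spine, Function.iterate_succ_apply]
      by_cases h : t (.pair e env) = .nil
      · have := ih env false
        simp only [bit] at this
        simp [st, h, this, UTFE.allList, bit]
      · have := ih env b
        simp [st, h, this, UTFE.allList]
  obtain ⟨pf, hpf⟩ := hf.size_le
  obtain ⟨pg, hpg⟩ := hg.size_le
  have := (hst.iterate hg (ini := fun x => .pair (g x) (.pair (bit true) (f x))) (by fun_prop)
    (pg + pf + 5) fun x i hi => by
      have := inv i (g x) (f x) true hi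
      have := hpf x
      have := hpg x
      simp only [Polynomial.eval_add, Polynomial.eval_ofNat]
      omega).snd.fst
  simpa [val] using this

/-- The value under the key `f` in an association list, or `nil`. -/
def lookup (f : Data) : Data → Data
  | .nil => .nil
  | .pair e r => if e.fst = f then .pair .nil e.snd else lookup f r

/-- The loop state is `(rest of the list, (result, key))`. A hit is stored as `pair nil value`,
which is never `nil`, and a result that is not `nil` is kept, so the first hit wins. -/
theorem PolyTime.lookup {f g : Data → Data} (hf : PolyTime f)
    (hg : PolyTime g) : PolyTime fun x => lookup (f x) (g x) := by
  let st : Data → Data := fun s => .pair s.fst.snd (.pair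
    (if s.snd.fst = .nil then (if s.fst.fst.fst = s.snd.snd then .pair .nil s.fst.fst.snd else .nil)
      else s.snd.fst) s.snd.snd)
  have hst : PolyTime st := by fun_prop
  -- The factor `2` leaves room for a copied entry: the result grows by at most the size of the
  -- entry plus two, while twice the list shrinks by twice the entry plus two.
  have inv : ∀ i (l acc k : Data), i ≤ l.spine →
      (st^[i] (.pair l (.pair acc k))).size ≤ 2 * l.size + acc.size + k.size + 2 := by
    intro i
    induction i with
    | zero => intro l acc k _; simp; omega
    | succ i ih =>
      intro l acc k hi
      cases l with
      | nil => simp [Data.spine] at hi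
      | pair e r =>
        simp only [Data.spine] at hi
        rw [Function.iterate_succ_apply]
        have h1 : st (.pair (.pair e r) (.pair acc k)) = .pair r (.pair
          (if acc = .nil then (if e.fst = k then .pair .nil e.snd else .nil) else acc) k) := rfl
        have h2 := ih r (if acc = .nil then (if e.fst = k then .pair .nil e.snd else .nil) else acc)
          k (by omega)
        have h3 : (if acc = .nil then (if e.fst = k then Data.pair .nil e.snd else .nil)
            else acc).size ≤ acc.size + e.size + 2 := by
          have := e.size_snd_le
          split_ifs <;> simp <;> omega
        rw [h1, size_pair]; omega
  have val : ∀ (l acc k : Data), st^[l.spine] (.pair l (.pair acc k))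
      = .pair .nil (.pair (if acc = .nil then UTFE.lookup k l else acc) k) := by
    intro l
    induction l with
    | nil => intro acc k; by_cases h : acc = .nil <;> simp [Data.spine, UTFE.lookup, h]
    | pair e r _ ih =>
      intro acc k
      rw [Data.spine, Function.iterate_succ_apply]
      by_cases h : acc = .nil
      · by_cases h' : e.fst = k <;> simp [st, h, h', ih, UTFE.lookup]
      · simp [st, h, ih]
  obtain ⟨pf, hpf⟩ := hf.size_le
  obtain ⟨pg, hpg⟩ := hg.size_le
  have := (hst.iterate hg (ini := fun x => .pair (g x) (.pair .nil (f x))) (by fun_prop)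
    (2 * pg + pf + 3) fun x i hi => by
      have := inv i (g x) .nil (f x) hi
      have := hpf x
      have := hpg x
      simp only [Polynomial.eval_add, Polynomial.eval_ofNat, Polynomial.eval_mul, size_nil] at *
      omega).snd.fst
  simpa [val] using this

/-! ## Size checks -/

/-- One step of the traversal of a stack of trees. -/
def popStep (s : Data) : Data :=
  if s = .nil then .nil else
    if s.fst = .nil then s.snd else .pair s.fst.fst (.pair s.fst.snd s.snd)

/-- The number of nodes of all trees on a stack. -/
def stackWeight : Data → ℕ
  | .nil => 0
  | .pair x r => x.size + stackWeight r

theorem stackWeight_eq_zero (s : Data) : stackWeight s = 0 ↔ s = .nil := by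
  cases s with
  | nil => simp [stackWeight]
  | pair x r => have := x.one_le_size; simp [stackWeight]; omega

/-- A leaf on top is removed; an inner node on top is replaced by its two subtrees. Either way
exactly one node disappears. -/
theorem stackWeight_popStep (s : Data) : stackWeight (popStep s) = stackWeight s - 1 := by
  cases s with
  | nil => simp [popStep, stackWeight]
  | pair x r => cases x <;> simp [popStep, stackWeight]; omega

theorem stackWeight_iterate (i : ℕ) (s : Data) :
    stackWeight (popStep^[i] s) = stackWeight s - i := by
  induction i generalizing s with
  | zero => simp
  | succ i ih => rw [Function.iterate_succ_apply, ih, stackWeight_popStep]; omega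

theorem size_popStep_le (s : Data) : (popStep s).size ≤ s.size := by
  cases s with
  | nil => simp [popStep]
  | pair x r => cases x <;> simp [popStep] <;> omega

theorem size_popStep_iterate_le (i : ℕ) (s : Data) : (popStep^[i] s).size ≤ s.size := by
  induction i generalizing s with
  | zero => simp
  | succ i ih => rw [Function.iterate_succ_apply]; exact (ih _).trans (size_popStep_le s)

/-- `x`, unless it is larger than the right spine of `B` is long. -/
def clip (B x : Data) : Data := if x.size ≤ B.spine then x else .nil

theorem size_clip_le (B x : Data) : (clip B x).size ≤ B.size := by
  unfold clip
  have := B.spine_lt_size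
  have := B.one_le_size
  split_ifs <;> simp <;> omega

theorem PolyTime.popStep : PolyTime popStep := by
  unfold UTFE.popStep
  fun_prop

/-- The size of `x` is counted by dismantling a stack that holds `x`, one node per round. After as
many rounds as the spine of the bound is long, the stack is empty exactly if `x` is small enough. -/
theorem PolyTime.clip {f g : Data → Data} (hf : PolyTime f) (hg : PolyTime g) :
    PolyTime fun x => clip (f x) (g x) := by
  obtain ⟨pg, hpg⟩ := hg.size_le
  have := PolyTime.popStep.iterate hf (ini := fun x => .pair (g x) .nil) (by fun_prop)
    (pg + 2) fun x i hi => by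
      have := size_popStep_iterate_le i (.pair (g x) .nil)
      have := hpg x
      simp only [Polynomial.eval_add, Polynomial.eval_ofNat, size_pair, size_nil] at *
      omega
  have h2 := this.ifEq PolyTime.nil hg PolyTime.nil
  convert h2 using 2 with x
  have h3 : UTFE.popStep^[(f x).spine] ((g x).pair Data.nil) = .nil ↔ (g x).size ≤ (f x).spine := by
    rw [← stackWeight_eq_zero, stackWeight_iterate]
    simp [stackWeight, Nat.sub_eq_zero_iff_le]
  simp only [UTFE.clip, h3]

/-! ## Unary polynomials -/

/-- Addition of the length of the right spine to a unary numeral. -/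
theorem pair_nil_iterate (i m : ℕ) : (Data.pair .nil)^[i] (unary m) = unary (m + i) := by
  induction i generalizing m with
  | zero => rfl
  | succ i ih => rw [Function.iterate_succ_apply]; exact (ih (m + 1)).trans (by congr 1; omega)

theorem PolyTime.addUnary : PolyTime fun x => (Data.pair .nil)^[x.fst.spine] (unary x.snd.spine) := by
  have h1 : PolyTime fun x => (Data.pair .nil)^[x.spine] (unary 0) :=
    PolyTime.iterate (by fun_prop) (cnt := fun x => x) (by fun_prop) (ini := fun _ => unary 0)
      (by fun_prop) (2 * Polynomial.X) fun x i hi => by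
        rw [pair_nil_iterate, size_unary]
        have := x.spine_lt_size
        simp; omega
  have h1' : PolyTime fun x => unary x.spine := by
    simpa only [pair_nil_iterate, zero_add] using h1
  refine PolyTime.iterate (by fun_prop) (by fun_prop) (h1'.comp (f := fun x => x.snd) (by fun_prop))
    (2 * Polynomial.X) fun x i hi => ?_
  rw [pair_nil_iterate, size_unary]
  have := x.fst.spine_lt_size
  have := x.snd.spine_lt_size
  cases x with
  | nil => simp [Data.spine] at *; omega
  | pair a b => simp at *; omega

theorem PolyTime.squareUnary : PolyTime fun x => unary (x.spine * x.spine) := by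
  let st : Data → Data := fun s => .pair s.fst ((Data.pair .nil)^[s.fst.spine] (unary s.snd.spine))
  have h := PolyTime.addUnary
  have hst : PolyTime st := by fun_prop
  have val : ∀ (i m : ℕ) (x : Data), st^[i] (.pair x (unary m)) = .pair x (unary (m + i * x.spine)) := by
    intro i
    induction i with
    | zero => simp
    | succ i ih =>
      intro m x
      rw [Function.iterate_succ_apply]
      have : st (.pair x (unary m)) = .pair x (unary (m + x.spine)) := by
        simp [st, pair_nil_iterate]
      rw [this, ih]
      congr 2; ring
  have := (hst.iterate (cnt := fun x => x) (by fun_prop) (ini := fun x => .pair x (unary 0))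
    (by fun_prop) (Polynomial.X + 2 * Polynomial.X * Polynomial.X + 2) fun x i hi => by
      rw [val, size_pair, size_unary]
      simp only [Polynomial.eval_add, Polynomial.eval_ofNat, Polynomial.eval_mul, Polynomial.eval_X]
      have h1 := x.spine_lt_size
      have := Nat.mul_le_mul (hi.trans h1.le) h1.le
      nlinarith).snd
  simpa [val] using this

/-- The exponent is a power of two so that the bound can be computed by repeated squaring. -/
theorem polyEval_le_pow (p : Polynomial ℕ) : ∃ k : ℕ, ∀ n, p.eval n ≤ (n + 2) ^ (2 ^ k) := by
  have : ∃ k : ℕ, ∀ n, p.eval n ≤ (n + 2) ^ k := by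
    induction p using Polynomial.induction_on' with
    | add p q hp hq =>
      obtain ⟨a, ha⟩ := hp
      obtain ⟨b, hb⟩ := hq
      refine ⟨max a b + 1, fun n => ?_⟩
      have h1 : (n + 2) ^ a ≤ (n + 2) ^ max a b := Nat.pow_le_pow_right (by omega) (le_max_left _ _)
      have h2 : (n + 2) ^ b ≤ (n + 2) ^ max a b := Nat.pow_le_pow_right (by omega) (le_max_right _ _)
      have := ha n
      have := hb n
      rw [Polynomial.eval_add, pow_succ]
      nlinarith
    | monomial d c =>
      refine ⟨c + d, fun n => ?_⟩
      rw [Polynomial.eval_monomial, pow_add]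
      have h1 : c ≤ (n + 2) ^ c := (Nat.lt_two_pow_self (n := c)).le.trans
        (Nat.pow_le_pow_left (by omega) _)
      exact Nat.mul_le_mul h1 (Nat.pow_le_pow_left (by omega) _)
  obtain ⟨k, hk⟩ := this
  exact ⟨k, fun n => (hk n).trans (Nat.pow_le_pow_right (by omega) Nat.lt_two_pow_self.le)⟩

/-- Unary numerals above any given polynomial can be computed. -/
theorem exists_unary_bound (p : Polynomial ℕ) :
    ∃ h : Data → Data, PolyTime h ∧ ∀ n, ∃ m, h (unary n) = unary m ∧ p.eval n ≤ m := by
  obtain ⟨k, hk⟩ := polyEval_le_pow p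
  have : ∀ k : ℕ, ∃ h : Data → Data, PolyTime h ∧ ∀ n, h (unary n) = unary ((n + 2) ^ (2 ^ k)) := by
    intro k
    induction k with
    | zero => exact ⟨fun x => .pair .nil (.pair .nil x), by fun_prop, fun n => by simp [unary]⟩
    | succ k ih =>
      obtain ⟨h, hh, hv⟩ := ih
      refine ⟨_, PolyTime.squareUnary.comp hh, fun n => ?_⟩
      rw [hv, spine_unary, pow_succ 2, pow_mul, sq]
  obtain ⟨h, hh, hv⟩ := this k
  exact ⟨h, hh, fun n => ⟨_, hv n, hk n⟩⟩

attribute [fun_prop] PolyTime.clip PolyTime.lookup PolyTime.allList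

end
end UTFE
namespace UTFE
noncomputable section
open Data

/-! ## Termination of machines -/

/-- From the classical state `c` a machine halts within `N` steps, and all states on the way have
size at most `S`, if answers have size at most `L`. -/
def Term (step : Data → Instr) (L S : ℕ) : ℕ → Data → Prop
  | 0, _ => False
  | N + 1, c => c.size ≤ S ∧ ∀ c', (step c).Next L c' → Term step L S N c'

theorem Instr.Next.mono {i : Instr} {L L' : ℕ} (hL : L ≤ L') {c : Data} (h : i.Next L c) :
    i.Next L' c := by
  cases h with
  | hadamard a c => exact .hadamard a c
  | tGate a c => exact .tGate a c
  | cnot a b c => exact .cnot a b c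
  | measure a c o => exact .measure a c o
  | query q c r h => exact .query q c r (h.trans hL)

theorem Term.mono {step : Data → Instr} {L L' S S' N N' : ℕ} (hL : L' ≤ L) (hS : S ≤ S')
    (hN : N ≤ N') {c : Data} (h : Term step L S N c) : Term step L' S' N' c := by
  induction N generalizing c N' with
  | zero => exact h.elim
  | succ N ih =>
    obtain ⟨N', rfl⟩ : ∃ m, N' = m + 1 := ⟨N' - 1, by omega⟩
    exact ⟨h.1.trans hS, fun c' hc' => ih (by omega) (h.2 c' (hc'.mono hL))⟩

/-- Steps taken and fuel left always add up to `p(L) + 1`. If the fuel ran out, a state would have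
been reached after more steps than `bounded` permits. -/
theorem QPT.term (M : QPT) : ∃ p : Polynomial ℕ, ∀ (L : ℕ) (c : Data), c.size ≤ L →
    Term M.step L (p.eval L) (p.eval L) c := by
  obtain ⟨p, hp⟩ := M.bounded
  refine ⟨p + 1, fun L x hx => ?_⟩
  have key : ∀ N t c, Reaches M.step L x t c → N + t = p.eval L + 1 →
      Term M.step L (p.eval L) N c := by
    intro N
    induction N with
    | zero => intro t c hc ht; have := (hp L x hx t c hc).1; omega
    | succ N ih =>
      intro t c hc ht
      exact ⟨(hp L x hx t c hc).2, fun c' hc' => ih (t + 1) c' (.next hc hc') (by omega)⟩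
  simp only [Polynomial.eval_add, Polynomial.eval_one]
  exact (key _ 0 x .start (by omega)).mono le_rfl (by omega) le_rfl

/-- A machine from a termination bound. -/
def QPT.mk' (step : Data → Instr) (h : PolyTime fun c => (step c).code)
    (ht : ∃ p : Polynomial ℕ, ∀ (L : ℕ) (c : Data), c.size ≤ L →
      Term step L (p.eval L) (p.eval L) c) : QPT where
  step := step
  step_polyTime := h
  bounded := by
    obtain ⟨p, hp⟩ := ht
    refine ⟨p, fun L x hx t c hc => ?_⟩
    have : ∃ N, Term step L (p.eval L) N c ∧ N + t = p.eval L := by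
      induction hc with
      | start => exact ⟨_, hp L x hx, rfl⟩
      | next _ hn ih =>
        obtain ⟨N, hN, h⟩ := ih
        cases N with
        | zero => exact hN.elim
        | succ N => exact ⟨N, hN.2 _ hn, by omega⟩
    obtain ⟨N, hN, h⟩ := this
    cases N with
    | zero => exact hN.elim
    | succ N => exact ⟨by omega, hN.1⟩

/-- Induction along the execution of a machine, if answers are bounded. -/
theorem QPT.induction (M : QPT) (L : ℕ) {P : Data → Prop}
    (h : ∀ c, (∀ c', (M.step c).Next L c' → P c') → P c) (c : Data) : P c := by
  obtain ⟨p, hp⟩ := M.term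
  have := (hp (max L c.size) c (le_max_right _ _)).mono (le_max_left _ _) le_rfl le_rfl
  generalize p.eval (max L c.size) = N at this
  generalize hS : N = S at this
  have key : ∀ N c, Term M.step L S N c → P c := by
    intro N
    induction N with
    | zero => intro c hc; exact hc.elim
    | succ N ih => exact fun c hc => h c fun c' hc' => ih c' (hc.2 c' hc')
  exact key _ _ this

theorem QPT.code_size_le (M : QPT) : ∃ r : Polynomial ℕ, ∀ c, (M.step c).code.size ≤ r.eval c.size :=
  M.step_polyTime.size_le

/-! ## The result of an execution -/

/-- All answers of the oracle have size at most `L`. -/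
def Oracle.BoundedBy {σ : Type} (O : Oracle σ) (L : ℕ) : Prop :=
  ∀ s q, ∀ a ∈ (O s q).support, a.1.size ≤ L

/-- The answers of the oracle are bounded. -/
def Oracle.Bounded {σ : Type} (O : Oracle σ) : Prop := ∃ L, O.BoundedBy L

/-- Performs one instruction and goes on with `k`. -/
def perform {σ : Type} (O : Oracle σ) (k : Data → Ket → σ → PMF (Data × Ket × σ)) :
    Instr → Ket → σ → PMF (Data × Ket × σ)
  | .halt out, v, s => PMF.pure (out, v, s)
  | .hadamard a c, v, s => k c (UTFE.hadamard a v) s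
  | .tGate a c, v, s => k c (UTFE.tGate a v) s
  | .cnot a b c, v, s => k c (UTFE.cnot a b v) s
  | .measure a c, v, s => (UTFE.measure a v).bind fun r => k (.pair (bit r.1) c) r.2 s
  | .query q c, v, s => (O s q).bind fun r => k (.pair r.1 c) v r.2

/-- At most `t` steps of a machine, with a default value if the machine does not halt. -/
def QPT.execN {σ : Type} (M : QPT) (O : Oracle σ) : ℕ → Data → Ket → σ → PMF (Data × Ket × σ)
  | 0, _, _, s => PMF.pure (.nil, 0, s)
  | t + 1, c, v, s => perform O (M.execN O t) (M.step c) v s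

open scoped Classical in
/-- The execution of a machine until it halts. -/
def QPT.exec {σ : Type} (M : QPT) (O : Oracle σ) (c : Data) (v : Ket) (s : σ) :
    PMF (Data × Ket × σ) :=
  if h : ∃ T, ∀ t, T ≤ t → M.execN O t c v s = M.execN O T c v s then M.execN O h.choose c v s
  else PMF.pure (.nil, 0, s)

theorem pmf_bind_congr {α β : Type} {p : PMF α} {f g : α → PMF β}
    (h : ∀ a ∈ p.support, f a = g a) : p.bind f = p.bind g := by
  ext b
  simp only [PMF.bind_apply]
  refine tsum_congr fun a => ?_
  by_cases ha : p a = 0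
  · simp [ha]
  · rw [h a ((PMF.mem_support_iff _ _).2 ha)]

/-- Two ways to go on after an instruction agree if they do so in all possible next states. -/
theorem perform_congr {σ : Type} {O : Oracle σ} {L : ℕ} (hO : O.BoundedBy L) {i : Instr}
    {k k' : Data → Ket → σ → PMF (Data × Ket × σ)} {v : Ket} {s : σ}
    (h : ∀ c', i.Next L c' → ∀ v' s', k c' v' s' = k' c' v' s') :
    perform O k i v s = perform O k' i v s := by
  cases i with
  | halt out => rfl
  | hadamard a c => exact h _ (.hadamard a c) _ _
  | tGate a c => exact h _ (.tGate a c) _ _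
  | cnot a b c => exact h _ (.cnot a b c) _ _
  | measure a c => exact pmf_bind_congr fun r _ => h _ (.measure a c r.1) _ _
  | query q c => exact pmf_bind_congr fun r hr => h _ (.query q c r.1 (hO s q r hr)) _ _

theorem QPT.execN_stable {σ : Type} (M : QPT) {O : Oracle σ} {L S N : ℕ} (hO : O.BoundedBy L)
    {c : Data} (hc : Term M.step L S N c) {t : ℕ} (ht : N ≤ t) (v : Ket) (s : σ) :
    M.execN O t c v s = M.execN O N c v s := by
  induction N generalizing c t v s with
  | zero => exact hc.elim
  | succ N ih =>
    obtain ⟨t, rfl⟩ : ∃ m, t = m + 1 := ⟨t - 1, by omega⟩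
    exact perform_congr hO fun c' hc' v' s' => ih (hc.2 c' hc') (by omega) v' s'

theorem QPT.exec_eq_execN {σ : Type} (M : QPT) {O : Oracle σ} {L S N : ℕ} (hO : O.BoundedBy L)
    {c : Data} (hc : Term M.step L S N c) (v : Ket) (s : σ) :
    M.exec O c v s = M.execN O N c v s := by
  have h : ∃ T, ∀ t, T ≤ t → M.execN O t c v s = M.execN O T c v s :=
    ⟨N, fun t ht => M.execN_stable hO hc ht v s⟩
  rw [QPT.exec, dif_pos h]
  have h1 := h.choose_spec (max N h.choose) (le_max_right _ _)
  rw [← h1]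
  exact M.execN_stable hO hc (le_max_left _ _) v s

theorem QPT.exists_term (M : QPT) (L : ℕ) (c : Data) : ∃ S N, Term M.step L S N c := by
  obtain ⟨p, hp⟩ := M.term
  exact ⟨_, _, (hp (max L c.size) c (le_max_right _ _)).mono (le_max_left _ _) le_rfl le_rfl⟩

/-- With bounded answers the fuel does not matter once it is large, so `exec` satisfies the
recursion of an unbounded execution. Later comparisons of machines rest on this equation together
with `QPT.induction`. -/
theorem QPT.exec_step {σ : Type} (M : QPT) {O : Oracle σ} (hO : O.Bounded) (c : Data) (v : Ket)
    (s : σ) : M.exec O c v s = perform O (M.exec O) (M.step c) v s := by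
  obtain ⟨L, hO⟩ := hO
  obtain ⟨S, N, h⟩ := M.exists_term L c
  rw [M.exec_eq_execN hO h]
  cases N with
  | zero => exact h.elim
  | succ N => exact perform_congr hO fun c' hc' v' s' => (M.exec_eq_execN hO (h.2 c' hc') v' s').symm

/-! ## Limits of experiments -/

theorem run_bind_apply {α β : Type} (x : OptionT PMF α) (f : α → OptionT PMF β) (b : β) :
    (x >>= f).run (some b) = ∑' a, x.run (some a) * (f a).run (some b) := by
  rw [OptionT.run_bind]
  change (PMF.bind _ _) _ = _
  rw [PMF.bind_apply]
  refine ((Option.some_injective α).tsum_eq fun a ha => ?_).symm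
  cases a with
  | none =>
    refine absurd ?_ ha
    change x.run none * (PMF.pure none : PMF (Option β)) (some b) = 0
    simp
  | some a => exact ⟨a, rfl⟩

theorem pure_some_apply {α : Type} (a b : α) :
    (PMF.pure (some a) : PMF (Option α)) (some b) = PMF.pure a b := by
  by_cases h : b = a
  · subst h; simp
  · rw [PMF.pure_apply_of_ne _ _ h, PMF.pure_apply_of_ne _ _ (by simpa using h)]

theorem map_some_apply {α : Type} (p : PMF α) (a : α) : (p.map some) (some a) = p a := by
  rw [PMF.map, PMF.bind_apply]
  simp only [Function.comp_apply, pure_some_apply]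
  rw [← PMF.bind_apply, PMF.bind_pure]

theorem run_liftM_apply {α : Type} (p : PMF α) (a : α) :
    (liftM p : OptionT PMF α).run (some a) = p a := by
  change (PMF.bind p fun x => PMF.pure (some x)) (some a) = p a
  exact map_some_apply p a

/-- Monotone convergence for the counting measure. -/
theorem iSup_tsum_of_monotone {α : Type} (f : ℕ → α → ℝ≥0∞) (hf : ∀ a, Monotone fun t => f t a) :
    ⨆ t, ∑' a, f t a = ∑' a, ⨆ t, f t a := by
  let _ : MeasurableSpace α := ⊤
  have := MeasureTheory.lintegral_iSup (μ := MeasureTheory.Measure.count) (f := f)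
    (fun _ => measurable_from_top) (fun i j hij a => hf a hij)
  simpa [MeasureTheory.lintegral_count] using this.symm

/-- The experiments `g t` have, in the limit, the outcome `a` with probability `w a`. -/
structure Lim {α : Type} (g : ℕ → OptionT PMF α) (w : α → ℝ≥0∞) : Prop where
  mono : ∀ a, Monotone fun t => (g t).run (some a)
  sup : ∀ a, ⨆ t, (g t).run (some a) = w a

theorem Lim.bind {α β : Type} {g : ℕ → OptionT PMF α} {w : α → ℝ≥0∞}
    {f : ℕ → α → OptionT PMF β} {u : α → β → ℝ≥0∞} (hg : Lim g w)
    (hf : ∀ a, Lim (fun t => f t a) (u a)) :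
    Lim (fun t => g t >>= f t) fun b => ∑' a, w a * u a b := by
  have hm : ∀ a b, Monotone fun t => (g t).run (some a) * (f t a).run (some b) :=
    fun a b s t hst => mul_le_mul' (hg.mono a hst) ((hf a).mono b hst)
  refine ⟨fun b s t hst => ?_, fun b => ?_⟩
  · simp only [run_bind_apply]
    exact ENNReal.tsum_le_tsum fun a => hm a b hst
  · simp only [run_bind_apply]
    rw [iSup_tsum_of_monotone _ fun a => hm a b]
    refine tsum_congr fun a => ?_
    rw [← hg.sup a, ← (hf a).sup b]
    refine le_antisymm (iSup_le fun i => mul_le_mul' (le_iSup (fun i => (g i).run (some a)) i)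
      (le_iSup (fun i => (f i a).run (some b)) i)) ?_
    rw [ENNReal.iSup_mul]
    refine iSup_le fun i => ?_
    rw [ENNReal.mul_iSup]
    -- Both factors increase with `t`, so the product of values at times `i` and `j` is dominated on
    -- the diagonal, at time `max i j`.
    exact iSup_le fun j => le_iSup_of_le (max i j) (mul_le_mul' (hg.mono a (le_max_left _ _))
      ((hf a).mono b (le_max_right _ _)))

theorem Lim.liftM {α : Type} (p : PMF α) : Lim (fun _ => (liftM p : OptionT PMF α)) p :=
  ⟨fun _ _ _ _ => le_rfl, fun a => by simp only [run_liftM_apply, ciSup_const]⟩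

theorem Lim.pure {α : Type} (a : α) : Lim (fun _ => (pure a : OptionT PMF α)) (PMF.pure a) :=
  Lim.liftM (PMF.pure a) |> fun h => ⟨fun _ _ _ _ => le_rfl, fun b => by
    rw [← h.sup b]; simp only [run_liftM_apply, ciSup_const, OptionT.run_pure]
    change (PMF.pure (some a) : PMF (Option α)) (some b) = _
    exact pure_some_apply a b⟩

/-- The pure monad instances agree with the explicit combinators. -/
theorem Lim.guard (P : Prop) [Decidable P] :
    Lim (fun _ => (guard P : OptionT PMF Unit)) fun _ => if P then 1 else 0 := by
  by_cases h : P
  · simp only [_root_.guard, h, if_true]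
    convert Lim.pure () using 1
    funext a
    simp
  · simp only [_root_.guard, h, if_false]
    refine ⟨fun _ _ _ _ => le_rfl, fun b => ?_⟩
    rw [ciSup_const, OptionT.run_failure]
    change (PMF.pure none : PMF (Option Unit)) (some b) = 0
    simp

theorem prOne_eq {g : ℕ → OptionT PMF Bool} {w : Bool → ℝ≥0∞} (h : Lim g w) :
    prOne g = (w true).toReal := by
  rw [prOne, h.sup]

/-! ## Runs and executions -/

/-- One more step of a run. -/
def performT {σ : Type} (O : Oracle σ) (k : Data → Ket → σ → OptionT PMF (Data × Ket × σ)) :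
    Instr → Ket → σ → OptionT PMF (Data × Ket × σ)
  | .halt out, v, s => pure (out, v, s)
  | .hadamard a c, v, s => k c (UTFE.hadamard a v) s
  | .tGate a c, v, s => k c (UTFE.tGate a v) s
  | .cnot a b c, v, s => k c (UTFE.cnot a b v) s
  | .measure a c, v, s => liftM (UTFE.measure a v) >>= fun r => k (.pair (bit r.1) c) r.2 s
  | .query q c, v, s => liftM (O s q) >>= fun r => k (.pair r.1 c) v r.2

theorem QPT.run_succ {σ : Type} (M : QPT) (O : Oracle σ) (t : ℕ) (c : Data) (v : Ket) (s : σ) :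
    M.run O (t + 1) c v s = performT O (M.run O t) (M.step c) v s := by
  rw [QPT.run]
  cases M.step c <;> rfl

theorem QPT.run_mono {σ : Type} (M : QPT) (O : Oracle σ) (t : ℕ) (c : Data) (v : Ket) (s : σ)
    (a : Data × Ket × σ) : (M.run O t c v s).run (some a) ≤ (M.run O (t + 1) c v s).run (some a) := by
  induction t generalizing c v s with
  | zero =>
    refine le_trans (le_of_eq ?_) zero_le
    rw [QPT.run, OptionT.run_failure]
    change (PMF.pure none : PMF (Option _)) (some a) = 0
    simp
  | succ t ih =>
    rw [M.run_succ O t, M.run_succ O (t + 1)]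
    cases M.step c with
    | halt out => exact le_rfl
    | hadamard a c => exact ih _ _ _
    | tGate a c => exact ih _ _ _
    | cnot a b c => exact ih _ _ _
    | measure a c =>
      simp only [performT, run_bind_apply]
      exact ENNReal.tsum_le_tsum fun r => mul_le_mul' le_rfl (ih _ _ _)
    | query q c =>
      simp only [performT, run_bind_apply]
      exact ENNReal.tsum_le_tsum fun r => mul_le_mul' le_rfl (ih _ _ _)

theorem pmf_bind_apply_congr {α β γ : Type} {p : PMF α} {f : α → β → ℝ≥0∞} {g : α → PMF γ} {b : β}
    {c : γ} (h : ∀ a ∈ p.support, f a b = g a c) : ∑' a, p a * f a b = p.bind g c := by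
  rw [PMF.bind_apply]
  refine tsum_congr fun a => ?_
  by_cases ha : p a = 0
  · simp [ha]
  · rw [h a ((PMF.mem_support_iff _ _).2 ha)]

theorem QPT.run_apply {σ : Type} (M : QPT) {O : Oracle σ} {L S N t : ℕ} (hO : O.BoundedBy L)
    {c : Data} (hc : Term M.step L S N c) (ht : N ≤ t) (v : Ket) (s : σ) (a : Data × Ket × σ) :
    (M.run O t c v s).run (some a) = M.exec O c v s a := by
  induction N generalizing c t v s with
  | zero => exact hc.elim
  | succ N ih =>
    obtain ⟨t, rfl⟩ : ∃ m, t = m + 1 := ⟨t - 1, by omega⟩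
    have ih' := fun c' hc' v s => ih (t := t) (hc.2 c' hc') (by omega) v s
    rw [M.run_succ O, M.exec_step ⟨L, hO⟩]
    revert ih'
    cases M.step c with
    | halt out =>
      intro _
      change (PMF.pure (some _) : PMF (Option _)) (some a) = PMF.pure _ a
      exact pure_some_apply _ _
    | hadamard a c => exact fun ih' => ih' _ (.hadamard a c) _ _
    | tGate a c => exact fun ih' => ih' _ (.tGate a c) _ _
    | cnot a b c => exact fun ih' => ih' _ (.cnot a b c) _ _
    | measure x c =>
      intro ih'
      simp only [performT, perform, run_bind_apply, run_liftM_apply]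
      exact pmf_bind_apply_congr (f := fun (r : Bool × Ket) a => (M.run O t (.pair (bit r.1) c) r.2 s).run (some a))
        fun r _ => ih' _ (.measure x c r.1) _ _
    | query q c =>
      intro ih'
      simp only [performT, perform, run_bind_apply, run_liftM_apply]
      exact pmf_bind_apply_congr (f := fun r a => (M.run O t (.pair r.1 c) v r.2).run (some a))
        fun r hr => ih' _ (.query q c r.1 (hO s q r hr)) _ _

theorem Lim.run {σ : Type} (M : QPT) {O : Oracle σ} (hO : O.Bounded) (c : Data) (v : Ket) (s : σ) :
    Lim (fun t => M.run O t c v s) (M.exec O c v s) := by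
  obtain ⟨L, hO⟩ := hO
  obtain ⟨S, N, h⟩ := M.exists_term L c
  have hm : ∀ a, Monotone fun t => (M.run O t c v s).run (some a) :=
    fun a => monotone_nat_of_le_succ fun t => M.run_mono O t c v s a
  refine ⟨hm, fun a => le_antisymm (iSup_le fun t => ?_) ?_⟩
  · exact (hm a (le_max_left t N)).trans (M.run_apply hO h (le_max_right _ _) v s a).le
  · rw [← M.run_apply hO h le_rfl v s a]
    exact le_iSup (fun t => (M.run O t c v s).run (some a)) N

/-- The oracle that does not answer. -/
def silent : Oracle Unit := fun _ _ => PMF.pure (.nil, ())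

theorem silent_boundedBy : silent.BoundedBy 1 := by
  intro s q a ha
  simp [silent] at ha
  simp [ha]

/-- Two probability distributions of which one lies pointwise below the other are equal, as both
have total mass one. This converts "halts with the right distribution after some `t` steps" into a
statement about `exec`. -/
theorem PMF_eq_of_run {α : Type} {p : PMF α} {x : OptionT PMF α} (h : ∀ a, x.run (some a) ≤ p a)
    {q : PMF α} (hq : x.run = q.map some) : q = p := by
  have hle : ∀ a, q a ≤ p a := fun a => by
    refine le_trans (le_of_eq ?_) (h a)
    rw [hq, map_some_apply]
  ext a
  refine le_antisymm (hle a) ?_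
  by_contra hlt
  push Not at hlt
  have : ∑' a, q a < ∑' a, p a :=
    ENNReal.tsum_lt_tsum (by rw [q.tsum_coe]; simp) hle hlt
  rw [q.tsum_coe, p.tsum_coe] at this
  exact lt_irrefl _ this

end
end UTFE
namespace UTFE
noncomputable section
open Data

/-! ## Gates in coordinates -/

theorem linearOp_zero (g : Finset Data → Ket) : linearOp g 0 = 0 := Finsupp.sum_zero_index

theorem linearOp_add (g : Finset Data → Ket) (v w : Ket) :
    linearOp g (v + w) = linearOp g v + linearOp g w :=
  Finsupp.sum_add_index' (fun _ => zero_smul _ _) fun _ _ _ => add_smul _ _ _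

theorem linearOp_single (g : Finset Data → Ket) (S : Finset Data) (z : ℂ) :
    linearOp g (Finsupp.single S z) = z • g S := Finsupp.sum_single_index (zero_smul _ _)

theorem basis_apply (S U : Finset Data) : basis S U = if S = U then 1 else 0 :=
  Finsupp.single_apply

/-- The matrix of the gate is symmetric: the coordinate at `U` is fed by the two basis vectors that
agree with `U` apart from qubit `a`. In this form gates can be compared coordinate by coordinate. -/
theorem hadamard_apply (a : Data) (v : Ket) (U : Finset Data) :
    hadamard a v U = ((1 / Real.sqrt 2 : ℝ) : ℂ) *
      (v (U.erase a) + (if a ∈ U then (-1 : ℂ) else 1) * v (insert a U)) := by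
  induction v using Finsupp.induction_linear with
  | zero => simp [hadamard, linearOp_zero]
  | add v w hv hw =>
    rw [hadamard, linearOp_add, Finsupp.add_apply]
    rw [hadamard] at hv hw
    rw [hv, hw, Finsupp.add_apply, Finsupp.add_apply]; ring
  | single S z =>
    rw [hadamard, linearOp_single]
    simp only [Finsupp.smul_apply, Finsupp.add_apply, basis_apply, smul_eq_mul, Finsupp.single_apply]
    by_cases hU : a ∈ U
    · have h1 : S.erase a ≠ U := fun h => by subst h; simp at hU
      have h2 : insert a U = U := Finset.insert_eq_of_mem hU
      rw [if_neg h1, h2, if_pos hU]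
      by_cases hS : a ∈ S
      · have h3 : S ≠ U.erase a := fun h => by subst h; simp at hS
        rw [if_neg h3, if_pos hS, Finset.insert_eq_of_mem hS]
        split_ifs <;> ring
      · have h3 : S ≠ U := fun h => hS (h ▸ hU)
        have h4 : insert a S = U ↔ S = U.erase a :=
          ⟨fun h => by rw [← h, Finset.erase_insert hS], fun h => by rw [h, Finset.insert_erase hU]⟩
        rw [if_neg h3, if_neg hS]
        simp only [h4]
        split_ifs <;> ring
    · have h1 : insert a S ≠ U := fun h => hU (h ▸ Finset.mem_insert_self a S)
      rw [if_neg h1, if_neg hU, Finset.erase_eq_of_notMem hU]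
      by_cases hS : a ∈ S
      · have h3 : S ≠ U := fun h => hU (h ▸ hS)
        have h4 : S.erase a = U ↔ S = insert a U :=
          ⟨fun h => by rw [← h, Finset.insert_erase hS], fun h => by rw [h, Finset.erase_insert hU]⟩
        rw [if_neg h3]
        simp only [h4]
        split_ifs <;> ring
      · have h3 : S ≠ insert a U := fun h => hS (h ▸ Finset.mem_insert_self a U)
        rw [if_neg h3, Finset.erase_eq_of_notMem hS]
        split_ifs <;> ring

theorem tGate_apply (a : Data) (v : Ket) (U : Finset Data) :
    tGate a v U = (if a ∈ U then Complex.exp (Complex.I * (Real.pi / 4)) else 1) * v U := by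
  induction v using Finsupp.induction_linear with
  | zero => simp [tGate, linearOp_zero]
  | add v w hv hw =>
    rw [tGate, linearOp_add, Finsupp.add_apply]
    rw [tGate] at hv hw
    rw [hv, hw, Finsupp.add_apply]; ring
  | single S z =>
    rw [tGate, linearOp_single]
    simp only [Finsupp.smul_apply, basis_apply, smul_eq_mul, Finsupp.single_apply]
    by_cases h : S = U
    · subst h; simp [mul_comm]
    · simp [h]

/-- Flips a qubit in a basis vector. -/
def flip (b : Data) (S : Finset Data) : Finset Data := if b ∈ S then S.erase b else insert b S

theorem flip_flip (b : Data) (S : Finset Data) : flip b (flip b S) = S := by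
  unfold flip
  by_cases h : b ∈ S <;> simp [h]

theorem mem_flip {a b : Data} (h : a ≠ b) (S : Finset Data) : a ∈ flip b S ↔ a ∈ S := by
  unfold flip
  split_ifs <;> simp [h]

theorem cnot_apply (a b : Data) (v : Ket) (U : Finset Data) :
    cnot a b v U = if a ∈ U ∧ a ≠ b then v (flip b U) else v U := by
  induction v using Finsupp.induction_linear with
  | zero => simp [cnot, linearOp_zero]
  | add v w hv hw =>
    rw [cnot, linearOp_add, Finsupp.add_apply]
    rw [cnot] at hv hw
    rw [hv, hw]
    split_ifs <;> rfl
  | single S z =>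
    rw [cnot, linearOp_single]
    simp only [Finsupp.smul_apply, smul_eq_mul, Finsupp.single_apply]
    have hfl : (if b ∈ S then S.erase b else insert b S) = flip b S := rfl
    rw [hfl]
    have h2 : flip b S = U ↔ S = flip b U :=
      ⟨fun h => by rw [← h, flip_flip], fun h => by rw [h, flip_flip]⟩
    by_cases hab : a = b
    · subst hab
      simp [basis_apply]
    · by_cases hS : a ∈ S
      · rw [if_pos ⟨hS, hab⟩, basis_apply]
        simp only [h2]
        by_cases hU : a ∈ U
        · simp [hU, hab]
        · have h3 : S ≠ flip b U := fun h => hU ((mem_flip hab U).1 (h ▸ hS))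
          have h4 : S ≠ U := fun h => hU (h ▸ hS)
          simp [hU, h3, h4]
      · rw [if_neg (fun h => hS h.1), basis_apply]
        by_cases hU : a ∈ U
        · have h3 : S ≠ flip b U := fun h => hS (h ▸ (mem_flip hab U).2 hU)
          have h4 : S ≠ U := fun h => hS (h ▸ hU)
          simp [hU, h3, h4]
        · simp [hU]

theorem component_apply (a : Data) (b : Bool) (v : Ket) (U : Finset Data) :
    component a b v U = if decide (a ∈ U) = b then v U else 0 := Finsupp.filter_apply _ _ _

/-! ## The norm -/

theorem normSq_eq_sum {v : Ket} {D : Finset (Finset Data)} (h : ∀ S, v S ≠ 0 → S ∈ D) :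
    normSq v = ∑ S ∈ D, ‖v S‖₊ ^ 2 :=
  Finsupp.sum_of_support_subset v (fun S hS => h S (Finsupp.mem_support_iff.1 hS)) _ (by simp)

theorem exists_register (v : Ket) (a : Data) :
    ∃ Z : Finset Data, a ∉ Z ∧ ∀ S, v S ≠ 0 → S ⊆ insert a Z := by
  refine ⟨(v.support.biUnion id).erase a, by simp, fun S hS x hx => ?_⟩
  by_cases hxa : x = a
  · simp [hxa]
  · refine Finset.mem_insert_of_mem (Finset.mem_erase.2 ⟨hxa, ?_⟩)
    exact Finset.mem_biUnion.2 ⟨S, Finsupp.mem_support_iff.2 hS, hx⟩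

theorem normSq_eq_sum_pair {v : Ket} {a : Data} {Z : Finset Data} (ha : a ∉ Z)
    (h : ∀ S, v S ≠ 0 → S ⊆ insert a Z) :
    normSq v = ∑ S ∈ Z.powerset, (‖v S‖₊ ^ 2 + ‖v (insert a S)‖₊ ^ 2) := by
  rw [normSq_eq_sum (D := (insert a Z).powerset) fun S hS => Finset.mem_powerset.2 (h S hS),
    Finset.sum_powerset_insert ha, Finset.sum_add_distrib]

/-- An operator preserves the norm if it does so on pairs of basis vectors that differ in one
qubit. -/
theorem normSq_congr_pair {v w : Ket} (a : Data)
    (h0 : ∀ S, w S ≠ 0 → v (S.erase a) ≠ 0 ∨ v (insert a S) ≠ 0)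
    (h : ∀ S, a ∉ S → ‖w S‖₊ ^ 2 + ‖w (insert a S)‖₊ ^ 2 = ‖v S‖₊ ^ 2 + ‖v (insert a S)‖₊ ^ 2) :
    normSq w = normSq v := by
  obtain ⟨Z, ha, hZ⟩ := exists_register v a
  rw [normSq_eq_sum_pair ha hZ, normSq_eq_sum_pair ha (v := w)]
  · exact Finset.sum_congr rfl fun S hS =>
      h S fun hS' => ha (Finset.mem_powerset.1 hS hS')
  · intro S hS x hx
    by_cases hxa : x = a
    · simp [hxa]
    · rcases h0 S hS with h1 | h1
      · exact hZ _ h1 (Finset.mem_erase.2 ⟨hxa, hx⟩)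
      · exact hZ _ h1 (Finset.mem_insert_of_mem hx)

/-- On each pair of basis vectors that differ in qubit `a` this is the parallelogram law, scaled by
`1/2`. -/
theorem normSq_hadamard (a : Data) (v : Ket) : normSq (hadamard a v) = normSq v := by
  refine normSq_congr_pair a (fun S hS => ?_) fun S hS => ?_
  · by_contra! h
    rw [hadamard_apply, h.1, h.2] at hS
    simp at hS
  · have h1 : a ∈ insert a S := Finset.mem_insert_self a S
    rw [hadamard_apply, hadamard_apply, if_neg hS, if_pos h1, Finset.erase_eq_of_notMem hS,
      Finset.erase_insert hS, Finset.insert_eq_of_mem h1]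
    set x := v S
    set y := v (insert a S)
    rw [← NNReal.coe_inj]
    simp only [NNReal.coe_add, NNReal.coe_pow, coe_nnnorm]
    have hp := parallelogram_law_with_norm ℝ x y
    have h2 : ‖((1 / Real.sqrt 2 : ℝ) : ℂ)‖ ^ 2 = 1 / 2 := by
      rw [Complex.norm_real, Real.norm_eq_abs, sq_abs, div_pow, Real.sq_sqrt (by norm_num)]; norm_num
    have h3 : x + (-1) * y = x - y := by ring
    rw [one_mul, h3, norm_mul, norm_mul, mul_pow, mul_pow, h2]
    nlinarith

theorem normSq_tGate (a : Data) (v : Ket) : normSq (tGate a v) = normSq v := by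
  have h : ∀ S, ‖tGate a v S‖₊ = ‖v S‖₊ := fun S => by
    rw [tGate_apply, nnnorm_mul]
    have h1 : ‖Complex.exp (Complex.I * (Real.pi / 4))‖₊ = 1 := by
      rw [← NNReal.coe_inj, coe_nnnorm, mul_comm]
      have := Complex.norm_exp_ofReal_mul_I (Real.pi / 4)
      push_cast at this ⊢
      exact this
    split_ifs <;> simp [h1]
  refine normSq_congr_pair a (fun S hS => ?_) fun S hS => by rw [h, h]
  rw [← nnnorm_ne_zero_iff, h, nnnorm_ne_zero_iff] at hS
  by_cases ha : a ∈ S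
  · right; rwa [Finset.insert_eq_of_mem ha]
  · left; rwa [Finset.erase_eq_of_notMem ha]

theorem normSq_cnot (a b : Data) (v : Ket) : normSq (cnot a b v) = normSq v := by
  by_cases hab : a = b
  · congr 1
    ext U
    rw [cnot_apply, if_neg (by simp [hab])]
  refine normSq_congr_pair b (fun S hS => ?_) fun S hS => ?_
  · rw [cnot_apply] at hS
    by_cases hb : b ∈ S
    · simp only [flip, hb, if_true] at hS
      rw [Finset.insert_eq_of_mem hb]
      split_ifs at hS
      exacts [.inl hS, .inr hS]
    · simp only [flip, hb, if_false] at hS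
      rw [Finset.erase_eq_of_notMem hb]
      split_ifs at hS
      exacts [.inr hS, .inl hS]
  · rw [cnot_apply, cnot_apply]
    have h1 : a ∈ insert b S ↔ a ∈ S := by simp [hab]
    have h2 : flip b S = insert b S := by simp [flip, hS]
    have h3 : flip b (insert b S) = S := by rw [← h2, flip_flip]
    rw [h2, h3]
    simp only [h1]
    split_ifs
    · rw [add_comm]
    · rfl

theorem normSq_component_add (a : Data) (v : Ket) :
    normSq (component a true v) + normSq (component a false v) = normSq v := by
  have hD : ∀ b, ∀ S, component a b v S ≠ 0 → S ∈ v.support := fun b S hS => by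
    rw [component_apply] at hS
    rw [Finsupp.mem_support_iff]
    split_ifs at hS
    · exact hS
    · simp at hS
  rw [normSq_eq_sum (hD true), normSq_eq_sum (hD false),
    normSq_eq_sum (fun S hS => Finsupp.mem_support_iff.2 hS), ← Finset.sum_add_distrib]
  refine Finset.sum_congr rfl fun S _ => ?_
  rw [component_apply, component_apply]
  by_cases h : a ∈ S <;> simp [h]

theorem normSq_smul (r : ℂ) (v : Ket) : normSq (r • v) = ‖r‖₊ ^ 2 * normSq v := by
  rw [normSq_eq_sum (D := v.support) (fun S hS => Finsupp.mem_support_iff.2 fun h => hS (by simp [h])),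
    normSq_eq_sum (fun S hS => Finsupp.mem_support_iff.2 hS), Finset.mul_sum]
  refine Finset.sum_congr rfl fun S _ => ?_
  rw [Finsupp.smul_apply, smul_eq_mul, nnnorm_mul, mul_pow]

theorem normSq_normalize {v : Ket} (h : normSq v ≠ 0) : normSq (normalize v) = 1 := by
  rw [normalize, normSq_smul, ← NNReal.coe_inj]
  simp only [NNReal.coe_mul, NNReal.coe_pow, coe_nnnorm, NNReal.coe_one]
  rw [Complex.norm_real, Real.norm_eq_abs, sq_abs, div_pow, Real.sq_sqrt (NNReal.coe_nonneg _)]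
  have : (normSq v : ℝ) ≠ 0 := by exact_mod_cast h
  field_simp

theorem normSq_vacuum : normSq vacuum = 1 := by
  rw [normSq, vacuum, basis, Finsupp.sum_single_index] <;> simp

/-- An outcome whose component vanishes has probability zero and is not in the support, so the
division in `normalize` is never by zero. For the outcome `false` this uses that the whole vector
has norm one. -/
theorem normSq_of_mem_measure {a : Data} {v : Ket} (hv : normSq v = 1) {r : Bool × Ket}
    (hr : r ∈ (measure a v).support) : normSq r.2 = 1 := by
  rw [measure, PMF.support_map] at hr
  obtain ⟨b, hb, rfl⟩ := hr
  refine normSq_normalize fun h0 => ?_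
  have hadd := normSq_component_add a v
  rw [PMF.mem_support_iff] at hb
  refine hb ?_
  rw [coin, PMF.ofFintype_apply]
  cases b with
  | true => simp [h0]
  | false =>
    rw [h0, add_zero, hv] at hadd
    simp [hadd]

theorem QPT.normSq_exec {σ : Type} (M : QPT) {O : Oracle σ} (hO : O.Bounded) (c : Data) :
    ∀ (v : Ket) (s : σ), normSq v = 1 → ∀ r ∈ (M.exec O c v s).support, normSq r.2.1 = 1 := by
  obtain ⟨L, hL⟩ := hO
  refine M.induction L (P := fun c => ∀ (v : Ket) (s : σ), normSq v = 1 →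
    ∀ r ∈ (M.exec O c v s).support, normSq r.2.1 = 1) (fun c ih v s hv r hr => ?_) c
  rw [M.exec_step ⟨L, hL⟩] at hr
  revert ih hr
  cases M.step c with
  | halt out =>
    intro _ hr
    simp only [perform, PMF.support_pure, Set.mem_singleton_iff] at hr
    rw [hr]; exact hv
  | hadamard a c => exact fun ih hr => ih _ (.hadamard a c) _ _ (by rw [normSq_hadamard, hv]) r hr
  | tGate a c => exact fun ih hr => ih _ (.tGate a c) _ _ (by rw [normSq_tGate, hv]) r hr
  | cnot a b c => exact fun ih hr => ih _ (.cnot a b c) _ _ (by rw [normSq_cnot, hv]) r hr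
  | measure a c =>
    intro ih hr
    obtain ⟨x, hx, hr⟩ := (PMF.mem_support_bind_iff _ _ _).1 hr
    exact ih _ (.measure a c x.1) _ _ (normSq_of_mem_measure hv hx) r hr
  | query q c =>
    intro ih hr
    obtain ⟨x, hx, hr⟩ := (PMF.mem_support_bind_iff _ _ _).1 hr
    exact ih _ (.query q c x.1 (hL s q x hx)) _ _ hv r hr

end
end UTFE
namespace UTFE
noncomputable section
open Data

/-! ## Products of quantum memories -/

/-- The qubits in the region `R` are `|0⟩`. -/
def Free (w : Ket) (R : Set Data) : Prop := ∀ T, w T ≠ 0 → ∀ x ∈ T, x ∉ R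

theorem Free.mono {w : Ket} {R R' : Set Data} (h : Free w R) (hR : R' ⊆ R) : Free w R' :=
  fun T hT x hx hx' => h T hT x hx (hR hx')

theorem free_vacuum (R : Set Data) : Free vacuum R := by
  intro T hT x hx
  rw [vacuum, basis_apply] at hT
  have : ∅ = T := by by_contra h; simp [h] at hT
  simp [← this] at hx

/-- The names of qubits of `U` before the renaming `ι`. -/
def inPart (ι : Data → Data) (U : Finset Data) (hι : Function.Injective ι) : Finset Data :=
  U.preimage ι hι.injOn

open scoped Classical in
/-- The qubits of `U` outside of the range of `ι`. -/
def outPart (ι : Data → Data) (U : Finset Data) : Finset Data := U.filter (· ∉ Set.range ι)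

/-- The product of `v`, with qubits renamed by `ι`, and `w`. -/
def merge (ι : Data → Data) (w v : Ket) : Ket :=
  v.sum fun S y => w.sum fun T z => (y * z) • basis (S.image ι ∪ T)

section
variable {ι : Data → Data} (hι : Function.Injective ι)
include hι

/-- Every set of names splits in exactly one way into names in the range of `ι` and others. -/
theorem image_union_eq_iff {S T U : Finset Data} (hT : ∀ x ∈ T, x ∉ Set.range ι) :
    S.image ι ∪ T = U ↔ S = inPart ι U hι ∧ T = outPart ι U := by
  constructor
  · rintro rfl
    constructor
    · ext x
      simp only [inPart, Finset.mem_preimage, Finset.mem_union, Finset.mem_image, hι.eq_iff,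
        exists_eq_right]
      exact ⟨.inl, fun h => h.elim id fun h => absurd ⟨x, rfl⟩ (hT _ h)⟩
    · ext x
      simp only [outPart, Finset.mem_filter, Finset.mem_union, Finset.mem_image]
      constructor
      · exact fun h => ⟨.inr h, hT x h⟩
      · rintro ⟨⟨y, _, rfl⟩ | h, h'⟩
        · exact absurd ⟨y, rfl⟩ h'
        · exact h
  · rintro ⟨rfl, rfl⟩
    ext x
    simp only [inPart, outPart, Finset.mem_union, Finset.mem_image, Finset.mem_preimage,
      Finset.mem_filter]
    constructor
    · rintro (⟨y, hy, rfl⟩ | h)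
      exacts [hy, h.1]
    · intro h
      by_cases hx : x ∈ Set.range ι
      · obtain ⟨y, rfl⟩ := hx
        exact .inl ⟨y, h, rfl⟩
      · exact .inr ⟨h, hx⟩

/-- As `w` has no excited qubit in the range of `ι`, different pairs of basis vectors are sent to
different basis vectors, no terms collide, and amplitudes multiply. -/
theorem merge_apply {w : Ket} (hw : Free w (Set.range ι)) (v : Ket) (U : Finset Data) :
    merge ι w v U = v (inPart ι U hι) * w (outPart ι U) := by
  rw [merge, Finsupp.sum_apply]
  have h1 : ∀ S y, (w.sum fun T z => (y * z) • basis (S.image ι ∪ T)) U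
      = if S = inPart ι U hι then y * w (outPart ι U) else 0 := by
    intro S y
    rw [Finsupp.sum_apply]
    have h2 : ∀ T ∈ w.support, ((y * w T) • basis (S.image ι ∪ T)) U
        = if T = outPart ι U then (if S = inPart ι U hι then y * w T else 0) else 0 := by
      intro T hT
      rw [Finsupp.smul_apply, basis_apply, smul_eq_mul]
      simp only [image_union_eq_iff hι (hw T (Finsupp.mem_support_iff.1 hT))]
      by_cases h : S = inPart ι U hι <;> by_cases h' : T = outPart ι U <;> simp [h, h']
    rw [Finsupp.sum, Finset.sum_congr rfl h2, Finset.sum_ite_eq']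
    split_ifs with h3 h4 h4
    · rfl
    · rfl
    · rw [Finsupp.notMem_support_iff.1 h3, mul_zero]
    · rfl
  simp only [h1]
  rw [Finsupp.sum, Finset.sum_ite_eq']
  split_ifs with h3
  · rfl
  · rw [Finsupp.notMem_support_iff.1 h3, zero_mul]

theorem merge_eq_iff {w : Ket} (hw : Free w (Set.range ι)) {v u : Ket} :
    u = merge ι w v ↔ ∀ U, u U = v (inPart ι U hι) * w (outPart ι U) := by
  constructor
  · rintro rfl U; exact merge_apply hι hw v U
  · intro h; ext U; rw [h, merge_apply hι hw]

theorem inPart_image_union {S T : Finset Data} (hT : ∀ x ∈ T, x ∉ Set.range ι) :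
    inPart ι (S.image ι ∪ T) hι = S := ((image_union_eq_iff hι hT).1 rfl).1.symm

theorem outPart_image_union {S T : Finset Data} (hT : ∀ x ∈ T, x ∉ Set.range ι) :
    outPart ι (S.image ι ∪ T) = T := ((image_union_eq_iff hι hT).1 rfl).2.symm

theorem image_inPart_union (U : Finset Data) :
    (inPart ι U hι).image ι ∪ outPart ι U = U :=
  (image_union_eq_iff hι (fun x hx => by
    classical exact (Finset.mem_filter.1 hx).2)).2 ⟨rfl, rfl⟩

theorem normSq_merge {w : Ket} (hw : Free w (Set.range ι)) (v : Ket) :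
    normSq (merge ι w v) = normSq v * normSq w := by
  have hD : ∀ U, merge ι w v U ≠ 0 → U ∈ (v.support ×ˢ w.support).image
      fun P => P.1.image ι ∪ P.2 := by
    intro U hU
    rw [merge_apply hι hw] at hU
    refine Finset.mem_image.2 ⟨(inPart ι U hι, outPart ι U), ?_, image_inPart_union hι U⟩
    rw [Finset.mem_product, Finsupp.mem_support_iff, Finsupp.mem_support_iff]
    exact ⟨left_ne_zero_of_mul hU, right_ne_zero_of_mul hU⟩
  rw [normSq_eq_sum hD, Finset.sum_image, Finset.sum_product,
    normSq_eq_sum (v := v) (fun S hS => Finsupp.mem_support_iff.2 hS),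
    normSq_eq_sum (v := w) (fun S hS => Finsupp.mem_support_iff.2 hS), Finset.sum_mul_sum]
  · refine Finset.sum_congr rfl fun S _ => Finset.sum_congr rfl fun T hT => ?_
    have hT' := hw T (Finsupp.mem_support_iff.1 hT)
    rw [merge_apply hι hw, inPart_image_union hι hT', outPart_image_union hι hT', nnnorm_mul, mul_pow]
  · rintro ⟨S, T⟩ hST ⟨S', T'⟩ hST' h
    have hT := hw T (Finsupp.mem_support_iff.1 (Finset.mem_product.1 hST).2)
    have hT' := hw T' (Finsupp.mem_support_iff.1 (Finset.mem_product.1 hST').2)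
    have h1 := (image_union_eq_iff hι hT).1 h
    simp only [inPart_image_union hι hT', outPart_image_union hι hT'] at h1
    exact Prod.ext h1.1 h1.2

end

/-- The operator `V` turns the gates on a qubit `a` into the gates on the qubit `ι a`. -/
structure Intertwines (ι : Data → Data) (V : Ket → Ket) : Prop where
  hadamard : ∀ a v, UTFE.hadamard (ι a) (V v) = V (UTFE.hadamard a v)
  tGate : ∀ a v, UTFE.tGate (ι a) (V v) = V (UTFE.tGate a v)
  cnot : ∀ a b v, UTFE.cnot (ι a) (ι b) (V v) = V (UTFE.cnot a b v)
  component : ∀ a b v, UTFE.component (ι a) b (V v) = V (UTFE.component a b v)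
  normSq : ∀ v, UTFE.normSq (V v) = UTFE.normSq v
  smul : ∀ (r : ℂ) v, V (r • v) = r • V v

theorem Intertwines.id : Intertwines (fun a => a) fun v => v where
  hadamard _ _ := rfl
  tGate _ _ := rfl
  cnot _ _ _ := rfl
  component _ _ _ := rfl
  normSq _ := rfl
  smul _ _ := rfl

theorem Intertwines.measure {ι : Data → Data} {V : Ket → Ket} (h : Intertwines ι V) (a : Data)
    (v : Ket) : UTFE.measure (ι a) (V v) = (UTFE.measure a v).map fun r => (r.1, V r.2) := by
  rw [UTFE.measure, UTFE.measure, PMF.map_comp, h.component, h.normSq]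
  congr 1
  funext b
  simp only [Function.comp_apply, normalize, h.component, h.normSq, h.smul]

/-- A gate on `ι a` changes only the part of a basis vector inside the range of `ι`; the factor from
`w` is carried along. That `w` is a unit vector is needed only for the norm, and hence for the
probabilities of outcomes. -/
theorem merge_intertwines {ι : Data → Data} (hι : Function.Injective ι) {w : Ket}
    (hw : Free w (Set.range ι)) (hn : normSq w = 1) : Intertwines ι (merge ι w) := by
  have hmem : ∀ a U, a ∈ inPart ι U hι ↔ ι a ∈ U := fun a U => Finset.mem_preimage
  have herase : ∀ a U, inPart ι (U.erase (ι a)) hι = (inPart ι U hι).erase a := fun a U => by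
    ext x; simp [hmem, hι.eq_iff]
  have hinsert : ∀ a U, inPart ι (insert (ι a) U) hι = insert a (inPart ι U hι) := fun a U => by
    ext x; simp [hmem, hι.eq_iff]
  have herase' : ∀ a U, outPart ι (U.erase (ι a)) = outPart ι U := fun a U => by
    ext x
    simp only [outPart, Finset.mem_filter, Finset.mem_erase]
    exact ⟨fun h => ⟨h.1.2, h.2⟩, fun h => ⟨⟨fun hx => h.2 ⟨a, hx.symm⟩, h.1⟩, h.2⟩⟩
  have hinsert' : ∀ a U, outPart ι (insert (ι a) U) = outPart ι U := fun a U => by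
    ext x
    simp only [outPart, Finset.mem_filter, Finset.mem_insert]
    exact ⟨fun h => ⟨h.1.resolve_left fun hx => h.2 ⟨a, hx.symm⟩, h.2⟩, fun h => ⟨.inr h.1, h.2⟩⟩
  have hflip : ∀ a U, inPart ι (flip (ι a) U) hι = flip a (inPart ι U hι) := fun a U => by
    by_cases h : ι a ∈ U <;> simp [flip, hmem, h, herase, hinsert]
  have hflip' : ∀ a U, outPart ι (flip (ι a) U) = outPart ι U := fun a U => by
    by_cases h : ι a ∈ U <;> simp [flip, h, herase', hinsert']
  refine ⟨fun a v => ?_, fun a v => ?_, fun a b v => ?_, fun a b v => ?_, fun v => ?_,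
    fun r v => ?_⟩
  · ext U
    simp only [hadamard_apply, merge_apply hι hw, herase, hinsert, herase', hinsert', hmem]
    ring
  · ext U
    simp only [tGate_apply, merge_apply hι hw, hmem]
    ring
  · ext U
    simp only [cnot_apply, merge_apply hι hw, hmem, hflip, hflip', ne_eq, hι.eq_iff]
    split_ifs <;> rfl
  · ext U
    simp only [component_apply, merge_apply hι hw, hmem]
    split_ifs <;> simp
  · rw [normSq_merge hι hw, hn, mul_one]
  · ext U
    rw [Finsupp.smul_apply, merge_apply hι hw, merge_apply hι hw, Finsupp.smul_apply]
    simp only [smul_eq_mul]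
    ring

theorem pair_injective (a : Data) : Function.Injective (Data.pair a) := fun _ _ h => by
  injection h

/-- The renamed copy of a memory. -/
def rename (ι : Data → Data) (v : Ket) : Ket := merge ι vacuum v

theorem rename_apply {ι : Data → Data} (hι : Function.Injective ι) (v : Ket) (U : Finset Data) :
    rename ι v U = if outPart ι U = ∅ then v (inPart ι U hι) else 0 := by
  rw [rename, merge_apply hι (free_vacuum _), vacuum, basis_apply]
  by_cases h : outPart ι U = ∅
  · simp [h]
  · simp [h, Ne.symm h]

theorem normSq_rename {ι : Data → Data} (hι : Function.Injective ι) (v : Ket) :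
    normSq (rename ι v) = normSq v := by
  rw [rename, normSq_merge hι (free_vacuum _), normSq_vacuum, mul_one]

theorem smul_basis (z : ℂ) (S : Finset Data) : z • basis S = Finsupp.single S z := by
  rw [basis, Finsupp.smul_single, smul_eq_mul, mul_one]

theorem vacuum_sum (f : Finset Data → ℂ → Ket) (h : f ∅ 0 = 0) : vacuum.sum f = f ∅ 1 :=
  Finsupp.sum_single_index h

/-- Any memory is the product of itself with an empty register. This lets a subroutine that expects
an empty memory start on unused names in the middle of a computation. -/
theorem merge_vacuum (ι : Data → Data) (w : Ket) : merge ι w vacuum = w := by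
  rw [merge, vacuum_sum _ (by simp)]
  simp only [Finset.image_empty, Finset.empty_union, one_mul, smul_basis]
  exact Finsupp.sum_single w

theorem free_merge {ι : Data → Data} (hι : Function.Injective ι) {w v : Ket}
    (hw : Free w (Set.range ι)) {R : Set Data} (hR : Free w R) (h : ∀ a, ι a ∉ R) :
    Free (merge ι w v) R := by
  intro T hT x hx hxR
  rw [merge_apply hι hw] at hT
  by_cases hxι : x ∈ Set.range ι
  · obtain ⟨a, rfl⟩ := hxι
    exact h a hxR
  · refine hR _ (right_ne_zero_of_mul hT) x ?_ hxR
    simp only [outPart, Finset.mem_filter]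
    exact ⟨hx, hxι⟩

theorem free_rename {ι : Data → Data} (hι : Function.Injective ι) (v : Ket) {R : Set Data}
    (h : ∀ a, ι a ∉ R) : Free (rename ι v) R :=
  free_merge hι (free_vacuum _) (free_vacuum _) h

/-- Products with respect to disjoint renamings can be rearranged. -/
theorem merge_merge {ι κ : Data → Data} (hι : Function.Injective ι) (hκ : Function.Injective κ)
    (hικ : ∀ a b, ι a ≠ κ b) {w v u : Ket} (hwι : Free w (Set.range ι))
    (hwκ : Free w (Set.range κ)) :
    merge κ (merge ι w v) u = merge ι (merge κ w u) v := by
  have h1 : Free (merge ι w v) (Set.range κ) :=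
    free_merge hι hwι hwκ fun a ⟨b, hb⟩ => hικ a b hb.symm
  have h2 : Free (merge κ w u) (Set.range ι) :=
    free_merge hκ hwκ hwι fun a ⟨b, hb⟩ => hικ b a hb
  have e1 : ∀ U, inPart ι (outPart κ U) hι = inPart ι U hι := fun U => by
    ext x
    simp only [inPart, outPart, Finset.mem_preimage, Finset.mem_filter]
    exact ⟨fun h => h.1, fun h => ⟨h, fun ⟨b, hb⟩ => hικ x b hb.symm⟩⟩
  have e2 : ∀ U, inPart κ (outPart ι U) hκ = inPart κ U hκ := fun U => by
    ext x
    simp only [inPart, outPart, Finset.mem_preimage, Finset.mem_filter]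
    exact ⟨fun h => h.1, fun h => ⟨h, fun ⟨b, hb⟩ => hικ b x hb⟩⟩
  have e3 : ∀ U, outPart ι (outPart κ U) = outPart κ (outPart ι U) := fun U => by
    ext x
    simp only [outPart, Finset.mem_filter]
    tauto
  ext U
  rw [merge_apply hκ h1, merge_apply hι hwι, merge_apply hι h2, merge_apply hκ hwκ, e1, e2, e3]
  ring

/-- The product in the experiments is a `merge` of the first factor into a renamed copy of the
second, so the rules for `merge` apply to it. -/
theorem tensor_eq_merge (v w : Ket) :
    tensor v w = merge (Data.pair (bit false)) (rename (Data.pair (bit true)) w) v := by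
  have hr : rename (Data.pair (bit true)) w
      = w.sum fun T z => z • basis (T.image (Data.pair (bit true))) := by
    rw [rename, merge]
    refine Finsupp.sum_congr fun T _ => ?_
    rw [vacuum_sum _ (by simp), mul_one, Finset.union_empty]
  rw [tensor, merge]
  refine Finsupp.sum_congr fun S _ => ?_
  rw [hr, Finsupp.sum_sum_index (by simp) (by intros; rw [mul_add, add_smul])]
  refine Finsupp.sum_congr fun T _ => ?_
  rw [smul_basis (w T), Finsupp.sum_single_index (by simp)]

theorem pair_ne_pair {a b : Data} (h : a ≠ b) (x y : Data) : Data.pair a x ≠ Data.pair b y :=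
  fun h' => h (by injection h')

theorem normSq_tensor (v w : Ket) : normSq (tensor v w) = normSq v * normSq w := by
  rw [tensor_eq_merge, normSq_merge (pair_injective _), normSq_rename (pair_injective _)]
  refine free_rename (pair_injective _) _ ?_
  rintro a ⟨b, hb⟩
  exact pair_ne_pair (by simp [bit]) _ _ hb

end
end UTFE
namespace UTFE
noncomputable section
open Data

/-! ## Machines that run other machines -/

/-- The state of a machine that runs another one, which is in the state `c`; the data `ctx` are
kept aside. -/
def mkS (ctx c : Data) : Data := .pair .nil (.pair (.pair .nil c) ctx)

/-- The state before an outcome or an answer is put in front. -/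
def aft (ctx c : Data) : Data := .pair (.pair (bit true) c) ctx

def ctxOf (z : Data) : Data := z.snd.snd

/-- The tag in `z.snd.fst.fst` separates the two forms of a state. Under `mkS` the inner state is
stored as it is; under `aft` the machine model has put an outcome or an answer in front of the outer
state, and it has to be moved in front of the inner one. -/
def subOf (z : Data) : Data :=
  if z.snd.fst.fst = .nil then z.snd.fst.snd else .pair z.fst z.snd.fst.snd

@[simp] theorem ctxOf_mkS (ctx c : Data) : ctxOf (mkS ctx c) = ctx := rfl
@[simp] theorem subOf_mkS (ctx c : Data) : subOf (mkS ctx c) = c := by simp [subOf, mkS]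
@[simp] theorem ctxOf_aft (r ctx c : Data) : ctxOf (.pair r (aft ctx c)) = ctx := rfl
@[simp] theorem subOf_aft (r ctx c : Data) : subOf (.pair r (aft ctx c)) = .pair r c := by
  simp [subOf, aft, bit]

theorem size_mkS (ctx c : Data) : (mkS ctx c).size = c.size + ctx.size + 5 := by
  simp [mkS]; omega

theorem size_aft (r ctx c : Data) :
    (Data.pair r (aft ctx c)).size = r.size + c.size + ctx.size + 6 := by
  simp [aft, bit]; omega

theorem size_ctxOf_le (z : Data) : (ctxOf z).size ≤ z.size :=
  (size_snd_le _).trans (size_snd_le _)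

theorem Data.size_fst_add_snd_le (z : Data) : z.fst.size + z.snd.size ≤ z.size + 1 := by
  cases z <;> simp; omega

theorem size_subOf_le (z : Data) : (subOf z).size ≤ z.size + 3 := by
  unfold subOf
  have h1 := z.snd.fst.size_fst_add_snd_le
  have h2 := z.snd.size_fst_add_snd_le
  have h3 := z.size_fst_add_snd_le
  have := z.snd.snd.one_le_size
  have := z.fst.one_le_size
  have := z.snd.fst.fst.one_le_size
  split_ifs
  · omega
  · simp; omega

@[fun_prop] theorem PolyTime.mkS {f g : Data → Data} (hf : PolyTime f) (hg : PolyTime g) :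
    PolyTime fun x => mkS (f x) (g x) := by unfold UTFE.mkS; fun_prop

@[fun_prop] theorem PolyTime.aft {f g : Data → Data} (hf : PolyTime f) (hg : PolyTime g) :
    PolyTime fun x => aft (f x) (g x) := by unfold UTFE.aft; fun_prop

@[fun_prop] theorem PolyTime.ctxOf {f : Data → Data} (hf : PolyTime f) :
    PolyTime fun x => ctxOf (f x) := by unfold UTFE.ctxOf; fun_prop

@[fun_prop] theorem PolyTime.subOf {f : Data → Data} (hf : PolyTime f) :
    PolyTime fun x => subOf (f x) := by unfold UTFE.subOf; fun_prop

/-- An instruction without effect. -/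
def noop (c : Data) : Instr := .cnot .nil .nil c

theorem cnot_self (a : Data) (v : Ket) : cnot a a v = v := by
  ext U
  rw [cnot_apply, if_neg (by simp)]

theorem noop_next {L : ℕ} {c c' : Data} (h : (noop c).Next L c') : c' = c := by
  cases h; rfl

theorem perform_noop {σ : Type} (O : Oracle σ) (k : Data → Ket → σ → PMF (Data × Ket × σ))
    (c : Data) (v : Ket) (s : σ) : perform O k (noop c) v s = k c v s := by
  rw [noop, perform, cnot_self]

/-- The instruction of a machine that runs another one: qubits are renamed by `ρ`, and `hlt` and
`qry` say what to do when the other machine halts or makes a query. -/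
def liftInstr (ρ : Data → Data) (ctx : Data) (hlt : Data → Instr) (qry : Data → Data → Instr) :
    Instr → Instr
  | .halt out => hlt out
  | .hadamard a c => .hadamard (ρ a) (mkS ctx c)
  | .tGate a c => .tGate (ρ a) (mkS ctx c)
  | .cnot a b c => .cnot (ρ a) (ρ b) (mkS ctx c)
  | .measure a c => .measure (ρ a) (aft ctx c)
  | .query q c => qry q c

theorem PolyTime.liftInstr {i : Data → Instr} {ctx : Data → Data} {ρ : Data → Data → Data}
    {hlt : Data → Data → Instr} {qry : Data → Data → Data → Instr}
    (hi : PolyTime fun z => (i z).code) (hctx : PolyTime ctx)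
    (hρ : PolyTime fun z => ρ z.fst z.snd) (hh : PolyTime fun z => (hlt z.fst z.snd).code)
    (hq : PolyTime fun z => (qry z.fst z.snd.fst z.snd.snd).code) :
    PolyTime fun z => (liftInstr (ρ (ctx z)) (ctx z) (hlt (ctx z)) (qry (ctx z)) (i z)).code := by
  -- The three functions on codes are made opaque, so that `fun_prop` treats them as black boxes
  -- known to be polynomial time.
  obtain ⟨R, hR, eR⟩ : ∃ R : Data → Data, PolyTime R ∧ ∀ z, R z = ρ z.fst z.snd :=
    ⟨_, hρ, fun _ => rfl⟩
  obtain ⟨A, hA, eA⟩ : ∃ A : Data → Data, PolyTime A ∧ ∀ z, A z = (hlt z.fst z.snd).code :=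
    ⟨_, hh, fun _ => rfl⟩
  obtain ⟨B, hB, eB⟩ : ∃ B : Data → Data, PolyTime B ∧
      ∀ z, B z = (qry z.fst z.snd.fst z.snd.snd).code := ⟨_, hq, fun _ => rfl⟩
  let F : Data → Data := fun w =>
    if w.snd.fst = unary 0 then A (.pair w.fst w.snd.snd) else
    if w.snd.fst = unary 5 then B (.pair w.fst w.snd.snd) else
    if w.snd.fst = unary 4 then
      .pair (unary 4) (.pair (R (.pair w.fst w.snd.snd.fst)) (UTFE.aft w.fst w.snd.snd.snd)) else
    if w.snd.fst = unary 3 then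
      .pair (unary 3) (.pair (R (.pair w.fst w.snd.snd.fst))
        (.pair (R (.pair w.fst w.snd.snd.snd.fst)) (UTFE.mkS w.fst w.snd.snd.snd.snd)))
    else .pair w.snd.fst (.pair (R (.pair w.fst w.snd.snd.fst)) (UTFE.mkS w.fst w.snd.snd.snd))
  have hF : PolyTime F := by fun_prop
  have := hF.comp (hctx.pair hi)
  convert this using 2 with z
  cases i z <;> simp [F, UTFE.liftInstr, Instr.code, unary, eA, eB, eR]

/-- The step function `D` runs `step` in the good states `G`. -/
structure Runs (D step : Data → Instr) (ρ : Data → Data) (ctx : Data) (hlt : Data → Instr)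
    (qry : Data → Data → Instr) (G : Data → Prop) : Prop where
  run : ∀ z, G z → D z = liftInstr ρ ctx hlt qry (step (subOf z))
  good_mkS : ∀ c, G (mkS ctx c)
  good_bit : ∀ o c, G (.pair (bit o) (aft ctx c))

theorem Runs.of_ctx {D step : Data → Instr} {ρ : Data → Data} {ctx : Data} {hlt : Data → Instr}
    {qry : Data → Data → Instr}
    (h : ∀ z, ctxOf z = ctx → D z = liftInstr ρ ctx hlt qry (step (subOf z))) :
    Runs D step ρ ctx hlt qry (fun z => ctxOf z = ctx) :=
  ⟨h, fun _ => rfl, fun _ _ => rfl⟩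

theorem Term.size_le {step : Data → Instr} {L S N : ℕ} {c : Data} (h : Term step L S N c) :
    c.size ≤ S := by
  cases N with
  | zero => exact h.elim
  | succ N => exact h.1

/-- Every step of `D` performs one step of the inner machine, so its `N` steps suffice until it
halts, and `N'` more are for what `hlt` starts. The condition `hq` says that handling a query leads
back to a good state in which the inner machine has received an answer within the bound. -/
theorem Term.lift {D step : Data → Instr} {ρ : Data → Data} {ctx : Data} {hlt : Data → Instr}
    {qry : Data → Data → Instr} {G : Data → Prop} (hD : Runs D step ρ ctx hlt qry G)
    {L S S' N N' : ℕ} {z : Data}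
    (hz : Term step L S N (subOf z)) (hG : G z) (hzS : z.size ≤ S') (hS : S + ctx.size + 8 ≤ S')
    (hq : ∀ c₀ q c, step c₀ = .query q c → ∀ c', (qry q c).Next L c' → ∃ r, r.size ≤ L ∧
      subOf c' = .pair r c ∧ G c' ∧ c'.size ≤ (Data.pair r c).size + ctx.size + 8)
    (hh : ∀ c out, c.size ≤ S → step c = .halt out → ∀ c', (hlt out).Next L c' →
      Term D L S' N' c') : Term D L S' (N + N') z := by
  induction N generalizing z with
  | zero => exact hz.elim
  | succ N ih =>
    rw [Nat.succ_add]
    refine ⟨hzS, fun c' hc' => ?_⟩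
    have hz2 := hz.2
    rw [hD.run z hG] at hc'
    cases hi : step (subOf z) with
    | halt out =>
      rw [hi] at hc'
      exact (hh _ out hz.1 hi c' hc').mono le_rfl le_rfl (by omega)
    | hadamard a c =>
      rw [hi] at hc' hz2
      cases hc'
      have := hz2 _ (.hadamard a c)
      exact ih (by simpa using this) (hD.good_mkS _) (by rw [size_mkS]; have := this.size_le; omega)
    | tGate a c =>
      rw [hi] at hc' hz2
      cases hc'
      have := hz2 _ (.tGate a c)
      exact ih (by simpa using this) (hD.good_mkS _) (by rw [size_mkS]; have := this.size_le; omega)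
    | cnot a b c =>
      rw [hi] at hc' hz2
      cases hc'
      have := hz2 _ (.cnot a b c)
      exact ih (by simpa using this) (hD.good_mkS _) (by rw [size_mkS]; have := this.size_le; omega)
    | measure a c =>
      rw [hi] at hc' hz2
      cases hc' with
      | measure _ _ o =>
        have := hz2 _ (.measure a c o)
        exact ih (by simpa using this) (hD.good_bit _ _) (by
          rw [size_aft]; have := this.size_le; simp at this; omega)
    | query q c =>
      rw [hi] at hc' hz2
      obtain ⟨r, hr, h1, h2, h3⟩ := hq _ q c hi c' hc'
      have := hz2 _ (.query q c r hr)
      exact ih (by rwa [h1]) h2 (by have := this.size_le; omega)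

theorem forward_next {G : Data → Prop} {ctx : Data} {L : ℕ} {q c c' : Data}
    (h : (Instr.query q (aft ctx c)).Next L c') (hG : ∀ r, G (.pair r (aft ctx c))) :
    ∃ r, r.size ≤ L ∧ subOf c' = .pair r c ∧ G c' ∧
      c'.size ≤ (Data.pair r c).size + ctx.size + 8 := by
  cases h with
  | query _ _ r hr => exact ⟨r, hr, by simp, hG r, by rw [size_aft, size_pair]; omega⟩

/-- The two machines move in lockstep: gates and measurements on renamed qubits pass through `V`,
and queries go unchanged to the same oracle. They part only when the inner machine halts, where
control is handed to `hlt`. -/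
theorem exec_lift {D M : QPT} {ρ : Data → Data} {ctx : Data} {hlt : Data → Instr}
    {G : Data → Prop}
    (hD : Runs D.step M.step ρ ctx hlt (fun q c => .query q (aft ctx c)) G)
    (hG : ∀ c₀ q c, M.step c₀ = .query q c → ∀ r, G (.pair r (aft ctx c))) {V : Ket → Ket}
    (hV : Intertwines ρ V) {σ : Type} {O : Oracle σ} (hO : O.Bounded) {z : Data} (hz : G z)
    (v : Ket) (s : σ) :
    D.exec O z (V v) s = (M.exec O (subOf z) v s).bind
      fun r => perform O (D.exec O) (hlt r.1) (V r.2.1) r.2.2 := by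
  obtain ⟨L, hL⟩ := hO
  suffices ∀ c z, G z → subOf z = c → ∀ v s, D.exec O z (V v) s = (M.exec O c v s).bind
      fun r => perform O (D.exec O) (hlt r.1) (V r.2.1) r.2.2 from this _ z hz rfl v s
  refine M.induction L fun c ih z hz hzc v s => ?_
  rw [D.exec_step ⟨L, hL⟩, M.exec_step ⟨L, hL⟩, hD.run z hz, hzc]
  have hq := hG c
  revert ih hq
  cases M.step c with
  | halt out =>
    intro _ _
    simp [perform, UTFE.liftInstr]
  | hadamard a c =>
    intro ih _
    simp only [perform, UTFE.liftInstr, hV.hadamard]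
    exact ih _ (.hadamard a c) _ (hD.good_mkS _) (by simp) _ _
  | tGate a c =>
    intro ih _
    simp only [perform, UTFE.liftInstr, hV.tGate]
    exact ih _ (.tGate a c) _ (hD.good_mkS _) (by simp) _ _
  | cnot a b c =>
    intro ih _
    simp only [perform, UTFE.liftInstr, hV.cnot]
    exact ih _ (.cnot a b c) _ (hD.good_mkS _) (by simp) _ _
  | measure a c =>
    intro ih _
    simp only [perform, UTFE.liftInstr, hV.measure, PMF.bind_bind, PMF.bind_map]
    refine pmf_bind_congr fun r _ => ?_
    exact ih _ (.measure a c r.1) _ (hD.good_bit _ _) (by simp) _ _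
  | query q c =>
    intro ih hq
    simp only [perform, UTFE.liftInstr, PMF.bind_bind]
    refine pmf_bind_congr fun r hr => ?_
    exact ih _ (.query q c r.1 (hL s q r hr)) _ (hq _ _ rfl _) (by simp) _ _

/-- The common form of a termination bound for machines that run one other machine. -/
theorem term_of_runs {step : Data → Instr} {M : QPT}
    {ρ : Data → Data} {hlt : Data → Data → Instr} {qry : Data → Data → Data → Instr}
    (hD : ∀ ctx, Runs step M.step ρ ctx (hlt ctx) (qry ctx) (fun z => ctxOf z = ctx))
    (hh : ∀ ctx out c L, ¬ (hlt ctx out).Next L c)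
    (hq : ∀ ctx q c c' L, 1 ≤ L → (qry ctx q c).Next L c' → ∃ r, r.size ≤ L ∧
      subOf c' = .pair r c ∧ ctxOf c' = ctx ∧ c'.size ≤ (Data.pair r c).size + ctx.size + 8) :
    ∃ p : Polynomial ℕ, ∀ (L : ℕ) (c : Data), c.size ≤ L → Term step L (p.eval L) (p.eval L) c := by
  obtain ⟨p, hp⟩ := M.term
  refine ⟨p.comp (Polynomial.X + 3) + Polynomial.X + 8, fun L z hz => ?_⟩
  have h1 := size_subOf_le z
  have h2 := size_ctxOf_le z
  simp only [Polynomial.eval_add, Polynomial.eval_comp, Polynomial.eval_X, Polynomial.eval_ofNat]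
  have := (hp (L + 3) (subOf z) (by omega)).mono (L' := L) (by omega) le_rfl le_rfl
  exact (Term.lift (N' := 0) (hD (ctxOf z)) this rfl (by omega) (by omega)
    (fun _ q c _ c' h => hq _ q c c' L (z.one_le_size.trans hz) h)
    (fun _ out _ _ c' h => absurd h (hh _ out c' L))).mono le_rfl le_rfl (by omega)

/-! ### Renaming of qubits -/

/-- The machine `M` on qubits that are renamed by `ρ`. It starts in states `mkS nil c`. -/
def ren (ρ : Data → Data) (hρ : PolyTime ρ) (M : QPT) : QPT :=
  QPT.mk' (fun z => liftInstr ρ (ctxOf z) (fun out => .halt out)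
      (fun q c => .query q (aft (ctxOf z) c)) (M.step (subOf z)))
    (PolyTime.liftInstr (ρ := fun _ => ρ) (hlt := fun _ out => .halt out)
      (qry := fun ctx q c => .query q (aft ctx c)) (M.step_polyTime.comp (by fun_prop))
      (by fun_prop) (by fun_prop) (by simp only [Instr.code]; fun_prop)
      (by simp only [Instr.code]; fun_prop))
    (term_of_runs (M := M) (ρ := ρ) (hlt := fun _ out => .halt out)
      (qry := fun ctx q c => .query q (aft ctx c)) (fun ctx => .of_ctx fun z hz => by rw [hz])
      (by rintro _ _ _ _ ⟨⟩) (fun ctx _ _ _ _ _ h =>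
        forward_next (G := fun z => ctxOf z = ctx) h fun _ => rfl))

theorem ren_exec {ρ : Data → Data} {hρ : PolyTime ρ} {M : QPT} {V : Ket → Ket}
    (hV : Intertwines ρ V) {σ : Type} {O : Oracle σ} (hO : O.Bounded) (c : Data) (v : Ket) (s : σ) :
    (ren ρ hρ M).exec O (mkS .nil c) (V v) s
      = (M.exec O c v s).map fun r => (r.1, V r.2.1, r.2.2) := by
  have hD : Runs (ren ρ hρ M).step M.step ρ .nil (fun out => .halt out)
      (fun q c => .query q (aft .nil c)) (fun z => ctxOf z = .nil) :=
    Runs.of_ctx fun z hz => (show (ren ρ hρ M).step z = liftInstr ρ (ctxOf z)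
      (fun out => .halt out) (fun q c => .query q (aft (ctxOf z) c)) (M.step (subOf z)) from
        rfl).trans (by rw [hz])
  rw [exec_lift hD (fun _ _ _ _ _ => rfl) hV hO rfl, subOf_mkS]
  rfl

/-! ### Machines without queries -/

/-- The machine `M` with all queries answered by `nil`. It starts in states `mkS nil c`. -/
def mute (M : QPT) : QPT :=
  QPT.mk' (fun z => liftInstr (fun a => a) (ctxOf z) (fun out => .halt out)
      (fun _ c => noop (mkS (ctxOf z) (.pair .nil c))) (M.step (subOf z)))
    (PolyTime.liftInstr (ρ := fun _ a => a) (hlt := fun _ out => .halt out)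
      (qry := fun ctx _ c => noop (mkS ctx (.pair .nil c))) (M.step_polyTime.comp (by fun_prop))
      (by fun_prop) (by fun_prop) (by simp only [Instr.code]; fun_prop)
      (by simp only [Instr.code, noop]; fun_prop))
    (term_of_runs (M := M) (ρ := fun a => a) (hlt := fun _ out => .halt out)
      (qry := fun ctx _ c => noop (mkS ctx (.pair .nil c)))
      (fun ctx => .of_ctx fun z hz => by rw [hz])
      (by rintro _ _ _ _ ⟨⟩) (fun _ _ c _ _ hL h => by
        rw [noop_next h]
        exact ⟨.nil, hL, by simp, rfl, by rw [size_mkS]; omega⟩))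

theorem mute_step (M : QPT) (z : Data) : (mute M).step z = liftInstr (fun a => a) (ctxOf z)
    (fun out => .halt out) (fun _ c => noop (mkS (ctxOf z) (.pair .nil c))) (M.step (subOf z)) := rfl

/-- An algorithm that is specified without an oracle is thereby usable inside a machine with any
oracle: it sees the same answers as with `silent` and leaves the oracle state alone. -/
theorem mute_exec {M : QPT} {σ : Type} {O : Oracle σ} (hO : O.Bounded) (z : Data) (v : Ket)
    (s : σ) : (mute M).exec O z v s
      = (M.exec silent (subOf z) v ()).map fun r => (r.1, r.2.1, s) := by
  suffices ∀ c z, subOf z = c → ∀ v, (mute M).exec O z v s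
      = (M.exec silent c v ()).map fun r => (r.1, r.2.1, s) from this _ z rfl v
  refine M.induction 1 fun c ih z hzc v => ?_
  rw [QPT.exec_step _ hO, M.exec_step ⟨1, silent_boundedBy⟩, mute_step, hzc]
  revert ih
  cases M.step c with
  | halt out => intro _; simp [perform, liftInstr, PMF.pure_map]
  | hadamard a c => exact fun ih => ih _ (.hadamard a c) _ (by simp) _
  | tGate a c => exact fun ih => ih _ (.tGate a c) _ (by simp) _
  | cnot a b c => exact fun ih => ih _ (.cnot a b c) _ (by simp) _
  | measure a c =>
    intro ih
    simp only [perform, liftInstr, PMF.map_bind]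
    exact pmf_bind_congr fun r _ => ih _ (.measure a c r.1) _ (by simp) _
  | query q c =>
    intro ih
    simp only [liftInstr, perform_noop]
    simp only [perform, silent, PMF.pure_bind]
    exact ih _ (.query q c .nil (by simp)) _ (by simp) _

end
end UTFE
namespace UTFE
noncomputable section
open Data

/-! ### Sequential composition -/

/-- The first entry of the context tells which machine is running: `nil` for the first, `bit true`
for the second. -/
def seqHalt (h e : Data → Data) (ctx out : Data) : Instr :=
  if ctx.fst = .nil then noop (mkS (.pair (bit true) (.pair out ctx.snd)) (h (.pair out ctx.snd)))
  else .halt (e (.pair out ctx.snd))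

def seqStep (M₁ M₂ : QPT) (h e : Data → Data) (z : Data) : Instr :=
  liftInstr (fun a => a) (ctxOf z) (seqHalt h e (ctxOf z)) (fun q c => .query q (aft (ctxOf z) c))
    (if (ctxOf z).fst = .nil then M₁.step (subOf z) else M₂.step (subOf z))

theorem seqStep_runs₁ (M₁ M₂ : QPT) (h e : Data → Data) {ctx : Data} (hc : ctx.fst = .nil) :
    Runs (seqStep M₁ M₂ h e) M₁.step (fun a => a) ctx (seqHalt h e ctx)
      (fun q c => .query q (aft ctx c)) (fun z => ctxOf z = ctx) :=
  .of_ctx fun z hz => by rw [seqStep, hz, if_pos hc]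

theorem seqStep_runs₂ (M₁ M₂ : QPT) (h e : Data → Data) {ctx : Data} (hc : ctx.fst ≠ .nil) :
    Runs (seqStep M₁ M₂ h e) M₂.step (fun a => a) ctx (seqHalt h e ctx)
      (fun q c => .query q (aft ctx c)) (fun z => ctxOf z = ctx) :=
  .of_ctx fun z hz => by rw [seqStep, hz, if_neg hc]

/-- Runs `M₁` and then `M₂`, which is started in the state `h (out, x)`, where `out` is the output
of `M₁`; the result is `e (out', (out, x))`, where `out'` is the output of `M₂`. It starts in states
`mkS (pair nil x) c`, where `c` is the initial state of `M₁`. -/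
def seq (M₁ M₂ : QPT) (h e : Data → Data) (hh : PolyTime h) (he : PolyTime e) : QPT :=
  QPT.mk' (seqStep M₁ M₂ h e)
    (by
      have h1 := M₁.step_polyTime
      have h2 := M₂.step_polyTime
      refine PolyTime.liftInstr (ρ := fun _ a => a) (hlt := seqHalt h e)
        (qry := fun ctx q c => .query q (aft ctx c)) ?_
        (by fun_prop) (by fun_prop) ?_ (by simp only [Instr.code]; fun_prop)
      · simp only [apply_ite Instr.code]
        exact .ifEq (by fun_prop) (by fun_prop) (h1.comp (by fun_prop)) (h2.comp (by fun_prop))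
      · have : PolyTime fun z : Data => if z.fst.fst = .nil then (noop (mkS (.pair (bit true)
              (.pair z.snd z.fst.snd)) (h (.pair z.snd z.fst.snd)))).code
            else (Instr.halt (e (.pair z.snd z.fst.snd))).code := by
          simp only [noop, Instr.code]; fun_prop
        convert this using 2
        rw [seqHalt]
        split_ifs <;> rfl)
    (by
      obtain ⟨p₁, hp₁⟩ := M₁.term
      obtain ⟨p₂, hp₂⟩ := M₂.term
      obtain ⟨r₁, hr₁⟩ := M₁.code_size_le
      obtain ⟨ph, hph⟩ := hh.size_le
      have claim : ∀ L z, z.size ≤ L → (ctxOf z).fst ≠ .nil →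
          Term (seqStep M₁ M₂ h e) L (p₂.eval (L + 3) + L + 8) (p₂.eval (L + 3)) z := by
        intro L z hz hc
        have h1 := size_subOf_le z
        have h2 := size_ctxOf_le z
        have := (hp₂ (L + 3) (subOf z) (by omega)).mono (L' := L) (by omega) le_rfl le_rfl
        refine (Term.lift (N' := 0) (seqStep_runs₂ M₁ M₂ h e hc) this rfl (by omega) (by omega)
          (fun _ q c _ c' h => forward_next (G := fun z' => ctxOf z' = ctxOf z) h fun _ => rfl) (fun _ out _ _ c' h => ?_))
        rw [seqHalt, if_neg hc] at h
        cases h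
      -- `y` bounds the output of `M₁` together with the data `x`, because the output is part of the
      -- code of a halting instruction; `l₂` then bounds the state in which `M₂` starts.
      let y : Polynomial ℕ := r₁.comp (p₁.comp (Polynomial.X + 3)) + Polynomial.X + 10
      let l₂ : Polynomial ℕ := ph.comp y + y + 10
      refine ⟨p₁.comp (Polynomial.X + 3) + p₂.comp (l₂ + 3) + l₂ + p₂.comp (Polynomial.X + 3)
        + Polynomial.X + 20, fun L z hz => ?_⟩
      have h1 := size_subOf_le z
      have h2 := size_ctxOf_le z
      have hy : y.eval L = r₁.eval (p₁.eval (L + 3)) + L + 10 := by simp [y]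
      have hl : l₂.eval L = ph.eval (y.eval L) + y.eval L + 10 := by simp [l₂]
      simp only [Polynomial.eval_add, Polynomial.eval_comp, Polynomial.eval_X, Polynomial.eval_ofNat]
      by_cases hc : (ctxOf z).fst = .nil
      · have := (hp₁ (L + 3) (subOf z) (by omega)).mono (L' := L) (by omega) le_rfl le_rfl
        refine (Term.lift (S' := p₁.eval (L + 3) + p₂.eval (l₂.eval L + 3) + l₂.eval L + L + 20)
          (N' := p₂.eval (l₂.eval L + 3)) (seqStep_runs₁ M₁ M₂ h e hc) this rfl (by omega) (by omega)
          (fun _ q c _ c' h => forward_next (G := fun z' => ctxOf z' = ctxOf z) h fun _ => rfl) (fun c out hcS hout c' h => ?_)).mono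
            le_rfl (by omega) (by omega)
        rw [seqHalt, if_pos hc] at h
        rw [noop_next h]
        have e1 := hr₁ c
        rw [hout, Instr.code, size_pair] at e1
        have e2 := polyEval_mono r₁ hcS
        have e3 := (ctxOf z).size_snd_le
        have e4 : (Data.pair out (ctxOf z).snd).size ≤ y.eval L := by rw [size_pair]; omega
        have e5 := (hph (.pair out (ctxOf z).snd)).trans (polyEval_mono ph e4)
        have e6 : (bit true).size ≤ 3 := size_bit_le _
        -- The second machine is analysed with the larger bound `l₂(L)` in place of `L`; termination
        -- for larger answers implies termination for answers of size at most `L`.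
        refine (claim (l₂.eval L) _ ?_ (by simp [bit])).mono (by omega) (by omega) le_rfl
        rw [size_mkS, size_pair]
        omega
      · exact (claim L z hz hc).mono le_rfl (by omega) (by omega))

theorem seq_exec {M₁ M₂ : QPT} {h e : Data → Data} {hh : PolyTime h} {he : PolyTime e} {σ : Type}
    {O : Oracle σ} (hO : O.Bounded) (x c : Data) (v : Ket) (s : σ) :
    (seq M₁ M₂ h e hh he).exec O (mkS (.pair .nil x) c) v s
      = (M₁.exec O c v s).bind fun r => (M₂.exec O (h (.pair r.1 x)) r.2.1 r.2.2).map
          fun r' => (e (.pair r'.1 (.pair r.1 x)), r'.2.1, r'.2.2) := by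
  rw [exec_lift (D := seq M₁ M₂ h e hh he) (M := M₁) (z := mkS (.pair .nil x) c) (V := fun v => v)
    (seqStep_runs₁ M₁ M₂ h e (ctx := .pair .nil x) rfl) (fun _ _ _ _ _ => rfl) .id hO rfl, subOf_mkS]
  refine pmf_bind_congr fun r _ => ?_
  rw [seqHalt, if_pos (by rfl), perform_noop, snd_pair]
  rw [exec_lift (D := seq M₁ M₂ h e hh he) (M := M₂) (V := fun v => v)
    (z := mkS (.pair (bit true) (.pair r.1 x)) (h (.pair r.1 x)))
    (seqStep_runs₂ M₁ M₂ h e (ctx := .pair (bit true) (.pair r.1 x)) (by simp [bit]))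
    (fun _ _ _ _ _ => rfl) .id hO rfl, subOf_mkS]
  refine pmf_bind_congr fun r' _ => ?_
  rw [seqHalt, if_neg (by simp [bit])]
  rfl

/-! ### Single queries -/

/-- The flag `z.snd.fst` is `nil` before the query and `bit true` once an answer stands in front. -/
def askStep (t g h : Data → Data) (z : Data) : Instr :=
  if z.snd.fst ≠ .nil ∨ t z.snd.snd ≠ .nil then .halt (h (.pair z.fst z.snd.snd))
  else .query (g z.snd.snd) (.pair (bit true) z.snd.snd)

/-- Started in the state `pair nil (pair nil x)`, asks the query `g x` if `t x = nil`; with the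
answer `r`, or `nil`, the result is `h (r, x)`. -/
def ask (t g h : Data → Data) (ht : PolyTime t) (hg : PolyTime g) (hh : PolyTime h) : QPT :=
  QPT.mk' (askStep t g h)
    (by
      have : PolyTime fun z => if z.snd.fst = .nil then
          (if t z.snd.snd = .nil then (Instr.query (g z.snd.snd) (.pair (bit true) z.snd.snd)).code
            else (Instr.halt (h (.pair z.fst z.snd.snd))).code)
          else (Instr.halt (h (.pair z.fst z.snd.snd))).code := by
        simp only [Instr.code]; fun_prop
      convert this using 2 with z
      rw [askStep]
      split_ifs <;> simp_all)
    (by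
      refine ⟨2 * Polynomial.X + 10, fun L z hz => ?_⟩
      simp only [Polynomial.eval_add, Polynomial.eval_mul, Polynomial.eval_X, Polynomial.eval_ofNat]
      have e1 := z.snd.size_snd_le
      have e2 := z.size_snd_le
      refine Term.mono (N := 2) le_rfl le_rfl (by omega) ⟨by omega, fun c' hc' => ?_⟩
      rw [askStep] at hc'
      split_ifs at hc'
      · cases hc'
      · cases hc' with
        | query _ _ r hr =>
          refine ⟨by simp [bit]; omega, fun c'' hc'' => ?_⟩
          rw [askStep, if_pos (by simp [bit])] at hc''
          cases hc'')

theorem ask_exec {t g h : Data → Data} {ht : PolyTime t} {hg : PolyTime g} {hh : PolyTime h}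
    {σ : Type} {O : Oracle σ} (hO : O.Bounded) (x : Data) (v : Ket) (s : σ) :
    (ask t g h ht hg hh).exec O (.pair .nil (.pair .nil x)) v s =
      if t x = .nil then (O s (g x)).map fun r => (h (.pair r.1 x), v, r.2)
      else PMF.pure (h (.pair .nil x), v, s) := by
  have hs : ∀ z, (ask t g h ht hg hh).step z = askStep t g h z := fun _ => rfl
  rw [QPT.exec_step _ hO, hs, askStep]
  by_cases hx : t x = .nil
  · rw [if_neg (by simp [hx]), if_pos hx, perform]
    refine pmf_bind_congr fun r _ => ?_
    rw [QPT.exec_step _ hO, hs, askStep, if_pos (by simp [bit])]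
    rfl
  · rw [if_pos (by simp [hx]), if_neg hx]
    rfl

/-! ### Wrapping of a machine for given inputs -/

/-- Marks internal states. -/
def mark : Data := .pair (bit true) .nil

/-- A machine in an experiment is started on its bare input, not on a state of the form `mkS`. Each
step therefore first decides which of the two it sees; the internal states have the context `mark`.
-/
def entryStep (tst g e : Data → Data) (M : QPT) (z : Data) : Instr :=
  if tst z = .nil then liftInstr (fun a => a) mark (fun out => .halt (e out))
    (fun q c => .query q (aft mark c)) (M.step (subOf z))
  else noop (mkS mark (g z))

/-- The test `tst` tells inputs from internal states. -/
structure IsEntryTest (tst : Data → Data) (M : QPT) : Prop where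
  polyTime : PolyTime tst
  mkS : ∀ c, tst (mkS mark c) = .nil
  bit : ∀ o c, tst (.pair (bit o) (aft mark c)) = .nil
  query : ∀ c₀ q c, M.step c₀ = .query q c → ∀ r, tst (.pair r (aft mark c)) = .nil

theorem entryStep_runs {tst : Data → Data} (g e : Data → Data) {M : QPT} (h : IsEntryTest tst M) :
    Runs (entryStep tst g e M) M.step (fun a => a) mark (fun out => .halt (e out))
      (fun q c => .query q (aft mark c)) (fun z => tst z = .nil) :=
  ⟨fun z hz => by rw [entryStep, if_pos hz], h.mkS, h.bit⟩

/-- On an input `z`, runs `M` from the state `g z`; the result is `e out` if `out` is the output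
of `M`. -/
def entry (tst g e : Data → Data) (hg : PolyTime g) (he : PolyTime e) (M : QPT)
    (h : IsEntryTest tst M) : QPT :=
  QPT.mk' (entryStep tst g e M)
    (by
      have h1 := h.polyTime
      have h2 : PolyTime fun z => (liftInstr (fun a => a) mark (fun out => .halt (e out))
          (fun q c => .query q (aft mark c)) (M.step (subOf z))).code :=
        PolyTime.liftInstr (ctx := fun _ => mark) (ρ := fun _ a => a)
          (hlt := fun _ out => .halt (e out))
          (qry := fun ctx q c => .query q (aft ctx c)) (M.step_polyTime.comp (by fun_prop))
          (by fun_prop) (by fun_prop) (by simp only [Instr.code]; fun_prop)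
          (by simp only [Instr.code]; fun_prop)
      simp only [entryStep, apply_ite Instr.code]
      exact .ifEq h1 (by fun_prop) h2 (by simp only [noop, Instr.code]; fun_prop))
    (by
      obtain ⟨p, hp⟩ := M.term
      obtain ⟨pg, hpg⟩ := hg.size_le
      have claim : ∀ L z, z.size ≤ L → tst z = .nil →
          Term (entryStep tst g e M) L (p.eval (L + 3) + L + 20) (p.eval (L + 3)) z := by
        intro L z hz hc
        have h1 := size_subOf_le z
        have := (hp (L + 3) (subOf z) (by omega)).mono (L' := L) (by omega) le_rfl le_rfl
        refine (Term.lift (N' := 0) (entryStep_runs g e h) this hc (by omega)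
          (by have : mark.size = 5 := rfl
              omega)
          (fun c₀ q c hc c' h' => forward_next (G := fun z => tst z = .nil) h' (h.query _ _ _ hc)) (fun _ out _ _ c' h => ?_))
        cases h
      refine ⟨p.comp (Polynomial.X + 3) + p.comp (pg + Polynomial.X + 20) + pg + Polynomial.X + 50,
        fun L z hz => ?_⟩
      simp only [Polynomial.eval_add, Polynomial.eval_comp, Polynomial.eval_X, Polynomial.eval_ofNat]
      by_cases hc : tst z = .nil
      · exact (claim L z hz hc).mono le_rfl (by omega) (by omega)
      · refine Term.mono (N := p.eval (pg.eval L + L + 20) + 1) le_rfl le_rfl (by omega)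
          ⟨by omega, fun c' hc' => ?_⟩
        rw [entryStep, if_neg hc] at hc'
        rw [noop_next hc']
        have e1 := (hpg z).trans (polyEval_mono pg hz)
        have := claim (pg.eval L + L + 17) (UTFE.mkS mark (g z)) (by
          rw [size_mkS]
          have : mark.size = 5 := rfl
          omega) (h.mkS _)
        rw [show pg.eval L + L + 17 + 3 = pg.eval L + L + 20 by omega] at this
        exact this.mono (by omega) (by omega) le_rfl)

theorem entry_exec {tst g e : Data → Data} {hg : PolyTime g} {he : PolyTime e} {M : QPT}
    {h : IsEntryTest tst M} {σ : Type} {O : Oracle σ} (hO : O.Bounded) {z : Data}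
    (hz : tst z ≠ .nil) (v : Ket) (s : σ) :
    (entry tst g e hg he M h).exec O z v s
      = (M.exec O (g z) v s).map fun r => (e r.1, r.2.1, r.2.2) := by
  rw [QPT.exec_step _ hO, show (entry tst g e hg he M h).step z = entryStep tst g e M z from rfl,
    entryStep, if_neg hz, perform_noop, exec_lift (D := entry tst g e hg he M h) (M := M)
      (V := fun v => v) (z := mkS mark (g z)) (entryStep_runs g e h) h.query .id hO (h.mkS _), subOf_mkS]
  rfl

end
end UTFE
namespace UTFE
noncomputable section
open Data

/-! ### Serving the queries of a machine by another machine -/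

/-- The data of a machine whose queries are served: `m` is `nil` or holds the state of that machine
while it waits, `κ` names the qubits of the server, `store` is the list of records of the server,
and `env` is fixed. The first entry of the second component of `env` bounds answers and records. -/
def interCtx (m κ store env : Data) : Data := .pair m (.pair κ (.pair store env))

/-- A refused query is answered by `nil` at once. Otherwise the state of the served machine is put
aside in the first entry of the context, which thereby stops being `nil` and switches the machine to
the server. -/
def interQuery (tst hin : Data → Data) (ctx q c : Data) : Instr :=
  if tst (.pair ctx.snd.snd.snd q) = .nil then noop (mkS ctx (.pair .nil c))
  else noop (mkS (.pair (.pair .nil c) ctx.snd)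
    (hin (.pair ctx.snd.snd.snd (.pair ctx.snd.snd.fst q))))

/-- The register name `κ` grows with every return, so that the next call of the server finds unused
qubits. Answer and record are cut off at the bound in `env`. -/
def interReturn (ctx out : Data) : Instr :=
  noop (mkS (interCtx .nil (.pair .nil ctx.snd.fst)
    (.pair (clip ctx.snd.snd.snd.snd.fst out.snd) ctx.snd.snd.fst) ctx.snd.snd.snd)
    (.pair (clip ctx.snd.snd.snd.snd.fst out.fst) ctx.fst.snd))

def interStep (A H : QPT) (ι tst hin : Data → Data) (z : Data) : Instr :=
  if (ctxOf z).fst = .nil then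
    liftInstr ι (ctxOf z) (fun out => .halt (.pair out (ctxOf z).snd.snd))
      (interQuery tst hin (ctxOf z)) (A.step (subOf z))
  else
    liftInstr (Data.pair (ctxOf z).snd.fst) (ctxOf z) (interReturn (ctxOf z))
      (fun q c => .query q (aft (ctxOf z) c)) (H.step (subOf z))

theorem interStep_runs (A H : QPT) (ι tst hin : Data → Data) {ctx : Data} (hc : ctx.fst ≠ .nil) :
    Runs (interStep A H ι tst hin) H.step (Data.pair ctx.snd.fst) ctx (interReturn ctx)
      (fun q c => .query q (aft ctx c)) (fun z => ctxOf z = ctx) :=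
  .of_ctx fun z hz => by rw [interStep, hz, if_neg hc]

theorem PolyTime.interStep (A H : QPT) {ι tst hin : Data → Data} (hι : PolyTime ι)
    (ht : PolyTime tst) (hh : PolyTime hin) :
    PolyTime fun z => (interStep A H ι tst hin z).code := by
  have h1 : PolyTime fun z => (UTFE.liftInstr ι (UTFE.ctxOf z)
      (fun out => .halt (.pair out (UTFE.ctxOf z).snd.snd))
      (interQuery tst hin (UTFE.ctxOf z)) (A.step (UTFE.subOf z))).code := by
    refine PolyTime.liftInstr (ρ := fun _ => ι) (hlt := fun ctx out => .halt (.pair out ctx.snd.snd))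
      (qry := interQuery tst hin) (A.step_polyTime.comp (by fun_prop)) (by fun_prop) (by fun_prop)
      (by simp only [Instr.code]; fun_prop) ?_
    have : PolyTime fun z : Data =>
        if tst (.pair z.fst.snd.snd.snd z.snd.fst) = .nil then
          (noop (UTFE.mkS z.fst (.pair .nil z.snd.snd))).code
        else (noop (UTFE.mkS (.pair (.pair .nil z.snd.snd) z.fst.snd)
          (hin (.pair z.fst.snd.snd.snd (.pair z.fst.snd.snd.fst z.snd.fst))))).code := by
      simp only [noop, Instr.code]; fun_prop
    convert this using 2
    rw [interQuery]
    split_ifs <;> rfl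
  have h2 : PolyTime fun z => (UTFE.liftInstr (Data.pair (UTFE.ctxOf z).snd.fst) (UTFE.ctxOf z)
      (interReturn (UTFE.ctxOf z)) (fun q c => .query q (UTFE.aft (UTFE.ctxOf z) c))
      (H.step (UTFE.subOf z))).code := by
    refine PolyTime.liftInstr (ρ := fun ctx => Data.pair ctx.snd.fst) (hlt := interReturn)
      (qry := fun ctx q c => .query q (UTFE.aft ctx c)) (H.step_polyTime.comp (by fun_prop))
      (by fun_prop) (by fun_prop) ?_ (by simp only [Instr.code]; fun_prop)
    simp only [interReturn, interCtx, noop, Instr.code]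
    fun_prop
  simp only [UTFE.interStep, apply_ite Instr.code]
  exact .ifEq (by fun_prop) (by fun_prop) h1 h2

/-- While the server works. -/
theorem inter_term_server {A H : QPT} {ι tst hin : Data → Data}
    {L SA SH NH C S N T : ℕ}
    (hS : C + SA + SH + L + 50 ≤ S)
    (ih : ∀ z, (ctxOf z).fst = .nil → (ctxOf z).snd.snd.snd.size ≤ L →
      Term A.step L SA N (subOf z) → (ctxOf z).size + N * (L + 20) ≤ C → z.size ≤ S →
      Term (interStep A H ι tst hin) L S T z) {z : Data} (hz : (ctxOf z).fst ≠ .nil)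
    (hzS : z.size ≤ S) (he : (ctxOf z).snd.snd.snd.size ≤ L)
    (hH : Term H.step L SH NH (subOf z)) (hw : (ctxOf z).size + 20 ≤ C + SA)
    (hA : ∀ r, r.size ≤ L → Term A.step L SA N (.pair r (ctxOf z).fst.snd))
    (hC : (ctxOf z).snd.size + (N + 1) * (L + 20) ≤ C) :
    Term (interStep A H ι tst hin) L S (NH + T) z := by
  refine Term.lift (interStep_runs A H ι tst hin hz) hH rfl hzS (by omega)
    (fun _ q c _ c' h => forward_next (G := fun z' => ctxOf z' = ctxOf z) h fun _ => rfl)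
    fun c out _ _ c' h => ?_
  rw [noop_next h]
  have e0 := (ctxOf z).snd.snd.snd.snd.size_fst_le
  have e1 := (ctxOf z).snd.snd.snd.size_snd_le
  have e2 := size_clip_le (ctxOf z).snd.snd.snd.snd.fst out.fst
  have e3 := size_clip_le (ctxOf z).snd.snd.snd.snd.fst out.snd
  have e4 := (ctxOf z).snd.size_fst_add_snd_le
  have e5 := (ctxOf z).snd.snd.size_fst_add_snd_le
  have e6 : (N + 1) * (L + 20) = N * (L + 20) + L + 20 := by ring
  -- The cut-off makes the answer at most as large as a part of `env`, hence at most `L`; this is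
  -- the bound under which `A` is known to terminate. Without it, answers could grow from call to
  -- call.
  have hA' := hA (clip (ctxOf z).snd.snd.snd.snd.fst out.fst) (by omega)
  have e7 := hA'.size_le
  refine ih _ rfl he (by simpa using hA') ?_ ?_
  · simp only [ctxOf_mkS, interCtx, size_pair, size_nil]
    omega
  · simp only [size_mkS, interCtx, size_pair, size_nil] at e7 ⊢
    omega

/-- While the served machine works. -/
theorem inter_term {A H : QPT} {ι tst hin : Data → Data} {L SA SH NH C S Q LH : ℕ} (hL : 1 ≤ L)
    (hS : C + SA + SH + L + LH + 50 ≤ S) (hH : ∀ c, c.size ≤ LH → Term H.step L SH NH c)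
    (hQ : ∀ c, c.size ≤ SA → (A.step c).code.size ≤ Q)
    (hhin : ∀ x, x.size ≤ C + Q + L + 10 → (hin x).size ≤ LH) (N : ℕ) :
    ∀ z, (ctxOf z).fst = .nil → (ctxOf z).snd.snd.snd.size ≤ L →
      Term A.step L SA N (subOf z) → (ctxOf z).size + N * (L + 20) ≤ C → z.size ≤ S →
      Term (interStep A H ι tst hin) L S (N * (NH + 3)) z := by
  -- The context may gain one record and one longer register name for each remaining step of `A`,
  -- which is at most `L + 20`; the condition with `N * (L + 20)` and `C` is this budget.
  induction N with
  | zero => exact fun z _ _ h => h.elim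
  | succ N ih =>
    intro z hz he hA hC hzS
    have e6 : (N + 1) * (L + 20) = N * (L + 20) + L + 20 := by ring
    have e7 : (N + 1) * (NH + 3) = N * (NH + 3) + NH + 2 + 1 := by ring
    rw [e7]
    refine ⟨hzS, fun c' hc' => ?_⟩
    have hA2 := hA.2
    have hQ' := hQ _ hA.1
    have hD : interStep A H ι tst hin z = liftInstr ι (ctxOf z)
        (fun out => .halt (.pair out (ctxOf z).snd.snd))
        (interQuery tst hin (ctxOf z)) (A.step (subOf z)) := by rw [interStep, if_pos hz]
    have goM : ∀ c, Term A.step L SA N c →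
        Term (interStep A H ι tst hin) L S (N * (NH + 3) + NH + 2) (mkS (ctxOf z) c) := by
      intro c hc
      refine (ih (mkS (ctxOf z) c) hz he (by simpa using hc) (by simp only [ctxOf_mkS]; omega) ?_).mono le_rfl le_rfl
        (by omega)
      have := hc.size_le
      rw [size_mkS]; omega
    rw [hD] at hc'
    cases hi : A.step (subOf z) with
    | halt out => rw [hi] at hc'; cases hc'
    | hadamard a c => rw [hi] at hc' hA2; cases hc'; exact goM _ (hA2 _ (.hadamard a c))
    | tGate a c => rw [hi] at hc' hA2; cases hc'; exact goM _ (hA2 _ (.tGate a c))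
    | cnot a b c => rw [hi] at hc' hA2; cases hc'; exact goM _ (hA2 _ (.cnot a b c))
    | measure a c =>
      rw [hi] at hc' hA2
      cases hc' with
      | measure _ _ o =>
        have := hA2 _ (.measure a c o)
        refine (ih (.pair (bit o) (aft (ctxOf z) c)) hz he (by simpa using this) (by simp only [ctxOf_aft]; omega) ?_).mono le_rfl
          le_rfl (by omega)
        have := this.size_le
        rw [size_aft]
        rw [size_pair] at this
        omega
    | query q c =>
      rw [hi] at hc' hA2 hQ'
      simp only [liftInstr, interQuery] at hc'
      split_ifs at hc'
      · rw [noop_next hc']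
        exact goM _ (hA2 _ (.query q c _ (by simpa using hL)))
      · rw [noop_next hc']
        have e1 := (ctxOf z).snd.size_snd_le
        have e2 := (ctxOf z).snd.snd.size_fst_le
        have e3 := (ctxOf z).size_snd_le
        have e4 := hhin (.pair (ctxOf z).snd.snd.snd (.pair (ctxOf z).snd.snd.fst q)) (by
          simp only [Instr.code, size_pair] at hQ' ⊢
          omega)
        have e5 := (hA2 _ (.query q c .nil (by simpa using hL))).size_le
        simp only [size_pair, size_nil] at e5
        refine (inter_term_server (SH := SH) (T := N * (NH + 3)) (by omega) ih (z := mkS (.pair (.pair .nil c)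
          (ctxOf z).snd) _) (by simp) ?_ he (by simpa using hH _ e4) ?_ ?_ ?_).mono le_rfl le_rfl
            (by omega)
        · simp only [size_mkS, size_pair, size_nil]
          omega
        · simp only [ctxOf_mkS, size_pair, size_nil]
          omega
        · exact fun r hr => hA2 _ (.query q c r hr)
        · have e8 := (ctxOf z).size_fst_add_snd_le
          rw [hz, size_nil] at e8
          simp only [ctxOf_mkS, snd_pair]
          omega

/-- The machine `A` on qubits that are renamed by `ι`. A query `q` of `A` with
`tst (env, q) = nil` is refused; any other one is served by the machine `H`, started in the state
`hin (env, (store, q))` with empty quantum memory: its output consists of an answer and a record.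
If `A` halts with the output `out`, the result is `(out, (store, env))`. The machine starts in states
`mkS (interCtx nil κ store env) c`, where `c` is the initial state of `A`. -/
def inter (A H : QPT) (ι tst hin : Data → Data) (hι : PolyTime ι) (ht : PolyTime tst)
    (hh : PolyTime hin) : QPT :=
  QPT.mk' (interStep A H ι tst hin) (.interStep A H hι ht hh) (by
    obtain ⟨pa, hpa⟩ := A.term
    obtain ⟨pH, hpH⟩ := H.term
    obtain ⟨ra, hra⟩ := A.code_size_le
    obtain ⟨qh, hqh⟩ := hh.size_le
    -- The bounds are fixed one after the other without circularity: states of `A` (`pSA`), the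
    -- context (`pC`), the instructions of `A` and hence its queries (`pQ`), the initial states of
    -- the server (`pLH`), its running time (`pSH`), and all states (`pS`). The first depends on `L`
    -- alone, as answers are cut off.
    let X : Polynomial ℕ := Polynomial.X
    let pSA : Polynomial ℕ := pa.comp (3 * X + 10)
    let pC : Polynomial ℕ := 2 * X + 20 + (pSA + 1) * (X + 20)
    let pQ : Polynomial ℕ := ra.comp pSA
    let pLH : Polynomial ℕ := qh.comp (pC + pQ + X + 10) + X + 3
    let pSH : Polynomial ℕ := pH.comp pLH
    let pS : Polynomial ℕ := pC + pSA + pSH + X + pLH + 50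
    refine ⟨pS + pSH + pSA * (pSH + 3), fun L z hz => ?_⟩
    have hL : 1 ≤ L := z.one_le_size.trans hz
    obtain ⟨SA, hSA⟩ : ∃ SA, pSA.eval L = SA := ⟨_, rfl⟩
    obtain ⟨C, hC⟩ : ∃ C, pC.eval L = C := ⟨_, rfl⟩
    obtain ⟨Q, hQ⟩ : ∃ Q, pQ.eval L = Q := ⟨_, rfl⟩
    obtain ⟨LH, hLH⟩ : ∃ LH, pLH.eval L = LH := ⟨_, rfl⟩
    obtain ⟨SH, hSH⟩ : ∃ SH, pSH.eval L = SH := ⟨_, rfl⟩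
    obtain ⟨S, hS⟩ : ∃ S, pS.eval L = S := ⟨_, rfl⟩
    have eSA : pa.eval (3 * L + 10) = SA := by rw [← hSA]; simp [pSA, X]
    have eC : 2 * L + 20 + (SA + 1) * (L + 20) = C := by rw [← hC, ← hSA]; simp [pC, X]
    have eQ : ra.eval SA = Q := by rw [← hQ, ← hSA]; simp [pQ]
    have eLH : qh.eval (C + Q + L + 10) + L + 3 = LH := by
      rw [← hLH, ← hC, ← hQ]; simp [pLH, X]
    have eSH : pH.eval LH = SH := by rw [← hSH, ← hLH]; simp [pSH]
    have eS : C + SA + SH + L + LH + 50 = S := by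
      rw [← hS, ← hC, ← hSA, ← hSH, ← hLH]; simp [pS, X]
    rw [show (pS + pSH + pSA * (pSH + 3)).eval L = S + SH + SA * (SH + 3) by
      rw [← hS, ← hSA, ← hSH]; simp]
    clear_value X pSA pC pQ pLH pSH pS
    have hA : ∀ c, c.size ≤ 3 * L + 10 → Term A.step L SA SA c := fun c hc => by
      have := hpa (3 * L + 10) c hc
      rw [eSA] at this
      exact this.mono (by omega) le_rfl le_rfl
    have hH : ∀ c, c.size ≤ LH → Term H.step L SH SH c := fun c hc => by
      have := hpH LH c hc
      rw [eSH] at this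
      exact this.mono (by omega) le_rfl le_rfl
    have key := inter_term (A := A) (H := H) (ι := ι) (tst := tst) (hin := hin) (L := L) (SA := SA)
      (SH := SH) (NH := SH) (C := C) (S := S) (Q := Q) (LH := LH) hL (by omega) hH
      (fun c hc => (hra c).trans (by rw [← eQ]; exact polyEval_mono ra hc))
      (fun x hx => (hqh x).trans (by have := polyEval_mono qh hx; omega)) SA
    have e1 := size_ctxOf_le z
    have e2 := size_subOf_le z
    have e3 := (ctxOf z).size_snd_le
    have e4 := (ctxOf z).snd.size_snd_le
    have e5 := (ctxOf z).snd.snd.size_snd_le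
    have e6 := (ctxOf z).fst.size_snd_le
    have e7 := (ctxOf z).size_fst_le
    have e8 : (SA + 1) * (L + 20) = SA * (L + 20) + L + 20 := by ring
    by_cases hc : (ctxOf z).fst = .nil
    · exact (key z hc (by omega) (hA _ (by omega)) (by omega) (by omega)).mono le_rfl (by omega)
        (by omega)
    · refine (inter_term_server (SH := SH) (by omega) key hc (by omega) (by omega)
        (hH _ (by omega)) (by omega) (fun r hr => hA _ ?_) (by omega)).mono le_rfl (by omega)
          (by omega)
      rw [size_pair]
      omega)

/-- The qubits that have not been used by the server if its next name is `κ`. -/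
def fresh (κ : Data) : Set Data := {x | ∃ (i : ℕ) (a : Data), x = .pair ((Data.pair .nil)^[i] κ) a}

theorem size_iterate_pair_nil (i : ℕ) (κ : Data) :
    ((Data.pair .nil)^[i] κ).size = κ.size + 2 * i := by
  induction i with
  | zero => rfl
  | succ i ih => rw [Function.iterate_succ_apply', size_pair, ih, size_nil]; ring

theorem fresh_next (κ : Data) : fresh (.pair .nil κ) ⊆ fresh κ := by
  rintro _ ⟨i, a, rfl⟩
  exact ⟨i + 1, a, rfl⟩

theorem range_subset_fresh (κ : Data) : Set.range (Data.pair κ) ⊆ fresh κ := by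
  rintro _ ⟨a, rfl⟩
  exact ⟨0, a, rfl⟩

/-- Names of later registers are strictly larger trees, so registers of different calls cannot
overlap. -/
theorem notMem_fresh_next (κ a : Data) : Data.pair κ a ∉ fresh (.pair .nil κ) := by
  rintro ⟨i, b, h⟩
  injection h with h _
  have := congrArg Data.size h
  rw [size_iterate_pair_nil, size_pair, size_nil] at this
  omega

/-- The memory `W` consists of the unit vector `v` on the qubits `ι a` and of other qubits, which do
not include those that are not used by the server yet. -/
def Mem (ι : Data → Data) (κ : Data) (W v : Ket) : Prop :=
  normSq v = 1 ∧ (∀ a, ι a ∉ fresh κ) ∧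
    ∃ w, normSq w = 1 ∧ Free w (Set.range ι) ∧ Free w (fresh κ) ∧ W = merge ι w v

/-- The oracle that is implemented by the server `H`. Its state includes the list of records. -/
def served (H : QPT) (tst hin : Data → Data) (env : Data) {σ : Type} (O : Oracle σ) :
    Oracle (Data × σ) := fun s q =>
  if tst (.pair env q) = .nil then PMF.pure (.nil, s)
  else (H.exec O (hin (.pair env (.pair s.1 q))) vacuum s.2).map fun r =>
    (clip env.snd.fst r.1.fst, (.pair (clip env.snd.fst r.1.snd) s.1, r.2.2))

theorem served_boundedBy (H : QPT) (tst hin : Data → Data) (env : Data) {σ : Type} (O : Oracle σ) :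
    (served H tst hin env O).BoundedBy env.snd.fst.size := by
  intro s q a ha
  rw [served] at ha
  split_ifs at ha
  · simp only [PMF.support_pure, Set.mem_singleton_iff] at ha
    rw [ha]
    exact Data.one_le_size _
  · obtain ⟨r, _, rfl⟩ := (PMF.mem_support_map_iff _ _ _).1 ha
    exact size_clip_le _ _

/-- The true memory contains, besides that of `A`, whatever the server has left behind, and this
depends on the random course of events. So the two executions are compared through continuations `k`
and `K` that agree on all memories related by `Mem`. The invariant is that the leftovers form a unit
tensor factor `w` which does not meet the qubits of `A` or the registers still to be used. -/
theorem inter_exec {A H : QPT} {ι tst hin : Data → Data} {hι : PolyTime ι} {ht : PolyTime tst}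
    {hh : PolyTime hin} (hinj : Function.Injective ι) {env : Data} {σ β : Type} {O : Oracle σ}
    (hO : O.Bounded) {k : Data × Ket × Data × σ → PMF β} {K : Data × Ket × σ → PMF β}
    (hk : ∀ out v store s W κ, Mem ι κ W v →
      k (out, v, store, s) = K (.pair out (.pair store env), W, s)) {κ : Data} {v W : Ket}
    (hm : Mem ι κ W v) (c store : Data) (s : σ) :
    (A.exec (served H tst hin env O) c v (store, s)).bind k
      = ((inter A H ι tst hin hι ht hh).exec O (mkS (interCtx .nil κ store env) c) W s).bind K := by
  obtain ⟨I, hI⟩ : ∃ I, I = inter A H ι tst hin hι ht hh := ⟨_, rfl⟩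
  have hIs : I.step = interStep A H ι tst hin := by rw [hI]; rfl
  rw [← hI]
  have hD : ∀ z, (ctxOf z).fst = .nil → I.step z
      = liftInstr ι (ctxOf z) (fun out => .halt (.pair out (ctxOf z).snd.snd))
        (interQuery tst hin (ctxOf z)) (A.step (subOf z)) := fun z hz => by
    rw [hIs, interStep, if_pos hz]
  have hB := served_boundedBy H tst hin env O
  suffices ∀ (κ store : Data) (v W : Ket) (s : σ) (z : Data), ctxOf z = interCtx .nil κ store env →
      subOf z = c → Mem ι κ W v →
      (A.exec (served H tst hin env O) c v (store, s)).bind k = (I.exec O z W s).bind K from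
    this κ store v W s _ rfl (by simp) hm
  refine A.induction env.snd.fst.size (P := fun c => ∀ (κ store : Data) (v W : Ket) (s : σ)
    (z : Data), ctxOf z = interCtx .nil κ store env → subOf z = c → Mem ι κ W v →
      (A.exec (served H tst hin env O) c v (store, s)).bind k = (I.exec O z W s).bind K)
    (fun c ih κ store v W s z hz hzc hm => ?_) c
  rw [A.exec_step ⟨_, hB⟩, QPT.exec_step _ hO, hD z (by rw [hz]; rfl), hz, hzc]
  have hm' := hm
  obtain ⟨hv, hf, w, hw1, hw2, hw3, rfl⟩ := hm
  have hV := merge_intertwines hinj hw2 hw1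
  revert ih
  cases A.step c with
  | halt out =>
    intro _
    simp only [perform, liftInstr, PMF.pure_bind]
    exact hk _ _ _ _ _ κ hm'
  | hadamard a c =>
    intro ih
    simp only [perform, liftInstr, hV.hadamard]
    exact ih _ (.hadamard a c) κ _ _ _ _ _ rfl (by simp)
      ⟨by rw [normSq_hadamard, hv], hf, w, hw1, hw2, hw3, rfl⟩
  | tGate a c =>
    intro ih
    simp only [perform, liftInstr, hV.tGate]
    exact ih _ (.tGate a c) κ _ _ _ _ _ rfl (by simp)
      ⟨by rw [normSq_tGate, hv], hf, w, hw1, hw2, hw3, rfl⟩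
  | cnot a b c =>
    intro ih
    simp only [perform, liftInstr, hV.cnot]
    exact ih _ (.cnot a b c) κ _ _ _ _ _ rfl (by simp)
      ⟨by rw [normSq_cnot, hv], hf, w, hw1, hw2, hw3, rfl⟩
  | measure a c =>
    intro ih
    simp only [perform, liftInstr, hV.measure, PMF.bind_bind, PMF.bind_map]
    refine pmf_bind_congr fun r hr => ?_
    exact ih _ (.measure a c r.1) κ _ _ _ _ _ rfl (by simp)
      ⟨normSq_of_mem_measure hv hr, hf, w, hw1, hw2, hw3, rfl⟩
  | query q c =>
    intro ih
    have hi := hB (store, s) q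
    rw [liftInstr, interQuery, perform, served]
    rw [served] at hi
    simp only [show (interCtx .nil κ store env).snd.snd.snd = env from rfl,
      show (interCtx .nil κ store env).snd.snd.fst = store from rfl] at hi ⊢
    by_cases htq : tst (.pair env q) = .nil
    · rw [if_pos htq, if_pos htq, PMF.pure_bind, perform_noop]
      exact ih _ (.query q c .nil (Data.one_le_size _)) κ _ _ _ _ _ rfl (by simp) hm'
    · rw [if_neg htq] at hi
      rw [if_neg htq, if_neg htq, perform_noop]
      have hfree : Free (merge ι w v) (Set.range (Data.pair κ)) :=
        free_merge hinj hw2 (hw3.mono (range_subset_fresh κ))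
          fun a ha => hf a (range_subset_fresh κ ha)
      have hnorm : normSq (merge ι w v) = 1 := by rw [normSq_merge hinj hw2, hv, hw1, one_mul]
      have hR := interStep_runs A H ι tst hin
        (ctx := .pair (.pair .nil c) (interCtx .nil κ store env).snd) (by simp)
      rw [← hIs] at hR
      -- The present memory is its product with an empty register named `κ`; so the server runs as
      -- if from `vacuum`, with everything else as a spectator.
      have key := exec_lift hR
        (fun _ _ _ _ _ => rfl) (merge_intertwines (pair_injective κ) hfree hnorm) hO
        (z := mkS (.pair (.pair .nil c) (interCtx .nil κ store env).snd)
          (hin (.pair env (.pair store q)))) rfl vacuum s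
      rw [merge_vacuum, subOf_mkS] at key
      rw [key, PMF.bind_bind, PMF.bind_bind, PMF.bind_map]
      refine pmf_bind_congr fun r hr => ?_
      have hu := H.normSq_exec hO _ _ _ normSq_vacuum r hr
      have hw3' := hw3.mono (range_subset_fresh κ)
      have hικ : ∀ a b, ι a ≠ Data.pair κ b := fun a b h =>
        hf a (range_subset_fresh κ ⟨b, h.symm⟩)
      rw [interReturn, perform_noop]
      -- The final memory of the server becomes part of the leftovers: by `merge_merge` it can be
      -- multiplied into `w` first, with `v` merged in last.
      refine ih _ (.query q c _ (hi _ ((PMF.mem_support_map_iff _ _ _).2 ⟨r, hr, rfl⟩)))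
        (.pair .nil κ) _ _ _ _ _ rfl (by simp [interCtx])
        ⟨hv, fun a ha => hf a (fresh_next κ ha), merge (.pair κ) w r.2.1, ?_, ?_, ?_,
          merge_merge hinj (pair_injective κ) hικ hw2 hw3'⟩
      · rw [normSq_merge (pair_injective κ) hw3', hu, hw1, one_mul]
      · exact free_merge (pair_injective κ) hw3' hw2 fun a ⟨b, hb⟩ => hικ b a hb
      · exact free_merge (pair_injective κ) hw3' (hw3.mono (fresh_next κ)) (notMem_fresh_next κ)

end
end UTFE
namespace UTFE
noncomputable section
open Data

/-! ## Algorithms with classical input and output -/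

/-- An output is contained in the halting instruction of a state that was actually reached, which
bounds its size. -/
theorem QPT.exec_out {σ : Type} (M : QPT) {O : Oracle σ} {L S N : ℕ} (hO : O.BoundedBy L)
    {c : Data} (hc : Term M.step L S N c) (v : Ket) (s : σ) {r : Data × Ket × σ}
    (hr : r ∈ (M.exec O c v s).support) : ∃ c', c'.size ≤ S ∧ M.step c' = .halt r.1 := by
  induction N generalizing c v s with
  | zero => exact hc.elim
  | succ N ih =>
    have ih' := fun c' hc' v s => ih (hc.2 c' hc') v s
    rw [M.exec_step ⟨L, hO⟩] at hr
    cases hi : M.step c with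
    | halt out =>
      rw [hi] at hr
      simp only [perform, PMF.support_pure, Set.mem_singleton_iff] at hr
      exact ⟨c, hc.1, by rw [hr, hi]⟩
    | hadamard a c => rw [hi] at hr ih'; exact ih' _ (.hadamard a c) _ _ hr
    | tGate a c => rw [hi] at hr ih'; exact ih' _ (.tGate a c) _ _ hr
    | cnot a b c => rw [hi] at hr ih'; exact ih' _ (.cnot a b c) _ _ hr
    | measure a c =>
      rw [hi] at hr ih'
      obtain ⟨x, hx, hr⟩ := (PMF.mem_support_bind_iff _ _ _).1 hr
      exact ih' _ (.measure a c x.1) _ _ hr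
    | query q c =>
      rw [hi] at hr ih'
      obtain ⟨x, hx, hr⟩ := (PMF.mem_support_bind_iff _ _ _).1 hr
      exact ih' _ (.query q c x.1 (hO s q x hx)) _ _ hr

/-- Polynomial bounds on the number of steps and on the output of a machine. -/
theorem QPT.exists_bound (M : QPT) : ∃ p : Polynomial ℕ, ∀ (L : ℕ) (c : Data), c.size ≤ L →
    Term M.step L (p.eval L) (p.eval L) c ∧ ∀ {σ : Type} {O : Oracle σ}, O.BoundedBy L →
      ∀ (v : Ket) (s : σ), ∀ r ∈ (M.exec O c v s).support, r.1.size ≤ p.eval L := by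
  obtain ⟨p, hp⟩ := M.term
  obtain ⟨q, hq⟩ := M.code_size_le
  refine ⟨p + q.comp p, fun L c hc => ?_⟩
  simp only [Polynomial.eval_add, Polynomial.eval_comp]
  refine ⟨(hp L c hc).mono le_rfl (by omega) (by omega), fun hO v s r hr => ?_⟩
  obtain ⟨c', h1, h2⟩ := M.exec_out hO (hp L c hc) v s hr
  have := (hq c').trans (polyEval_mono q h1)
  rw [h2, Instr.code, size_pair] at this
  omega

/-- A run that is stopped after `t` steps lies pointwise below `exec`. If it has halted with
certainty, it already has mass one, and the two coincide. -/
theorem QPT.exec_of_output {M : QPT} {t : ℕ} {x : Data} {v : Ket} {β : Type}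
    {g : Data × Ket → β} {q : PMF β}
    (h : (M.output t x v).map (Option.map g) = q.map some) :
    (M.exec silent x v ()).map (fun r => g (r.1, r.2.1)) = q := by
  have hl := Lim.run M ⟨1, silent_boundedBy⟩ x v ()
  refine (PMF_eq_of_run (x := OptionT.mk ((M.run silent t x v ()).run.map
    (Option.map fun r => g (r.1, r.2.1)))) (fun a => ?_) ?_).symm
  · change (PMF.map (Option.map fun r => g (r.1, r.2.1)) (M.run silent t x v ()).run) (some a) ≤ _
    rw [PMF.map_apply, PMF.map_apply]
    refine (le_of_eq ((Option.some_injective _).tsum_eq fun b hb => ?_).symm).trans ?_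
    · cases b with
      | none => simp at hb
      | some b => exact ⟨b, rfl⟩
    · refine ENNReal.tsum_le_tsum fun r => ?_
      by_cases hr : a = g (r.1, r.2.1)
      · rw [if_pos (by rw [hr]; rfl), if_pos hr, ← hl.sup]
        exact le_iSup (fun t => (M.run silent t x v ()).run (some r)) t
      · rw [if_neg (by simpa using hr), if_neg hr]
  · rw [QPT.output, PMF.map_comp] at h
    rw [← h]
    change PMF.map _ _ = PMF.map _ _
    congr 1
    funext r
    cases r <;> rfl

theorem IsQPT.exists_machine {f : ℕ → Data → PMF Data} (h : IsQPT f) : ∃ M : QPT, ∀ n x,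
    (M.exec silent (.pair (unary n) x) vacuum ()).map Prod.fst = f n x := by
  obtain ⟨M, hM⟩ := h
  refine ⟨M, fun n x => ?_⟩
  obtain ⟨t, ht⟩ := hM n x
  exact QPT.exec_of_output ht

theorem IsQPTOut.exists_machine {f : ℕ → Data → PMF (Data × Ket)} (h : IsQPTOut f) :
    ∃ M : QPT, ∀ n x,
      (M.exec silent (.pair (unary n) x) vacuum ()).map (fun r => (r.1, r.2.1)) = f n x := by
  obtain ⟨M, hM⟩ := h
  refine ⟨M, fun n x => ?_⟩
  obtain ⟨t, ht⟩ := hM n x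
  exact QPT.exec_of_output (g := id) (by rw [ht, Option.map_id, PMF.map_id])

theorem QPT.size_le_of_exec (M : QPT) : ∃ p : Polynomial ℕ, ∀ n x,
    ∀ r ∈ (M.exec silent (.pair (unary n) x) vacuum ()).support, r.1.size ≤ p.eval (n + x.size) := by
  obtain ⟨p, hp⟩ := M.exists_bound
  refine ⟨p.comp (2 * Polynomial.X + 3), fun n x r hr => ?_⟩
  have := (hp (2 * (n + x.size) + 3) (.pair (unary n) x) (by rw [size_pair, size_unary]; omega)).2
    (fun s q a ha => (silent_boundedBy s q a ha).trans (by omega)) _ _ r hr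
  simpa using this

theorem IsQPT.size_le {f : ℕ → Data → PMF Data} (h : IsQPT f) : ∃ p : Polynomial ℕ, ∀ n x,
    ∀ y ∈ (f n x).support, y.size ≤ p.eval (n + x.size) := by
  obtain ⟨M, hM⟩ := h.exists_machine
  obtain ⟨p, hp⟩ := M.size_le_of_exec
  refine ⟨p, fun n x y hy => ?_⟩
  rw [← hM] at hy
  obtain ⟨r, hr, rfl⟩ := (PMF.mem_support_map_iff _ _ _).1 hy
  exact hp n x r hr

theorem IsQPTOut.size_le {f : ℕ → Data → PMF (Data × Ket)} (h : IsQPTOut f) :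
    ∃ p : Polynomial ℕ, ∀ n x, ∀ y ∈ (f n x).support, y.1.size ≤ p.eval (n + x.size) := by
  obtain ⟨M, hM⟩ := h.exists_machine
  obtain ⟨p, hp⟩ := M.size_le_of_exec
  refine ⟨p, fun n x y hy => ?_⟩
  rw [← hM] at hy
  obtain ⟨r, hr, rfl⟩ := (PMF.mem_support_map_iff _ _ _).1 hy
  exact hp n x r hr

theorem IsQPTOut.normSq_eq {f : ℕ → Data → PMF (Data × Ket)} (h : IsQPTOut f) (n : ℕ) (x : Data) :
    ∀ y ∈ (f n x).support, normSq y.2 = 1 := by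
  obtain ⟨M, hM⟩ := h.exists_machine
  intro y hy
  rw [← hM] at hy
  obtain ⟨r, hr, rfl⟩ := (PMF.mem_support_map_iff _ _ _).1 hy
  exact M.normSq_exec ⟨1, silent_boundedBy⟩ _ _ _ normSq_vacuum r hr

theorem PolyFun.size_le {g : ℕ → Data → Data} (h : PolyFun g) : ∃ p : Polynomial ℕ, ∀ n x,
    (g n x).size ≤ p.eval (n + x.size) := by
  obtain ⟨f, hf, hv⟩ := h
  obtain ⟨p, hp⟩ := hf.size_le
  refine ⟨p.comp (2 * Polynomial.X + 3), fun n x => ?_⟩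
  rw [← hv]
  refine (hp _).trans ?_
  rw [Polynomial.eval_comp]
  refine polyEval_mono p ?_
  simp only [size_pair, size_unary, Polynomial.eval_add, Polynomial.eval_mul, Polynomial.eval_X,
    Polynomial.eval_ofNat]
  omega

/-- A machine together with the preparation of its initial state. -/
structure Alg where
  M : QPT
  start : Data → Data
  polyTime : PolyTime start

attribute [fun_prop] Alg.polyTime

/-- The output on the input `x`, and the state of the oracle. -/
def Alg.run (A : Alg) {σ : Type} (O : Oracle σ) (x : Data) (s : σ) : PMF (Data × σ) :=
  (A.M.exec O (A.start x) vacuum s).map fun r => (r.1, r.2.2)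

/-- Computes `f` of the input. -/
def Alg.pre (A : Alg) (f : Data → Data) (hf : PolyTime f) : Alg where
  M := A.M
  start x := A.start (f x)
  polyTime := A.polyTime.comp hf

theorem Alg.pre_run (A : Alg) {f : Data → Data} (hf : PolyTime f) {σ : Type} (O : Oracle σ)
    (x : Data) (s : σ) : (A.pre f hf).run O x s = A.run O (f x) s := rfl

/-- Asks the query `g x` if `t x = nil`; the result is `h (r, x)`, where `r` is the answer, if
there is one. -/
def Alg.ask (t g h : Data → Data) (ht : PolyTime t) (hg : PolyTime g) (hh : PolyTime h) : Alg where
  M := UTFE.ask t g h ht hg hh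
  start x := .pair .nil (.pair .nil x)
  polyTime := by fun_prop

theorem Alg.ask_run {t g h : Data → Data} (ht : PolyTime t) (hg : PolyTime g) (hh : PolyTime h)
    {σ : Type} {O : Oracle σ} (hO : O.Bounded) (x : Data) (s : σ) :
    (Alg.ask t g h ht hg hh).run O x s = if t x = .nil then
      (O s (g x)).map fun r => (h (.pair r.1 x), r.2) else PMF.pure (h (.pair .nil x), s) := by
  rw [Alg.run, Alg.ask, ask_exec hO]
  split_ifs
  · rw [PMF.map_comp]; rfl
  · rw [PMF.pure_map]

/-- A machine that makes no queries. -/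
def Alg.ofMute (M : QPT) : Alg where
  M := mute M
  start x := mkS .nil x
  polyTime := by fun_prop

theorem Alg.ofMute_run {M : QPT} {f : ℕ → Data → PMF Data} (hM : ∀ n x,
    (M.exec silent (.pair (unary n) x) vacuum ()).map Prod.fst = f n x) {σ : Type}
    {O : Oracle σ} (hO : O.Bounded) (n : ℕ) (x : Data) (s : σ) :
    (Alg.ofMute M).run O (.pair (unary n) x) s = (f n x).map fun y => (y, s) := by
  rw [Alg.run, Alg.ofMute, mute_exec hO, subOf_mkS, ← hM, PMF.map_comp, PMF.map_comp]
  rfl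

theorem IsQPT.exists_alg {f : ℕ → Data → PMF Data} (h : IsQPT f) : ∃ A : Alg,
    ∀ {σ : Type} {O : Oracle σ}, O.Bounded → ∀ n x s,
      A.run O (.pair (unary n) x) s = (f n x).map fun y => (y, s) := by
  obtain ⟨M, hM⟩ := h.exists_machine
  exact ⟨.ofMute M, fun hO n x s => Alg.ofMute_run hM hO n x s⟩

theorem pair_nil_ne_pair_true (a b : Data) : Data.pair (bit false) a ≠ .pair (bit true) b :=
  pair_ne_pair (by simp [bit]) _ _

theorem free_rename_false (v : Ket) :
    Free (rename (Data.pair (bit false)) v) (Set.range (Data.pair (bit true))) :=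
  free_rename (pair_injective _) v fun a ⟨b, h⟩ => pair_nil_ne_pair_true a b h.symm

theorem free_rename_true (v : Ket) :
    Free (rename (Data.pair (bit true)) v) (Set.range (Data.pair (bit false))) :=
  free_rename (pair_injective _) v fun a ⟨b, h⟩ => pair_nil_ne_pair_true b a h

/-- A machine on qubits of its own. -/
theorem ren_exec_vacuum {κ : Data} {hκ : PolyTime (Data.pair κ)} {M : QPT} {W : Ket}
    (hf : Free W (Set.range (Data.pair κ))) (hn : normSq W = 1) {σ : Type} {O : Oracle σ}
    (hO : O.Bounded) (c : Data) (s : σ) :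
    (ren (Data.pair κ) hκ M).exec O (mkS .nil c) W s
      = (M.exec O c vacuum s).map fun r => (r.1, merge (Data.pair κ) W r.2.1, r.2.2) := by
  have := ren_exec (hρ := hκ) (M := M) (merge_intertwines (pair_injective κ) hf hn) hO c vacuum s
  rwa [merge_vacuum] at this

/-- Runs `A` on the input `x` and then `B` on the input `(out, x)`, where `out` is the output of
`A`. -/
def Alg.bind (A B : Alg) : Alg where
  M := seq (ren (Data.pair (bit false)) (by fun_prop) A.M) (ren (Data.pair (bit true)) (by fun_prop) B.M)
    (fun x => mkS .nil (B.start x)) Data.fst (by have := B.polyTime; fun_prop) (by fun_prop)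
  start x := mkS (.pair .nil x) (mkS .nil (A.start x))
  polyTime := by have := A.polyTime; fun_prop

/-- The two algorithms use the disjoint families of names `pair (bit false)` and `pair (bit true)`;
hence the memory left by the first does not affect the second, which runs as from an empty memory.
-/
theorem Alg.bind_run (A B : Alg) {σ : Type} {O : Oracle σ} (hO : O.Bounded) (x : Data) (s : σ) :
    (A.bind B).run O x s = (A.run O x s).bind fun r => B.run O (.pair r.1 x) r.2 := by
  rw [Alg.run, Alg.bind, seq_exec hO, ren_exec_vacuum (free_vacuum _) normSq_vacuum hO,
    PMF.map_bind, PMF.bind_map, Alg.run, PMF.bind_map]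
  refine pmf_bind_congr fun r hr => ?_
  have hn := A.M.normSq_exec hO _ _ _ normSq_vacuum r hr
  simp only [Function.comp_apply]
  rw [ren_exec_vacuum (W := merge (Data.pair (bit false)) vacuum r.2.1) (free_rename_false _) (by rw [← hn]; exact normSq_rename (pair_injective _) _)
    hO, PMF.map_comp, PMF.map_comp]
  rfl

/-- Applies `f` to the output. -/
def Alg.post (A : Alg) (f : Data → Data) (hf : PolyTime f) : Alg :=
  A.bind (.ask (fun _ => bit true) (fun _ => .nil) (fun x => f x.snd) (by fun_prop) (by fun_prop)
    (by fun_prop))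

/-- `f` is given the output and the input. -/
theorem Alg.post_run (A : Alg) {f : Data → Data} (hf : PolyTime f) {σ : Type} {O : Oracle σ}
    (hO : O.Bounded) (x : Data) (s : σ) :
    (A.post f hf).run O x s = (A.run O x s).map fun r => (f (.pair r.1 x), r.2) := by
  rw [Alg.post, Alg.bind_run _ _ hO]
  simp only [Alg.ask_run _ _ _ hO, bit, reduceCtorEq, if_false, snd_pair]
  rfl

end
end UTFE
namespace UTFE
noncomputable section
open Data

/-! ## The naming of qubits in the second phase -/

/-- The qubits of a machine whose memory is a tensor product: those of the first factor are already
used under the names `pair nil (pair nil a)`. -/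
def tensorName (x : Data) : Data :=
  if x = .nil then .pair (unary 2) x
  else if x.fst = bit false then .pair (bit false) x
  else if x.fst = bit true then x
  else .pair (unary 2) x

theorem PolyTime.tensorName : PolyTime tensorName := by
  unfold UTFE.tensorName
  fun_prop

theorem tensorName_false (a : Data) :
    tensorName (.pair (bit false) a) = .pair (bit false) (.pair (bit false) a) := by
  simp [tensorName]

theorem tensorName_true (a : Data) : tensorName (.pair (bit true) a) = .pair (bit true) a := by
  simp [tensorName, bit]

theorem tensorName_other {x : Data} (h1 : x ∉ Set.range (Data.pair (bit false)))
    (h2 : x ∉ Set.range (Data.pair (bit true))) : tensorName x = .pair (unary 2) x := by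
  cases x with
  | nil => rfl
  | pair a b =>
    rw [tensorName, if_neg (by simp), if_neg fun h => h1 ⟨b, by rw [← h]; rfl⟩,
      if_neg fun h => h2 ⟨b, by rw [← h]; rfl⟩]

theorem tensorName_cases (x : Data) :
    (∃ a, x = .pair (bit false) a ∧ tensorName x = .pair (bit false) (.pair (bit false) a)) ∨
    (∃ a, x = .pair (bit true) a ∧ tensorName x = .pair (bit true) a) ∨
    (x ∉ Set.range (Data.pair (bit false)) ∧ x ∉ Set.range (Data.pair (bit true)) ∧
      tensorName x = .pair (unary 2) x) := by
  by_cases h1 : x ∈ Set.range (Data.pair (bit false))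
  · obtain ⟨a, rfl⟩ := h1
    exact .inl ⟨a, rfl, tensorName_false a⟩
  · by_cases h2 : x ∈ Set.range (Data.pair (bit true))
    · obtain ⟨a, rfl⟩ := h2
      exact .inr (.inl ⟨a, rfl, tensorName_true a⟩)
    · exact .inr (.inr ⟨h1, h2, tensorName_other h1 h2⟩)

theorem tensorName_injective : Function.Injective tensorName := by
  intro x y h
  rcases tensorName_cases x with ⟨a, rfl, hx⟩ | ⟨a, rfl, hx⟩ | ⟨_, _, hx⟩ <;>
  rcases tensorName_cases y with ⟨b, rfl, hy⟩ | ⟨b, rfl, hy⟩ | ⟨_, _, hy⟩ <;>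
  rw [hx, hy] at h <;> simp_all [bit, unary]

/-- The families `nil`, `bit true` and `unary 2` are taken by `tensorName`, so the registers of the
server begin at `unary 3` in the second phase. -/
theorem tensorName_notMem_fresh (x : Data) : tensorName x ∉ fresh (unary 3) := by
  rintro ⟨i, a, h⟩
  have hs := congrArg (fun x => x.fst.size) h
  simp only [fst_pair, size_iterate_pair_nil, size_unary] at hs
  rcases tensorName_cases x with ⟨b, _, hx⟩ | ⟨b, _, hx⟩ | ⟨_, _, hx⟩ <;>
    rw [hx] at hs <;> simp [bit, unary] at hs <;> omega

theorem pair_false_notMem_fresh (a : Data) : Data.pair (bit false) a ∉ fresh (unary 2) := by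
  rintro ⟨i, b, h⟩
  have hs := congrArg (fun x => x.fst.size) h
  simp only [fst_pair, size_iterate_pair_nil, size_unary, bit, size_nil] at hs
  omega

@[simp] theorem mem_inPart {ι : Data → Data} (hι : Function.Injective ι) {U : Finset Data}
    {a : Data} : a ∈ inPart ι U hι ↔ ι a ∈ U := Finset.mem_preimage

@[simp] theorem mem_outPart {ι : Data → Data} {U : Finset Data} {x : Data} :
    x ∈ outPart ι U ↔ x ∈ U ∧ x ∉ Set.range ι := by
  classical exact Finset.mem_filter

/-- The state `φ` is put next to a memory that is used by a machine. -/
theorem Mem.tensor {κ : Data} {W v φ : Ket} (h : Mem (Data.pair (bit false)) κ W v)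
    (hφ : normSq φ = 1) : Mem tensorName (unary 3) (tensor W φ) (tensor v φ) := by
  obtain ⟨hv, _, w, hw1, hw2, _, rfl⟩ := h
  -- After the tensor product the leftovers have names `pair (bit false) x` with `x` not of the form
  -- `pair (bit false) a`, and those are missed by `tensorName`.
  have hw' : Free (rename (Data.pair (bit false)) w) (Set.range tensorName) := by
    intro T hT x hx ⟨y, hy⟩
    rw [rename_apply (pair_injective _), ne_eq, ite_eq_right_iff, Classical.not_imp] at hT
    obtain ⟨hT1, hT2⟩ := hT
    have hxr : x ∈ Set.range (Data.pair (bit false)) := by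
      by_contra hxr
      exact Finset.notMem_empty x (hT1 ▸ mem_outPart.2 ⟨hx, hxr⟩)
    obtain ⟨a, rfl⟩ := hxr
    have ha := hw2 _ hT2 a ((mem_inPart _).2 hx)
    rcases tensorName_cases y with ⟨b, _, h⟩ | ⟨b, _, h⟩ | ⟨_, _, h⟩ <;> rw [hy] at h
    · exact ha ⟨b, by injection h with _ h; exact h.symm⟩
    · exact pair_nil_ne_pair_true _ _ h
    · exact pair_ne_pair (by simp [bit, unary]) _ _ h
  refine ⟨by rw [normSq_tensor, hv, hφ, one_mul], tensorName_notMem_fresh,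
    rename (Data.pair (bit false)) w, by rw [normSq_rename (pair_injective _), hw1], hw',
    free_rename (pair_injective _) _ ?_, ?_⟩
  · rintro a ⟨i, b, h⟩
    have hs := congrArg (fun x => x.fst.size) h
    simp only [fst_pair, size_iterate_pair_nil, size_unary, bit, size_nil] at hs
    omega
  · have hr := fun v : Ket => free_rename_true v
    rw [merge_eq_iff tensorName_injective hw']
    intro U
    rw [tensor_eq_merge, tensor_eq_merge, merge_apply (pair_injective _) (hr φ),
      merge_apply (pair_injective _) hw2, merge_apply (pair_injective _) (hr φ),
      rename_apply (pair_injective _), rename_apply (pair_injective _),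
      rename_apply (pair_injective _)]
    -- Both sides are products of amplitudes of `v`, `φ` and `w`. The equations `e1`, `e2`, `e3`
    -- match the parts of `U` that these read off, and `e4` matches the conditions that no other
    -- qubit is excited.
    have e1 : inPart _ (inPart tensorName U tensorName_injective) (pair_injective (bit false))
        = inPart _ (inPart _ U (pair_injective (bit false))) (pair_injective (bit false)) := by
      ext a; simp [tensorName_false]
    have e2 : inPart _ (outPart (Data.pair (bit false)) (inPart tensorName U tensorName_injective))
          (pair_injective (bit true))
        = inPart _ (outPart (Data.pair (bit false)) U) (pair_injective (bit true)) := by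
      ext a
      simp only [mem_inPart, mem_outPart, tensorName_true]
    have e3 : inPart _ (outPart tensorName U) (pair_injective (bit false))
        = outPart (Data.pair (bit false)) (inPart _ U (pair_injective (bit false))) := by
      ext a
      simp only [mem_inPart, mem_outPart]
      refine and_congr_right fun _ => not_congr ⟨fun ⟨y, hy⟩ => ?_, fun ⟨b, hb⟩ => ⟨.pair (bit false) b, by
        rw [tensorName_false, hb]⟩⟩
      rcases tensorName_cases y with ⟨b, _, h⟩ | ⟨b, _, h⟩ | ⟨_, _, h⟩ <;> rw [hy] at h
      · exact ⟨b, by injection h with _ h; exact h.symm⟩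
      · exact absurd h (pair_nil_ne_pair_true _ _)
      · exact absurd h (pair_ne_pair (by simp [bit, unary]) _ _)
    have e4 : outPart (Data.pair (bit true)) (outPart (Data.pair (bit false)) U) = ∅ ↔
        outPart (Data.pair (bit true)) (outPart (Data.pair (bit false))
          (inPart tensorName U tensorName_injective)) = ∅ ∧
        outPart (Data.pair (bit false)) (outPart tensorName U) = ∅ := by
      simp only [Finset.eq_empty_iff_forall_notMem, mem_outPart, mem_inPart]
      constructor
      · refine fun h => ⟨fun x ⟨⟨hx, h1⟩, h2⟩ => h _ ⟨⟨hx, ?_⟩, ?_⟩, fun x ⟨⟨hx, h1⟩, h2⟩ =>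
          h x ⟨⟨hx, h2⟩, fun ⟨a, ha⟩ => h1 ⟨_, (tensorName_true a).trans ha⟩⟩⟩
        · rintro ⟨a, ha⟩
          rw [tensorName_other h1 h2] at ha
          exact pair_ne_pair (by simp [bit, unary]) _ _ ha
        · rintro ⟨a, ha⟩
          rw [tensorName_other h1 h2] at ha
          exact pair_ne_pair (by simp [bit, unary]) _ _ ha
      · rintro ⟨h1, h2⟩ x ⟨⟨hx, h3⟩, h4⟩
        by_cases hr : x ∈ Set.range tensorName
        · obtain ⟨y, rfl⟩ := hr
          refine h1 y ⟨⟨hx, ?_⟩, ?_⟩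
          · rintro ⟨a, rfl⟩
            exact h3 ⟨_, (tensorName_false a).symm⟩
          · rintro ⟨a, rfl⟩
            exact h4 ⟨_, (tensorName_true a).symm⟩
        · exact h2 x ⟨⟨hx, hr⟩, h3⟩
    simp only [e1, e2, e3, e4]
    split_ifs <;> simp_all
    ring

end
end UTFE
namespace UTFE
noncomputable section
open Data

/-! ## The untelegraphability experiment -/

/-- The challenge messages are admissible, given the functions for which there are keys. -/
def Fair (S : UTSKFE) (n : ℕ) (out : Data) (fs : List Data) : Prop :=
  out.fst ∈ S.msgs n ∧ out.snd.fst ∈ S.msgs n ∧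
    ∀ f ∈ fs, S.funs.eval n f out.fst = S.funs.eval n f out.snd.fst

/-- The functions for which keys are given out if the challenge messages are `p`. -/
def Allowed (𝓕 : FunSpace) (n : ℕ) (p f : Data) : Prop :=
  f ∈ 𝓕.desc n ∧ 𝓕.eval n f p.fst = 𝓕.eval n f p.snd

open scoped Classical in
/-- The experiment with a key oracle `O p` that depends on the challenge messages `p`, which are
`nil` in the phases without restrictions. The key oracle keeps its state throughout the experiment.
A ciphertext consists of a ciphertext of `S` under the key `msk` and of `ctP`. -/
def core (S : UTSKFE) (𝒜 : UTAdversary) (b : Bool) (n : ℕ) (pub msk ctP : Data) {σ : Type}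
    (O : Data → Oracle σ) (logs : σ → List Data) (s₀ : σ) : PMF Bool :=
  (𝒜.A₁.exec (O .nil) (.pair (unary n) pub) vacuum s₀).bind fun r₁ =>
    if Fair S n r₁.1 (logs r₁.2.2) then
      (S.enc n msk (if b then r₁.1.snd.fst else r₁.1.fst)).bind fun e =>
        (𝒜.A₂.exec (O (.pair r₁.1.fst r₁.1.snd.fst))
          (.pair (unary n) (.pair (.pair e.1 ctP) r₁.1.snd.snd)) (tensor r₁.2.1 e.2) r₁.2.2).bind
            fun r₂ => (𝒜.B.exec (O .nil) (.pair (unary n) r₂.1) vacuum r₂.2.2).map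
              fun r₃ => decide (r₃.1 = bit true)
    else PMF.pure false

/-- A machine sees the answers of its oracle, not the oracle state. If a map of states commutes with
the oracles, it therefore commutes with whole executions. Changes of bookkeeping in key oracles are
handled in this way. -/
theorem QPT.exec_map {σ τ : Type} (M : QPT) {O : Oracle σ} {O' : Oracle τ} (hO : O.Bounded)
    (hO' : O'.Bounded) {φ : σ → τ} (h : ∀ s q, (O s q).map (fun r => (r.1, φ r.2)) = O' (φ s) q)
    (c : Data) (v : Ket) (s : σ) :
    (M.exec O c v s).map (fun r => (r.1, r.2.1, φ r.2.2)) = M.exec O' c v (φ s) := by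
  obtain ⟨L, hL⟩ := hO
  refine M.induction L (P := fun c => ∀ v s, (M.exec O c v s).map (fun r => (r.1, r.2.1, φ r.2.2))
    = M.exec O' c v (φ s)) (fun c ih v s => ?_) c v s
  rw [M.exec_step ⟨L, hL⟩, M.exec_step hO']
  revert ih
  cases M.step c with
  | halt out => intro _; simp [perform, PMF.pure_map]
  | hadamard a c => exact fun ih => ih _ (.hadamard a c) _ _
  | tGate a c => exact fun ih => ih _ (.tGate a c) _ _
  | cnot a b c => exact fun ih => ih _ (.cnot a b c) _ _
  | measure a c =>
    intro ih
    simp only [perform, PMF.map_bind]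
    exact pmf_bind_congr fun r _ => ih _ (.measure a c r.1) _ _
  | query q c =>
    intro ih
    simp only [perform, PMF.map_bind, ← h, PMF.bind_map]
    exact pmf_bind_congr fun r hr => ih _ (.query q c r.1 (hL s q r hr)) _ _

theorem core_map {S : UTSKFE} {𝒜 : UTAdversary} {b : Bool} {n : ℕ} {pub msk ctP : Data}
    {σ τ : Type} {O : Data → Oracle σ} {O' : Data → Oracle τ} (hO : ∀ p, (O p).Bounded)
    (hO' : ∀ p, (O' p).Bounded) {φ : σ → τ}
    (h : ∀ p s q, (O p s q).map (fun r => (r.1, φ r.2)) = O' p (φ s) q) (logs : τ → List Data)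
    (s : σ) : core S 𝒜 b n pub msk ctP O (fun s => logs (φ s)) s
      = core S 𝒜 b n pub msk ctP O' logs (φ s) := by
  rw [core, core, ← 𝒜.A₁.exec_map (hO .nil) (hO' .nil) (h .nil), PMF.bind_map]
  refine pmf_bind_congr fun r₁ _ => ?_
  simp only [Function.comp_apply]
  by_cases hf : Fair S n r₁.1 (logs (φ r₁.2.2))
  · rw [if_pos hf, if_pos hf]
    refine pmf_bind_congr fun e _ => ?_
    rw [← 𝒜.A₂.exec_map (hO _) (hO' _) (h _), PMF.bind_map]
    refine pmf_bind_congr fun r₂ _ => ?_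
    simp only [Function.comp_apply]
    rw [← 𝒜.B.exec_map (hO .nil) (hO' .nil) (h .nil), PMF.map_comp]
    rfl
  · rw [if_neg hf, if_neg hf]

/-! ## Running the experiment -/

/-- The fixed data of a simulation: `un` is the security parameter, `B` bounds answers and records,
`p` are the challenge messages, and `K` holds `((pub, (msk, ctP)), K')`. -/
def envOf (un B p K : Data) : Data := .pair un (.pair B (.pair p K))

/-- The data for given parameters. -/
def fullEnv (n : ℕ) (B pub msk ctP K p : Data) : Data :=
  envOf (unary n) B p (.pair (.pair pub (.pair msk ctP)) K)

/-- The functions in the list of records. -/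
def logged {σ : Type} (s : Data × σ) : List Data := s.1.toList.map Data.fst

/-- Register names start at `unary 2`: the served machine owns `pair (bit false)`, and `pair (bit
true)` is kept free for qubits that a preceding sampler may have left. -/
def startA (e : Data) : Data :=
  mkS (interCtx .nil (unary 2) .nil e) (.pair e.fst e.snd.snd.snd.fst.fst)

/-- The challenge messages are entered into the environment, so that the test for allowed queries
becomes the restriction of the phase after the challenge. -/
def envB (y : Data) : Data :=
  envOf y.snd.snd.fst y.snd.snd.snd.fst (.pair y.fst.fst y.fst.snd.fst) y.snd.snd.snd.snd.snd

def startB (w : Data) : Data :=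
  mkS (interCtx .nil (unary 3) w.snd.snd.fst (envB w.snd)) (.pair w.snd.snd.snd.fst
    (.pair (.pair w.fst w.snd.snd.snd.snd.snd.snd.fst.snd.snd) w.snd.fst.snd.snd))

/-- With `nil` in place of the challenge messages the equation in `Allowed` is trivial, so all
functions in the function space may be queried. -/
def envC (y : Data) : Data := envOf y.snd.snd.fst y.snd.snd.snd.fst .nil y.snd.snd.snd.snd.snd

def startC (y : Data) : Data :=
  mkS (interCtx .nil (unary 2) y.snd.fst (envC y)) (.pair y.snd.snd.fst y.fst)

theorem PolyTime.startA : PolyTime startA := by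
  unfold UTFE.startA interCtx; fun_prop

theorem PolyTime.startB : PolyTime startB := by
  unfold UTFE.startB interCtx envB envOf; fun_prop

theorem PolyTime.startC : PolyTime startC := by
  unfold UTFE.startC interCtx envC envOf; fun_prop

attribute [fun_prop] PolyTime.startA PolyTime.startB PolyTime.startC PolyTime.tensorName

/-- The machine `M` with its queries served by `H`. -/
def phase (M : QPT) (H : Alg) (ι tst : Data → Data) (hι : PolyTime ι) (ht : PolyTime tst) : QPT :=
  inter M H.M ι tst H.start hι ht H.polyTime

abbrev servedBy (H : Alg) (tst : Data → Data) (e : Data) {σ : Type} (O : Oracle σ) :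
    Oracle (Data × σ) := served H.M tst H.start e O

theorem phase_exec {M : QPT} {H : Alg} {ι tst : Data → Data} {hι : PolyTime ι} {ht : PolyTime tst}
    (hinj : Function.Injective ι) {e : Data} {σ β : Type} {O : Oracle σ} (hO : O.Bounded)
    {k : Data × Ket × Data × σ → PMF β} {K : Data × Ket × σ → PMF β}
    (hk : ∀ out v store s W κ, Mem ι κ W v →
      k (out, v, store, s) = K (.pair out (.pair store e), W, s)) {κ : Data} {v W : Ket}
    (hm : Mem ι κ W v) (c store : Data) (s : σ) :
    ((phase M H ι tst hι ht).exec O (mkS (interCtx .nil κ store e) c) W s).bind K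
      = (M.exec (servedBy H tst e O) c v (store, s)).bind k :=
  (inter_exec hinj hO hk hm c store s).symm

theorem phase_map {M : QPT} {H : Alg} {ι tst : Data → Data} {hι : PolyTime ι} {ht : PolyTime tst}
    (hinj : Function.Injective ι) {σ : Type} {O : Oracle σ} (hO : O.Bounded) {κ : Data} {v W : Ket}
    (hm : Mem ι κ W v) (c store e : Data) (s : σ) :
    ((phase M H ι tst hι ht).exec O (mkS (interCtx .nil κ store e) c) W s).map
        (fun r => (r.1, r.2.2))
      = (M.exec (servedBy H tst e O) c v (store, s)).map
        fun r => (.pair r.1 (.pair r.2.2.1 e), r.2.2.2) :=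
  phase_exec hinj hO
    (k := fun r : Data × Ket × Data × σ => PMF.pure ((.pair r.1 (.pair r.2.2.1 e), r.2.2.2) : Data × σ))
    (K := fun r : Data × Ket × σ => PMF.pure (r.1, r.2.2)) (fun _ _ _ _ _ _ _ => rfl) hm c store s

theorem mem_start {w : Ket} (h1 : normSq w = 1) (h2 : Free w (Set.range (Data.pair (bit false))))
    (h3 : Free w (fresh (unary 2))) : Mem (Data.pair (bit false)) (unary 2) w vacuum :=
  ⟨normSq_vacuum, pair_false_notMem_fresh, w, h1, h2, h3, (merge_vacuum _ _).symm⟩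

/-- The outcome of the experiment: the bit of the second stage, unless the experiment is unfair. -/
def verdict (gt : Data → Data) (x : Data) : Data :=
  if gt x.snd.fst.snd = .nil then .nil else bit (decide (x.fst.fst = bit true))

theorem PolyTime.verdict {gt : Data → Data} (hgt : PolyTime gt) : PolyTime (verdict gt) := by
  unfold UTFE.verdict; fun_prop

theorem verdict_eq (gt : Data → Data) (o s y z w : Data) :
    decide (verdict gt (.pair (.pair o s) (.pair (.pair y z) w)) = bit true)
      = decide (gt z ≠ .nil ∧ o = bit true) := by
  simp only [verdict, fst_pair, snd_pair]
  by_cases h : gt z = .nil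
  · simp [h, bit]
  · by_cases ho : o = bit true
    · simp [h, ho]
    · simp only [h, ho, if_false, decide_false, ne_eq, not_false_eq_true, and_false]
      simp [bit]

section
variable (𝒜 : UTAdversary) (H : Alg) (tst : Data → Data) (ht : PolyTime tst) (E : QPT) (b : Bool)

def phaseA : QPT := phase 𝒜.A₁ H (Data.pair (bit false)) tst (by fun_prop) ht
def phaseB : QPT := phase 𝒜.A₂ H tensorName tst (by fun_prop) ht
def phaseC : QPT := phase 𝒜.B H (Data.pair (bit false)) tst (by fun_prop) ht

/-- The first stage, with encryption by the machine `E`. -/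
def stageOne : Alg where
  M := seq (ren (Data.pair (bit false)) (by fun_prop) (phaseA 𝒜 H tst ht))
    (seq (ren (Data.pair (bit true)) (by fun_prop) (mute E)) (phaseB 𝒜 H tst ht) startB Data.fst
      (by fun_prop) (by fun_prop))
    (fun x => mkS (.pair .nil x.fst) (mkS .nil (mkS .nil (.pair x.fst.snd.snd.fst
      (.pair x.fst.snd.snd.snd.snd.snd.fst.snd.fst
        (if b then x.fst.fst.snd.fst else x.fst.fst.fst))))))
    (fun x => .pair x.fst x.snd.fst) (by cases b <;> simp <;> fun_prop) (by fun_prop)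
  start e := mkS (.pair .nil .nil) (mkS .nil (startA e))
  polyTime := by fun_prop

/-- The second stage. -/
def stageTwo : Alg where
  M := phaseC 𝒜 H tst ht
  start x := startC x.fst.fst
  polyTime := by fun_prop

/-- The whole experiment. -/
def play (gt : Data → Data) (hgt : PolyTime gt) : Alg :=
  (stageOne 𝒜 H tst ht E b).bind ((stageTwo 𝒜 H tst ht).post (verdict gt) hgt.verdict)

end

theorem stageOne_run {S : UTSKFE} (𝒜 : UTAdversary) (H : Alg) {tst : Data → Data}
    (ht : PolyTime tst) {E : QPT} (b : Bool) (hE : ∀ n x, (E.exec silent (.pair (unary n) x) vacuum ()).map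
      (fun r => (r.1, r.2.1)) = S.enc n x.fst x.snd) {σ : Type} {O : Oracle σ} (hO : O.Bounded)
    (n : ℕ) (B pub msk ctP K : Data) (s : σ) :
    (stageOne 𝒜 H tst ht E b).run O (fullEnv n B pub msk ctP K .nil) s =
      (𝒜.A₁.exec (servedBy H tst (fullEnv n B pub msk ctP K .nil) O) (.pair (unary n) pub) vacuum (.nil, s)).bind fun r₁ =>
        (S.enc n msk (if b then r₁.1.snd.fst else r₁.1.fst)).bind fun x =>
          (𝒜.A₂.exec (servedBy H tst (fullEnv n B pub msk ctP K (.pair r₁.1.fst r₁.1.snd.fst)) O)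
            (.pair (unary n) (.pair (.pair x.1 ctP) r₁.1.snd.snd)) (tensor r₁.2.1 x.2) r₁.2.2).map
              fun r₂ => (.pair (.pair r₂.1 (.pair r₂.2.2.1 (fullEnv n B pub msk ctP K (.pair r₁.1.fst r₁.1.snd.fst))))
                (.pair r₁.1 (.pair r₁.2.2.1 (fullEnv n B pub msk ctP K .nil))), r₂.2.2.2) := by
  rw [Alg.run, stageOne, seq_exec hO, ren_exec_vacuum (free_vacuum _) normSq_vacuum hO, PMF.bind_map,
    PMF.map_bind]
  refine phase_exec (pair_injective _) hO (fun out v store s W κ hm => ?_)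
    (mem_start normSq_vacuum (free_vacuum _) (free_vacuum _)) _ _ s
  obtain ⟨hv, _, w, hw1, hw2, _, hW⟩ := id hm
  have hWn : normSq W = 1 := by rw [hW, normSq_merge (pair_injective _) hw2, hv, hw1, one_mul]
  simp only [Function.comp_apply, fst_pair]
  rw [seq_exec hO, ren_exec_vacuum (W := merge (Data.pair (bit false)) vacuum W)
    (free_rename_false _) ((normSq_rename (pair_injective _) _).trans hWn) hO, mute_exec hO,
    subOf_mkS]
  have hx := hE n (.pair msk (if b then out.snd.fst else out.fst))
  rw [fst_pair, snd_pair] at hx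
  rw [← hx, PMF.bind_map, PMF.map_comp, PMF.map_bind, PMF.bind_map, PMF.bind_map]
  refine pmf_bind_congr fun x hx => ?_
  have hn := E.normSq_exec ⟨1, silent_boundedBy⟩ _ _ _ normSq_vacuum x hx
  -- The first phase works on one half of the names and the encryption on the other half;
  -- rearranged, their joint memory is the tensor product prescribed by the experiment.
  have ht := merge_merge (pair_injective (bit false)) (pair_injective (bit true))
    pair_nil_ne_pair_true (v := W) (u := x.2.1) (free_vacuum _) (free_vacuum _)
  have key := phase_map (M := 𝒜.A₂) (H := H) (tst := tst) (hι := .tensorName) (ht := ‹_›)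
    tensorName_injective hO (hm.tensor hn)
  rw [tensor_eq_merge W, rename, ← ht] at key
  have := congrArg (PMF.map fun r : Data × σ => (Data.pair r.1 (.pair out (.pair store (fullEnv n B pub msk ctP K .nil))), r.2))
    (key (.pair (unary n) (.pair (.pair x.1 ctP) out.snd.snd)) store
      (fullEnv n B pub msk ctP K (.pair out.fst out.snd.fst)) s)
  rw [PMF.map_comp, PMF.map_comp] at this
  simp only [Function.comp_apply, fst_pair, PMF.map_comp]
  exact this.symm

/-- The flag of an experiment that is fair. -/
def IsFairTest (S : UTSKFE) (gt : Data → Data) : Prop :=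
  ∀ n B p K out store, gt (.pair out (.pair store (envOf (unary n) B p K))) = .nil ↔
    ¬ Fair S n out (store.toList.map Data.fst)

theorem play_run {S : UTSKFE} (𝒜 : UTAdversary) (H : Alg) {tst : Data → Data}
    (ht : PolyTime tst) {E : QPT} (b : Bool) (hE : ∀ n x, (E.exec silent (.pair (unary n) x) vacuum ()).map
      (fun r => (r.1, r.2.1)) = S.enc n x.fst x.snd) {gt : Data → Data} (hgt : PolyTime gt)
    (hg : IsFairTest S gt) {σ : Type} {O : Oracle σ} (hO : O.Bounded)
    (n : ℕ) (B pub msk ctP K : Data) (s : σ) :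
    ((play 𝒜 H tst ht E b gt hgt).run O (fullEnv n B pub msk ctP K .nil) s).map (fun r => decide (r.1 = bit true))
      = core S 𝒜 b n pub msk ctP (fun p => servedBy H tst (fullEnv n B pub msk ctP K p) O) logged (.nil, s) := by
  obtain ⟨e, he⟩ : ∃ e, e = fullEnv n B pub msk ctP K := ⟨_, rfl⟩
  rw [play, Alg.bind_run _ _ hO, stageOne_run 𝒜 H ht b hE hO, core]
  simp only [← he]
  rw [PMF.bind_bind, PMF.map_bind]
  refine pmf_bind_congr fun r₁ _ => ?_
  have key : ∀ (r₂ : Data × Ket × Data × σ) p, (stageTwo 𝒜 H tst ht).run O (.pair (.pair (.pair r₂.1 (.pair r₂.2.2.1 (e p)))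
      (.pair r₁.1 (.pair r₁.2.2.1 (e .nil)))) (e .nil)) r₂.2.2.2
      = (𝒜.B.exec (servedBy H tst (e .nil) O) (.pair (unary n) r₂.1) vacuum r₂.2.2).map
        fun r₃ => (.pair r₃.1 (.pair r₃.2.2.1 (e .nil)), r₃.2.2.2) := fun r₂ p =>
    by
      subst he
      exact phase_map (M := 𝒜.B) (H := H) (tst := tst) (hι := by fun_prop) (ht := ht)
        (pair_injective (bit false)) hO (mem_start normSq_vacuum (free_vacuum _) (free_vacuum _))
        _ _ _ _
  have e1 := hg n B .nil (.pair (.pair pub (.pair msk ctP)) K) r₁.1 r₁.2.2.1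
  rw [show envOf _ B .nil _ = e .nil by rw [he]; rfl] at e1
  rw [PMF.bind_bind, PMF.map_bind]
  simp only [PMF.bind_map, PMF.map_bind, Alg.post_run _ _ hO, Function.comp_def, key, PMF.map_comp]
  by_cases hf : Fair S n r₁.1 (logged r₁.2.2)
  · rw [if_pos hf]
    have hf' : gt (.pair r₁.1 (.pair r₁.2.2.1 (e .nil))) ≠ .nil := fun h => e1.1 h hf
    refine pmf_bind_congr fun x _ => pmf_bind_congr fun r₂ _ => ?_
    simp only [verdict_eq, hf', ne_eq, not_false_eq_true, true_and]
  -- An unfair simulation is not interrupted. It is played to the end and the verdict is overwritten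
  -- by `nil`, which has the same law as stopping with `false`.
  · rw [if_neg hf]
    have hf' : gt (.pair r₁.1 (.pair r₁.2.2.1 (e .nil))) = .nil := e1.2 hf
    have h0 : ∀ {α : Type} (p : PMF α), p.map (fun _ => false) = PMF.pure false :=
      fun p => PMF.map_const p false
    simp only [verdict_eq, hf', ne_eq, not_true_eq_false, false_and, decide_false, h0,
      PMF.bind_const]

/-! ## Tests -/

theorem UTSKFE.exists_fairTest {S : UTSKFE} (h1 : PolyDecidable S.msgs) (h2 : S.funs.Efficient) :
    ∃ gt, PolyTime gt ∧ IsFairTest S gt := by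
  obtain ⟨m, hm, em⟩ := h1
  obtain ⟨-, -, v, hv, ev⟩ := h2
  let t : Data → Data := fun x => if v (.pair x.snd.fst (.pair x.fst.fst x.snd.snd.fst))
    = v (.pair x.snd.fst (.pair x.fst.fst x.snd.snd.snd)) then bit true else .nil
  have ht : PolyTime t := by fun_prop
  refine ⟨fun x => if m (.pair x.snd.snd.fst x.fst.fst) = .nil then .nil else
    if m (.pair x.snd.snd.fst x.fst.snd.fst) = .nil then .nil else
    bit (allList t (.pair x.snd.snd.fst (.pair x.fst.fst x.fst.snd.fst)) x.snd.fst), by fun_prop,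
    fun n B p K out store => ?_⟩
  simp only [fst_pair, snd_pair, envOf, em, bit_eq_nil, decide_eq_false_iff_not]
  have hl : allList t (.pair (unary n) (.pair out.fst out.snd.fst)) store = true ↔
      ∀ f ∈ store.toList.map Data.fst, S.funs.eval n f out.fst = S.funs.eval n f out.snd.fst := by
    rw [allList_iff, List.forall_mem_map]
    refine forall₂_congr fun e _ => ?_
    simp only [t, fst_pair, snd_pair, ev]
    split_ifs with h <;> simp [h, bit]
  unfold Fair
  rw [← hl]
  by_cases a1 : out.fst ∈ S.msgs n <;> by_cases a2 : out.snd.fst ∈ S.msgs n <;>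
    simp [a1, a2, bit_eq_nil]

/-- Whether a query is allowed. -/
def IsAllowedTest (𝓕 : FunSpace) (tst : Data → Data) : Prop :=
  ∀ n B p K f, tst (.pair (envOf (unary n) B p K) f) = .nil ↔ ¬ Allowed 𝓕 n p f

theorem FunSpace.exists_allowedTest {𝓕 : FunSpace} (h : 𝓕.Efficient) :
    ∃ tst, PolyTime tst ∧ IsAllowedTest 𝓕 tst := by
  obtain ⟨-, ⟨d, hd, ed⟩, v, hv, ev⟩ := h
  refine ⟨fun x => if d (.pair x.fst.fst x.snd) = .nil then .nil else
    if v (.pair x.fst.fst (.pair x.snd x.fst.snd.snd.fst.fst))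
      = v (.pair x.fst.fst (.pair x.snd x.fst.snd.snd.fst.snd)) then bit true else .nil, by fun_prop,
    fun n B p K f => ?_⟩
  simp only [fst_pair, snd_pair, envOf, ed, ev, bit_eq_nil, decide_eq_false_iff_not]
  unfold Allowed
  by_cases a1 : f ∈ 𝓕.desc n <;> by_cases a2 : 𝓕.eval n f p.fst = 𝓕.eval n f p.snd <;>
    simp [a1, a2, bit]

end
end UTFE
namespace UTFE
noncomputable section
open Data

/-! ## Experiments as distributions -/

/-- In the limit, the experiments `g t` output `1` with the probability given by `p`. -/
def LimOne (g : ℕ → OptionT PMF Bool) (p : PMF Bool) : Prop := ∃ w, Lim g w ∧ w true = p true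

theorem LimOne.prOne_eq {g : ℕ → OptionT PMF Bool} {p : PMF Bool} (h : LimOne g p) :
    prOne g = (p true).toReal := by
  obtain ⟨w, hw, e⟩ := h
  rw [UTFE.prOne_eq hw, e]

theorem LimOne.bind {α : Type} {g : ℕ → OptionT PMF α} {p : PMF α} {f : ℕ → α → OptionT PMF Bool}
    {q : α → PMF Bool} (hg : Lim g p) (hf : ∀ a, LimOne (fun t => f t a) (q a)) :
    LimOne (fun t => g t >>= f t) (p.bind q) := by
  choose w hw e using hf
  refine ⟨_, hg.bind hw, ?_⟩
  rw [PMF.bind_apply]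
  simp only [e]

theorem LimOne.pure (b : Bool) : LimOne (fun _ => pure b) (PMF.pure b) := ⟨_, Lim.pure b, rfl⟩

open scoped Classical in
-- An aborted experiment has no output, whereas the distribution shows `false`; only the probability
-- of `true` is compared, so the difference is invisible.
theorem LimOne.guard {P : Prop} {dP : Decidable P} {f : ℕ → OptionT PMF Bool} {q : PMF Bool}
    (hf : LimOne f q) :
    LimOne (fun t => (guard P : OptionT PMF Unit) >>= fun _ => f t)
      (if P then q else PMF.pure false) := by
  obtain ⟨w, hw, e⟩ := hf
  refine ⟨_, (Lim.guard P).bind (f := fun t _ => f t) fun _ => hw, ?_⟩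
  by_cases h : P
  · simp [h, e]
  · simp [h]

open scoped Classical in
/-- The untelegraphability experiment as a distribution. -/
def utDist (msgs : Finset Data) (desc : Finset Data) (eval : Data → Data → Data)
    (pub : Data) (kg : Data → PMF Data) (enc : Data → PMF (Data × Ket))
    (𝒜 : UTAdversary) (n : ℕ) (b : Bool) : PMF Bool :=
  (𝒜.A₁.exec (keyOracle kg (· ∈ desc)) (.pair (unary n) pub) vacuum []).bind fun r₁ =>
    if r₁.1.fst ∈ msgs ∧ r₁.1.snd.fst ∈ msgs ∧
        ∀ f ∈ r₁.2.2, eval f r₁.1.fst = eval f r₁.1.snd.fst then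
      (enc (if b then r₁.1.snd.fst else r₁.1.fst)).bind fun e =>
        (𝒜.A₂.exec (keyOracle kg fun f => f ∈ desc ∧ eval f r₁.1.fst = eval f r₁.1.snd.fst)
          (.pair (unary n) (.pair e.1 r₁.1.snd.snd)) (tensor r₁.2.1 e.2) []).bind fun r₂ =>
          (𝒜.B.exec (keyOracle kg (· ∈ desc)) (.pair (unary n) r₂.1) vacuum []).bind
              fun r₃ => PMF.pure (decide (r₃.1 = bit true))
    else PMF.pure false

theorem keyOracle_bounded {kg : Data → PMF Data} {ok : Data → Prop} {L : ℕ}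
    (h : ∀ f, ok f → ∀ a ∈ (kg f).support, a.size ≤ L) : (keyOracle kg ok).Bounded := by
  refine ⟨max L 1, fun s f a ha => ?_⟩
  unfold keyOracle at ha
  split_ifs at ha with hf
  · obtain ⟨x, hx, rfl⟩ := (PMF.mem_support_map_iff _ _ _).1 ha
    exact (h f hf x hx).trans (le_max_left _ _)
  · change a ∈ (PMF.pure _).support at ha
    rw [PMF.support_pure, Set.mem_singleton_iff] at ha
    rw [ha]
    exact le_max_right _ _

theorem limOne_utExperiment {msgs desc : Finset Data} {eval : Data → Data → Data} {pub : Data}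
    {kg : Data → PMF Data} {enc : Data → PMF (Data × Ket)} {𝒜 : UTAdversary} {n : ℕ} {b : Bool}
    {L : ℕ} (h : ∀ f ∈ desc, ∀ a ∈ (kg f).support, a.size ≤ L) :
    LimOne (utExperiment msgs desc eval pub kg enc 𝒜 n b)
      (utDist msgs desc eval pub kg enc 𝒜 n b) := by
  have h1 : (keyOracle kg (· ∈ desc)).Bounded := keyOracle_bounded h
  have h2 : ∀ Q : Data → Prop, (keyOracle kg fun f => f ∈ desc ∧ Q f).Bounded :=
    fun Q => keyOracle_bounded fun f hf => h f hf.1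
  refine LimOne.bind (Lim.run _ h1 _ _ _) ?_
  rintro ⟨out, v, fs⟩
  refine LimOne.guard (LimOne.bind (Lim.liftM _) ?_)
  rintro ⟨c, φ⟩
  refine LimOne.bind (Lim.run _ (h2 _) _ _ _) ?_
  rintro ⟨st, _⟩
  refine LimOne.bind (Lim.run _ h1 _ _ _) ?_
  rintro ⟨o, _⟩
  exact LimOne.pure _

/-- The key generation oracle for given challenge messages. -/
def stdOracle (𝓕 : FunSpace) (n : ℕ) (kg : Data → PMF Data) (p : Data) : Oracle (List Data) :=
  keyOracle kg (Allowed 𝓕 n p)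

theorem stdOracle_nil (𝓕 : FunSpace) (n : ℕ) (kg : Data → PMF Data) :
    stdOracle 𝓕 n kg .nil = keyOracle kg (· ∈ 𝓕.desc n) := by
  rw [stdOracle]
  congr 1
  funext f
  simp [Allowed]

theorem stdOracle_bounded {𝓕 : FunSpace} {n : ℕ} {kg : Data → PMF Data} {L : ℕ}
    (h : ∀ f ∈ 𝓕.desc n, ∀ a ∈ (kg f).support, a.size ≤ L) (p : Data) :
    (stdOracle 𝓕 n kg p).Bounded := keyOracle_bounded fun f hf => h f hf.1

open scoped Classical in
/-- The key generation oracle without a record of the queries. -/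
def bareOracle (kg : Data → PMF Data) (ok : Data → Prop) : Oracle Unit := fun _ f =>
  if ok f then (kg f).map fun sk => (sk, ()) else PMF.pure (.nil, ())

theorem keyOracle_map (kg : Data → PMF Data) (ok : Data → Prop) (l : List Data) (f : Data) :
    (keyOracle kg ok l f).map (fun r => (r.1, ())) = bareOracle kg ok () f := by
  unfold keyOracle bareOracle
  split_ifs
  · rw [PMF.map_comp]; rfl
  · exact PMF.pure_map _ _

theorem bareOracle_bounded {kg : Data → PMF Data} {ok : Data → Prop}
    (h : (keyOracle kg ok).Bounded) : (bareOracle kg ok).Bounded := by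
  obtain ⟨L, hL⟩ := h
  refine ⟨L, fun s f a ha => ?_⟩
  rw [← keyOracle_map kg ok []] at ha
  obtain ⟨x, hx, rfl⟩ := (PMF.mem_support_map_iff _ _ _).1 ha
  exact hL _ _ x hx

/-- The record of earlier queries does not matter. -/
theorem exec_keyOracle_bind {kg : Data → PMF Data} {ok : Data → Prop}
    (h : (keyOracle kg ok).Bounded) (M : QPT) (c : Data) (v : Ket) (l l' : List Data) {β : Type}
    (k : Data → Ket → PMF β) :
    (M.exec (keyOracle kg ok) c v l).bind (fun r => k r.1 r.2.1)
      = (M.exec (keyOracle kg ok) c v l').bind fun r => k r.1 r.2.1 := by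
  have := fun l => M.exec_map h (bareOracle_bounded h) (φ := fun _ => ())
    (fun s q => keyOracle_map kg ok s q) c v l
  have key := fun l => congrArg (fun p : PMF (Data × Ket × Unit) => p.bind fun r => k r.1 r.2.1) (this l)
  simp only [PMF.bind_map] at key
  exact (key l).trans (key l').symm

/-- Two rearrangements are made. The data `D` of the ciphertext are independent of the first phase
and can be drawn at the beginning. The list of queries is not reset between the phases, which is
harmless because it is inspected after the first phase only and never influences an answer. -/
theorem utDist_eq_core {S : UTSKFE} {𝒜 : UTAdversary} {b : Bool} {n : ℕ} {pub : Data}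
    {kg : Data → PMF Data} {L : ℕ} (h : ∀ f ∈ S.funs.desc n, ∀ a ∈ (kg f).support, a.size ≤ L)
    (D : PMF (Data × Data)) :
    utDist (S.msgs n) (S.funs.desc n) (S.funs.eval n) pub kg (fun m => D.bind fun x =>
        (S.enc n x.1 m).map fun e => (.pair e.1 x.2, e.2)) 𝒜 n b
      = D.bind fun x => core S 𝒜 b n pub x.1 x.2 (stdOracle S.funs n kg) id [] := by
  unfold utDist core
  rw [PMF.bind_comm, stdOracle_nil]
  refine pmf_bind_congr fun r₁ _ => ?_
  have e0 : (r₁.1.fst ∈ S.msgs n ∧ r₁.1.snd.fst ∈ S.msgs n ∧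
    ∀ f ∈ r₁.2.2, S.funs.eval n f r₁.1.fst = S.funs.eval n f r₁.1.snd.fst) =
      Fair S n r₁.1 (id r₁.2.2) := rfl
  by_cases hf : Fair S n r₁.1 (id r₁.2.2)
  · rw [if_pos (e0 ▸ hf), PMF.bind_bind]
    refine pmf_bind_congr fun x _ => ?_
    rw [if_pos hf, PMF.bind_map]
    refine pmf_bind_congr fun e _ => ?_
    simp only [Function.comp_apply]
    have h1 : (keyOracle kg (· ∈ S.funs.desc n)).Bounded := keyOracle_bounded h
    have h2 := stdOracle_bounded h (.pair r₁.1.fst r₁.1.snd.fst)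
    have e1 := fun (st : Data) (l : List Data) => exec_keyOracle_bind h1 𝒜.B (.pair (unary n) st) vacuum
      l [] fun o _ => PMF.pure (decide (o = bit true))
    have e2 := exec_keyOracle_bind h2 𝒜.A₂ (.pair (unary n) (.pair (.pair e.1 x.2) r₁.1.snd.snd))
      (tensor r₁.2.1 e.2) r₁.2.2 [] fun st _ =>
        (𝒜.B.exec (keyOracle kg (· ∈ S.funs.desc n)) (.pair (unary n) st) vacuum []).bind fun r₃ =>
          PMF.pure (decide (r₃.1 = bit true))
    refine Eq.trans e2.symm ?_
    refine pmf_bind_congr fun r₂ _ => ?_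
    exact (e1 r₂.1 r₂.2.2).symm
  · rw [if_neg (e0 ▸ hf)]
    simp only [if_neg hf, PMF.bind_const]

/-! ## The experiments of the building blocks -/

/-- The outcomes have bounded size. -/
def SizeBounded (p : PMF Data) : Prop := ∃ L, ∀ a ∈ p.support, a.size ≤ L

theorem SizeBounded.uniform {X : Finset Data} {p : Data → PMF Data}
    (h : ∀ f ∈ X, SizeBounded (p f)) : ∃ L, ∀ f ∈ X, ∀ a ∈ (p f).support, a.size ≤ L := by
  choose! L hL using h
  exact ⟨X.sup L, fun f hf a ha => (hL f hf a ha).trans (Finset.le_sup hf)⟩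

theorem IsQPT.sizeBounded {f : ℕ → Data → PMF Data} (h : IsQPT f) (n : ℕ) (x : Data) :
    SizeBounded (f n x) := by
  obtain ⟨p, hp⟩ := h.size_le
  exact ⟨_, hp n x⟩

theorem PMF.sizeBounded_map {α : Type} [Finite α] (p : PMF α) (f : α → Data) :
    SizeBounded (p.map f) := by
  cases nonempty_fintype α
  refine ⟨Finset.univ.sup fun a => (f a).size, fun a ha => ?_⟩
  obtain ⟨x, _, rfl⟩ := (PMF.mem_support_map_iff _ _ _).1 ha
  exact Finset.le_sup (f := fun a => (f a).size) (Finset.mem_univ x)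

theorem funOracle_bounded {m : ℕ} (X : Finset Data) (f : X → (Fin m → Bool)) :
    (funOracle X f).Bounded := by
  refine ⟨max 1 (Finset.univ.sup fun x => (word (f x)).size), fun s q a ha => ?_⟩
  change a ∈ (PMF.pure _).support at ha
  rw [PMF.support_pure, Set.mem_singleton_iff] at ha
  rw [ha]
  dsimp only
  split_ifs with h
  · exact le_max_of_le_right (Finset.le_sup (f := fun x => (word (f x)).size) (Finset.mem_univ _))
  · exact le_max_left _ _

theorem SKE.lrOracle_bounded {E : SKE} (hE : E.Efficient) (n : ℕ) (sk : Data) (b : Bool) :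
    (E.lrOracle n sk b).Bounded := by
  obtain ⟨-, -, h, -⟩ := hE
  obtain ⟨L, hL⟩ := SizeBounded.uniform (X := E.msgs n) (p := E.enc n sk)
    fun m _ => h.sizeBounded n (.pair sk m)
  refine ⟨max L 1, fun s q a ha => ?_⟩
  unfold SKE.lrOracle at ha
  by_cases hq : q.fst ∈ E.msgs n ∧ q.snd ∈ E.msgs n
  · rw [if_pos hq] at ha
    obtain ⟨x, hx, rfl⟩ := (PMF.mem_support_map_iff _ _ _).1 ha
    refine (hL _ ?_ x hx).trans (le_max_left _ _)
    cases b
    exacts [hq.1, hq.2]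
  · rw [if_neg hq] at ha
    change a ∈ (PMF.pure _).support at ha
    rw [PMF.support_pure, Set.mem_singleton_iff] at ha
    rw [ha]
    exact le_max_right _ _

theorem PKFE.keyGen_bounded {P : PKFE} (hP : P.Efficient) (n : ℕ) (msk : Data) :
    ∃ L, ∀ f ∈ P.funs.desc n, ∀ a ∈ (P.keyGen n msk f).support, a.size ≤ L :=
  SizeBounded.uniform fun f _ => hP.2.2.2.1.sizeBounded n (.pair msk f)

theorem UTSKFE.sampleKey_bounded (S : UTSKFE) (n : ℕ) (msk : Data) (X : Finset Data) :
    ∃ L, ∀ f ∈ X, ∀ a ∈ (S.sampleKey n msk f).support, a.size ≤ L :=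
  SizeBounded.uniform fun _ _ => PMF.sizeBounded_map _ _

theorem PRF.prOne_game {X : ℕ → Finset Data} {ℓ : ℕ → ℕ} (F : PRF X ℓ) (A : QPT) (n : ℕ) (b : Bool) :
    prOne (F.game A n b) = (((F.key n).bind fun k =>
      (PMF.uniformOfFintype (X n → (Fin (ℓ n) → Bool))).bind fun f =>
        (A.exec (funOracle (X n) (if b then f else fun x => F.eval n k x)) (unary n) vacuum ()).map
          fun r => decide (r.1 = bit true)) true).toReal := by
  refine LimOne.prOne_eq ?_
  refine LimOne.bind (Lim.liftM _) fun k => LimOne.bind (Lim.liftM _) fun f =>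
    LimOne.bind (Lim.run _ ?_ _ _ _) ?_
  · exact funOracle_bounded _ _
  · rintro ⟨o, _⟩
    exact LimOne.pure _

theorem SKE.prOne_game (E : SKE) (hE : E.Efficient) (A : QPT) (n : ℕ) (b : Bool) :
    prOne (E.game A n b) = (((E.gen n).bind fun sk =>
        (A.exec (E.lrOracle n sk b) (unary n) vacuum ()).map
          fun r => decide (r.1 = bit true)) true).toReal := by
  refine LimOne.prOne_eq ?_
  refine LimOne.bind (Lim.liftM _) fun k => LimOne.bind (Lim.run _ ?_ _ _ _) ?_
  · exact E.lrOracle_bounded hE _ _ _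
  · rintro ⟨o, _⟩
    exact LimOne.pure _

open scoped Classical in
theorem PKFE.prOne_game (P : PKFE) (hP : P.Efficient) (𝒜 : FEAdversary) (n : ℕ) (b : Bool) :
    prOne (P.game 𝒜 n b) = (((P.setup n).bind fun kk =>
      (𝒜.A₁.exec (keyOracle (P.keyGen n kk.2) (· ∈ P.funs.desc n)) (.pair (unary n) kk.1) vacuum []).bind
        fun r₁ => if r₁.1.fst ∈ P.msgs n ∧ r₁.1.snd.fst ∈ P.msgs n ∧
          ∀ f ∈ r₁.2.2, P.funs.eval n f r₁.1.fst = P.funs.eval n f r₁.1.snd.fst then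
          (P.enc n kk.1 (if b then r₁.1.snd.fst else r₁.1.fst)).bind fun ct =>
          (𝒜.A₂.exec (keyOracle (P.keyGen n kk.2) fun f => f ∈ P.funs.desc n ∧
              P.funs.eval n f r₁.1.fst = P.funs.eval n f r₁.1.snd.fst)
            (.pair (unary n) (.pair ct r₁.1.snd.snd)) r₁.2.1 []).map fun r => decide (r.1 = bit true)
        else PMF.pure false) true).toReal := by
  refine LimOne.prOne_eq (LimOne.bind (Lim.liftM _) ?_)
  rintro ⟨pk, msk⟩
  obtain ⟨L, hL⟩ := P.keyGen_bounded hP n msk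
  refine LimOne.bind (Lim.run _ (keyOracle_bounded hL) _ _ _) ?_
  rintro ⟨out, v, fs⟩
  refine LimOne.guard (LimOne.bind (Lim.liftM _) fun ct => ?_)
  refine LimOne.bind (Lim.run _ (keyOracle_bounded fun f hf => hL f hf.1) _ _ _) ?_
  rintro ⟨o, _⟩
  exact LimOne.pure _

theorem UTSKFE.prOne_game (S : UTSKFE) (𝒜 : UTAdversary) (n : ℕ) (b : Bool) :
    prOne (S.game 𝒜 n b) = (((S.setup n).bind fun msk => utDist (S.msgs n) (S.funs.desc n)
      (S.funs.eval n) .nil (S.sampleKey n msk) (S.enc n msk) 𝒜 n b) true).toReal := by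
  refine LimOne.prOne_eq (LimOne.bind (Lim.liftM _) fun msk => ?_)
  obtain ⟨L, hL⟩ := S.sampleKey_bounded n msk (S.funs.desc n)
  exact limOne_utExperiment hL

/-! ## The experiment of the construction -/

section
variable {P : PKFE} {S : UTSKFE} {E : SKE} {F : PRF S.funs.desc S.coins} {zero : ℕ → Data}
  {G : ℕ → Data → Data → Data}

theorem keyGen_utpkfe_sizeBounded (hP : P.Efficient) (hE : E.Efficient)
    (hG : PolyFun fun n x => G n x.fst x.snd) (n : ℕ) (x y : Data) (m : Data → Data) (f : Data) :
    SizeBounded ((E.enc n x (m f)).bind fun ct => P.keyGen n y (G n ct f)) := by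
  obtain ⟨L, hL⟩ := hE.2.2.1.sizeBounded n (.pair x (m f))
  obtain ⟨pG, hpG⟩ := hG.size_le
  obtain ⟨pk, hpk⟩ := hP.2.2.2.1.size_le
  refine ⟨pk.eval (n + y.size + pG.eval (n + L + f.size + 1) + 1), fun a ha => ?_⟩
  obtain ⟨ct, hct, ha⟩ := (PMF.mem_support_bind_iff _ _ _).1 ha
  refine (hpk n (.pair y (G n ct f)) a ha).trans (polyEval_mono pk ?_)
  have h1 := hL ct hct
  have h2 := (hpG n (.pair ct f)).trans (polyEval_mono pG (b := n + L + f.size + 1)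
    (by rw [size_pair]; omega))
  rw [fst_pair, snd_pair] at h2
  rw [size_pair]
  omega

/-- The experiment of the construction if the keys `k` and `sk` lead to the function keys `kg`. -/
theorem utpkfe_prOne_game (hP : P.Efficient) (hE : E.Efficient)
    (hG : PolyFun fun n x => G n x.fst x.snd) (𝒜 : UTAdversary) (n : ℕ) (b : Bool) :
    prOne ((utpkfe P S E F zero G).game 𝒜 n b) = (((P.setup n).bind fun kk => (E.gen n).bind fun sk =>
      (S.setup n).bind fun msk => (F.key n).bind fun k =>
        (P.enc n kk.1 (plaintext false msk k .nil)).bind fun ctP =>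
          core S 𝒜 b n kk.1 msk ctP (stdOracle S.funs n fun f =>
            (E.enc n sk (zero n)).bind fun ct => P.keyGen n kk.2 (G n ct f)) id []) true).toReal := by
  let D := fun pk => (S.setup n).bind fun msk => (F.key n).bind fun k =>
    (P.enc n pk (plaintext false msk k .nil)).bind fun ctP => PMF.pure (msk, ctP)
  have key : ∀ pk msk : Data, LimOne (utExperiment (S.msgs n) (S.funs.desc n) (S.funs.eval n) pk
      ((utpkfe P S E F zero G).keyGen n msk) ((utpkfe P S E F zero G).enc n pk) 𝒜 n b)
      ((D pk).bind fun x => core S 𝒜 b n pk x.1 x.2 (stdOracle S.funs n fun f =>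
        (E.enc n msk.snd (zero n)).bind fun ct => P.keyGen n msk.fst (G n ct f)) id []) := by
    intro pk msk
    obtain ⟨L, hL⟩ := SizeBounded.uniform (X := S.funs.desc n) fun f _ =>
      keyGen_utpkfe_sizeBounded hP hE hG n msk.snd msk.fst (fun _ => zero n) f
    rw [← utDist_eq_core hL]
    have he : (utpkfe P S E F zero G).enc n pk = fun m => (D pk).bind fun x =>
        (S.enc n x.1 m).map fun e => (Data.pair e.1 x.2, e.2) := by
      funext m
      change ((S.setup n).bind fun msk => (F.key n).bind fun k => (S.enc n msk m).bind fun e =>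
        (P.enc n pk (plaintext false msk k .nil)).bind fun ctP =>
          PMF.pure (Data.pair e.1 ctP, e.2)) = _
      simp only [D, PMF.bind_bind, PMF.pure_bind]
      refine pmf_bind_congr fun msk _ => pmf_bind_congr fun k _ => ?_
      rw [PMF.bind_comm]
      rfl
    rw [he]
    exact limOne_utExperiment hL
  have h : LimOne (fun t => (utpkfe P S E F zero G).game 𝒜 n b t)
      (((utpkfe P S E F zero G).setup n).bind fun y => (D y.1).bind fun x =>
        core S 𝒜 b n y.1 x.1 x.2 (stdOracle S.funs n fun f =>
          (E.enc n y.2.snd (zero n)).bind fun ct => P.keyGen n y.2.fst (G n ct f)) id []) := by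
    refine LimOne.bind (Lim.liftM _) ?_
    rintro ⟨pk, msk⟩
    exact key pk msk
  rw [h.prOne_eq]
  have hs : (utpkfe P S E F zero G).setup n = (P.setup n).bind fun kk => (E.gen n).bind fun sk =>
    PMF.pure (kk.1, Data.pair kk.2 sk) := rfl
  rw [hs]
  simp only [D, PMF.bind_bind, PMF.pure_bind, fst_pair, snd_pair]

end

end
end UTFE
namespace UTFE
noncomputable section
open Data

/-! ## Statistical distance -/

/-- No event is more likely under `p` than under `q` by more than `ε`. -/
def Near (ε : ℝ≥0∞) {α : Type} (p q : PMF α) : Prop :=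
  ∀ f : α → ℝ≥0∞, (∀ a, f a ≤ 1) → ∑' a, p a * f a ≤ (∑' a, q a * f a) + ε

theorem tsum_bind_mul {α β : Type} (p : PMF α) (f : α → PMF β) (h : β → ℝ≥0∞) :
    ∑' b, (p.bind f) b * h b = ∑' a, p a * ∑' b, f a b * h b := by
  simp only [PMF.bind_apply, ← ENNReal.tsum_mul_right, ← ENNReal.tsum_mul_left]
  rw [ENNReal.tsum_comm]
  simp only [mul_assoc]

theorem tsum_mul_le_one {α : Type} (p : PMF α) {f : α → ℝ≥0∞} (hf : ∀ a, f a ≤ 1) :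
    ∑' a, p a * f a ≤ 1 :=
  (ENNReal.tsum_le_tsum fun a => mul_le_of_le_one_right' (hf a)).trans p.tsum_coe.le

theorem Near.refl {α : Type} (p : PMF α) : Near 0 p p := fun _ _ => le_self_add

theorem Near.mono {ε δ : ℝ≥0∞} (h : ε ≤ δ) {α : Type} {p q : PMF α} (hp : Near ε p q) :
    Near δ p q := fun f hf => (hp f hf).trans (by gcongr)

theorem Near.bind {ε δ : ℝ≥0∞} {α β : Type} {p q : PMF α} {f g : α → PMF β} (h : Near ε p q)
    (hf : ∀ a ∈ p.support, Near δ (f a) (g a)) : Near (ε + δ) (p.bind f) (q.bind g) := by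
  intro u hu
  rw [tsum_bind_mul, tsum_bind_mul]
  calc ∑' a, p a * ∑' b, f a b * u b
      ≤ ∑' a, (p a * (∑' b, g a b * u b) + p a * δ) := by
        refine ENNReal.tsum_le_tsum fun a => ?_
        by_cases ha : p a = 0
        · simp [ha]
        · rw [← mul_add]
          gcongr
          exact hf a ((PMF.mem_support_iff _ _).2 ha) u hu
    _ = (∑' a, p a * ∑' b, g a b * u b) + δ := by
        rw [ENNReal.tsum_add, ENNReal.tsum_mul_right, p.tsum_coe, one_mul]
    _ ≤ ((∑' a, q a * ∑' b, g a b * u b) + ε) + δ := by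
        gcongr
        exact h _ fun a => tsum_mul_le_one _ hu
    _ = _ := by rw [add_assoc]

theorem Near.bind_right {δ : ℝ≥0∞} {α β : Type} {p : PMF α} {f g : α → PMF β}
    (hf : ∀ a ∈ p.support, Near δ (f a) (g a)) : Near δ (p.bind f) (p.bind g) := by
  simpa using (Near.refl p).bind hf

theorem Near.map {ε : ℝ≥0∞} {α β : Type} {p q : PMF α} (h : Near ε p q) (f : α → β) :
    Near ε (p.map f) (q.map f) := by
  have := h.bind (f := fun a => PMF.pure (f a)) fun a _ => Near.refl _
  rwa [add_zero] at this

theorem Near.apply_le {ε : ℝ≥0∞} {p q : PMF Bool} (h : Near ε p q) : p true ≤ q true + ε := by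
  simpa using h (fun b => if b then 1 else 0) fun b => by cases b <;> simp

/-- Replacing a distribution by a fixed one outside of an event. -/
theorem near_ite {α β : Type} (p : PMF α) (P : α → Prop) [DecidablePred P] (f g : α → PMF β) :
    Near (p.toOuterMeasure {a | ¬ P a}) (p.bind f) (p.bind fun a => if P a then f a else g a) := by
  intro u hu
  rw [tsum_bind_mul, tsum_bind_mul, PMF.toOuterMeasure_apply, ← ENNReal.tsum_add]
  refine ENNReal.tsum_le_tsum fun a => ?_
  by_cases h : P a
  · simp [h]
  · simp only [h, if_false, Set.indicator, Set.mem_ofPred_eq, not_false_eq_true, if_true]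
    exact (mul_le_of_le_one_right' (tsum_mul_le_one _ hu)).trans le_add_self

theorem near_ite' {α β : Type} (p : PMF α) (P : α → Prop) [DecidablePred P] (f g : α → PMF β) :
    Near (p.toOuterMeasure {a | ¬ P a}) (p.bind fun a => if P a then f a else g a) (p.bind f) := by
  intro u hu
  rw [tsum_bind_mul, tsum_bind_mul, PMF.toOuterMeasure_apply, ← ENNReal.tsum_add]
  refine ENNReal.tsum_le_tsum fun a => ?_
  by_cases h : P a
  · simp [h]
  · simp only [h, if_false, Set.indicator, Set.mem_ofPred_eq, not_false_eq_true, if_true]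
    exact (mul_le_of_le_one_right' (tsum_mul_le_one _ hu)).trans le_add_self

/-- A hybrid argument over time: each step makes at most one query and loses at most `δ` there;
everything else is the same in both executions. -/
theorem QPT.near_exec {σ : Type} (M : QPT) {O O' : Oracle σ} {L S N : ℕ} {δ : ℝ≥0∞}
    (hO : O.BoundedBy L) (hO' : O'.BoundedBy L) (h : ∀ s q, Near δ (O s q) (O' s q)) {c : Data}
    (hc : Term M.step L S N c) (v : Ket) (s : σ) :
    Near (N * δ) (M.exec O c v s) (M.exec O' c v s) := by
  induction N generalizing c v s with
  | zero => exact hc.elim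
  | succ N ih =>
    have ih' := fun c' hc' v s => ih (hc.2 c' hc') v s
    have hle : (N : ℝ≥0∞) * δ ≤ (N + 1 : ℕ) * δ := by gcongr; omega
    rw [M.exec_step ⟨L, hO⟩, M.exec_step ⟨L, hO'⟩]
    revert ih'
    cases M.step c with
    | halt out => exact fun _ => (Near.refl _).mono zero_le
    | hadamard a c => exact fun ih' => (ih' _ (.hadamard a c) _ _).mono hle
    | tGate a c => exact fun ih' => (ih' _ (.tGate a c) _ _).mono hle
    | cnot a b c => exact fun ih' => (ih' _ (.cnot a b c) _ _).mono hle
    | measure a c =>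
      exact fun ih' => (Near.bind_right fun r _ => ih' _ (.measure a c r.1) _ _).mono hle
    | query q c =>
      intro ih'
      refine ((h s q).bind fun r hr => ih' _ (.query q c r.1 (hO s q r hr)) _ _).mono ?_
      rw [Nat.cast_succ, add_mul, one_mul, add_comm]

theorem near_keyOracle {kg kg' : Data → PMF Data} {ok : Data → Prop} {δ : ℝ≥0∞}
    (h : ∀ f, ok f → Near δ (kg f) (kg' f)) (s : List Data) (f : Data) :
    Near δ (keyOracle kg ok s f) (keyOracle kg' ok s f) := by
  unfold keyOracle
  split_ifs with hf
  · exact (h f hf).map _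
  · exact (Near.refl _).mono zero_le

theorem stdOracle_boundedBy {𝓕 : FunSpace} {n : ℕ} {kg : Data → PMF Data} {L : ℕ} (hL : 1 ≤ L)
    (h : ∀ f ∈ 𝓕.desc n, ∀ a ∈ (kg f).support, a.size ≤ L) (p : Data) :
    (stdOracle 𝓕 n kg p).BoundedBy L := by
  intro s f a ha
  unfold stdOracle keyOracle at ha
  split_ifs at ha with hf
  · obtain ⟨x, hx, rfl⟩ := (PMF.mem_support_map_iff _ _ _).1 ha
    exact h f hf.1 x hx
  · change a ∈ (PMF.pure _).support at ha
    rw [PMF.support_pure, Set.mem_singleton_iff] at ha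
    rw [ha]
    exact hL

/-- If single keys are close, so are the experiments. -/
theorem exists_near_core {S : UTSKFE} (hS : S.Efficient) (𝒜 : UTAdversary) (b : Bool) :
    ∃ p : Polynomial ℕ, ∀ (n L : ℕ) (pub msk ctP : Data) (kg kg' : Data → PMF Data) (δ : ℝ≥0∞),
      n ≤ L → pub.size ≤ L → msk.size ≤ L → ctP.size ≤ L →
      (∀ f ∈ S.funs.desc n, ∀ a ∈ (kg f).support, a.size ≤ L) →
      (∀ f ∈ S.funs.desc n, ∀ a ∈ (kg' f).support, a.size ≤ L) →
      (∀ f ∈ S.funs.desc n, Near δ (kg f) (kg' f)) →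
      Near ((p.eval L : ℕ) * δ) (core S 𝒜 b n pub msk ctP (stdOracle S.funs n kg) id [])
        (core S 𝒜 b n pub msk ctP (stdOracle S.funs n kg') id []) := by
  obtain ⟨pE, hE⟩ := hS.2.2.2.2.2.2.1.size_le
  obtain ⟨p₁, h₁⟩ := 𝒜.A₁.exists_bound
  obtain ⟨p₂, h₂⟩ := 𝒜.A₂.exists_bound
  obtain ⟨p₃, h₃⟩ := 𝒜.B.exists_bound
  -- `ℓ₁`, `ℓ₂`, `ℓ₃` bound the inputs of the three machines, and `o₁`, `o₂` the steps and outputs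
  -- of the first two, which enter the inputs of the next. The loss is the total number of steps
  -- times `δ`.
  let ℓ₁ : Polynomial ℕ := 3 * Polynomial.X + 5
  let o₁ : Polynomial ℕ := p₁.comp ℓ₁
  let ℓ₂ : Polynomial ℕ := 3 * Polynomial.X + 5 + pE.comp (2 * Polynomial.X + o₁ + 1) + o₁
  let o₂ : Polynomial ℕ := p₂.comp ℓ₂
  let ℓ₃ : Polynomial ℕ := 3 * Polynomial.X + 5 + o₂
  refine ⟨o₁ + o₂ + p₃.comp ℓ₃, fun n L pub msk ctP kg kg' δ hn hpub hmsk hctP hkg hkg' hk => ?_⟩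
  have e1 : ℓ₁.eval L = 3 * L + 5 := by simp [ℓ₁]
  have e2 : ℓ₂.eval L = 3 * L + 5 + pE.eval (2 * L + o₁.eval L + 1) + o₁.eval L := by simp [ℓ₂]
  have e3 : ℓ₃.eval L = 3 * L + 5 + o₂.eval L := by simp [ℓ₃]
  have f1 : o₁.eval L = p₁.eval (ℓ₁.eval L) := by simp [o₁]
  have f2 : o₂.eval L = p₂.eval (ℓ₂.eval L) := by simp [o₂]
  have hO := fun p ℓ (h : L + 1 ≤ ℓ) => stdOracle_boundedBy (𝓕 := S.funs) (L := ℓ) (by omega)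
    (fun f hf a ha => (hkg f hf a ha).trans (by omega)) p
  have hO' := fun p ℓ (h : L + 1 ≤ ℓ) => stdOracle_boundedBy (𝓕 := S.funs) (L := ℓ) (by omega)
    (fun f hf a ha => (hkg' f hf a ha).trans (by omega)) p
  have hN := fun p => near_keyOracle (ok := Allowed S.funs n p) fun f hf => hk f hf.1
  have b1 := h₁ (ℓ₁.eval L) (.pair (unary n) pub) (by rw [e1, size_pair, size_unary]; omega)
  rw [← f1] at b1
  have hev : (((o₁ + o₂ + p₃.comp ℓ₃).eval L : ℕ) : ℝ≥0∞) * δ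
      = (o₁.eval L : ℕ) * δ + ((o₂.eval L : ℕ) * δ + (p₃.eval (ℓ₃.eval L) : ℕ) * δ) := by
    simp only [Polynomial.eval_add, Polynomial.eval_comp]
    push_cast
    ring
  rw [hev]
  unfold core
  refine (𝒜.A₁.near_exec (hO .nil _ (by omega)) (hO' .nil _ (by omega)) (hN .nil) b1.1 vacuum []).bind
    fun r₁ hr₁ => ?_
  have hr₁ := b1.2 (hO .nil _ (by omega)) _ _ r₁ hr₁
  have i1 := Data.size_fst_le r₁.1
  have i2 := Data.size_snd_le r₁.1
  have i3 := Data.size_fst_le r₁.1.snd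
  have i4 := Data.size_snd_le r₁.1.snd
  by_cases hf : Fair S n r₁.1 (id r₁.2.2)
  swap
  · rw [if_neg hf, if_neg hf]
    exact (Near.refl _).mono zero_le
  rw [if_pos hf, if_pos hf]
  refine Near.bind_right fun e he => ?_
  have he := (hE n (.pair msk _) e (by simpa only [fst_pair, snd_pair] using he)).trans
    (polyEval_mono pE (b := 2 * L + o₁.eval L + 1) (by
      rw [size_pair]; cases b <;> simp only [Bool.false_eq_true, if_true, if_false] <;> omega))
  have b2 := h₂ (ℓ₂.eval L) (.pair (unary n) (.pair (.pair e.1 ctP) r₁.1.snd.snd)) (by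
    rw [e2, size_pair, size_pair, size_pair, size_unary]; omega)
  rw [← f2] at b2
  refine (𝒜.A₂.near_exec (hO _ _ (by omega)) (hO' _ _ (by omega)) (hN _) b2.1 _ _).bind
    fun r₂ hr₂ => ?_
  have hr₂ := b2.2 (hO _ _ (by omega)) _ _ r₂ hr₂
  have b3 := h₃ (ℓ₃.eval L) (.pair (unary n) r₂.1) (by rw [e3, size_pair, size_unary]; omega)
  exact (𝒜.B.near_exec (hO _ _ (by omega)) (hO' _ _ (by omega)) (hN _) b3.1 _ _).map _

end
end UTFE
namespace UTFE
noncomputable section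
open Data

/-! ## Lazy sampling of random functions -/

section
variable {ξ ζ : Type} [DecidableEq ξ] [Fintype ξ] [Fintype ζ] [Nonempty ζ]

theorem uniformOfFintype_bind_apply {α β : Type} [Fintype α] [Nonempty α] (F : α → PMF β) (b : β) :
    ((PMF.uniformOfFintype α).bind F) b = (Fintype.card α : ℝ≥0∞)⁻¹ * ∑ a, F a b := by
  rw [PMF.bind_apply, tsum_fintype, Finset.mul_sum]
  simp only [PMF.uniformOfFintype_apply]

/-- One value of a random function can be sampled again. -/
theorem uniformOfFintype_bind_update {β : Type} (F : (ξ → ζ) → PMF β) (x : ξ) :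
    (PMF.uniformOfFintype (ξ → ζ)).bind F = (PMF.uniformOfFintype ζ).bind fun r =>
      (PMF.uniformOfFintype (ξ → ζ)).bind fun R => F (Function.update R x r) := by
  ext b
  rw [uniformOfFintype_bind_apply, uniformOfFintype_bind_apply]
  simp only [uniformOfFintype_bind_apply]
  rw [← Finset.mul_sum, mul_left_comm]
  congr 1
  -- The involution exchanges the fresh value with the old value of the function at `x`. It
  -- preserves the uniform distribution on pairs.
  let e : ζ × (ξ → ζ) → ζ × (ξ → ζ) := fun y => (y.2 x, Function.update y.2 x y.1)
  have he : Function.Involutive e := fun y => by simp [e]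
  have h : ∑ y : ζ × (ξ → ζ), F (Function.update y.2 x y.1) b = ∑ y : ζ × (ξ → ζ), F y.2 b :=
    Fintype.sum_equiv he.toPerm _ _ fun y => rfl
  rw [Fintype.sum_prod_type, Fintype.sum_prod_type] at h
  refine Eq.symm ((congrArg _ h).trans ?_)
  simp only []
  rw [Finset.sum_const, nsmul_eq_mul, ← mul_assoc, Finset.card_univ, ENNReal.inv_mul_cancel, one_mul]
  · simp
  · simp

end

section
variable {X : Finset Data} {ζ : Type} (ok : Data → Prop) (kk : X → ζ → PMF Data)

open scoped Classical in
/-- Key queries that are answered with the coins given by a function. The queries and their coins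
are recorded. -/
def tableOracle (R : X → ζ) : Oracle (List (X × ζ)) := fun s q =>
  if h : q ∈ X ∧ ok q then (kk ⟨q, h.1⟩ (R ⟨q, h.1⟩)).map fun a =>
    (a, (⟨q, h.1⟩, R ⟨q, h.1⟩) :: s)
  else PMF.pure (.nil, s)

/-- The coins that have been used for `x`, or else fresh ones. -/
def drawCoins [Fintype ζ] [Nonempty ζ] (s : List (X × ζ)) (x : X) : PMF ζ :=
  (s.lookup x).elim (PMF.uniformOfFintype ζ) PMF.pure

open scoped Classical in
/-- Key queries that are answered with coins that are sampled when they are needed. -/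
def lazyOracle [Fintype ζ] [Nonempty ζ] : Oracle (List (X × ζ)) := fun s q =>
  if h : q ∈ X ∧ ok q then (drawCoins s ⟨q, h.1⟩).bind fun r => (kk ⟨q, h.1⟩ r).map fun a =>
    (a, (⟨q, h.1⟩, r) :: s)
  else PMF.pure (.nil, s)

/-- The function `R` with the recorded values. -/
def complete (R : X → ζ) (s : List (X × ζ)) (x : X) : ζ := (s.lookup x).getD (R x)

theorem complete_nil (R : X → ζ) : complete R [] = R := rfl

theorem complete_cons_self (R : X → ζ) (s : List (X × ζ)) (x : X) :
    complete R ((x, complete R s x) :: s) = complete R s := by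
  funext y
  unfold complete
  rw [List.lookup_cons]
  by_cases h : y = x
  · subst h; simp
  · have : (y == x) = false := by simpa using h
    rw [this]

theorem complete_update [DecidableEq X] (R : X → ζ) (s : List (X × ζ)) {x : X}
    (hs : s.lookup x = none) (r : ζ) :
    complete (Function.update R x r) s = complete R ((x, r) :: s) := by
  funext y
  unfold complete
  rw [List.lookup_cons]
  by_cases h : y = x
  · subst h; simp [hs]
  · have : (y == x) = false := by simpa using h
    rw [this, Function.update_of_ne h]

variable [Fintype ζ] {ok} {kk}

theorem exists_coins_bound (h : ∀ x r, SizeBounded (kk x r)) :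
    ∃ L, 1 ≤ L ∧ ∀ x r, ∀ a ∈ (kk x r).support, a.size ≤ L := by
  choose L hL using h
  refine ⟨max 1 (Finset.univ.sup fun y : X × ζ => L y.1 y.2), le_max_left _ _,
    fun x r a ha => le_max_of_le_right ?_⟩
  exact (hL x r a ha).trans (Finset.le_sup (f := fun y : X × ζ => L y.1 y.2) (Finset.mem_univ (x, r)))

theorem tableOracle_bounded (h : ∀ x r, SizeBounded (kk x r)) (R : X → ζ) :
    (tableOracle ok kk R).Bounded := by
  obtain ⟨L, h1, hL⟩ := exists_coins_bound h
  refine ⟨L, fun s q a ha => ?_⟩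
  unfold tableOracle at ha
  split_ifs at ha with hq
  · obtain ⟨x, hx, rfl⟩ := (PMF.mem_support_map_iff _ _ _).1 ha
    exact hL _ _ x hx
  · rw [PMF.support_pure, Set.mem_singleton_iff] at ha
    rw [ha]
    exact h1

/-- The functions that have been queried. -/
def queried (s : List (X × ζ)) : List Data := s.map fun e => e.1

/-- With coins given by a function, the experiment is one with a key generation algorithm. -/
theorem core_tableOracle {S : UTSKFE} {𝒜 : UTAdversary} {b : Bool} {n : ℕ} {pub msk ctP : Data}
    {kk : S.funs.desc n → ζ → PMF Data} (h : ∀ x r, SizeBounded (kk x r)) (R : S.funs.desc n → ζ)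
    {kg : Data → PMF Data} (hkg : ∀ x : S.funs.desc n, kg x = kk x (R x)) :
    core S 𝒜 b n pub msk ctP (stdOracle S.funs n kg) id []
      = core S 𝒜 b n pub msk ctP (fun p => tableOracle (Allowed S.funs n p) kk R) queried [] := by
  obtain ⟨L, h1, hL⟩ := exists_coins_bound h
  refine (core_map (φ := queried) (fun p => tableOracle_bounded h R)
    (fun p => stdOracle_bounded (L := L) (fun f hf a ha => hL ⟨f, hf⟩ (R ⟨f, hf⟩) a
      (by rwa [← hkg])) p) (fun p s q => ?_) id []).symm
  unfold tableOracle stdOracle keyOracle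
  by_cases hq : Allowed S.funs n p q
  · rw [dif_pos ⟨hq.1, hq⟩, if_pos hq, PMF.map_comp, ← hkg]
    rfl
  · rw [dif_neg fun h => hq h.2, if_neg hq]
    exact PMF.pure_map _ _

variable [Nonempty ζ]

theorem lazyOracle_bounded (h : ∀ x r, SizeBounded (kk x r)) : (lazyOracle ok kk).Bounded := by
  obtain ⟨L, h1, hL⟩ := exists_coins_bound h
  refine ⟨L, fun s q a ha => ?_⟩
  unfold lazyOracle at ha
  split_ifs at ha with hq
  · obtain ⟨r, -, ha⟩ := (PMF.mem_support_bind_iff _ _ _).1 ha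
    obtain ⟨x, hx, rfl⟩ := (PMF.mem_support_map_iff _ _ _).1 ha
    exact hL _ _ x hx
  · rw [PMF.support_pure, Set.mem_singleton_iff] at ha
    rw [ha]
    exact h1

/-- At a recorded point the value is the recorded one and adding it again changes nothing. At any
other point the value of the table can be resampled, and recording the fresh value is the same as
updating the table. -/
theorem uniform_complete_bind {β : Type} (s : List (X × ζ)) (x : X) (F : (X → ζ) → ζ → PMF β) :
    ((PMF.uniformOfFintype (X → ζ)).bind fun R => F (complete R s) (complete R s x))
      = (drawCoins s x).bind fun r => (PMF.uniformOfFintype (X → ζ)).bind fun R =>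
          F (complete R ((x, r) :: s)) r := by
  cases hs : s.lookup x with
  | some r =>
    simp only [drawCoins, hs, Option.elim, PMF.pure_bind]
    refine pmf_bind_congr fun R _ => ?_
    have h : complete R s x = r := by rw [complete, hs]; rfl
    have := complete_cons_self R s x
    rw [h] at this
    rw [this, h]
  | none =>
    simp only [drawCoins, hs, Option.elim]
    rw [uniformOfFintype_bind_update _ x]
    refine pmf_bind_congr fun r _ => pmf_bind_congr fun R _ => ?_
    rw [complete_update R s hs]
    congr 1
    simp [complete]

/-- Stated for an arbitrary record `s` and a continuation that may depend on the completed table, so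
that it passes through the induction and can be chained over the phases of the experiment: after
each phase a uniform table, completed by the new record, is still available. -/
theorem exec_lazyOracle (h : ∀ x r, SizeBounded (kk x r)) (M : QPT) (c : Data) (v : Ket)
    (s : List (X × ζ)) {β : Type} (k : Data × Ket × List (X × ζ) → (X → ζ) → PMF β) :
    ((PMF.uniformOfFintype (X → ζ)).bind fun R =>
        (M.exec (tableOracle ok kk (complete R s)) c v s).bind fun r => k r (complete R s))
      = (M.exec (lazyOracle ok kk) c v s).bind fun r =>
          (PMF.uniformOfFintype (X → ζ)).bind fun R => k r (complete R r.2.2) := by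
  obtain ⟨L, h1, hL⟩ := exists_coins_bound h
  have hT := fun R => tableOracle_bounded (ok := ok) h R
  have hZ := lazyOracle_bounded (ok := ok) h
  refine M.induction L (P := fun c => ∀ v s,
    ((PMF.uniformOfFintype (X → ζ)).bind fun R =>
        (M.exec (tableOracle ok kk (complete R s)) c v s).bind fun r => k r (complete R s))
      = (M.exec (lazyOracle ok kk) c v s).bind fun r =>
          (PMF.uniformOfFintype (X → ζ)).bind fun R => k r (complete R r.2.2)) (fun c ih v s => ?_) c v s
  rw [M.exec_step hZ]
  have e := fun R => M.exec_step (hT (complete R s)) c v s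
  simp only [e]
  clear e
  revert ih
  cases M.step c with
  | halt out => intro _; simp only [perform, PMF.pure_bind]
  | hadamard a c => exact fun ih => ih _ (.hadamard a c) _ _
  | tGate a c => exact fun ih => ih _ (.tGate a c) _ _
  | cnot a b c => exact fun ih => ih _ (.cnot a b c) _ _
  | measure a c =>
    intro ih
    simp only [perform, PMF.bind_bind]
    rw [PMF.bind_comm]
    exact pmf_bind_congr fun r _ => ih _ (.measure a c r.1) _ _
  | query q c =>
    intro ih
    simp only [perform, PMF.bind_bind]
    by_cases hq : q ∈ X ∧ ok q
    · simp only [tableOracle, lazyOracle, dif_pos hq, PMF.bind_bind, PMF.bind_map,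
        Function.comp_def]
      rw [uniform_complete_bind s ⟨q, hq.1⟩ fun R r => (kk ⟨q, hq.1⟩ r).bind fun a =>
        (M.exec (tableOracle ok kk R) (.pair a c) v ((⟨q, hq.1⟩, r) :: s)).bind fun x => k x R]
      refine pmf_bind_congr fun r _ => ?_
      rw [PMF.bind_comm]
      exact pmf_bind_congr fun a ha => ih _ (.query q c a (hL _ _ a ha)) _ _
    · simp only [tableOracle, lazyOracle, dif_neg hq, PMF.pure_bind]
      exact ih _ (.query q c .nil h1) _ _

open scoped Classical in
-- `exec_lazyOracle` is applied to the three machines in turn, the table being pushed into the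
-- continuation each time. In the end nothing depends on the table and its sampling can be dropped.
theorem core_lazyOracle {S : UTSKFE} {𝒜 : UTAdversary} {b : Bool} {n : ℕ} {pub msk ctP : Data}
    (ok : Data → Data → Prop) (h : ∀ x r, SizeBounded (kk x r)) :
    ((PMF.uniformOfFintype (X → ζ)).bind fun R =>
        core S 𝒜 b n pub msk ctP (fun p => tableOracle (ok p) kk R) queried [])
      = core S 𝒜 b n pub msk ctP (fun p => lazyOracle (ok p) kk) queried [] := by
  simp only [core, PMF.map, Function.comp_def]
  have key := exec_lazyOracle (ok := ok .nil) h 𝒜.A₁ (.pair (unary n) pub) vacuum [] fun r₁ R =>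
    if Fair S n r₁.1 (queried r₁.2.2) then
      (S.enc n msk (if b then r₁.1.snd.fst else r₁.1.fst)).bind fun e =>
        (𝒜.A₂.exec (tableOracle (ok (.pair r₁.1.fst r₁.1.snd.fst)) kk R)
          (.pair (unary n) (.pair (.pair e.1 ctP) r₁.1.snd.snd)) (tensor r₁.2.1 e.2) r₁.2.2).bind
            fun r₂ => (𝒜.B.exec (tableOracle (ok .nil) kk R) (.pair (unary n) r₂.1) vacuum r₂.2.2).bind
              fun r₃ => PMF.pure (decide (r₃.1 = bit true))
    else PMF.pure false
  simp only [complete_nil] at key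
  refine key.trans ?_
  refine pmf_bind_congr fun r₁ _ => ?_
  by_cases hf : Fair S n r₁.1 (queried r₁.2.2)
  · simp only [if_pos hf]
    rw [PMF.bind_comm]
    refine pmf_bind_congr fun e _ => ?_
    refine Eq.trans (exec_lazyOracle (ok := ok (.pair r₁.1.fst r₁.1.snd.fst)) h 𝒜.A₂
      (.pair (unary n) (.pair (.pair e.1 ctP) r₁.1.snd.snd)) (tensor r₁.2.1 e.2) r₁.2.2 fun r₂ R =>
      (𝒜.B.exec (tableOracle (ok .nil) kk R) (.pair (unary n) r₂.1) vacuum r₂.2.2).bind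
        fun r₃ => PMF.pure (decide (r₃.1 = bit true))) ?_
    refine pmf_bind_congr fun r₂ _ => ?_
    refine (exec_lazyOracle (ok := ok .nil) h 𝒜.B (.pair (unary n) r₂.1) vacuum r₂.2.2
      fun r₃ _ => PMF.pure (decide (r₃.1 = bit true))).trans ?_
    simp only [PMF.bind_const]
  · simp only [if_neg hf, PMF.bind_const]

end

end
end UTFE
namespace UTFE
noncomputable section
open Data

/-! ## Machines that start from their input -/

/-- Whether a state is the input of `Alg.machine`. -/
def isInput (z : Data) : Data := if z.snd.snd = mark then .nil else bit true

theorem PolyTime.isInput : PolyTime isInput := by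
  unfold UTFE.isInput; fun_prop

theorem isInput_isEntryTest (M : QPT) : IsEntryTest isInput M where
  polyTime := .isInput
  mkS _ := if_pos rfl
  bit _ _ := if_pos rfl
  query _ _ _ _ _ := if_pos rfl

theorem isInput_ne_nil {z : Data} (h : z.snd.snd ≠ mark) : isInput z ≠ .nil := by
  rw [isInput, if_neg h]; simp [bit]

theorem unary_snd_snd_ne_mark (n : ℕ) : (unary n).snd.snd ≠ mark := by
  rcases n with _ | _ | _ | n <;> simp [unary, mark, bit, Data.snd]

/-- The algorithm as a machine that is started on the input. -/
def Alg.machine (A : Alg) : QPT := entry isInput A.start id A.polyTime (by fun_prop) A.M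
  (isInput_isEntryTest _)

theorem Alg.machine_exec (A : Alg) {σ : Type} {O : Oracle σ} (hO : O.Bounded) {z : Data}
    (hz : z.snd.snd ≠ mark) (s : σ) :
    (A.machine.exec O z vacuum s).map (fun r => (r.1, r.2.2)) = A.run O z s := by
  rw [Alg.machine, entry_exec hO (isInput_ne_nil hz), PMF.map_comp]
  rfl

theorem Alg.machine_map (A : Alg) {σ : Type} {O : Oracle σ} (hO : O.Bounded) {z : Data}
    (hz : z.snd.snd ≠ mark) (s : σ) {β : Type} (g : Data → β) :
    (A.machine.exec O z vacuum s).map (fun r => g r.1) = (A.run O z s).map fun r => g r.1 := by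
  rw [← A.machine_exec hO hz, PMF.map_comp]
  rfl

/-- Runs `A` on a part `f x` of the input `x`, and then `B` on `(out, x)`. -/
def Alg.andThen (A : Alg) (f : Data → Data) (hf : PolyTime f) (B : Alg) : Alg := (A.pre f hf).bind B

theorem Alg.andThen_run (n : ℕ) {A : Alg} {g : ℕ → Data → PMF Data} {f : Data → Data}
    (hf : PolyTime f) {B : Alg} {σ : Type} {O : Oracle σ} (hO : O.Bounded)
    (hA : ∀ n y s, A.run O (.pair (unary n) y) s = (g n y).map fun a => (a, s))
    (x : Data) (s : σ) (hx : f x = .pair (unary n) (f x).snd) :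
    (A.andThen f hf B).run O x s = (g n (f x).snd).bind fun a => B.run O (.pair a x) s := by
  rw [Alg.andThen, Alg.bind_run _ _ hO, Alg.pre_run, hx, hA, PMF.bind_map]
  rfl

/-! ## Simulated key generation -/

theorem clip_eq {B x : Data} (h : x.size ≤ B.spine) : clip B x = x := if_pos h

/-- The bound `B` is at least as large as all honest keys and records, so cutting off has no effect
on them. Each record begins with the query, so the store carries the log of the key oracle. -/
theorem servedBy_map {𝓕 : FunSpace} {n : ℕ} {tst : Data → Data} (ht : IsAllowedTest 𝓕 tst) {H : Alg}
    {σ : Type} {O : Oracle σ} {kg : Data → PMF Data} {ρ : Data → Data} {B K p f : Data} {s : Data × σ}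
    (hH : Allowed 𝓕 n p f → (H.run O (.pair (envOf (unary n) B p K) (.pair s.1 f)) s.2).map Prod.fst
      = (kg f).map fun a => .pair a (.pair f (ρ f)))
    (hB : f ∈ 𝓕.desc n → (Data.pair f (ρ f)).size ≤ B.spine ∧ ∀ a ∈ (kg f).support, a.size ≤ B.spine) :
    (servedBy H tst (envOf (unary n) B p K) O s f).map (fun r => (r.1, logged r.2))
      = stdOracle 𝓕 n kg p (logged s) f := by
  unfold servedBy served stdOracle keyOracle
  have ht := ht n B p K f
  by_cases h : Allowed 𝓕 n p f
  · rw [if_neg (fun e => ht.1 e h), if_pos h, PMF.map_comp]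
    have hH := hH h
    rw [Alg.run, PMF.map_comp] at hH
    have := congrArg (PMF.map fun o : Data =>
      (clip B o.fst, Data.fst (clip B o.snd) :: logged s)) hH
    rw [PMF.map_comp, PMF.map_comp] at this
    refine this.trans ?_
    obtain ⟨h1, h2⟩ := hB h.1
    rw [PMF.map, PMF.map]
    refine pmf_bind_congr fun a ha => ?_
    simp only [Function.comp_apply, fst_pair, snd_pair]
    rw [clip_eq (h2 a ha), clip_eq h1, fst_pair]
  · rw [if_pos (ht.2 h), if_neg h]
    exact PMF.pure_map _ _

theorem servedBy_bounded (H : Alg) (tst : Data → Data) (e : Data) {σ : Type} (O : Oracle σ) :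
    (servedBy H tst e O).Bounded := ⟨_, served_boundedBy _ _ _ _ _⟩

/-- A simulation of the experiment. -/
theorem play_std {S : UTSKFE} (𝒜 : UTAdversary) (H : Alg) {tst : Data → Data}
    (htp : PolyTime tst) (ht : IsAllowedTest S.funs tst) {M : QPT} (b : Bool)
    (hM : ∀ n x, (M.exec silent (.pair (unary n) x) vacuum ()).map
      (fun r => (r.1, r.2.1)) = S.enc n x.fst x.snd) {gt : Data → Data} (hgt : PolyTime gt)
    (hg : IsFairTest S gt) {σ : Type} {O : Oracle σ} (hO : O.Bounded) {n : ℕ}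
    {B pub msk ctP K : Data} {kg : Data → PMF Data} (ρ : Data → Data) (hH : ∀ p f store s, Allowed S.funs n p f →
      (H.run O (.pair (fullEnv n B pub msk ctP K p) (.pair store f)) s).map Prod.fst
        = (kg f).map fun a => .pair a (.pair f (ρ f)))
    (hB : ∀ f ∈ S.funs.desc n, (Data.pair f (ρ f)).size ≤ B.spine ∧
      ∀ a ∈ (kg f).support, a.size ≤ B.spine) (s : σ) :
    ((play 𝒜 H tst htp M b gt hgt).run O (fullEnv n B pub msk ctP K .nil) s).map
        (fun r => decide (r.1 = bit true))
      = core S 𝒜 b n pub msk ctP (stdOracle S.funs n kg) id [] := by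
  rw [play_run 𝒜 H htp b hM hgt hg hO]
  exact core_map (φ := logged) (fun p => servedBy_bounded _ _ _ _)
    (fun p => stdOracle_bounded (fun f hf => (hB f hf).2) p)
    (fun p s f => servedBy_map ht (fun h => hH p f s.1 s.2 h) (hB f)) id (.nil, s)

/-! ## The hybrid experiments -/

section
variable (P : PKFE) (S : UTSKFE) (E : SKE) (F : PRF S.funs.desc S.coins) (zero : ℕ → Data)
  (G : ℕ → Data → Data → Data)

/-- A key for `f` whose circuit contains an encryption of `m`. -/
def hybridKey (n : ℕ) (mskP sk m f : Data) : PMF Data :=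
  (E.enc n sk m).bind fun ct => P.keyGen n mskP (G n ct f)

/-- The same, but the key is withheld if decryption fails. -/
def checkedKey (n : ℕ) (mskP sk m f : Data) : PMF Data :=
  (E.enc n sk m).bind fun ct => if E.dec n sk ct = m then P.keyGen n mskP (G n ct f)
    else PMF.pure .nil

/-- The function key for `f` with pseudorandom coins. -/
def prfKey (n : ℕ) (msk k f : Data) : Data := S.keyGen n msk f (F.eval n k f)

/-- The experiment in which the plain ciphertext encrypts `pt sk msk k` and the function keys are
`kg mskP sk msk k`. -/
def hybrid (𝒜 : UTAdversary) (b : Bool) (n : ℕ) (pt : Data → Data → Data → Data)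
    (kg : Data → Data → Data → Data → Data → PMF Data) : PMF Bool :=
  (P.setup n).bind fun kk => (E.gen n).bind fun sk => (S.setup n).bind fun msk =>
    (F.key n).bind fun k => (P.enc n kk.1 (pt sk msk k)).bind fun ctP =>
      core S 𝒜 b n kk.1 msk ctP (stdOracle S.funs n (kg kk.2 sk msk k)) id []

end

section
variable {P : PKFE} {S : UTSKFE} {E : SKE} {F : PRF S.funs.desc S.coins} {zero : ℕ → Data}
  {G : ℕ → Data → Data → Data}

theorem PolyFun.size_le' {g : ℕ → Data → Data} (h : PolyFun g) : ∃ p : Polynomial ℕ, ∀ n L x,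
    n ≤ L → x.size ≤ L → (g n x).size ≤ p.eval L := by
  obtain ⟨p, hp⟩ := h.size_le
  refine ⟨p.comp (2 * Polynomial.X), fun n L x hn hx => (hp n x).trans ?_⟩
  rw [Polynomial.eval_comp]
  refine polyEval_mono p ?_
  simp
  omega

theorem IsQPT.size_le' {g : ℕ → Data → PMF Data} (h : IsQPT g) : ∃ p : Polynomial ℕ, ∀ n L x,
    n ≤ L → x.size ≤ L → ∀ a ∈ (g n x).support, a.size ≤ p.eval L := by
  obtain ⟨p, hp⟩ := h.size_le
  refine ⟨p.comp (2 * Polynomial.X), fun n L x hn hx a ha => (hp n x a ha).trans ?_⟩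
  rw [Polynomial.eval_comp]
  refine polyEval_mono p ?_
  simp
  omega

/-- A polynomial bound on everything that occurs in the experiments. -/
structure SizeBound (P : PKFE) (S : UTSKFE) (E : SKE) (F : PRF S.funs.desc S.coins)
    (G : ℕ → Data → Data → Data) (n L : ℕ) : Prop where
  param : n ≤ L
  setup : ∀ kk ∈ (P.setup n).support, kk.1.size ≤ L
  master : ∀ msk ∈ (S.setup n).support, msk.size ≤ L
  cipher : ∀ kk ∈ (P.setup n).support, ∀ m ∈ P.msgs n, ∀ ct ∈ (P.enc n kk.1 m).support, ct.size ≤ L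
  record : ∀ f ∈ S.funs.desc n, ∀ m ∈ E.msgs n, (Data.pair f m).size ≤ L
  key : ∀ kk ∈ (P.setup n).support, ∀ sk ∈ (E.gen n).support, ∀ m ∈ E.msgs n,
    ∀ ct ∈ (E.enc n sk m).support, ∀ f ∈ S.funs.desc n, ∀ a ∈ (P.keyGen n kk.2 (G n ct f)).support,
      a.size ≤ L

theorem exists_sizeBound (hP : P.Efficient) (hS : S.Efficient) (hE : E.Efficient)
    (hG : PolyFun fun n x => G n x.fst x.snd) :
    ∃ q : Polynomial ℕ, ∀ n, SizeBound P S E F G n (q.eval n) := by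
  obtain ⟨⟨pm, hpm⟩, -, hset, hkg, henc, -⟩ := hP
  obtain ⟨-, -, ⟨⟨pf, hpf⟩, -⟩, -, hmsk, -⟩ := hS
  obtain ⟨⟨em, hem⟩, hgen, heenc, -⟩ := hE
  obtain ⟨p1, h1⟩ := hset.size_le
  obtain ⟨p2, h2⟩ := hkg.size_le'
  obtain ⟨p3, h3⟩ := henc.size_le'
  obtain ⟨p4, h4⟩ := hmsk.size_le
  obtain ⟨p5, h5⟩ := hgen.size_le
  obtain ⟨p6, h6⟩ := heenc.size_le'
  obtain ⟨p7, h7⟩ := hG.size_le'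
  -- `a` bounds the parameter, keys, messages and functions; `c` bounds a ciphertext of `E`; `d`
  -- bounds the circuit made from it. The outcomes of encryption and key generation of `P` come
  -- last.
  let a : Polynomial ℕ := Polynomial.X + p1.comp (Polynomial.X + 1) + p4.comp (Polynomial.X + 1)
    + p5.comp (Polynomial.X + 1) + pm + pf + em + 1
  let c : Polynomial ℕ := p6.comp a + a + 1
  let d : Polynomial ℕ := p7.comp c + c + 1
  let q : Polynomial ℕ := a + p3.comp a + p2.comp d
  refine ⟨q, fun n => ?_⟩
  have ea : a.eval n = n + p1.eval (n + 1) + p4.eval (n + 1) + p5.eval (n + 1) + pm.eval n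
    + pf.eval n + em.eval n + 1 := by simp [a]
  have ec : c.eval n = p6.eval (a.eval n) + a.eval n + 1 := by simp [c]
  have ed : d.eval n = p7.eval (c.eval n) + c.eval n + 1 := by simp [d]
  have eq : q.eval n = a.eval n + p3.eval (a.eval n) + p2.eval (d.eval n) := by simp [q]
  have hk : ∀ kk ∈ (P.setup n).support, kk.1.size + kk.2.size + 1 ≤ p1.eval (n + 1) := by
    intro kk hk
    have := h1 n .nil _ ((PMF.mem_support_map_iff _ _ _).2 ⟨kk, hk, rfl⟩)
    rwa [size_pair] at this
  have hsk : ∀ sk ∈ (E.gen n).support, sk.size ≤ p5.eval (n + 1) := h5 n .nil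
  have hm1 := fun m hm => hem n m hm
  have hf1 := fun f hf => hpf n f hf
  have b2 : a.eval n + 1 ≤ c.eval n := by omega
  have b3 : c.eval n + 1 ≤ d.eval n := by omega
  refine ⟨by omega, fun kk h => ?_, fun msk h => ?_, fun kk h m hm ct hct => ?_,
    fun f hf m hm => ?_, fun kk h sk hs m hm ct hct f hf x hx => ?_⟩
  · have := hk kk h
    omega
  · have := h4 n .nil msk h
    simp only [size_nil] at this
    omega
  · have := hk kk h
    have := h3 n (a.eval n) (.pair kk.1 m) (by omega) (by
      have := hpm n m hm; rw [size_pair]; omega) ct (by simpa using hct)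
    omega
  · have := hm1 m hm
    have := hf1 f hf
    rw [size_pair]
    omega
  · have := hk kk h
    have := hsk sk hs
    have := hm1 m hm
    have := hf1 f hf
    have i1 := h6 n (a.eval n) (.pair sk m) (by omega) (by rw [size_pair]; omega) ct
      (by simpa using hct)
    have i2 := h7 n (c.eval n) (.pair ct f) (by omega) (by rw [size_pair]; omega)
    rw [fst_pair, snd_pair] at i2
    have := h2 n (d.eval n) (.pair kk.2 (G n ct f)) (by omega) (by rw [size_pair]; omega) x
      (by simpa using hx)
    omega

end

end
end UTFE
-- Decryption errors and the reduction to CPA security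
namespace UTFE
noncomputable section
open Data

/-- The error may depend on the sampled value and enters with its mean. This matches the correctness
assumption, which is an average over the secret key. -/
theorem Near.bind_average {α β : Type} {p : PMF α} {f g : α → PMF β} {δ : α → ℝ≥0∞}
    (hf : ∀ a ∈ p.support, Near (δ a) (f a) (g a)) : Near (∑' a, p a * δ a) (p.bind f) (p.bind g) := by
  intro u hu
  rw [tsum_bind_mul, tsum_bind_mul, ← ENNReal.tsum_add]
  refine ENNReal.tsum_le_tsum fun a => ?_
  by_cases ha : p a = 0
  · simp [ha]
  · rw [← mul_add]
    gcongr
    exact hf a ((PMF.mem_support_iff _ _).2 ha) u hu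

theorem Near.abs_sub_le {ε : ℝ≥0∞} (hε : ε ≠ ⊤) {p q : PMF Bool} (h : Near ε p q) (h' : Near ε q p) :
    |(p true).toReal - (q true).toReal| ≤ ε.toReal := by
  have key : ∀ {p q : PMF Bool}, Near ε p q → (p true).toReal ≤ (q true).toReal + ε.toReal := by
    intro p q h
    rw [← ENNReal.toReal_add (PMF.apply_ne_top _ _) hε]
    exact ENNReal.toReal_mono (ENNReal.add_ne_top.2 ⟨PMF.apply_ne_top _ _, hε⟩) h.apply_le
  have h1 := key h
  have h2 := key h'
  rw [abs_le]
  constructor <;> linarith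

section
variable {P : PKFE} {S : UTSKFE} {E : SKE} {F : PRF S.funs.desc S.coins} {zero : ℕ → Data}
  {G : ℕ → Data → Data → Data}

theorem mem_keys_of_mem_support {n : ℕ} {k : Data} (h : k ∈ (F.key n).support) : k ∈ F.keys n :=
  (PMF.mem_support_uniformOfFinset_iff _ _).1 h

/-- The largest decryption error. -/
def SKE.error (E : SKE) (n : ℕ) (sk : Data) : ℝ≥0∞ :=
  ⨆ m ∈ E.msgs n, (E.enc n sk m).toOuterMeasure {ct | E.dec n sk ct ≠ m}

theorem SKE.error_le_one (E : SKE) (n : ℕ) (sk : Data) : E.error n sk ≤ 1 := by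
  refine iSup₂_le fun m _ => ?_
  rw [PMF.toOuterMeasure_apply]
  refine (ENNReal.tsum_le_tsum fun a => ?_).trans (E.enc n sk m).tsum_coe.le
  exact Set.indicator_le_self _ _ _

theorem SKE.mean_error_le_one (E : SKE) (n : ℕ) : ∑' sk, E.gen n sk * E.error n sk ≤ 1 :=
  tsum_mul_le_one _ fun sk => E.error_le_one n sk

theorem near_checkedKey {n : ℕ} {mskP sk m f : Data} (hm : m ∈ E.msgs n) :
    Near (E.error n sk) (hybridKey P E G n mskP sk m f) (checkedKey P E G n mskP sk m f) ∧
      Near (E.error n sk) (checkedKey P E G n mskP sk m f) (hybridKey P E G n mskP sk m f) := by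
  have h : (E.enc n sk m).toOuterMeasure {ct | ¬ E.dec n sk ct = m} ≤ E.error n sk :=
    le_iSup₂ (f := fun m (_ : m ∈ E.msgs n) =>
      (E.enc n sk m).toOuterMeasure {ct | E.dec n sk ct ≠ m}) m hm
  exact ⟨(near_ite _ _ _ _).mono h, (near_ite' _ _ _ _).mono h⟩

theorem SizeBound.hybridKey_le {n L : ℕ} (h : SizeBound P S E F G n L) {kk : Data × Data}
    (hk : kk ∈ (P.setup n).support) {sk m f : Data} (hs : sk ∈ (E.gen n).support) (hm : m ∈ E.msgs n)
    (hf : f ∈ S.funs.desc n) : ∀ a ∈ (hybridKey P E G n kk.2 sk m f).support, a.size ≤ L := by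
  intro a ha
  obtain ⟨ct, hct, ha⟩ := (PMF.mem_support_bind_iff _ _ _).1 ha
  exact h.key kk hk sk hs m hm ct hct f hf a ha

theorem SizeBound.checkedKey_le {n L : ℕ} (h : SizeBound P S E F G n L) {kk : Data × Data}
    (hk : kk ∈ (P.setup n).support) {sk m f : Data} (hs : sk ∈ (E.gen n).support) (hm : m ∈ E.msgs n)
    (hf : f ∈ S.funs.desc n) : ∀ a ∈ (checkedKey P E G n kk.2 sk m f).support, a.size ≤ L := by
  intro a ha
  obtain ⟨ct, hct, ha⟩ := (PMF.mem_support_bind_iff _ _ _).1 ha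
  split_ifs at ha
  · exact h.key kk hk sk hs m hm ct hct f hf a ha
  · rw [PMF.support_pure, Set.mem_singleton_iff] at ha
    rw [ha]
    have := h.record f hf m hm
    have := f.one_le_size
    rw [size_pair] at *
    rw [size_nil]
    omega

/-- For a fixed `sk` a single key changes only if its ciphertext fails to decrypt, and the number of
keys is polynomial; then the average over `sk` is taken. The encrypted messages are function keys
for functions chosen adaptively, possibly depending on `sk` through earlier answers, so the error
has to be bounded uniformly in the message for each `sk`. -/
theorem abs_hybrid_checked_le (hP : P.Efficient) (hS : S.Efficient) (hE : E.Efficient)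
    (hc : Compatible P S E F zero G) (𝒜 : UTAdversary) (b : Bool) : ∃ p : Polynomial ℕ, ∀ n,
      |(hybrid P S E F 𝒜 b n (fun _ msk k => plaintext false msk k .nil) (fun mskP sk msk k f =>
          hybridKey P E G n mskP sk (prfKey S F n msk k f) f) true).toReal -
        (hybrid P S E F 𝒜 b n (fun _ msk k => plaintext false msk k .nil) (fun mskP sk msk k f =>
          checkedKey P E G n mskP sk (prfKey S F n msk k f) f) true).toReal| ≤
        (p.eval n : ℕ) * (∑' sk, E.gen n sk * E.error n sk).toReal := by
  obtain ⟨q, hq⟩ := exists_sizeBound (F := F) hP hS hE hc.circuit_poly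
  obtain ⟨p, hp⟩ := exists_near_core hS 𝒜 b
  refine ⟨p.comp q, fun n => ?_⟩
  have hb := hq n
  rw [Polynomial.eval_comp]
  have hfin : ((p.eval (q.eval n) : ℕ) : ℝ≥0∞) * ∑' sk, E.gen n sk * E.error n sk ≠ ⊤ :=
    ENNReal.mul_ne_top (ENNReal.natCast_ne_top _) ((E.mean_error_le_one n).trans_lt ENNReal.one_lt_top).ne
  -- Stated for two arbitrary ways of making keys, since closeness is needed in both directions.
  have key := fun (kg kg' : Data → Data → Data → Data → Data → PMF Data)
      (hk : ∀ kk ∈ (P.setup n).support, ∀ sk ∈ (E.gen n).support, ∀ msk ∈ (S.setup n).support, ∀ k,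
        ∀ f ∈ S.funs.desc n, (∀ a ∈ (kg kk.2 sk msk k f).support, a.size ≤ q.eval n) ∧
          (∀ a ∈ (kg' kk.2 sk msk k f).support, a.size ≤ q.eval n) ∧
          Near (E.error n sk) (kg kk.2 sk msk k f) (kg' kk.2 sk msk k f)) =>
    show Near ((p.eval (q.eval n) : ℕ) * ∑' sk, E.gen n sk * E.error n sk)
        (hybrid P S E F 𝒜 b n (fun _ msk k => plaintext false msk k .nil) kg)
        (hybrid P S E F 𝒜 b n (fun _ msk k => plaintext false msk k .nil) kg') by
      rw [← ENNReal.tsum_mul_left]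
      simp only [mul_left_comm _ (E.gen n _) _]
      refine Near.bind_right fun kk hkk => Near.bind_average fun sk hsk =>
        Near.bind_right fun msk hmsk => Near.bind_right fun k hk' => Near.bind_right fun ctP hct => ?_
      have h := fun f hf => hk kk hkk sk hsk msk hmsk k f hf
      exact hp n (q.eval n) kk.1 msk ctP _ _ _ hb.param (hb.setup kk hkk) (hb.master msk hmsk)
        (hb.cipher kk hkk _ (hc.plain_false_mem n msk hmsk k (mem_keys_of_mem_support hk')) ctP hct)
        (fun f hf => (h f hf).1) (fun f hf => (h f hf).2.1) (fun f hf => (h f hf).2.2)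
  refine (Near.abs_sub_le hfin (key _ _ ?_) (key _ _ ?_)).trans ?_
  · intro kk hkk sk hsk msk hmsk k f hf
    have hm := hc.key_mem n msk hmsk f hf (F.eval n k f)
    exact ⟨hb.hybridKey_le hkk hsk hm hf, hb.checkedKey_le hkk hsk hm hf, (near_checkedKey hm).1⟩
  · intro kk hkk sk hsk msk hmsk k f hf
    have hm := hc.key_mem n msk hmsk f hf (F.eval n k f)
    exact ⟨hb.checkedKey_le hkk hsk hm hf, hb.hybridKey_le hkk hsk hm hf, (near_checkedKey hm).2⟩
  · rw [ENNReal.toReal_mul, ENNReal.toReal_natCast]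

theorem exists_prfKey_polyTime (hS : S.Efficient) (hF : F.Efficient) : ∃ κ, PolyTime κ ∧
    ∀ n msk k f, κ (.pair (unary n) (.pair msk (.pair k f))) = prfKey S F n msk k f := by
  obtain ⟨-, -, -, -, -, ⟨h, hh, eh⟩, -⟩ := hS
  obtain ⟨-, φ, hφ, eφ⟩ := hF
  refine ⟨fun x => h (.pair x.fst (.pair x.snd.fst (.pair x.snd.snd.snd (φ (.pair x.fst x.snd.snd))))),
    by fun_prop, fun n msk k f => ?_⟩
  simp only [fst_pair, snd_pair]
  rw [eφ n (.pair k f)]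
  exact eh n msk f (F.eval n k f)

/-- Implementations of everything that occurs in the experiments. -/
structure Kit (P : PKFE) (S : UTSKFE) (E : SKE) (F : PRF S.funs.desc S.coins) (zero : ℕ → Data)
    (G : ℕ → Data → Data → Data) where
  bnd : Data → Data
  bnd_poly : PolyTime bnd
  bnd_spec : ∀ n, ∃ L, bnd (unary n) = unary L ∧ SizeBound P S E F G n L
  prf : Data → Data
  prf_poly : PolyTime prf
  prf_spec : ∀ n msk k f, prf (.pair (unary n) (.pair msk (.pair k f))) = prfKey S F n msk k f
  coinKey : Data → Data
  coinKey_poly : PolyTime coinKey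
  coinKey_spec : ∀ n msk f r, coinKey (.pair (unary n) (.pair msk (.pair f (word r)))) = S.keyGen n msk f r
  zeroFun : Data → Data
  zero_poly : PolyTime zeroFun
  zero_spec : ∀ n x, zeroFun (.pair (unary n) x) = zero n
  circuit : Data → Data
  circuit_poly : PolyTime circuit
  circuit_spec : ∀ n ct f, circuit (.pair (unary n) (.pair ct f)) = G n ct f
  dec : Data → Data
  dec_poly : PolyTime dec
  dec_spec : ∀ n sk ct, dec (.pair (unary n) (.pair sk ct)) = E.dec n sk ct
  tst : Data → Data
  tst_poly : PolyTime tst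
  tst_spec : IsAllowedTest S.funs tst
  fair : Data → Data
  fair_poly : PolyTime fair
  fair_spec : IsFairTest S fair
  setup : Alg
  setup_run : ∀ {σ : Type} {O : Oracle σ}, O.Bounded → ∀ n x s,
    setup.run O (.pair (unary n) x) s = ((P.setup n).map fun k => .pair k.1 k.2).map fun y => (y, s)
  keyGen : Alg
  keyGen_run : ∀ {σ : Type} {O : Oracle σ}, O.Bounded → ∀ n x s,
    keyGen.run O (.pair (unary n) x) s = (P.keyGen n x.fst x.snd).map fun y => (y, s)
  enc : Alg
  enc_run : ∀ {σ : Type} {O : Oracle σ}, O.Bounded → ∀ n x s,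
    enc.run O (.pair (unary n) x) s = (P.enc n x.fst x.snd).map fun y => (y, s)
  master : Alg
  master_run : ∀ {σ : Type} {O : Oracle σ}, O.Bounded → ∀ n x s,
    master.run O (.pair (unary n) x) s = (S.setup n).map fun y => (y, s)
  key : Alg
  key_run : ∀ {σ : Type} {O : Oracle σ}, O.Bounded → ∀ n x s,
    key.run O (.pair (unary n) x) s = (F.key n).map fun y => (y, s)
  skeGen : Alg
  skeGen_run : ∀ {σ : Type} {O : Oracle σ}, O.Bounded → ∀ n x s,
    skeGen.run O (.pair (unary n) x) s = (E.gen n).map fun y => (y, s)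
  skeEnc : Alg
  skeEnc_run : ∀ {σ : Type} {O : Oracle σ}, O.Bounded → ∀ n x s,
    skeEnc.run O (.pair (unary n) x) s = (E.enc n x.fst x.snd).map fun y => (y, s)
  M : QPT
  M_exec : ∀ n x, (M.exec silent (.pair (unary n) x) vacuum ()).map (fun r => (r.1, r.2.1))
    = S.enc n x.fst x.snd

attribute [fun_prop] Kit.bnd_poly Kit.prf_poly Kit.coinKey_poly Kit.zero_poly Kit.circuit_poly
  Kit.dec_poly Kit.tst_poly Kit.fair_poly

theorem SizeBound.mono {n L L' : ℕ} (h : SizeBound P S E F G n L) (hL : L ≤ L') :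
    SizeBound P S E F G n L' where
  param := h.param.trans hL
  setup kk hk := (h.setup kk hk).trans hL
  master m hm := (h.master m hm).trans hL
  cipher kk hk m hm ct hct := (h.cipher kk hk m hm ct hct).trans hL
  record f hf m hm := (h.record f hf m hm).trans hL
  key kk hk sk hs m hm ct hct f hf a ha := (h.key kk hk sk hs m hm ct hct f hf a ha).trans hL

theorem exists_kit (hP : P.Efficient) (hS : S.Efficient) (hE : E.Efficient)
    (hF : F.Efficient) (hc : Compatible P S E F zero G) : Nonempty (Kit P S E F zero G) := by
  obtain ⟨q, hq⟩ := exists_sizeBound (F := F) hP hS hE hc.circuit_poly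
  obtain ⟨bnd, hbnd, ebnd⟩ := exists_unary_bound q
  obtain ⟨κ, hκ, eκ⟩ := exists_prfKey_polyTime hS hF
  obtain ⟨h, hh, eh⟩ := hS.2.2.2.2.2.1
  obtain ⟨z, hz, ez⟩ := hc.zero_poly
  obtain ⟨g, hg, eg⟩ := hc.circuit_poly
  obtain ⟨d, hd, ed⟩ := hE.2.2.2
  obtain ⟨A₁, e₁⟩ := hP.2.2.1.exists_alg
  obtain ⟨A₂, e₂⟩ := hP.2.2.2.1.exists_alg
  obtain ⟨A₃, e₃⟩ := hP.2.2.2.2.1.exists_alg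
  obtain ⟨A₄, e₄⟩ := hS.2.2.2.2.1.exists_alg
  obtain ⟨A₅, e₅⟩ := hF.1.exists_alg
  obtain ⟨A₆, e₆⟩ := hE.2.1.exists_alg
  obtain ⟨A₇, e₇⟩ := hE.2.2.1.exists_alg
  obtain ⟨M, hM⟩ := hS.2.2.2.2.2.2.1.exists_machine
  obtain ⟨tst, htp, ht⟩ := FunSpace.exists_allowedTest hS.2.2.1
  obtain ⟨gt, hgt, hg'⟩ := UTSKFE.exists_fairTest hS.2.1 hS.2.2.1
  exact ⟨⟨bnd, hbnd, fun n => by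
    obtain ⟨m, hm, hl⟩ := ebnd n
    exact ⟨m, hm, (hq n).mono hl⟩, κ, hκ, eκ, h, hh, eh, z, hz, ez, g, hg,
    fun n ct f => eg n (.pair ct f), d, hd, fun n sk ct => ed n (.pair sk ct), tst, htp, ht, gt, hgt, hg',
    A₁, e₁, A₂, e₂, A₃, e₃, A₄, e₄, A₅, e₅, A₆, e₆, A₇, e₇, M, hM⟩⟩

namespace Kit
variable (T : Kit P S E F zero G)

/-- Makes a key for `f` with the ciphertext `ct`; the input is `(ct, x)`, where `x` is the input of
the server of key queries. -/
def finish : Alg := (T.keyGen.pre (fun y => .pair y.snd.fst.fst (.pair y.snd.fst.snd.snd.snd.snd.fst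
    (T.circuit (.pair y.snd.fst.fst (.pair y.fst y.snd.snd.snd))))) (by have := T.circuit_poly; fun_prop)).post
  (fun w => .pair w.fst (.pair w.snd.snd.snd.snd .nil)) (by fun_prop)

theorem finish_run {σ : Type} {O : Oracle σ} (hO : O.Bounded) (n : ℕ)
    (B pub msk ctP mskP K p ct store f : Data) (s : σ) :
    T.finish.run O (.pair ct (.pair (fullEnv n B pub msk ctP (.pair mskP K) p) (.pair store f))) s
      = (P.keyGen n mskP (G n ct f)).map fun a => (.pair a (.pair f .nil), s) := by
  rw [finish, Alg.post_run _ _ hO, Alg.pre_run]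
  simp only [fullEnv, envOf, fst_pair, snd_pair, T.circuit_spec]
  rw [T.keyGen_run hO, PMF.map_comp]
  simp only [fst_pair, snd_pair]
  rfl

/-- The server of key queries against the security of the secret-key scheme. -/
def cpaServer : Alg := (Alg.ask (fun _ => .nil) (fun x => .pair (T.zeroFun (.pair x.fst.fst .nil))
      (T.prf (.pair x.fst.fst (.pair x.fst.snd.snd.snd.fst.snd.fst
        (.pair x.fst.snd.snd.snd.snd.snd x.snd.snd)))))
      Data.fst (by fun_prop) (by have := T.zero_poly; have := T.prf_poly; fun_prop) (by fun_prop)).bind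
    T.finish

/-- The adversary against the secret-key scheme. -/
def cpaAdversary (𝒜 : UTAdversary) (b : Bool) : Alg :=
  T.setup.andThen (fun x => .pair x .nil) (by fun_prop) <|
  T.master.andThen (fun x => .pair x.snd .nil) (by fun_prop) <|
  T.key.andThen (fun x => .pair x.snd.snd .nil) (by fun_prop) <|
  T.enc.andThen (fun x => .pair x.snd.snd.snd (.pair x.snd.snd.fst.fst
    (plaintext false x.snd.fst x.fst .nil))) (by unfold plaintext; fun_prop) <|
  (play 𝒜 T.cpaServer T.tst T.tst_poly T.M b T.fair T.fair_poly).pre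
    (fun x => envOf x.snd.snd.snd.snd (T.bnd x.snd.snd.snd.snd) .nil
      (.pair (.pair x.snd.snd.snd.fst.fst (.pair x.snd.snd.fst x.fst))
        (.pair x.snd.snd.snd.fst.snd x.snd.fst))) (by have := T.bnd_poly; unfold envOf; fun_prop)

theorem record_le {n L : ℕ} (h : SizeBound P S E F G n L) {f m : Data} (hf : f ∈ S.funs.desc n)
    (hm : m ∈ E.msgs n) : (Data.pair f .nil).size ≤ L := by
  have := h.record f hf m hm
  have := m.one_le_size
  rw [size_pair] at *
  rw [size_nil]
  omega

/-- The reduction samples everything except `sk`. Each key query for `f` becomes one query with the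
messages `0` and the function key for `f`; the answer goes into the circuit. Thus the bit of the CPA
experiment selects the content of all ciphertexts, and there is no loss. -/
theorem cpa_prOne (hE : E.Efficient) (hc : Compatible P S E F zero G) (𝒜 : UTAdversary) (b : Bool)
    (n : ℕ) (c : Bool) : prOne (E.game (T.cpaAdversary 𝒜 b).machine n c) =
      (hybrid P S E F 𝒜 b n (fun _ msk k => plaintext false msk k .nil) (fun mskP sk msk k f =>
        hybridKey P E G n mskP sk (if c then prfKey S F n msk k f else zero n) f) true).toReal := by
  obtain ⟨L, hL, hb⟩ := T.bnd_spec n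
  -- The CPA experiment draws `sk` before anything else, the hybrid experiment after the setup of
  -- `P`.
  rw [E.prOne_game hE, hybrid, PMF.bind_comm]
  congr 2
  refine pmf_bind_congr fun sk hsk => ?_
  have hO := E.lrOracle_bounded hE n sk c
  rw [Alg.machine_map _ hO (unary_snd_snd_ne_mark n) () fun o => decide (o = bit true), cpaAdversary,
    Alg.andThen_run n _ hO (T.setup_run hO) _ _ rfl, PMF.bind_map, PMF.map_bind]
  refine pmf_bind_congr fun kk hkk => ?_
  rw [Function.comp_apply, Alg.andThen_run n _ hO (T.master_run hO) _ _ rfl, PMF.map_bind]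
  refine pmf_bind_congr fun msk hmsk => ?_
  rw [Alg.andThen_run n _ hO (T.key_run hO) _ _ rfl, PMF.map_bind]
  refine pmf_bind_congr fun k hk => ?_
  rw [Alg.andThen_run n _ hO (T.enc_run hO) _ _ rfl, PMF.map_bind]
  simp only [fst_pair, snd_pair]
  refine pmf_bind_congr fun ctP hct => ?_
  rw [Alg.pre_run]
  simp only [fst_pair, snd_pair, hL]
  have hmem := fun f (hf : f ∈ S.funs.desc n) => hc.key_mem n msk hmsk f hf (F.eval n k f)
  refine play_std 𝒜 _ _ T.tst_spec b T.M_exec _ T.fair_spec hO (K := .pair kk.2 k) (fun _ => .nil)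
    (fun p f store s hf => ?_)
    (fun f hf => ?_) ()
  · rw [cpaServer, Alg.bind_run _ _ hO, Alg.ask_run _ _ _ hO, if_pos rfl, PMF.bind_map]
    simp only [Function.comp_def, fst_pair, T.finish_run hO]
    simp only [fullEnv, envOf, fst_pair, snd_pair, T.zero_spec, T.prf_spec]
    rw [SKE.lrOracle, fst_pair, snd_pair, if_pos ⟨hc.zero_mem n, hmem f hf.1⟩, PMF.bind_map,
      PMF.map_bind, hybridKey, PMF.map_bind]
    refine pmf_bind_congr fun ct _ => ?_
    rw [Function.comp_apply, PMF.map_comp]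
    rfl
  · rw [spine_unary]
    refine ⟨record_le hb hf (hmem f hf), hb.hybridKey_le hkk hsk ?_ hf⟩
    cases c
    exacts [hc.zero_mem n, hmem f hf]

end Kit

end

end
end UTFE
-- The reduction to the security of the pseudorandom function
namespace UTFE
noncomputable section
open Data

section
variable {P : PKFE} {S : UTSKFE} {E : SKE} {F : PRF S.funs.desc S.coins} {zero : ℕ → Data}
  {G : ℕ → Data → Data → Data}

theorem stdOracle_congr {𝓕 : FunSpace} {n : ℕ} {kg kg' : Data → PMF Data}
    (h : ∀ f ∈ 𝓕.desc n, kg f = kg' f) : stdOracle 𝓕 n kg = stdOracle 𝓕 n kg' := by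
  funext p s f
  unfold stdOracle keyOracle
  split_ifs with hf
  · rw [h f hf.1]
  · rfl

variable (P S E G) in
/-- A key for `f` with the coins `r`. -/
def coinedKey (n : ℕ) (mskP sk msk : Data) (f : S.funs.desc n) (r : Fin (S.coins n) → Bool) :
    PMF Data := checkedKey P E G n mskP sk (S.keyGen n msk f r) f

variable (P S E G) in
/-- The keys with the coins `R`. -/
def tableKey (n : ℕ) (mskP sk msk : Data) (R : S.funs.desc n → (Fin (S.coins n) → Bool)) (f : Data) :
    PMF Data := if h : f ∈ S.funs.desc n then coinedKey P S E G n mskP sk msk ⟨f, h⟩ (R ⟨f, h⟩)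
      else PMF.pure .nil

variable (P S E) in
/-- The experiments in which the plain ciphertext does not depend on the keys of the secret-key
functional encryption scheme, continued with `C`. -/
def blindWorld (n : ℕ) (C : Data × Data → Data → Data → Data → PMF Bool) : PMF Bool :=
  (P.setup n).bind fun kk => (E.gen n).bind fun sk => (S.setup n).bind fun msk =>
    (P.enc n kk.1 (plaintext true .nil .nil sk)).bind fun ctP => C kk sk msk ctP

namespace Kit
variable (T : Kit P S E F zero G)

/-- Encrypts the function key, and makes a key unless decryption fails; the input is `(key, x)`,
where `x` is the input of the server of key queries. -/
def encFinish : Alg := T.skeEnc.andThen (fun y => .pair y.snd.fst.fst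
    (.pair y.snd.fst.snd.snd.snd.snd.snd y.fst)) (by fun_prop) <|
  (T.finish.pre (fun y => .pair y.fst y.snd.snd) (by fun_prop)).post
    (fun w => .pair (if T.dec (.pair w.snd.snd.snd.fst.fst (.pair w.snd.snd.snd.fst.snd.snd.snd.snd.snd
      w.snd.fst)) = w.snd.snd.fst then w.fst.fst else .nil)
      (.pair w.snd.snd.snd.snd.snd w.snd.snd.fst)) (by have := T.dec_poly; fun_prop)

theorem encFinish_run {σ : Type} {O : Oracle σ} (hO : O.Bounded) (n : ℕ)
    (B pub msk ctP mskP sk p key store f : Data) (s : σ) :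
    T.encFinish.run O (.pair key (.pair (fullEnv n B pub msk ctP (.pair mskP sk) p) (.pair store f))) s
      = (checkedKey P E G n mskP sk key f).map fun a => (.pair a (.pair f key), s) := by
  rw [encFinish, Alg.andThen_run n _ hO (T.skeEnc_run hO) _ _ rfl, checkedKey, PMF.map_bind]
  simp only [fst_pair, snd_pair]
  refine pmf_bind_congr fun ct _ => ?_
  rw [Alg.post_run _ _ hO, Alg.pre_run, fst_pair, snd_pair, snd_pair, T.finish_run hO, PMF.map_comp]
  simp only [Function.comp_def, fullEnv, envOf, fst_pair, snd_pair, T.dec_spec]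
  split_ifs
  · rfl
  -- The plain key is generated in any case; if decryption fails it is discarded, so its
  -- distribution becomes irrelevant.
  · rw [PMF.pure_map]
    exact PMF.map_const _ _

/-- The server of key queries against the pseudorandom function. -/
def prfServer : Alg := (Alg.ask (fun _ => .nil) (fun x => x.snd.snd)
    (fun y => T.coinKey (.pair y.snd.fst.fst (.pair y.snd.fst.snd.snd.snd.fst.snd.fst
      (.pair y.snd.snd.snd y.fst)))) (by fun_prop) (by fun_prop)
      (by have := T.coinKey_poly; fun_prop)).bind T.encFinish

theorem prfServer_run {n : ℕ} (R : S.funs.desc n → (Fin (S.coins n) → Bool)) (B pub msk ctP mskP sk p store : Data)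
    (f : S.funs.desc n) : T.prfServer.run (funOracle (S.funs.desc n) R)
        (.pair (fullEnv n B pub msk ctP (.pair mskP sk) p) (.pair store f)) ()
      = (coinedKey P S E G n mskP sk msk f (R f)).map fun a =>
          (.pair a (.pair f (S.keyGen n msk f (R f))), ()) := by
  have hO := funOracle_bounded (S.funs.desc n) R
  have h : funOracle (S.funs.desc n) R () f = PMF.pure (word (R f), ()) := by
    unfold funOracle
    rw [dif_pos f.2]
    rfl
  rw [prfServer, Alg.bind_run _ _ hO, Alg.ask_run _ _ _ hO, if_pos rfl, snd_pair, snd_pair, h,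
    PMF.pure_map, PMF.pure_bind]
  have h' : T.coinKey (.pair (unary n) (.pair msk (.pair f (word (R f))))) = S.keyGen n msk f (R f) :=
    T.coinKey_spec _ _ _ _
  have := T.encFinish_run hO n B pub msk ctP mskP sk p (S.keyGen n msk f (R f)) store f ()
  rw [← h'] at this
  rw [coinedKey, ← h']
  exact this

/-- The adversary against the pseudorandom function. -/
def prfAdversary (𝒜 : UTAdversary) (b : Bool) : Alg :=
  T.setup.andThen (fun x => .pair x .nil) (by fun_prop) <|
  T.skeGen.andThen (fun x => .pair x.snd .nil) (by fun_prop) <|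
  T.master.andThen (fun x => .pair x.snd.snd .nil) (by fun_prop) <|
  T.enc.andThen (fun x => .pair x.snd.snd.snd (.pair x.snd.snd.fst.fst
    (plaintext true .nil .nil x.snd.fst))) (by unfold plaintext; fun_prop) <|
  (play 𝒜 T.prfServer T.tst T.tst_poly T.M b T.fair T.fair_poly).pre
    (fun x => envOf x.snd.snd.snd.snd (T.bnd x.snd.snd.snd.snd) .nil
      (.pair (.pair x.snd.snd.snd.fst.fst (.pair x.snd.fst x.fst))
        (.pair x.snd.snd.snd.fst.snd x.snd.snd.fst))) (by have := T.bnd_poly; unfold envOf; fun_prop)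

/-- The plain ciphertext now encrypts `(1, ⊥, ⊥, sk)`, so the adversary can prepare it without
knowing `k`. It holds `msk` and `sk` itself and asks its oracle only for the coins of function keys.
-/
theorem prfAdversary_run (hc : Compatible P S E F zero G) (𝒜 : UTAdversary) (b : Bool) (n : ℕ)
    (R : S.funs.desc n → (Fin (S.coins n) → Bool)) :
    ((T.prfAdversary 𝒜 b).machine.exec (funOracle (S.funs.desc n) R) (unary n) vacuum ()).map
        (fun r => decide (r.1 = bit true))
      = blindWorld P S E n fun kk sk msk ctP => core S 𝒜 b n kk.1 msk ctP
          (stdOracle S.funs n (tableKey P S E G n kk.2 sk msk R)) id [] := by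
  obtain ⟨L, hL, hb⟩ := T.bnd_spec n
  have hO := funOracle_bounded (S.funs.desc n) R
  rw [Alg.machine_map _ hO (unary_snd_snd_ne_mark n) () fun o => decide (o = bit true), prfAdversary,
    Alg.andThen_run n _ hO (T.setup_run hO) _ _ rfl, PMF.bind_map, PMF.map_bind, blindWorld]
  refine pmf_bind_congr fun kk hkk => ?_
  rw [Function.comp_apply, Alg.andThen_run n _ hO (T.skeGen_run hO) _ _ rfl, PMF.map_bind]
  refine pmf_bind_congr fun sk hsk => ?_
  rw [Alg.andThen_run n _ hO (T.master_run hO) _ _ rfl, PMF.map_bind]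
  refine pmf_bind_congr fun msk hmsk => ?_
  rw [Alg.andThen_run n _ hO (T.enc_run hO) _ _ rfl, PMF.map_bind]
  simp only [fst_pair, snd_pair]
  refine pmf_bind_congr fun ctP hct => ?_
  rw [Alg.pre_run]
  simp only [fst_pair, snd_pair, hL]
  -- A record pairs the query with its function key. The value `nil` outside the function space is
  -- never used, as such queries are refused.
  let ρ : Data → Data := fun f => if h : f ∈ S.funs.desc n then S.keyGen n msk f (R ⟨f, h⟩) else .nil
  have hρ : ∀ f, f ∈ S.funs.desc n → ρ f ∈ E.msgs n := fun f hf => by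
    simp only [ρ, dif_pos hf]
    exact hc.key_mem n msk hmsk f hf _
  have hk : ∀ f, f ∈ S.funs.desc n → tableKey P S E G n kk.2 sk msk R f
      = checkedKey P E G n kk.2 sk (ρ f) f := fun f hf => by
    simp only [ρ, tableKey, dif_pos hf, coinedKey]
  refine play_std 𝒜 _ _ T.tst_spec b T.M_exec _ T.fair_spec hO (K := .pair kk.2 sk) ρ
    (fun p f store s hf => ?_) (fun f hf => ?_) ()
  · have := T.prfServer_run R (unary L) kk.1 msk ctP kk.2 sk p store ⟨f, hf.1⟩
    refine (congrArg (PMF.map Prod.fst) this).trans ?_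
    rw [hk f hf.1, PMF.map_comp]
    simp only [ρ, dif_pos hf.1]
    rfl
  · rw [spine_unary, hk f hf]
    exact ⟨hb.record f hf _ (hρ f hf), hb.checkedKey_le hkk hsk (hρ f hf) hf⟩

/-- With the table `F(k, ·)` the coined keys are the checked keys of the hybrid; the independent key
`k` only has to be moved to its place in the order of sampling. -/
theorem prf_prOne_false (hc : Compatible P S E F zero G) (𝒜 : UTAdversary) (b : Bool) (n : ℕ) :
    prOne (F.game (T.prfAdversary 𝒜 b).machine n false) =
      (hybrid P S E F 𝒜 b n (fun sk _ _ => plaintext true .nil .nil sk) (fun mskP sk msk k f =>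
        checkedKey P E G n mskP sk (prfKey S F n msk k f) f) true).toReal := by
  rw [F.prOne_game]
  simp only [Bool.false_eq_true, if_false, T.prfAdversary_run hc, PMF.bind_const]
  congr 2
  unfold blindWorld hybrid
  rw [PMF.bind_comm]
  refine pmf_bind_congr fun kk _ => ?_
  rw [PMF.bind_comm]
  refine pmf_bind_congr fun sk _ => ?_
  rw [PMF.bind_comm]
  refine pmf_bind_congr fun msk _ => pmf_bind_congr fun k _ => pmf_bind_congr fun ctP _ => ?_
  rw [stdOracle_congr fun f hf => ?_]
  simp only [tableKey, dif_pos hf, coinedKey, prfKey]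

/-- A uniformly random table fixed at the beginning is exchanged for coins that are drawn at the
first query and recorded, the form that a key oracle with fresh coins can supply. -/
theorem prf_prOne_true (hc : Compatible P S E F zero G) (𝒜 : UTAdversary) (b : Bool) (n : ℕ) :
    prOne (F.game (T.prfAdversary 𝒜 b).machine n true) =
      (blindWorld P S E n (fun kk sk msk ctP => core S 𝒜 b n kk.1 msk ctP
        (fun p => lazyOracle (Allowed S.funs n p) (coinedKey P S E G n kk.2 sk msk)) queried [])
        true).toReal := by
  rw [F.prOne_game]
  simp only [if_true, T.prfAdversary_run hc, PMF.bind_const]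
  congr 2
  unfold blindWorld
  rw [PMF.bind_comm]
  refine pmf_bind_congr fun kk hkk => ?_
  rw [PMF.bind_comm]
  refine pmf_bind_congr fun sk hsk => ?_
  rw [PMF.bind_comm]
  refine pmf_bind_congr fun msk hmsk => ?_
  rw [PMF.bind_comm]
  refine pmf_bind_congr fun ctP _ => ?_
  obtain ⟨L, -, hb⟩ := T.bnd_spec n
  have h : ∀ x r, SizeBounded (coinedKey P S E G n kk.2 sk msk x r) := fun x r =>
    ⟨L, hb.checkedKey_le hkk hsk (hc.key_mem n msk hmsk x x.2 r) x.2⟩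
  refine Eq.trans ?_ (core_lazyOracle _ h)
  refine pmf_bind_congr fun R _ => core_tableOracle h R fun x => ?_
  simp only [tableKey, dif_pos x.2]

end Kit

end

end
end UTFE
namespace UTFE
noncomputable section
open Data

/-! ## Machines for the two parts of an adversary -/

/-- Whether a state is the input of `Alg.quiet`. -/
def isParamInput (z : Data) : Data :=
  if z.snd.snd = mark then (if z.fst = .nil then .nil else if z.fst = bit true then .nil else bit true)
  else bit true

theorem PolyTime.isParamInput : PolyTime isParamInput := by
  unfold UTFE.isParamInput; fun_prop

/-- The public key in the input is arbitrary and could imitate `mark`, so the first component is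
examined as well. A muted machine asks no queries, hence its internal states begin with `nil` or a
bit and never with `unary n` for `n ≥ 2`. -/
theorem isParamInput_isEntryTest (M : QPT) : IsEntryTest isParamInput (mute M) where
  polyTime := .isParamInput
  mkS _ := (if_pos rfl).trans (if_pos rfl)
  bit o _ := by
    cases o
    · exact (if_pos rfl).trans (if_pos rfl)
    · exact (if_pos rfl).trans ((if_neg (by simp [bit])).trans (if_pos rfl))
  query c₀ q c h := by
    rw [mute_step] at h
    cases hi : M.step (subOf c₀) <;> rw [hi] at h <;> cases h

theorem isParamInput_ne_nil {n : ℕ} (hn : 2 ≤ n) (x : Data) : isParamInput (.pair (unary n) x) ≠ .nil := by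
  obtain ⟨m, rfl⟩ := Nat.exists_eq_add_of_le' hn
  unfold isParamInput
  split_ifs with h1 h2 h3
  · simp [unary] at h2
  · simp [unary, bit] at h3
  · simp [bit]
  · simp [bit]

/-- The algorithm, without queries, on one half of the qubits. -/
def Alg.quiet (A : Alg) : QPT :=
  entry isParamInput (fun z => mkS .nil (mkS .nil (A.start z))) id (by have := A.polyTime; fun_prop)
    (by fun_prop) (mute (ren (Data.pair (bit false)) (by fun_prop) A.M)) (isParamInput_isEntryTest _)

theorem Alg.quiet_exec (A : Alg) {σ : Type} {O : Oracle σ} (hO : O.Bounded) {n : ℕ} (hn : 2 ≤ n)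
    (x : Data) (s : σ) : A.quiet.exec O (.pair (unary n) x) vacuum s
      = (A.M.exec silent (A.start (.pair (unary n) x)) vacuum ()).map fun r =>
          (r.1, rename (Data.pair (bit false)) r.2.1, s) := by
  rw [Alg.quiet, entry_exec hO (isParamInput_ne_nil hn x), mute_exec hO, subOf_mkS,
    ren_exec_vacuum (free_vacuum _) normSq_vacuum ⟨1, silent_boundedBy⟩, PMF.map_comp, PMF.map_comp]
  rfl

/-- The algorithm on the other half of the qubits. -/
def Alg.resume (A : Alg) : QPT :=
  entry isInput (fun z => mkS .nil (A.start z)) id (by have := A.polyTime; fun_prop)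
    (by fun_prop) (ren (Data.pair (bit true)) (by fun_prop) A.M) (isInput_isEntryTest _)

theorem Alg.resume_map (A : Alg) {σ : Type} {O : Oracle σ} (hO : O.Bounded) {z : Data}
    (hz : z.snd.snd ≠ mark) {v : Ket} (hv : normSq v = 1) (s : σ) {β : Type} (g : Data → β) :
    (A.resume.exec O z (rename (Data.pair (bit false)) v) s).map (fun r => g r.1)
      = (A.run O z s).map fun r => g r.1 := by
  rw [Alg.resume, entry_exec hO (isInput_ne_nil hz), ren_exec_vacuum (free_rename_false _)
    ((normSq_rename (pair_injective _) _).trans hv) hO, Alg.run, PMF.map_comp, PMF.map_comp,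
    PMF.map_comp]
  rfl

section
variable {P : PKFE} {S : UTSKFE} {E : SKE} {F : PRF S.funs.desc S.coins} {zero : ℕ → Data}
  {G : ℕ → Data → Data → Data}

namespace Kit
variable (T : Kit P S E F zero G)

/-- Samples the two plaintexts. -/
def plainSampler : Alg :=
  T.skeGen.andThen (fun x => .pair x.fst .nil) (by fun_prop) <|
  T.master.andThen (fun x => .pair x.snd.fst .nil) (by fun_prop) <|
  T.key.andThen (fun x => .pair x.snd.snd.fst .nil) (by fun_prop) <|
  .ask (fun _ => bit true) (fun _ => .nil) (fun w => .pair
    (plaintext false w.snd.snd.fst w.snd.fst .nil) (.pair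
    (plaintext true .nil .nil w.snd.snd.snd.fst) (.pair w.snd.snd.snd.snd.snd
      (.pair w.snd.snd.snd.fst (.pair w.snd.snd.fst w.snd.fst))))) (by fun_prop) (by fun_prop)
      (by unfold plaintext; fun_prop)

theorem plainSampler_run {σ : Type} {O : Oracle σ} (hO : O.Bounded) (n : ℕ) (pk : Data) (s : σ) :
    T.plainSampler.run O (.pair (unary n) pk) s = (E.gen n).bind fun sk => (S.setup n).bind fun msk =>
      (F.key n).bind fun k => PMF.pure (.pair (plaintext false msk k .nil)
        (.pair (plaintext true .nil .nil sk) (.pair pk (.pair sk (.pair msk k)))), s) := by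
  rw [plainSampler, Alg.andThen_run n _ hO (T.skeGen_run hO) _ _ rfl]
  refine pmf_bind_congr fun sk _ => ?_
  rw [Alg.andThen_run n _ hO (T.master_run hO) _ _ rfl]
  refine pmf_bind_congr fun msk _ => ?_
  rw [Alg.andThen_run n _ hO (T.key_run hO) _ _ rfl]
  refine pmf_bind_congr fun k _ => ?_
  rw [Alg.ask_run _ _ _ hO, if_neg (by simp [bit])]
  rfl

/-- The server of key queries against the security of the plain functional encryption scheme. -/
def plainServer : Alg := T.skeEnc.andThen (fun x => .pair x.fst.fst (.pair x.fst.snd.snd.snd.snd.fst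
    (T.prf (.pair x.fst.fst (.pair x.fst.snd.snd.snd.fst.snd.fst
      (.pair x.fst.snd.snd.snd.snd.snd x.snd.snd)))))) (by have := T.prf_poly; fun_prop) <|
  .ask (fun _ => .nil) (fun y => T.circuit (.pair y.snd.fst.fst (.pair y.fst y.snd.snd.snd)))
    (fun w => .pair w.fst (.pair w.snd.snd.snd.snd .nil)) (by fun_prop)
    (by have := T.circuit_poly; fun_prop) (by fun_prop)

theorem plainServer_run {σ : Type} {O : Oracle σ} (hO : O.Bounded) (n : ℕ)
    (B pub msk ctP sk k p store f : Data) (s : σ) :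
    T.plainServer.run O (.pair (fullEnv n B pub msk ctP (.pair sk k) p) (.pair store f)) s
      = (E.enc n sk (prfKey S F n msk k f)).bind fun ct =>
          (O s (G n ct f)).map fun r => (.pair r.1 (.pair f .nil), r.2) := by
  rw [plainServer, Alg.andThen_run n _ hO (T.skeEnc_run hO) _ _ rfl]
  simp only [fullEnv, envOf, fst_pair, snd_pair, T.prf_spec]
  refine pmf_bind_congr fun ct _ => ?_
  rw [Alg.ask_run _ _ _ hO, if_pos rfl]
  simp only [fst_pair, snd_pair, T.circuit_spec]

/-- The adversary after the challenge. -/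
def plainPlay (𝒜 : UTAdversary) (b : Bool) : Alg :=
  (play 𝒜 T.plainServer T.tst T.tst_poly T.M b T.fair T.fair_poly).pre
    (fun z => envOf z.fst (T.bnd z.fst) .nil (.pair (.pair z.snd.snd.fst
      (.pair z.snd.snd.snd.snd.fst z.snd.fst)) (.pair z.snd.snd.snd.fst z.snd.snd.snd.snd.snd)))
    (by have := T.bnd_poly; unfold envOf; fun_prop)

/-- The adversary against the plain functional encryption scheme. -/
def plainAdversary (𝒜 : UTAdversary) (b : Bool) : FEAdversary where
  A₁ := T.plainSampler.quiet
  A₂ := (T.plainPlay 𝒜 b).resume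

/-- The challenge messages are sampled by the reduction before it asks for any key. After the
challenge it simulates both stages of the given adversary, with `sk`, `msk` and `k` known to it and
plain keys from its oracle. That oracle refuses a circuit exactly if its two values differ, so the
withheld keys of the hybrid appear by themselves. -/
theorem plain_prOne (hP : P.Efficient) (hc : Compatible P S E F zero G) (𝒜 : UTAdversary) (b : Bool)
    {n : ℕ} (hn : 2 ≤ n) (c : Bool) : prOne (P.game (T.plainAdversary 𝒜 b) n c) =
      (hybrid P S E F 𝒜 b n (fun sk msk k => if c then plaintext true .nil .nil sk else
        plaintext false msk k .nil) (fun mskP sk msk k f =>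
          checkedKey P E G n mskP sk (prfKey S F n msk k f) f) true).toReal := by
  obtain ⟨L, hL, hb⟩ := T.bnd_spec n
  rw [P.prOne_game hP]
  congr 2
  unfold hybrid
  refine pmf_bind_congr fun kk hkk => ?_
  obtain ⟨L', hL'⟩ := P.keyGen_bounded hP n kk.2
  rw [plainAdversary, Alg.quiet_exec _ (keyOracle_bounded hL') hn, PMF.bind_map]
  simp only [Function.comp_def]
  have key : ∀ (sk msk k : Data), sk ∈ (E.gen n).support → msk ∈ (S.setup n).support →
      k ∈ (F.key n).support → ∀ v, normSq v = 1 →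
      (P.enc n kk.1 (if c then plaintext true .nil .nil sk else plaintext false msk k .nil)).bind (fun ct =>
        ((T.plainPlay 𝒜 b).resume.exec (keyOracle (P.keyGen n kk.2) fun f => f ∈ P.funs.desc n ∧
              P.funs.eval n f (plaintext false msk k .nil) = P.funs.eval n f (plaintext true .nil .nil sk))
            (.pair (unary n) (.pair ct (.pair kk.1 (.pair sk (.pair msk k)))))
            (rename (Data.pair (bit false)) v) []).map fun r => decide (r.1 = bit true))
      = (P.enc n kk.1 (if c then plaintext true .nil .nil sk else plaintext false msk k .nil)).bind fun ctP =>
        core S 𝒜 b n kk.1 msk ctP (stdOracle S.funs n fun f =>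
          checkedKey P E G n kk.2 sk (prfKey S F n msk k f) f) id [] := by
    intro sk msk k hsk hmsk hk v hv
    refine pmf_bind_congr fun ct hct => ?_
    have hO : (keyOracle (P.keyGen n kk.2) fun f => f ∈ P.funs.desc n ∧
              P.funs.eval n f (plaintext false msk k .nil) = P.funs.eval n f (plaintext true .nil .nil sk)).Bounded :=
      keyOracle_bounded fun f hf => hL' f hf.1
    rw [Alg.resume_map _ hO (by simp [mark]) hv [] fun o => decide (o = bit true), plainPlay, Alg.pre_run]
    simp only [fst_pair, snd_pair, hL]
    have hmem := fun f (hf : f ∈ S.funs.desc n) => hc.key_mem n msk hmsk f hf (F.eval n k f)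
    refine play_std 𝒜 _ _ T.tst_spec b T.M_exec _ T.fair_spec hO (K := .pair sk k) (fun _ => .nil)
      (fun p f store s hf => ?_) (fun f hf => ?_) []
    · rw [T.plainServer_run hO, PMF.map_bind, checkedKey, PMF.map_bind]
      refine pmf_bind_congr fun ct hct => ?_
      have h1 := hc.circuit_mem n sk hsk _ (hmem f hf.1) ct hct f hf.1
      have h2 := hc.circuit_eval n sk hsk _ (hmem f hf.1) ct hct f hf.1
      have h3 := h2 false msk k .nil (hc.plain_false_mem n msk hmsk k (mem_keys_of_mem_support hk))
      have h4 := h2 true .nil .nil sk (hc.plain_true_mem n sk hsk)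
      -- On the first plaintext the circuit gives the function key with coins `F(k, f)`, on the
      -- second one the decryption of `ct`; so the plain key is allowed exactly if decryption
      -- succeeds.
      have h5 : (G n ct f ∈ P.funs.desc n ∧ P.funs.eval n (G n ct f) (plaintext false msk k .nil)
          = P.funs.eval n (G n ct f) (plaintext true .nil .nil sk)) ↔
          E.dec n sk ct = prfKey S F n msk k f := by
        rw [h3, h4]
        simp only [hybridFun, Bool.false_eq_true, if_true, if_false]
        exact ⟨fun h => h.2.symm, fun h => ⟨h1, h.symm⟩⟩
      rw [PMF.map_comp]
      unfold keyOracle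
      by_cases h : E.dec n sk ct = prfKey S F n msk k f
      · rw [if_pos h, if_pos (h5.2 h), PMF.map_comp]
        rfl
      · rw [if_neg h, if_neg fun h' => h (h5.1 h')]
        change PMF.map _ (PMF.pure _) = _
        rw [PMF.pure_map, PMF.pure_map]
        rfl
    · rw [spine_unary]
      exact ⟨record_le hb hf (hmem f hf), hb.checkedKey_le hkk hsk (hmem f hf) hf⟩
  -- The rest of the experiment as a function of the output of the sampler, from which `sk`, `msk`
  -- and `k` are read off. This keeps the final memory of the sampler available in the comparison.
  let D : Data → PMF Bool := fun o => (P.enc n kk.1 (if c then o.snd.fst else o.fst)).bind fun ctP =>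
    core S 𝒜 b n kk.1 o.snd.snd.snd.snd.fst ctP (stdOracle S.funs n fun f =>
      checkedKey P E G n kk.2 o.snd.snd.snd.fst (prfKey S F n o.snd.snd.snd.snd.fst o.snd.snd.snd.snd.snd f) f) id []
  have hs : silent.Bounded := ⟨1, silent_boundedBy⟩
  have hrun := T.plainSampler_run hs n kk.1 ()
  have hD : (T.plainSampler.run silent (.pair (unary n) kk.1) ()).bind (fun r => D r.1) =
      (E.gen n).bind fun sk => (S.setup n).bind fun msk => (F.key n).bind fun k =>
        (P.enc n kk.1 (if c then plaintext true .nil .nil sk else plaintext false msk k .nil)).bind fun ctP =>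
          core S 𝒜 b n kk.1 msk ctP (stdOracle S.funs n fun f =>
            checkedKey P E G n kk.2 sk (prfKey S F n msk k f) f) id [] := by
    rw [hrun]
    simp only [PMF.bind_bind, PMF.pure_bind, D, fst_pair, snd_pair]
  rw [← hD, Alg.run, PMF.bind_map]
  refine pmf_bind_congr fun r hr => ?_
  have hv := T.plainSampler.M.normSq_exec hs _ _ _ normSq_vacuum r hr
  have hr' : (r.1, r.2.2) ∈ (T.plainSampler.run silent (.pair (unary n) kk.1) ()).support := by
    rw [Alg.run, PMF.mem_support_map_iff]
    exact ⟨r, hr, rfl⟩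
  rw [hrun] at hr'
  simp only [PMF.mem_support_bind_iff, PMF.mem_support_pure_iff, Prod.mk.injEq] at hr'
  obtain ⟨sk, hsk, msk, hmsk, k, hk, e, -⟩ := hr'
  simp only [Function.comp_apply, e, D, fst_pair, snd_pair]
  rw [if_pos]
  · exact key sk msk k hsk hmsk hk _ hv
  -- The first part makes no key queries, so the condition on earlier keys is void.
  · refine ⟨hc.plain_false_mem n msk hmsk k (mem_keys_of_mem_support hk),
      hc.plain_true_mem n sk hsk, fun f hf => ?_⟩
    exact absurd hf (List.not_mem_nil)

end Kit

end

end
end UTFE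
namespace UTFE
noncomputable section
open Data

/-! ## Passing on the challenge ciphertext -/

/-- The challenge messages, followed by all of the output of the first phase. -/
def spread (y : Data) : Data := .pair y.fst.fst (.pair y.fst.snd.fst y)

theorem PolyTime.spread : PolyTime spread := by
  unfold UTFE.spread; fun_prop

section
variable (𝒜 : UTAdversary) (H : Alg) (tst : Data → Data) (ht : PolyTime tst) (A : Alg)

/-- The adversary that samples an environment with `A` and then simulates `𝒜`, where key queries
are served by `H` and the challenge ciphertext is part of that of `𝒜`. -/
def relay : UTAdversary where
  A₁ := entry isInput (fun z => mkS (.pair .nil .nil) (mkS .nil (A.start z))) spread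
    (by have := A.polyTime; fun_prop) .spread
    (seq (ren (Data.pair (bit true)) (by fun_prop) A.M) (phaseA 𝒜 H tst ht)
      (fun x => startA x.fst) Data.fst (by fun_prop) (by fun_prop)) (isInput_isEntryTest _)
  A₂ := entry isInput (fun z => startB z.snd) id (by fun_prop) (by fun_prop) (phaseB 𝒜 H tst ht)
    (isInput_isEntryTest _)
  B := entry isInput (fun z => startC z.snd) Data.fst (by fun_prop) (by fun_prop) (phaseC 𝒜 H tst ht)
    (isInput_isEntryTest _)

end

section
variable {S : UTSKFE} {𝒜 : UTAdversary} {H : Alg} {tst : Data → Data} {ht : PolyTime tst} {A : Alg}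
  {n : ℕ} {kg : Data → PMF Data} {L : ℕ}

/-- The string that reaches the second stage contains the output of `𝒜.A₂`, the store and the
environment; all of this is classical, and the server of queries can resume from it with an empty
quantum memory. Starting with a different list of earlier queries makes no difference. -/
theorem relay_B_exec (h : ∀ f ∈ S.funs.desc n, ∀ a ∈ (kg f).support, a.size ≤ L)
    (B pub μ ctP K p out store : Data) (l l' : List Data) :
    ((relay 𝒜 H tst ht A).B.exec (stdOracle S.funs n kg .nil)
        (.pair (unary n) (.pair out (.pair store (fullEnv n B pub μ ctP K p)))) vacuum l).bind
          (fun r => PMF.pure (decide (r.1 = bit true)))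
      = (𝒜.B.exec (servedBy H tst (fullEnv n B pub μ ctP K .nil) (stdOracle S.funs n kg .nil))
          (.pair (unary n) out) vacuum (store, l')).map fun r => decide (r.1 = bit true) := by
  have hO := stdOracle_bounded h .nil
  refine (exec_keyOracle_bind hO _ _ _ l l' fun o _ => PMF.pure (decide (o = bit true))).trans ?_
  change (PMF.bind ((relay 𝒜 H tst ht A).B.exec (stdOracle S.funs n kg .nil) _ vacuum l') _) = _
  rw [relay, entry_exec hO (isInput_ne_nil (by simp [mark, fullEnv, envOf])), PMF.bind_map]
  refine phase_exec (M := 𝒜.B) (H := H) (tst := tst) (hι := by fun_prop) (ht := ht)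
    (k := fun r : Data × Ket × Data × List Data => PMF.pure (decide (r.1 = bit true)))
    (pair_injective (bit false)) hO (fun _ _ _ _ _ _ _ => rfl)
    (mem_start normSq_vacuum (free_vacuum _) (free_vacuum _)) _ _ _

/-- The received ciphertext state is put next to a memory that still contains leftovers of the
server; by `Mem.tensor` the machine `𝒜.A₂` finds the memory `tensor v φ` under the names
`tensorName`. The classical part of the ciphertext is completed by `ctP`. -/
theorem relay_A₂_exec (h : ∀ f ∈ S.funs.desc n, ∀ a ∈ (kg f).support, a.size ≤ L)
    {v W φ : Ket} {κ : Data} (hm : Mem (Data.pair (bit false)) κ W v) (hφ : normSq φ = 1)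
    (B pub μ ctP K c out store : Data) (l l' : List Data) :
    ((relay 𝒜 H tst ht A).A₂.exec (stdOracle S.funs n kg (.pair out.fst out.snd.fst))
        (.pair (unary n) (.pair c (.pair out (.pair store (fullEnv n B pub μ ctP K .nil)))))
          (tensor W φ) l).bind (fun r =>
        ((relay 𝒜 H tst ht A).B.exec (stdOracle S.funs n kg .nil) (.pair (unary n) r.1) vacuum []).bind
          (fun r => PMF.pure (decide (r.1 = bit true))))
      = (𝒜.A₂.exec (servedBy H tst (fullEnv n B pub μ ctP K (.pair out.fst out.snd.fst))
            (stdOracle S.funs n kg (.pair out.fst out.snd.fst)))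
          (.pair (unary n) (.pair (.pair c ctP) out.snd.snd)) (tensor v φ) (store, l')).bind fun r =>
        (𝒜.B.exec (servedBy H tst (fullEnv n B pub μ ctP K .nil) (stdOracle S.funs n kg .nil))
          (.pair (unary n) r.1) vacuum r.2.2).map fun r => decide (r.1 = bit true) := by
  have hO := stdOracle_bounded h (.pair out.fst out.snd.fst)
  refine (exec_keyOracle_bind hO _ _ _ l l' fun o _ =>
    ((relay 𝒜 H tst ht A).B.exec (stdOracle S.funs n kg .nil) (.pair (unary n) o) vacuum []).bind
          (fun r => PMF.pure (decide (r.1 = bit true)))).trans ?_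
  change (PMF.bind ((relay 𝒜 H tst ht A).A₂.exec (stdOracle S.funs n kg _) _ _ l') _) = _
  have e : ∀ z W l, z.snd.snd ≠ mark → (relay 𝒜 H tst ht A).A₂.exec (stdOracle S.funs n kg (.pair out.fst out.snd.fst)) z W l
      = ((phaseB 𝒜 H tst ht).exec (stdOracle S.funs n kg (.pair out.fst out.snd.fst)) (startB z.snd) W l).map
        fun r => (id r.1, r.2.1, r.2.2) := by
    intro z W l hz
    rw [relay, entry_exec hO (isInput_ne_nil hz)]
  rw [e _ _ _ (by simp [mark]), PMF.bind_map]
  refine phase_exec (M := 𝒜.A₂) (H := H) (tst := tst) (hι := .tensorName) (ht := ht)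
    (k := fun r : Data × Ket × Data × List Data => (𝒜.B.exec (servedBy H tst (fullEnv n B pub μ ctP K .nil)
      (stdOracle S.funs n kg .nil)) (.pair (unary n) r.1) vacuum r.2.2).map fun r => decide (r.1 = bit true))
    tensorName_injective hO (fun o _ st s _ _ _ => ?_) (hm.tensor hφ) _ _ _
  exact (relay_B_exec h B pub μ ctP K (.pair out.fst out.snd.fst) o st [] s).symm

theorem pair_true_notMem_fresh (a : Data) : Data.pair (bit true) a ∉ fresh (unary 2) := by
  rintro ⟨i, b, h⟩
  have hs := congrArg (fun x => x.fst.size) h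
  simp only [fst_pair, size_iterate_pair_nil, size_unary, bit, size_pair, size_nil] at hs
  omega

/-- The experiment of the relaying adversary is that of the relayed one. -/
theorem utDist_relay (hS : S.Efficient) (h : ∀ f ∈ S.funs.desc n, ∀ a ∈ (kg f).support, a.size ≤ L)
    (msk : Data) (b : Bool) {D : PMF (Data × Data × Data × Data × Data)}
    (hA : A.run (stdOracle S.funs n kg .nil) (.pair (unary n) .nil) [] = D.map fun d =>
      (fullEnv n d.1 d.2.1 d.2.2.1 d.2.2.2.1 d.2.2.2.2 .nil, [])) :
    utDist (S.msgs n) (S.funs.desc n) (S.funs.eval n) .nil kg (S.enc n msk) (relay 𝒜 H tst ht A) n b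
      = D.bind fun d => core S 𝒜 b n d.2.1 msk d.2.2.2.1 (fun p =>
          servedBy H tst (fullEnv n d.1 d.2.1 d.2.2.1 d.2.2.2.1 d.2.2.2.2 p) (stdOracle S.funs n kg p))
            Prod.snd (.nil, []) := by
  have hO := stdOracle_bounded h .nil
  -- The simulated experiment as a function of the environment that the sampler outputs; the master
  -- key `msk` is a parameter from outside, as it is chosen by the challenger.
  let C : Data → PMF Bool := fun e => core S 𝒜 b n e.snd.snd.snd.fst.fst msk e.snd.snd.snd.fst.snd.snd
    (fun p => servedBy H tst (envOf e.fst e.snd.fst p e.snd.snd.snd) (stdOracle S.funs n kg p))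
      Prod.snd (.nil, [])
  have hC : (A.run (stdOracle S.funs n kg .nil) (.pair (unary n) .nil) []).bind (fun r => C r.1)
      = D.bind fun d => core S 𝒜 b n d.2.1 msk d.2.2.2.1 (fun p =>
          servedBy H tst (fullEnv n d.1 d.2.1 d.2.2.1 d.2.2.2.1 d.2.2.2.2 p) (stdOracle S.funs n kg p))
            Prod.snd (.nil, []) := by
    rw [hA, PMF.bind_map]
    rfl
  have e : ∀ z l, z.snd.snd ≠ mark → (relay 𝒜 H tst ht A).A₁.exec (stdOracle S.funs n kg .nil) z vacuum l
      = (A.M.exec (stdOracle S.funs n kg .nil) (A.start z) vacuum l).bind fun r =>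
        ((phaseA 𝒜 H tst ht).exec (stdOracle S.funs n kg .nil) (startA r.1)
          (rename (Data.pair (bit true)) r.2.1) r.2.2).map fun r => (spread r.1, r.2.1, r.2.2) := by
    intro z l hz
    rw [relay, entry_exec hO (isInput_ne_nil hz), seq_exec hO, ren_exec_vacuum (free_vacuum _) normSq_vacuum hO, PMF.bind_map, PMF.map_bind]
    refine pmf_bind_congr fun r _ => ?_
    rw [Function.comp_apply, PMF.map_comp]
    simp only [fst_pair]
    rfl
  rw [← hC, utDist, ← stdOracle_nil, e _ _ (by simp [mark]), PMF.bind_bind, Alg.run, PMF.bind_map]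
  refine pmf_bind_congr fun r hr => ?_
  have hv := A.M.normSq_exec hO _ _ _ normSq_vacuum r hr
  have hr' : (r.1, r.2.2) ∈ (A.run (stdOracle S.funs n kg .nil) (.pair (unary n) .nil) []).support := by
    rw [Alg.run, PMF.mem_support_map_iff]
    exact ⟨r, hr, rfl⟩
  rw [hA, PMF.mem_support_map_iff] at hr'
  obtain ⟨⟨B, pub, μ, ctP, K⟩, -, hd⟩ := hr'
  obtain ⟨h1, h2⟩ := Prod.mk.inj hd
  simp only at h1 h2
  rw [PMF.bind_map, Function.comp_apply, ← h1, ← h2]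
  simp only [Function.comp_def, spread, fst_pair, snd_pair]
  refine phase_exec (M := 𝒜.A₁) (H := H) (tst := tst) (hι := by fun_prop) (ht := ht)
    (pair_injective (bit false)) hO (fun out v store l W κ hm => ?_)
    (mem_start ((normSq_rename (pair_injective _) _).trans hv) (free_rename_true _)
      (free_rename (pair_injective _) _ pair_true_notMem_fresh)) _ _ _
  simp only [fst_pair]
  by_cases hf : Fair S n out l
  · rw [if_pos hf]
    refine Eq.trans ?_ (if_pos hf).symm
    refine pmf_bind_congr fun x hx => ?_
    have hφ : normSq x.2 = 1 := hS.2.2.2.2.2.2.1.normSq_eq n (.pair msk _) x (by simpa using hx)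
    exact (relay_A₂_exec h hm hφ B pub μ ctP K x.1 out store [] l).symm
  · rw [if_neg hf]
    exact (if_neg hf).symm

end

end
end UTFE
-- The reduction to the secret-key functional encryption scheme
namespace UTFE
noncomputable section
open Data

section
variable {P : PKFE} {S : UTSKFE} {E : SKE} {F : PRF S.funs.desc S.coins} {zero : ℕ → Data}
  {G : ℕ → Data → Data → Data}

/-- Recorded queries and coins as a list of queries and function keys. -/
def encodeRecord (S : UTSKFE) (n : ℕ) (msk : Data) :
    List (S.funs.desc n × (Fin (S.coins n) → Bool)) → Data
  | [] => .nil
  | e :: s => .pair (.pair e.1 (S.keyGen n msk e.1 e.2)) (encodeRecord S n msk s)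

theorem lookup_encodeRecord (n : ℕ) (msk : Data) (f : S.funs.desc n)
    (s : List (S.funs.desc n × (Fin (S.coins n) → Bool))) :
    lookup f (encodeRecord S n msk s)
      = (s.lookup f).elim .nil fun r => .pair .nil (S.keyGen n msk f r) := by
  induction s with
  | nil => rfl
  | cons e s ih =>
    rw [encodeRecord, lookup, List.lookup_cons, fst_pair, snd_pair]
    by_cases h : e.1 = f
    · subst h
      simp
    · rw [if_neg fun h' => h (Subtype.ext h'), ih]
      have : (f == e.1) = false := by simpa using fun h' => h h'.symm
      rw [this]

theorem mem_queried_iff {X : Finset Data} {ζ : Type} (s : List (X × ζ)) (f : X) :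
    (f : Data) ∈ queried s ↔ s.lookup f ≠ none := by
  induction s with
  | nil => simp [queried]
  | cons e s ih =>
    rw [List.lookup_cons]
    by_cases h : f = e.1
    · subst h
      simp [queried]
    · have h' : (f == e.1) = false := by simpa using h
      rw [h', ← ih]
      simp only [queried, List.map_cons, List.mem_cons, or_iff_right_iff_imp]
      exact fun h'' => absurd (Subtype.ext h'') h

namespace Kit
variable (T : Kit P S E F zero G)

/-- The server of key queries against the secret-key functional encryption scheme. Keys are asked
for once only. -/
def relayServer : Alg := (Alg.ask (fun x => lookup x.snd.snd x.snd.fst) (fun x => x.snd.snd)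
    (fun y => if lookup y.snd.snd.snd y.snd.snd.fst = .nil then y.fst
      else (lookup y.snd.snd.snd y.snd.snd.fst).snd) (by fun_prop) (by fun_prop) (by fun_prop)).bind
    T.encFinish

theorem relayServer_run {σ : Type} {O : Oracle σ} (hO : O.Bounded) (n : ℕ)
    (B pub msk ctP mskP sk p store f : Data) (s : σ) :
    T.relayServer.run O (.pair (fullEnv n B pub msk ctP (.pair mskP sk) p) (.pair store f)) s
      = if lookup f store = .nil then (O s f).bind fun r =>
          (checkedKey P E G n mskP sk r.1 f).map fun a => (.pair a (.pair f r.1), r.2)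
        else (checkedKey P E G n mskP sk (lookup f store).snd f).map fun a =>
          (.pair a (.pair f (lookup f store).snd), s) := by
  rw [relayServer, Alg.bind_run _ _ hO, Alg.ask_run _ _ _ hO]
  by_cases h : lookup f store = .nil
  · rw [if_pos h, if_pos (show lookup (Data.pair (fullEnv n B pub msk ctP (.pair mskP sk) p)
      (.pair store f)).snd.snd (Data.pair (fullEnv n B pub msk ctP (.pair mskP sk) p)
      (.pair store f)).snd.fst = .nil from h), PMF.bind_map]
    simp only [Function.comp_def, fst_pair, snd_pair, h, if_true, T.encFinish_run hO]
  · rw [if_neg h, if_neg (show ¬ lookup (Data.pair (fullEnv n B pub msk ctP (.pair mskP sk) p)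
      (.pair store f)).snd.snd (Data.pair (fullEnv n B pub msk ctP (.pair mskP sk) p)
      (.pair store f)).snd.fst = .nil from h), PMF.pure_bind]
    simp only [fst_pair, snd_pair, h, if_false, T.encFinish_run hO]

/-- Samples the environment of the server. -/
def relaySampler : Alg :=
  T.setup.andThen (fun x => .pair x.fst .nil) (by fun_prop) <|
  T.skeGen.andThen (fun x => .pair x.snd.fst .nil) (by fun_prop) <|
  T.enc.andThen (fun x => .pair x.snd.snd.fst (.pair x.snd.fst.fst
    (plaintext true .nil .nil x.fst))) (by unfold plaintext; fun_prop) <|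
  .ask (fun _ => bit true) (fun _ => .nil) (fun w => envOf w.snd.snd.snd.snd.fst
    (T.bnd w.snd.snd.snd.snd.fst) .nil (.pair (.pair w.snd.snd.snd.fst.fst (.pair .nil w.snd.fst))
      (.pair w.snd.snd.snd.fst.snd w.snd.snd.fst))) (by fun_prop) (by fun_prop)
      (by have := T.bnd_poly; unfold envOf; fun_prop)

/-- The adversary against the secret-key functional encryption scheme. -/
def relayAdversary (𝒜 : UTAdversary) : UTAdversary :=
  relay 𝒜 T.relayServer T.tst T.tst_poly T.relaySampler

/-- The slot of the environment for the master key is filled with `nil`: that key stays with the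
challenger, and the server obtains function keys by queries. -/
theorem relaySampler_run {σ : Type} {O : Oracle σ} (hO : O.Bounded) {n L : ℕ}
    (hL : T.bnd (unary n) = unary L) (s : σ) : T.relaySampler.run O (.pair (unary n) .nil) s
      = ((P.setup n).bind fun kk => (E.gen n).bind fun sk =>
          (P.enc n kk.1 (plaintext true .nil .nil sk)).map fun ctP =>
            (unary L, kk.1, .nil, ctP, .pair kk.2 sk)).map fun d : Data × Data × Data × Data × Data =>
              (fullEnv n d.1 d.2.1 d.2.2.1 d.2.2.2.1 d.2.2.2.2 .nil, s) := by
  rw [relaySampler, Alg.andThen_run n _ hO (T.setup_run hO) _ _ rfl, PMF.bind_map, PMF.map_bind]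
  refine pmf_bind_congr fun kk _ => ?_
  rw [Function.comp_apply, Alg.andThen_run n _ hO (T.skeGen_run hO) _ _ rfl, PMF.map_bind]
  refine pmf_bind_congr fun sk _ => ?_
  rw [Alg.andThen_run n _ hO (T.enc_run hO) _ _ rfl, PMF.map_comp]
  simp only [fst_pair, snd_pair]
  rw [PMF.map]
  refine pmf_bind_congr fun ctP _ => ?_
  rw [Alg.ask_run _ _ _ hO, if_neg (by simp [bit])]
  simp only [fst_pair, snd_pair, hL]
  rfl

/-- Serving the queries amounts to sampling coins when they are needed. -/
theorem relayServer_map {n L : ℕ} (hc : Compatible P S E F zero G) (hb : SizeBound P S E F G n L)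
    {kk : Data × Data} (hkk : kk ∈ (P.setup n).support) {sk msk : Data} (hsk : sk ∈ (E.gen n).support)
    (hmsk : msk ∈ (S.setup n).support) (ctP p : Data)
    (s : List (S.funs.desc n × (Fin (S.coins n) → Bool))) (f : Data) :
    (lazyOracle (Allowed S.funs n p) (coinedKey P S E G n kk.2 sk msk) s f).map
        (fun r => (r.1, encodeRecord S n msk r.2, (queried r.2).dedup))
      = servedBy T.relayServer T.tst (fullEnv n (unary L) kk.1 .nil ctP (.pair kk.2 sk) p)
          (stdOracle S.funs n (S.sampleKey n msk) p) (encodeRecord S n msk s, (queried s).dedup) f := by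
  have ht := T.tst_spec n (unary L) p (.pair (.pair kk.1 (.pair .nil ctP)) (.pair kk.2 sk)) f
  change T.tst (.pair (fullEnv n (unary L) kk.1 .nil ctP (.pair kk.2 sk) p) f) = .nil ↔ _ at ht
  unfold servedBy served lazyOracle
  by_cases h : Allowed S.funs n p f
  swap
  · rw [if_pos (ht.2 h), dif_neg fun h' => h h'.2, PMF.pure_map]
  rw [if_neg fun e => ht.1 e h, dif_pos ⟨h.1, h⟩, PMF.map_bind]
  obtain ⟨L', hL'⟩ := S.sampleKey_bounded n msk (S.funs.desc n)
  have hO := stdOracle_bounded hL' p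
  have hrun := T.relayServer_run hO n (unary L) kk.1 .nil ctP kk.2 sk p (encodeRecord S n msk s) f
    (queried s).dedup
  have hclip : ∀ r : Fin (S.coins n) → Bool, ∀ l : List Data,
      (coinedKey P S E G n kk.2 sk msk ⟨f, h.1⟩ r).map (fun a => (a,
          Data.pair (.pair f (S.keyGen n msk f r)) (encodeRecord S n msk s), l))
        = (checkedKey P E G n kk.2 sk (S.keyGen n msk f r) f).map fun a =>
          (clip (unary L) a, .pair (clip (unary L) (.pair f (S.keyGen n msk f r))) (encodeRecord S n msk s), l) := by
    intro r l
    have hm := hc.key_mem n msk hmsk f h.1 r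
    rw [coinedKey, PMF.map, PMF.map]
    refine pmf_bind_congr fun a ha => ?_
    simp only [Function.comp_apply]
    rw [clip_eq (by rw [spine_unary]; exact hb.checkedKey_le hkk hsk hm h.1 a ha),
      clip_eq (by rw [spine_unary]; exact hb.record f h.1 _ hm)]
  have key := congrArg (PMF.map fun r : Data × List Data => (clip (unary L) r.1.fst,
    Data.pair (clip (unary L) r.1.snd) (encodeRecord S n msk s), r.2)) hrun
  rw [Alg.run, PMF.map_comp] at key
  refine Eq.trans ?_ key.symm
  rw [lookup_encodeRecord n msk ⟨f, h.1⟩ s, drawCoins]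
  have hq := mem_queried_iff s ⟨f, h.1⟩
  cases hs : s.lookup ⟨f, h.1⟩ with
  -- A repeated query must have the same coins as before, whereas the key oracle would draw fresh
  -- ones. It is answered from the store, so the log of the outer experiment, kept without
  -- repetitions, does not change; only the encryption and the plain key are made anew.
  | some r =>
    rw [hs] at hq
    simp only [Option.elim, PMF.pure_bind, PMF.map_comp, reduceCtorEq, if_false, snd_pair,
      Function.comp_def, fst_pair]
    rw [← hclip]
    have hd : (queried ((⟨f, h.1⟩, r) :: s)).dedup = (queried s).dedup :=
      List.dedup_cons_of_mem (hq.2 (by simp))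
    rw [hd]
    rfl
  -- A new query is passed on, and the coins inside `sampleKey` play the role of the lazily drawn
  -- ones. The outer log grows by `f`.
  | none =>
    rw [hs] at hq
    simp only [Option.elim, if_true, stdOracle, keyOracle, if_pos h, UTSKFE.sampleKey, PMF.map_bind,
      PMF.bind_map, PMF.map_comp, Function.comp_def, fst_pair, snd_pair]
    refine pmf_bind_congr fun r _ => ?_
    rw [← hclip]
    have hd : (queried ((⟨f, h.1⟩, r) :: s)).dedup = f :: (queried s).dedup :=
      List.dedup_cons_of_notMem fun h' => (hq.1 h') rfl
    rw [hd]
    rfl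

/-- Fairness depends only on the set of functions that were queried. The relaying adversary asks
once for each function, so its log agrees with the simulated one up to repetitions. -/
theorem core_dedup {𝒜 : UTAdversary} {b : Bool} {n : ℕ} {pub msk ctP : Data} {σ : Type}
    {O : Data → Oracle σ} (logs : σ → List Data) (s : σ) :
    core S 𝒜 b n pub msk ctP O (fun s => (logs s).dedup) s = core S 𝒜 b n pub msk ctP O logs s := by
  have h : ∀ out l, Fair S n out (List.dedup l) = Fair S n out l := fun out l => by
    simp only [Fair, List.mem_dedup]
  refine pmf_bind_congr fun r₁ _ => ?_
  by_cases hf : Fair S n r₁.1 (logs r₁.2.2)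
  · rw [if_pos hf, if_pos ((h _ _).mpr hf)]
  · rw [if_neg hf, if_neg fun h' => hf ((h _ _).mp h')]

/-- The challenger's master key takes the place of `msk`, and the relaying adversary draws the
remaining data from the same distribution. The lazy coins are matched with the coins of the
challenger through the map from records to stores and logs. -/
theorem relay_prOne (hS : S.Efficient) (hc : Compatible P S E F zero G) (𝒜 : UTAdversary) (b : Bool)
    (n : ℕ) : prOne (S.game (T.relayAdversary 𝒜) n b) =
      (blindWorld P S E n (fun kk sk msk ctP => core S 𝒜 b n kk.1 msk ctP
        (fun p => lazyOracle (Allowed S.funs n p) (coinedKey P S E G n kk.2 sk msk)) queried [])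
        true).toReal := by
  obtain ⟨L, hL, hb⟩ := T.bnd_spec n
  rw [S.prOne_game]
  congr 2
  have e : ∀ C : Data × Data → Data → Data → Data → PMF Bool, blindWorld P S E n C
      = (S.setup n).bind fun msk => (P.setup n).bind fun kk => (E.gen n).bind fun sk =>
        (P.enc n kk.1 (plaintext true .nil .nil sk)).bind fun ctP => C kk sk msk ctP := by
    intro C
    rw [PMF.bind_comm, blindWorld]
    refine pmf_bind_congr fun kk _ => ?_
    rw [PMF.bind_comm]
  rw [e]
  refine pmf_bind_congr fun msk hmsk => ?_
  obtain ⟨L', hL'⟩ := S.sampleKey_bounded n msk (S.funs.desc n)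
  rw [relayAdversary, utDist_relay hS hL' msk b (T.relaySampler_run (stdOracle_bounded hL' _) hL []),
    PMF.bind_bind]
  refine pmf_bind_congr fun kk hkk => ?_
  rw [PMF.bind_bind]
  refine pmf_bind_congr fun sk hsk => ?_
  rw [PMF.bind_map]
  refine pmf_bind_congr fun ctP _ => ?_
  have h : ∀ x r, SizeBounded (coinedKey P S E G n kk.2 sk msk x r) := fun x r =>
    ⟨L, hb.checkedKey_le hkk hsk (hc.key_mem n msk hmsk x x.2 r) x.2⟩
  rw [← core_dedup queried]
  exact (core_map (φ := fun s => (encodeRecord S n msk s, (queried s).dedup))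
    (fun p => lazyOracle_bounded h) (fun p => servedBy_bounded _ _ _ _)
    (fun p s f => T.relayServer_map hc hb hkk hsk hmsk ctP p s f) Prod.snd []).symm

end Kit

end

end
end UTFE
-- Negligible functions and the conclusion
namespace UTFE
noncomputable section
open Data

theorem Negligible.add {ε δ : ℕ → ℝ} (h : Negligible ε) (h' : Negligible δ) :
    Negligible fun n => ε n + δ n := Asymptotics.SuperpolynomialDecay.add h h'

theorem Negligible.mono {ε δ : ℕ → ℝ} (h : Negligible ε) (hδ : ∀ᶠ n in Filter.atTop, |δ n| ≤ ε n) :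
    Negligible δ :=
  Asymptotics.SuperpolynomialDecay.trans_eventually_abs_le h
    (hδ.mono fun _ hn => hn.trans (le_abs_self _))

theorem Negligible.polynomial_mul {ε : ℕ → ℝ} (h : Negligible ε) (p : Polynomial ℕ) :
    Negligible fun n => (p.eval n : ℕ) * ε n := by
  have := Asymptotics.SuperpolynomialDecay.polynomial_mul h (p.map (Nat.castRingHom ℝ))
  have e : ∀ n : ℕ, (p.map (Nat.castRingHom ℝ)).eval (n : ℝ) = ((p.eval n : ℕ) : ℝ) := fun n =>
    Polynomial.eval_natCast_map (Nat.castRingHom ℝ) p n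
  refine this.congr fun n => ?_
  simp only [e]

/-- The construction is secure. -/
theorem utpkfe_secure {P : PKFE} {S : UTSKFE} {E : SKE} {F : PRF S.funs.desc S.coins}
    {zero : ℕ → Data} {G : ℕ → Data → Data → Data} (hP : P.Efficient) (hS : S.Efficient)
    (hE : E.Efficient) (hF : F.Efficient) (hc : Compatible P S E F zero G)
    (hPsec : P.AdaptivelySecure) (hFsec : F.Secure) (hEsec : E.CPASecure) (hEcorrect : E.Correct)
    (hSsec : S.SingleCiphertextSecure) : (utpkfe P S E F zero G).Secure := by
  intro 𝒜
  obtain ⟨T⟩ := exists_kit hP hS hE hF hc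
  -- The adversaries of the intermediate reductions depend on `b`, but `T.relayAdversary 𝒜` does
  -- not; so the two instances can be joined by the security of `S`.
  have step : ∀ b, Negligible fun n => |prOne ((utpkfe P S E F zero G).game 𝒜 n b)
      - prOne (S.game (T.relayAdversary 𝒜) n b)| := by
    intro b
    obtain ⟨p, hp⟩ := abs_hybrid_checked_le hP hS hE hc 𝒜 b
    have h1 := hEsec (T.cpaAdversary 𝒜 b).machine
    have h2 := Negligible.polynomial_mul hEcorrect p
    have h3 := hPsec (T.plainAdversary 𝒜 b)
    have h4 := hFsec (T.prfAdversary 𝒜 b).machine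
    -- The reduction to the plain scheme recognises its input only for `n ≥ 2`, which is enough for
    -- negligibility.
    refine (((h1.add h2).add h3).add h4).mono ((Filter.eventually_ge_atTop 2).mono fun n hn => ?_)
    have e1 : prOne ((utpkfe P S E F zero G).game 𝒜 n b)
        = prOne (E.game (T.cpaAdversary 𝒜 b).machine n false) := by
      rw [utpkfe_prOne_game hP hE hc.circuit_poly, T.cpa_prOne hE hc]
      rfl
    have e2 := T.cpa_prOne hE hc 𝒜 b n true
    have e3 := T.plain_prOne hP hc 𝒜 b hn false
    have e4 := (T.plain_prOne hP hc 𝒜 b hn true).trans (T.prf_prOne_false hc 𝒜 b n).symm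
    have e5 := (T.prf_prOne_true hc 𝒜 b n).trans (T.relay_prOne hS hc 𝒜 b n).symm
    have hd := hp n
    simp only [if_true, Bool.false_eq_true, if_false] at e2 e3
    rw [← e2, ← e3] at hd
    rw [abs_abs, e1, ← e5]
    rw [← e4]
    refine (abs_sub_le _ (prOne (E.game (T.cpaAdversary 𝒜 b).machine n true)) _).trans ?_
    rw [add_assoc, add_assoc]
    refine add_le_add_right ?_ _
    refine (abs_sub_le _ (prOne (P.game (T.plainAdversary 𝒜 b) n false)) _).trans ?_
    refine add_le_add hd ?_
    exact abs_sub_le _ _ _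
  -- From the construction with `false` to the secret-key experiment with `false`, then with `true`,
  -- and back to the construction with `true`.
  refine (((step false).add (hSsec (T.relayAdversary 𝒜))).add (step true)).mono
    (Filter.Eventually.of_forall fun n => ?_)
  rw [abs_abs]
  refine (abs_sub_le _ (prOne (S.game (T.relayAdversary 𝒜) n true)) _).trans ?_
  rw [abs_sub_comm (prOne (S.game (T.relayAdversary 𝒜) n true))]
  gcongr
  exact abs_sub_le _ _ _

end
end UTFE
theorem mainTheorem12 (P : UTFE.PKFE) (S : UTFE.UTSKFE) (E : UTFE.SKE)
    (F : UTFE.PRF S.funs.desc S.coins) (zero : ℕ → UTFE.Data)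
    (G : ℕ → UTFE.Data → UTFE.Data → UTFE.Data)
    (hP : P.Efficient) (hS : S.Efficient) (hE : E.Efficient) (hF : F.Efficient)
    (hcompat : UTFE.Compatible P S E F zero G)
    (hPsec : P.AdaptivelySecure) (hFsec : F.Secure)
    (hEsec : E.CPASecure) (hEcorrect : E.Correct)
    (hSsec : S.SingleCiphertextSecure) :
    (UTFE.utpkfe P S E F zero G).Secure := by
  exact UTFE.utpkfe_secure hP hS hE hF hcompat hPsec hFsec hEsec hEcorrect hSsec
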